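/- **Setting.** Let $K$ be a field of characteristic $0$ (containing the kinematic data), $L,n\ge 0$, and let $\boldsymbol G=(p_l\cdot p_m)_{1\le l,m\le n}$ be a symmetric matrix over $K$ with $\det\boldsymbol G\neq 0$, the Gram matrix of $n$ independent external momenta. A *sector* $\Theta$ consists of * a connected oriented graph $G$ (with finitely many internal vertices and internal edges, loops and multiple edges allowed) with $n+1$ external edges $0,1,\dots,n$, each attached to an internal vertex; external edge $l\ge 1$ carries the inflowing momentum $p_l$, external edge $0$ carries $-(p_1+\dots+p_n)$; * squared masses $m_e^2\in K$ of the internal edges $e$; * an edge-momentum parametrization $\boldsymbol q=\boldsymbol C^T\boldsymbol k+\boldsymbol E^T\boldsymbol p$, where the $L$ rows of the integer matrix $\boldsymbol C$ form a $\mathbb Z$-basis of $H_1(G,\mathbb Z)$ and $\boldsymbol E$ is a rational matrix such that momentum is conserved at every internal vertex. Squares $q_e^2$ are polynomials in the independent variables $k_i\cdot k_j$, $k_i\cdot p_l$, with $p_l\cdot p_m=\boldsymbol G_{lm}$. We assume that the sector is momentum-grouped (at most one external edge at each internal vertex), that every internal edge lies on a cycle, that the inverse propagators $D_e=q_e^2-m_e^2$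 are pairwise distinct, and, if $n\ge1$, that all vertices carrying external edges lie in one common block (2-vertex-connected component) of $G$, i.e. all other blocks are vacuum subgraphs. For two sectors $\Theta_1,\Theta_2$ (with the same $L$, $n$, $\boldsymbol G$) let $\mathrm{Sym}(\Theta_1,\Theta_2)$ be the set of triples $(\boldsymbol L,\boldsymbol M,\boldsymbol N)$ of matrices over $K$, defining $\boldsymbol k_1=\boldsymbol L\boldsymbol k_2+\boldsymbol M\boldsymbol p_2$, $\boldsymbol p_1=\boldsymbol N\boldsymbol p_2$, such that $\det\boldsymbol L=\pm1$, $\boldsymbol N\boldsymbol G\boldsymbol N^T=\boldsymbol G$, and there is a bijection $\alpha$ from the internal edges of $G_2$ to those of $G_1$ with $q_{1,\alpha(i)}^2(\boldsymbol k_1,\boldsymbol p_1)=q_{2,i}^2(\boldsymbol k_2,\boldsymbol p_2)$ and $m_{\alpha(i)}^2=m_i^2$ for all $i$. Let $\mathcal G_i=\mathcal U_i+\mathcal F_i$ be the Lee–Pomeransky polynomials, with $$\mathcal U=\sum_{T}\prod_{e\notin T}x_e,\qquad \mathcal F=\Big(\sum_e m_e^2x_e\Big)\,\mathcal U-\sum_{(T_1,T_2)}s_{T_1,T_2}\prod_{e\notin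 T_1\cup T_2}x_e ,$$ the sums running over spanning trees and spanning 2-forests, and $s_{T_1,T_2}$ the square of the momentum flowing from $T_1$ to $T_2$. Let $\mathbb S(\mathcal G_1,\mathcal G_2)$ be the set of bijections $\sigma$ from the edges of $G_2$ to those of $G_1$ with $\mathcal G_1(\sigma(\boldsymbol x))=\mathcal G_2(\boldsymbol x)$, $\sigma(\boldsymbol x)_i=x_{\sigma^{-1}(i)}$, and $\mathbb G(\mathcal G)=\mathbb S(\mathcal G,\mathcal G)$. Let $c$ be the number of blocks of $G_1$ (for $n\ge1$: the number of vacuum blocks plus $1$), and identify $\mathbb Z_2^c$ with the sign functions $z$ on the blocks of $G_1$. For a signed bijection $(\boldsymbol\kappa,\sigma)$ put $(\boldsymbol P)_{ij}=\kappa_j\delta_{i\sigma(j)}$, $\boldsymbol\Pi^\perp_{C_l}=\mathbb 1-\boldsymbol C_l^T(\boldsymbol C_l\boldsymbol C_l^T)^{-1}\boldsymbol C_l$ and $$\begin{aligned}\boldsymbol L_{\boldsymbol\kappa,\sigma}&=(\boldsymbol C_1\boldsymbol C_1^T)^{-1}\boldsymbol C_1\boldsymbol P\boldsymbol C_2^T,\\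 \boldsymbol N_{\boldsymbol\kappa,\sigma}&=(\boldsymbol E_1\boldsymbol\Pi^\perp_{C_1}\boldsymbol E_1^T)^{-1}\boldsymbol E_1\boldsymbol\Pi^\perp_{C_1}\boldsymbol P\,\boldsymbol\Pi^\perp_{C_2}\boldsymbol E_2^T,\\ \boldsymbol M_{\boldsymbol\kappa,\sigma}&=(\boldsymbol C_1\boldsymbol C_1^T)^{-1}\boldsymbol C_1\boldsymbol P\boldsymbol E_2^T-(\boldsymbol C_1\boldsymbol C_1^T)^{-1}\boldsymbol C_1\boldsymbol E_1^T\boldsymbol N_{\boldsymbol\kappa,\sigma}.\end{aligned}$$ **Theorem.** The matrices $\boldsymbol C_l\boldsymbol C_l^T$ and $\boldsymbol E_l\boldsymbol\Pi^\perp_{C_l}\boldsymbol E_l^T$ are invertible, and: 1. There are signs $\boldsymbol\kappa^\sigma$ ($\sigma\in\mathbb S(\mathcal G_1,\mathcal G_2)$) and a bijection $$\mathbb Z_2^c\times\mathbb S(\mathcal G_1,\mathcal G_2)\;\xrightarrow{\ \sim\ }\;\mathrm{Sym}(\Theta_1,\Theta_2),\qquad (z,\sigma)\mapsto(\boldsymbol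 L,\boldsymbol M,\boldsymbol N)_{z\cdot\boldsymbol\kappa^\sigma,\sigma},$$ where $(z\cdot\boldsymbol\kappa^\sigma)_e=z(\text{block of }\sigma(e))\,\kappa^\sigma_e$. The image of $(z,\sigma)$ satisfies $\boldsymbol q_1=\boldsymbol P\boldsymbol q_2$ with $\boldsymbol P$ the signed permutation matrix of $(z\cdot\boldsymbol\kappa^\sigma,\sigma)$, and $\sigma$ is the only bijection of the propagators that it induces. 2. For a single sector $\Theta=\Theta_1$ with $\mathcal G=\mathcal G_1$, the matrices $\begin{pmatrix}\boldsymbol L&\boldsymbol M\\0&\boldsymbol N\end{pmatrix}$ with $(\boldsymbol L,\boldsymbol M,\boldsymbol N)\in\mathrm{Sym}(\Theta,\Theta)$ form a subgroup $\mathrm{Aut}(\Theta)$ of $\mathrm{GL}_{L+n}(K)$, and the signs $\boldsymbol\kappa^\sigma$ ($\sigma\in\mathbb G(\mathcal G)$) can be chosen such that $(z,\sigma)\mapsto(\boldsymbol L,\boldsymbol M,\boldsymbol N)_{z\cdot\boldsymbol\kappa^\sigma,\sigma}$ is a group isomorphism $$\mathbb Z_2^c\rtimes\mathbb G(\mathcal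 G)\;\xrightarrow{\ \sim\ }\;\mathrm{Aut}(\Theta),$$ where $\mathbb G(\mathcal G)$ acts on $\mathbb Z_2^c$ by permuting the blocks of $G_1$. -/

import Mathlib

open scoped Matrix

noncomputable section

/-- A Feynman graph with internal vertices `V`, oriented internal edges (propagators) `Ed` and
`n + 1` external edges.  The external edge `x` is attached to the internal vertex `leg x`.
The external edge `l.succ` carries the inflowing momentum `p_l`; the inflowing momentum
`-(p_1 + ... + p_n)` of the external edge `0` is eliminated by overall momentum conservation.
For `n = 0` no momentum flows in: this is a vacuum graph (with a marked vertex). -/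
structure FeynmanGraph (V Ed : Type*) (n : ℕ) where
  src : Ed → V
  tgt : Ed → V
  leg : Fin (n + 1) → V

namespace FeynmanGraph

variable {V Ed : Type*} {n : ℕ} (G : FeynmanGraph V Ed n)

open Classical in
/-- The incidence matrix, i.e. the matrix of the boundary operator `∂e = tgt e - src e`. -/
def incidence : Matrix V Ed ℤ :=
  Matrix.of fun v e => (if G.tgt e = v then 1 else 0) - (if G.src e = v then 1 else 0)

/-- The first homology group `H₁(G, ℤ)`. -/
def cycleSpace [Fintype Ed] : Submodule ℤ (Ed → ℤ) :=
  LinearMap.ker G.incidence.mulVecLin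

/-- The momentum entering through the external edge `x` is `∑ l, legCoeff x l * p_l`. -/
def legCoeff (n : ℕ) : Matrix (Fin (n + 1)) (Fin n) ℤ :=
  Matrix.of fun x l => if x = l.succ then 1 else if x = 0 then -1 else 0

open Classical in
/-- The external momentum entering at the internal vertex `v` is `∑ l, inflow v l * p_l`. -/
def inflow : Matrix V (Fin n) ℤ :=
  Matrix.of fun v l => ∑ x, if G.leg x = v then legCoeff n x l else 0

/-- Two vertices are related if they are joined by a path using only edges of `F`. -/
def linked (F : Set Ed) : Setoid V :=
  Relation.EqvGen.setoid fun v w => ∃ e ∈ F, G.src e = v ∧ G.tgt e = w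

def Connected : Prop := ∀ v w, G.linked Set.univ v w

/-- `F` has no cycles. -/
def IsForest [Fintype Ed] (F : Finset Ed) : Prop :=
  ∀ h ∈ G.cycleSpace, (∀ e ∉ F, h e = 0) → h = 0

/-- `F` is the edge set of a spanning `p`-forest. -/
def IsSpanningForest [Fintype Ed] (p : ℕ) (F : Finset Ed) : Prop :=
  G.IsForest F ∧ Nat.card (Quotient (G.linked (F : Set Ed))) = p

/-- A simple cycle, as a set of edges. -/
def IsCircuit [Fintype Ed] (S : Set Ed) : Prop :=
  Minimal (fun S : Set Ed => ∃ h ∈ G.cycleSpace, h ≠ 0 ∧ Function.support h = S) S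

/-- Edges are equivalent if they are equal or lie on a common simple cycle
(already a transitive relation; we take the generated equivalence relation). -/
def blockSetoid [Fintype Ed] : Setoid Ed :=
  Relation.EqvGen.setoid fun e e' => ∃ S, G.IsCircuit S ∧ e ∈ S ∧ e' ∈ S

/-- The blocks (2-vertex-connected components) of the graph. -/
def Block [Fintype Ed] : Type _ := Quotient G.blockSetoid

/-- The block containing an edge. -/
def block [Fintype Ed] (e : Ed) : G.Block := Quotient.mk G.blockSetoid e

open Classical in
/-- For a spanning 2-forest `F`, the square `s_{T₁,T₂}` of the momentum flowing from one tree to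
the other, i.e. of the sum of all `p_l` entering in the tree that does not contain the external
edge `0`. `Gm` is the Gram matrix of the external momenta. -/
def flowSq {K : Type*} [Field K] (Gm : Matrix (Fin n) (Fin n) K) (F : Finset Ed) : K :=
  ∑ l : Fin n, ∑ m : Fin n,
    if ¬ G.linked (F : Set Ed) (G.leg 0) (G.leg l.succ) ∧
        ¬ G.linked (F : Set Ed) (G.leg 0) (G.leg m.succ) then Gm l m else 0

variable [Fintype Ed] [DecidableEq Ed] {K : Type*} [Field K]

open Classical in
/-- First Symanzik polynomial `𝒰`. -/
def firstSymanzik (K : Type*) [Field K] : MvPolynomial Ed K :=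
  ∑ F : Finset Ed with G.IsSpanningForest 1 F, ∏ e ∈ Fᶜ, MvPolynomial.X e

open Classical in
/-- Second Symanzik polynomial `ℱ`. -/
def secondSymanzik (massSq : Ed → K) (Gm : Matrix (Fin n) (Fin n) K) : MvPolynomial Ed K :=
  (∑ e, MvPolynomial.C (massSq e) * MvPolynomial.X e) * G.firstSymanzik K +
    ∑ F : Finset Ed with G.IsSpanningForest 2 F,
      MvPolynomial.C (-G.flowSq Gm F) * ∏ e ∈ Fᶜ, MvPolynomial.X e

/-- Lee–Pomeransky polynomial `𝒢 = 𝒰 + ℱ`. -/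
def leePomeransky (massSq : Ed → K) (Gm : Matrix (Fin n) (Fin n) K) : MvPolynomial Ed K :=
  G.firstSymanzik K + G.secondSymanzik massSq Gm

end FeynmanGraph

/-- `𝕊(f₁, f₂)`: the bijections `σ` of the variables with `f₁(σ(x)) = f₂(x)`,
where `σ(x)_i = x_{σ⁻¹(i)}`. -/
def permSet {K Ed₁ Ed₂ : Type*} [Field K] (f₁ : MvPolynomial Ed₁ K) (f₂ : MvPolynomial Ed₂ K) :
    Set (Ed₂ ≃ Ed₁) :=
  {σ | MvPolynomial.rename σ.symm f₁ = f₂}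

/-- `𝔾(f) = 𝕊(f, f)` as a group of permutations. -/
def permGroup {K Ed : Type*} [Field K] (f : MvPolynomial Ed K) : Subgroup (Equiv.Perm Ed) where
  carrier := permSet f f
  one_mem' := by
    change MvPolynomial.rename (fun x : Ed => x) f = f
    exact MvPolynomial.rename_id_apply f
  mul_mem' := by
    intro a b ha hb
    change MvPolynomial.rename a.symm f = f at ha
    change MvPolynomial.rename b.symm f = f at hb
    change MvPolynomial.rename (b.symm ∘ a.symm) f = f
    rw [← MvPolynomial.rename_rename, ha, hb]
  inv_mem' := by
    intro a ha
    change MvPolynomial.rename a.symm f = f at ha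
    change MvPolynomial.rename a f = f
    conv_lhs => rw [← ha]
    rw [MvPolynomial.rename_rename]
    simp

/-- A sector: its Feynman graph, the squared masses of its propagators, and an edge-momentum
parametrization `q = Cᵀ k + Eᵀ p` by `L` loop momenta `k` and `n` external momenta `p`. -/
structure Sector (K V Ed : Type*) [Fintype Ed] (L n : ℕ) where
  graph : FeynmanGraph V Ed n
  massSq : Ed → K
  /-- cycle basis matrix -/
  C : Matrix (Fin L) Ed ℤ
  /-- external momentum flow -/
  E : Matrix (Fin n) Ed ℚ
  /-- the rows of `C` form a `ℤ`-basis of `H₁(G, ℤ)` -/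
  C_indep : LinearIndependent ℤ C.row
  C_span : Submodule.span ℤ (Set.range C.row) = graph.cycleSpace
  /-- momentum conservation at every internal vertex -/
  E_conserved : graph.incidence.map (Int.cast : ℤ → ℚ) * Eᵀ +
    graph.inflow.map (Int.cast : ℤ → ℚ) = 0

/-- The square of the momentum `∑ a_i k_i + ∑ b_l p_l`, as a polynomial in the scalar products
`k_i · k_j` and `k_i · p_l`, which are independent variables (generic space-time dimension), while
`p_l · p_m` takes the value `Gm l m`. -/
def momentumSq {K : Type*} [Field K] {L n : ℕ} (Gm : Matrix (Fin n) (Fin n) K)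
    (a : Fin L → K) (b : Fin n → K) : MvPolynomial (Sym2 (Fin L) ⊕ Fin L × Fin n) K :=
  (∑ i, ∑ j, MvPolynomial.C (a i * a j) * MvPolynomial.X (Sum.inl s(i, j))) +
    2 * (∑ i, ∑ l, MvPolynomial.C (a i * b l) * MvPolynomial.X (Sum.inr (i, l))) +
    MvPolynomial.C (∑ l, ∑ m, b l * b m * Gm l m)

/-- The change of variables `k₁ = L k₂ + M p₂`, `p₁ = N p₂`. -/
@[ext]
structure MomentumMap (K : Type*) (ℓ n : ℕ) where
  L : Matrix (Fin ℓ) (Fin ℓ) K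
  M : Matrix (Fin ℓ) (Fin n) K
  N : Matrix (Fin n) (Fin n) K

namespace MomentumMap

variable {K : Type*} {L n : ℕ}

/-- The block matrix `T = (L M; 0 N)`. -/
def toMatrix [Zero K] (T : MomentumMap K L n) :
    Matrix (Fin L ⊕ Fin n) (Fin L ⊕ Fin n) K :=
  Matrix.fromBlocks T.L T.M 0 T.N

/-- A map with rational entries, viewed over `K`. -/
def ofRat (K : Type*) [DivisionRing K] (T : MomentumMap ℚ L n) : MomentumMap K L n where
  L := T.L.map (Rat.cast : ℚ → K)
  M := T.M.map (Rat.cast : ℚ → K)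
  N := T.N.map (Rat.cast : ℚ → K)

end MomentumMap

/-- The signed permutation matrix `(P_σ)_{ij} = κ_j δ_{i σ(j)}`. -/
def signedPerm {Ed₁ Ed₂ : Type*} [DecidableEq Ed₁] (κ : Ed₂ → ℤˣ) (σ : Ed₂ ≃ Ed₁) :
    Matrix Ed₁ Ed₂ ℚ :=
  Matrix.of fun i j => if i = σ j then ((κ j : ℤ) : ℚ) else 0

namespace Sector

variable {K V Ed V₁ V₂ Ed₁ Ed₂ : Type*} [Fintype Ed] [DecidableEq Ed] [Fintype Ed₁]
  [DecidableEq Ed₁] [Fintype Ed₂] [DecidableEq Ed₂] {L n : ℕ}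

/-- The cycle basis matrix with entries in `F`. -/
def CIn (F : Type*) [DivisionRing F] (S : Sector K V Ed L n) : Matrix (Fin L) Ed F :=
  S.C.map (Int.cast : ℤ → F)

/-- The matrix `E` with entries in `F`. -/
def EIn (F : Type*) [DivisionRing F] (S : Sector K V Ed L n) : Matrix (Fin n) Ed F :=
  S.E.map (Rat.cast : ℚ → F)

/-- The orthogonal projector `Π_C = Cᵀ (C Cᵀ)⁻¹ C`. -/
def proj (S : Sector K V Ed L n) : Matrix Ed Ed ℚ :=
  (S.CIn ℚ)ᵀ * (S.CIn ℚ * (S.CIn ℚ)ᵀ)⁻¹ * S.CIn ℚ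

/-- `Π_C^⊥ = 1 - Π_C`. -/
def projPerp (S : Sector K V Ed L n) : Matrix Ed Ed ℚ := 1 - S.proj

/-- The matrices `L_σ`, `M_σ`, `N_σ` attached to a signed bijection `(κ, σ)`. -/
def lift (S₁ : Sector K V₁ Ed₁ L n) (S₂ : Sector K V₂ Ed₂ L n) (κ : Ed₂ → ℤˣ)
    (σ : Ed₂ ≃ Ed₁) : MomentumMap ℚ L n :=
  let C₁ := S₁.CIn ℚ
  let C₂ := S₂.CIn ℚ
  let P := signedPerm κ σ
  let N := (S₁.E * S₁.projPerp * S₁.Eᵀ)⁻¹ * S₁.E * S₁.projPerp * P * S₂.projPerp * S₂.Eᵀ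
  { L := (C₁ * C₁ᵀ)⁻¹ * C₁ * P * C₂ᵀ
    M := (C₁ * C₁ᵀ)⁻¹ * C₁ * P * S₂.Eᵀ - (C₁ * C₁ᵀ)⁻¹ * C₁ * S₁.Eᵀ * N
    N := N }

variable [Field K]

/-- The square of the edge momentum `q_e(k, p)`. -/
def edgeSq (Gm : Matrix (Fin n) (Fin n) K) (S : Sector K V Ed L n) (e : Ed) :
    MvPolynomial (Sym2 (Fin L) ⊕ Fin L × Fin n) K :=
  momentumSq Gm ((S.CIn K)ᵀ e) ((S.EIn K)ᵀ e)

/-- The square of the edge momentum `q_e(k, p)` at `k = L k' + M p'`, `p = N p'`, as a function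
of `k'` and `p'`. -/
def edgeSqComp (Gm : Matrix (Fin n) (Fin n) K) (S : Sector K V Ed L n) (T : MomentumMap K L n)
    (e : Ed) : MvPolynomial (Sym2 (Fin L) ⊕ Fin L × Fin n) K :=
  momentumSq Gm (((S.CIn K)ᵀ * T.L) e) (((S.CIn K)ᵀ * T.M + (S.EIn K)ᵀ * T.N) e)

/-- The inverse propagator `D_e = q_e² - m_e²`. -/
def propagator (Gm : Matrix (Fin n) (Fin n) K) (S : Sector K V Ed L n) (e : Ed) :
    MvPolynomial (Sym2 (Fin L) ⊕ Fin L × Fin n) K :=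
  S.edgeSq Gm e - MvPolynomial.C (S.massSq e)

/-- `α` is a bijection of the propagators compatible with the change of variables `T`. -/
def Induces (Gm : Matrix (Fin n) (Fin n) K) (S₁ : Sector K V₁ Ed₁ L n)
    (S₂ : Sector K V₂ Ed₂ L n) (T : MomentumMap K L n) (α : Ed₂ ≃ Ed₁) : Prop :=
  ∀ i, S₁.edgeSqComp Gm T (α i) = S₂.edgeSq Gm i ∧ S₁.massSq (α i) = S₂.massSq i

/-- `Sym(Θ₁, Θ₂)`: the symmetry transformations from the first to the second sector. -/
def Sym (Gm : Matrix (Fin n) (Fin n) K) (S₁ : Sector K V₁ Ed₁ L n) (S₂ : Sector K V₂ Ed₂ L n) :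
    Set (MomentumMap K L n) :=
  {T | (T.L.det = 1 ∨ T.L.det = -1) ∧ (∃ α, Induces Gm S₁ S₂ T α) ∧ T.N * Gm * T.Nᵀ = Gm}

/-- The Lee–Pomeransky polynomial of the sector. -/
def leePomeransky (Gm : Matrix (Fin n) (Fin n) K) (S : Sector K V Ed L n) : MvPolynomial Ed K :=
  S.graph.leePomeransky S.massSq Gm

/-- The standing assumptions on a momentum-grouped sector. -/
structure MomentumGrouped (Gm : Matrix (Fin n) (Fin n) K) (S : Sector K V Ed L n) : Prop where
  connected : S.graph.Connected
  /-- at most one external edge at every internal vertex -/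
  leg_injective : Function.Injective S.graph.leg
  /-- every propagator depends on the loop momenta, i.e. every edge lies on a cycle -/
  loop : ∀ e, ∃ h ∈ S.graph.cycleSpace, h e ≠ 0
  /-- all external momenta enter one common block, i.e. all other factors of the integral
  are vacuum integrals -/
  common_block : 0 < n → ∃ b : S.graph.Block, ∀ x, ∃ e, S.graph.block e = b ∧
    (S.graph.src e = S.graph.leg x ∨ S.graph.tgt e = S.graph.leg x)
  /-- the propagators are pairwise distinct functions -/
  propagator_injective : Function.Injective (S.propagator Gm)

end Sector

end

/-! Write X for the diagonal matrix of the edge variables, N = Cᵀ(CXCᵀ)⁻¹C, W = 1 − XN and H = X −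
XNX. By the matrix-tree theorem 𝒰 = det(CXCᵀ), and bordering C with external flows gives ℱ/𝒰 = Σ m²x
− tr(EᵀGE·H) (`eval_firstSymanzik`, `eval_secondSymanzik`). Since 𝒰 and ℱ have different degrees, a
permutation matching the polynomials 𝒢 matches both (`det_eq_and_potential_eq`). Comparisons are
made at positive rational points, where CXCᵀ is invertible.

From 𝒢 to momenta. Successive increments of single variables in det(CXCᵀ) reveal N_ee, then N_ef²,
then N_ef N_fg N_ge. At a generic point N_ef ≠ 0 is an equivalence relation, so these data fix N up
to conjugation by a diagonal sign matrix, and the two cycle spaces agree after a signed permutation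
P (`exists_signs`). The same increments in ℱ/𝒰 show that the masses agree and that WᵀDW vanishes
wherever N_ef ≠ 0, where D is the difference of the two external forms (`form_vanishing`). The
external legs share a block, so the reduced flows WᵀEᵀ live in a single class; hence their Gram
forms agree completely, and as G is invertible they differ by an orthogonal matrix
(`exists_orthogonal`). What is left of the external flows is a combination of cycles and defines the
loop shift. This gives `exists_isSymLift`.

From momenta to 𝒢. The square of a momentum that involves loop momenta determines it up to sign, so
every symmetry has the form q₁ = Pq₂. It is therefore rational and given by the projector formulas
(`exists_isSymLift_of_induces`, `IsLift.eq_lift`), and the formulas for 𝒰 and ℱ/𝒰 are invariant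
under it (`IsSymLift.mem_permSet`). Two sign choices over the same σ differ by a function whose
multiplication preserves the cycle space; such functions are exactly those constant on blocks
(`IsCycle.block_mul`, `eq_of_block_eq`). Together this is the bijection `exists_symEquiv`.

The group statement asks for a multiplicative choice of signs, a splitting of an extension by ℤ₂^c.
If a sign cocycle χ on the blocks satisfies χ = z on the block flip z, the elements with χ = 1 form
a complement (`exists_section`). Such a cocycle is induced (`exists_cocycle`) from characters of the
block stabilizers that take the value −1 on elements acting as −1 on the block. Their existence,
`exists_char_of_isConn`, is the combinatorial core and holds for any group of monomial automorphisms
of a connected cycle space, by induction on the number of edges. If that number is odd, the sign of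
the product of the coefficients works. If all edges are parallel, or all in series, the group acts
on a line. If there is a proper nontrivial invariant family of edge sets glued to the rest along
lines (parallel classes, series classes, translates of a minimal 2-separation), each set is replaced
by one edge. Otherwise the graph behaves like a simple 3-connected one, and, as in Whitney's
theorem, an automorphism maps vertex stars to vertex stars times one common scalar, whose sign is
the character. -/

/-! ### Flows on directed multigraphs -/

namespace EdgeFlow

variable {V E : Type*}

/-- Two vertices are joined if they are connected by a path using only edges of `T`. -/
def joined (src tgt : E → V) (T : Set E) : Setoid V :=
  Relation.EqvGen.setoid fun v w => ∃ e ∈ T, src e = v ∧ tgt e = w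

variable (src tgt : E → V)

theorem joined_edge {T : Set E} {e : E} (he : e ∈ T) : joined src tgt T (src e) (tgt e) :=
  Relation.EqvGen.rel _ _ ⟨e, he, rfl, rfl⟩

variable {src tgt} in
theorem joined_induction {T : Set E} {r : V → V → Prop} (hr : Equivalence r)
    (h : ∀ e ∈ T, r (src e) (tgt e)) {u v : V} (huv : joined src tgt T u v) : r u v := by
  induction huv with
  | rel x y hxy =>
    obtain ⟨e, he, rfl, rfl⟩ := hxy
    exact h e he
  | refl x => exact hr.refl x
  | symm x y _ ih => exact hr.symm ih
  | trans x y z _ _ ih1 ih2 => exact hr.trans ih1 ih2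

variable {src tgt} in
theorem joined_mono {T T' : Set E} (hT : T ⊆ T') {u v : V} (huv : joined src tgt T u v) :
    joined src tgt T' u v :=
  joined_induction (joined src tgt T').iseqv (fun _ he => joined_edge src tgt (hT he)) huv

variable {src tgt} in
theorem eq_of_joined {T : Set E} {α : Type*} {f : V → α} (h : ∀ e ∈ T, f (src e) = f (tgt e))
    {u v : V} (huv : joined src tgt T u v) : f u = f v :=
  joined_induction (r := fun u v => f u = f v)
    ⟨fun _ => rfl, fun h => h.symm, fun h1 h2 => h1.trans h2⟩ h huv

variable [Fintype E]

open Classical in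
/-- The boundary of an edge function. -/
noncomputable def bdry {R : Type*} [CommRing R] (src tgt : E → V) : (E → R) →ₗ[R] (V → R) where
  toFun h v := ∑ e, h e * ((if tgt e = v then 1 else 0) - (if src e = v then 1 else 0))
  map_add' a b := by
    ext v
    simp only [Pi.add_apply, add_mul, Finset.sum_add_distrib]
  map_smul' a b := by
    ext v
    simp only [Pi.smul_apply, smul_eq_mul, mul_assoc, Finset.mul_sum, RingHom.id_apply]

open Classical in
theorem bdry_apply {R : Type*} [CommRing R] (h : E → R) (v : V) :
    bdry src tgt h v =
      ∑ e, h e * ((if tgt e = v then 1 else 0) - (if src e = v then 1 else 0)) := rfl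

theorem bdry_single [DecidableEq E] [DecidableEq V] {R : Type*} [CommRing R] (e : E) (r : R) :
    bdry src tgt (Pi.single e r) = Pi.single (tgt e) r - Pi.single (src e) r := by
  ext v
  rw [bdry_apply, Finset.sum_eq_single e]
  · simp only [Pi.single_eq_same, Pi.sub_apply, Pi.single_apply, mul_sub, mul_ite, mul_one,
      mul_zero, eq_comm]
  · intro b _ hb
    simp [hb]
  · simp

theorem sum_mul_bdry [Fintype V] {R : Type*} [CommRing R] (f : V → R) (h : E → R) :
    ∑ v, f v * bdry src tgt h v = ∑ e, h e * (f (tgt e) - f (src e)) := by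
  classical
  simp only [bdry_apply, Finset.mul_sum]
  rw [Finset.sum_comm]
  refine Finset.sum_congr rfl fun e _ => ?_
  simp only [mul_left_comm (f _), ← Finset.mul_sum]
  simp [mul_sub, Finset.sum_sub_distrib]

theorem bdry_map {R S : Type*} [CommRing R] [CommRing S] (φ : R →+* S) (h : E → R) (v : V) :
    bdry src tgt (fun e => φ (h e)) v = φ (bdry src tgt h v) := by
  classical
  simp only [bdry_apply, map_sum, map_mul, map_sub]
  refine Finset.sum_congr rfl fun e _ => ?_
  split_ifs <;> simp

open Classical in
variable {src tgt} in
theorem exists_flow_of_joined {R : Type*} [CommRing R] {T : Set E} {u v : V}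
    (huv : joined src tgt T u v) :
    ∃ y : E → R, (∀ e ∉ T, y e = 0) ∧ bdry src tgt y = Pi.single v 1 - Pi.single u 1 := by
  refine joined_induction (T := T) (src := src) (tgt := tgt)
    (r := fun u v => ∃ y : E → R, (∀ e ∉ T, y e = 0) ∧
      bdry src tgt y = Pi.single v 1 - Pi.single u 1) ⟨?_, ?_, ?_⟩ ?_ huv
  · exact fun x => ⟨0, by simp, by simp⟩
  · rintro x y ⟨f, hf, hb⟩
    exact ⟨-f, by simpa using hf, by rw [map_neg, hb, neg_sub]⟩
  · rintro x y z ⟨f, hf, hb⟩ ⟨f', hf', hb'⟩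
    exact ⟨f + f', fun e he => by simp [hf e he, hf' e he], by rw [map_add, hb, hb']; abel⟩
  · intro e he
    refine ⟨Pi.single e 1, fun e' he' => ?_, bdry_single src tgt e 1⟩
    refine Pi.single_eq_of_ne (fun h => he' ?_) 1
    rwa [h]

-- Route the demand at each vertex from a fixed representative of its component; a representative
-- then has to emit the total demand of the component, which is zero.
open Classical in
theorem exists_flow_of_sum_eq_zero [Fintype V] {R : Type*} [CommRing R] (T : Set E) (f : V → R)
    (hf : ∀ u, ∑ v, (if joined src tgt T u v then f v else 0) = 0) :
    ∃ y : E → R, (∀ e ∉ T, y e = 0) ∧ bdry src tgt y = f := by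
  let rep : V → V := fun v => (Quotient.mk (joined src tgt T) v).out
  have hrep : ∀ v, joined src tgt T (rep v) v := fun v => Quotient.mk_out v
  choose y hy hb using fun v => exists_flow_of_joined (R := R) (hrep v)
  refine ⟨∑ v, f v • y v, fun e he => ?_, ?_⟩
  · simp [Finset.sum_apply, hy _ e he]
  · simp only [map_sum, map_smul, hb, smul_sub, Finset.sum_sub_distrib]
    have h1 : ∑ v, f v • (Pi.single v 1 : V → R) = f := by
      ext w
      simp [Finset.sum_apply, Pi.single_apply]
    have h2 : ∑ v, f v • (Pi.single (rep v) 1 : V → R) = 0 := by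
      ext w
      simp only [Finset.sum_apply, Pi.smul_apply, Pi.single_apply, smul_eq_mul, mul_ite, mul_one,
        mul_zero, Pi.zero_apply]
      by_cases hw : ∃ u, rep u = w
      · obtain ⟨u, rfl⟩ := hw
        refine Eq.trans ?_ (hf u)
        refine Finset.sum_congr rfl fun v _ => ?_
        have hiff : rep u = rep v ↔ joined src tgt T u v := by
          refine ⟨fun h => ?_, fun h => ?_⟩
          · exact (joined src tgt T).trans ((joined src tgt T).symm (hrep u)) (h ▸ hrep v)
          · have : Quotient.mk (joined src tgt T) u = Quotient.mk _ v := Quotient.sound h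
            simp only [rep, this]
        simp only [hiff]
      · push Not at hw
        exact Finset.sum_eq_zero fun v _ => if_neg fun h => hw v h.symm
    rw [h1, h2, sub_zero]

/-- A flow supported on `T` never leaves a component of `T`: pair its boundary with the indicator of
the component. -/
theorem sum_bdry_class_eq_zero [Fintype V] {R : Type*} [CommRing R] (T : Set E) (h : E → R)
    (hh : ∀ e ∉ T, h e = 0) (u : V) [DecidablePred (joined src tgt T u)] :
    ∑ v, (if joined src tgt T u v then bdry src tgt h v else 0) = 0 := by
  have := sum_mul_bdry src tgt (fun v => if joined src tgt T u v then (1 : R) else 0) h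
  simp only [ite_mul, one_mul, zero_mul] at this
  rw [this]
  refine Finset.sum_eq_zero fun e _ => ?_
  by_cases he : e ∈ T
  · have : joined src tgt T u (tgt e) ↔ joined src tgt T u (src e) :=
      ⟨fun h => (joined src tgt T).trans h ((joined src tgt T).symm (joined_edge src tgt he)),
        fun h => (joined src tgt T).trans h (joined_edge src tgt he)⟩
    simp [this]
  · simp [hh e he]

end EdgeFlow

/-! ### Euler's formula and forests -/

namespace EdgeFlow

variable {V E : Type*} (src tgt : E → V)

open Classical in
/-- The vertex-edge matrix of the boundary. -/
noncomputable def bdryMatrix (R : Type*) [CommRing R] : Matrix V E R :=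
  Matrix.of fun v e => (if tgt e = v then 1 else 0) - (if src e = v then 1 else 0)

theorem bdryMatrix_mulVec [Fintype E] {R : Type*} [CommRing R] (h : E → R) :
    (bdryMatrix src tgt R) *ᵥ h = bdry src tgt h := by
  ext v
  simp [Matrix.mulVec, dotProduct, bdryMatrix, bdry_apply, mul_comm]

theorem bdryMatrix_transpose_mulVec [Fintype V] {R : Type*} [CommRing R] (f : V → R) (e : E) :
    ((bdryMatrix src tgt R)ᵀ *ᵥ f) e = f (tgt e) - f (src e) := by
  classical
  simp [Matrix.mulVec, dotProduct, bdryMatrix, sub_mul, Finset.sum_sub_distrib]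

/-- Rank-nullity for the boundary matrix and for its transpose, which have the same rank. The kernel
of the transpose consists of the functions that are constant on components. -/
theorem finrank_ker_bdry_add_card [Fintype E] [Fintype V] :
    Module.finrank ℚ (LinearMap.ker (bdry (R := ℚ) src tgt)) + Fintype.card V =
      Fintype.card E + Nat.card (Quotient (joined src tgt Set.univ)) := by
  classical
  have hk : LinearMap.ker (bdryMatrix src tgt ℚ).mulVecLin =
      LinearMap.ker (bdry (R := ℚ) src tgt) := by
    ext h
    simp [bdryMatrix_mulVec]
  have h1 := LinearMap.finrank_range_add_finrank_ker (bdryMatrix src tgt ℚ).mulVecLin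
  have h2 := LinearMap.finrank_range_add_finrank_ker (bdryMatrix src tgt ℚ)ᵀ.mulVecLin
  have h3 := Matrix.rank_transpose (bdryMatrix src tgt ℚ)
  rw [Matrix.rank, Matrix.rank] at h3
  rw [Module.finrank_fintype_fun_eq_card] at h1 h2
  have h4 : Module.finrank ℚ (LinearMap.ker (bdryMatrix src tgt ℚ)ᵀ.mulVecLin) =
      Nat.card (Quotient (joined src tgt Set.univ)) := by
    rw [Nat.card_eq_fintype_card, ← Module.finrank_fintype_fun_eq_card ℚ]
    have key : ∀ f : V → ℚ, f ∈ LinearMap.ker (bdryMatrix src tgt ℚ)ᵀ.mulVecLin ↔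
        ∀ e, f (src e) = f (tgt e) := by
      intro f
      rw [LinearMap.mem_ker, Matrix.mulVecLin_apply, funext_iff]
      simp only [bdryMatrix_transpose_mulVec, Pi.zero_apply, sub_eq_zero, eq_comm]
    refine LinearEquiv.finrank_eq ?_
    refine
      { toFun := fun f => Quotient.lift f.1 fun a b hab =>
          eq_of_joined (fun e _ => (key f.1).1 f.2 e) hab
        map_add' := ?_
        map_smul' := ?_
        invFun := fun g => ⟨fun v => g (Quotient.mk _ v), (key _).2 fun e =>
          congrArg g (Quotient.sound (joined_edge src tgt (Set.mem_univ e)))⟩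
        left_inv := fun f => rfl
        right_inv := ?_ }
    · rintro f g
      ext q
      induction q using Quotient.ind
      rfl
    · rintro f g
      ext q
      induction q using Quotient.ind
      rfl
    · intro g
      ext q
      induction q using Quotient.ind
      rfl
  rw [hk] at h1
  omega

theorem joined_subtype (T : Set E) :
    joined (fun e : T => src e) (fun e : T => tgt e) Set.univ = joined src tgt T := by
  ext u v
  constructor
  · exact joined_induction (joined src tgt T).iseqv fun e _ => joined_edge src tgt e.2
  · exact joined_induction (joined _ _ _).iseqv fun e he =>
      joined_edge (fun e : T => src e) (fun e : T => tgt e) (e := ⟨e, he⟩) (Set.mem_univ _)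

open Classical in
theorem bdry_subtype [Fintype E] {R : Type*} [CommRing R] (T : Set E) [Fintype T] (h : T → R) :
    bdry (fun e : T => src e) (fun e : T => tgt e) h =
      bdry src tgt (fun e => if he : e ∈ T then h ⟨e, he⟩ else 0) := by
  ext v
  rw [bdry_apply, bdry_apply]
  have : ∀ e ∉ T, (if he : e ∈ T then h ⟨e, he⟩ else 0) *
      ((if tgt e = v then 1 else 0) - (if src e = v then (1 : R) else 0)) = 0 := by
    intro e he
    simp [he]
  symm
  rw [← Finset.sum_subset (s₁ := T.toFinset) (Finset.subset_univ _) (by simpa using this)]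
  rw [← Finset.sum_coe_sort]
  refine Fintype.sum_equiv (Equiv.subtypeEquivRight (by simp)) _ _ ?_
  rintro ⟨e, he⟩
  have he' : e ∈ T := by simpa using he
  simp [he']
  rfl

/-- Euler's formula for the subgraph with edge set `F`, whose cycle space is zero. -/
theorem card_quotient_joined_of_forest [Fintype E] [Fintype V] (F : Finset E)
    (hF : ∀ h : E → ℚ, bdry src tgt h = 0 → (∀ e ∉ F, h e = 0) → h = 0) :
    F.card + Nat.card (Quotient (joined src tgt (F : Set E))) = Fintype.card V := by
  classical
  have h1 := finrank_ker_bdry_add_card (fun e : (F : Set E) => src e) (fun e : (F : Set E) => tgt e)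
  rw [joined_subtype] at h1
  have h2 : LinearMap.ker (bdry (R := ℚ) (fun e : (F : Set E) => src e)
      (fun e : (F : Set E) => tgt e)) = ⊥ := by
    rw [LinearMap.ker_eq_bot']
    intro h hh
    rw [bdry_subtype] at hh
    have := hF _ hh fun e he => by simp [show e ∉ (F : Set E) from by simpa using he]
    ext ⟨e, he⟩
    have h3 := congrFun this e
    simpa [show e ∈ F from by simpa using he] using h3
  rw [h2, finrank_bot] at h1
  simp only [Finset.coe_sort_coe, Fintype.card_coe] at h1
  omega

theorem exists_integer_multiple [Fintype E] (h : E → ℚ) :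
    ∃ (d : ℕ) (g : E → ℤ), d ≠ 0 ∧ ∀ e, (g e : ℚ) = d * h e := by
  classical
  refine ⟨∏ e, (h e).den, fun e => (h e).num * ∏ e' ∈ Finset.univ.erase e, ((h e').den : ℤ),
    Finset.prod_ne_zero_iff.2 fun e _ => (h e).den_ne_zero, fun e => ?_⟩
  rw [← Finset.mul_prod_erase _ _ (Finset.mem_univ e)]
  push_cast
  have := Rat.mul_den_eq_num (h e)
  rw [← this]
  ring

end EdgeFlow

/-! ### Determinants of `B X Dᵀ` with a diagonal matrix `X` -/

namespace Matrix

theorem det_mul_diagonal_mul_transpose_eq_sum_fun {m E R : Type*} [Fintype m] [DecidableEq m]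
    [Fintype E] [DecidableEq E] [CommRing R] (B D : Matrix m E R) (x : E → R) :
    (B * diagonal x * Dᵀ).det =
      ∑ f : m → E, (∏ i, x (f i)) * ((∏ i, B i (f i)) * (Dᵀ.submatrix f id).det) := by
  have h1 : B * diagonal x * Dᵀ = fun i => ∑ e, (B i e * x e) • Dᵀ e := by
    ext i j
    rw [Matrix.mul_apply, Finset.sum_apply]
    simp [Matrix.mul_diagonal]
  have h2 : (B * diagonal x * Dᵀ).det =
      (detRowAlternating (n := m) (R := R)).toMultilinearMap
        (fun i => ∑ e, (B i e * x e) • Dᵀ e) := by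
    rw [h1]
    rfl
  rw [h2, MultilinearMap.map_sum]
  refine Finset.sum_congr rfl fun f _ => ?_
  rw [MultilinearMap.map_smul_univ, Finset.prod_mul_distrib, smul_eq_mul]
  rw [mul_comm (∏ i, B i (f i)), mul_assoc]
  rfl

/-- Cauchy–Binet, with the product of the two minors kept packed as one determinant: in this form
the coefficient of each monomial can be evaluated by graph theory. -/
theorem det_mul_diagonal_mul_transpose_eq_sum {m E R : Type*} [Fintype m] [DecidableEq m]
    [Fintype E] [DecidableEq E] [CommRing R] (B D : Matrix m E R) (x : E → R) :
    (B * diagonal x * Dᵀ).det =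
      ∑ S ∈ Finset.powersetCard (Fintype.card m) Finset.univ,
        (∏ e ∈ S, x e) * (B * diagonal (fun e => if e ∈ S then (1 : R) else 0) * Dᵀ).det := by
  -- Both sides are expanded over maps `f : m → E`. A non-injective `f` contributes nothing, an
  -- injective one only to the set S equal to its image.
  simp only [det_mul_diagonal_mul_transpose_eq_sum_fun B D]
  simp only [Finset.mul_sum]
  rw [Finset.sum_comm]
  refine Finset.sum_congr rfl fun f _ => ?_
  by_cases hf : Function.Injective f
  · rw [Finset.sum_eq_single (Finset.univ.image f)]
    · rw [Finset.prod_image fun a _ b _ h => hf h]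
      simp
    · intro S hS hne
      have hS' : ¬ ∀ i, f i ∈ S := by
        intro hall
        apply hne
        symm
        apply Finset.eq_of_subset_of_card_le
        · intro e he
          obtain ⟨i, -, rfl⟩ := Finset.mem_image.1 he
          exact hall i
        · rw [(Finset.mem_powersetCard.1 hS).2, Finset.card_image_of_injective _ hf,
            Finset.card_univ]
      push Not at hS'
      obtain ⟨i, hi⟩ := hS'
      rw [Finset.prod_eq_zero (i := i) (Finset.mem_univ i) (by simp [hi])]
      simp
    · intro h
      exact absurd (Finset.mem_powersetCard.2 ⟨Finset.subset_univ _, by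
        rw [Finset.card_image_of_injective _ hf, Finset.card_univ]⟩) h
  · have h0 : (Dᵀ.submatrix f id).det = 0 := by
      simp only [Function.Injective, not_forall] at hf
      obtain ⟨i, j, hij, hne⟩ := hf
      exact det_zero_of_row_eq hne (by ext k; simp [hij])
    simp [h0]

/-! ### The response matrix `N = Cᵀ (C X Cᵀ)⁻¹ C` -/

variable {ι E F : Type*} [Fintype ι] [DecidableEq ι] [Fintype E] [DecidableEq E] [Field F]

/-- The matrix `A = C X Cᵀ`. -/
def weighted (C : Matrix ι E F) (x : E → F) : Matrix ι ι F := C * diagonal x * Cᵀ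

/-- The matrix `N = Cᵀ (C X Cᵀ)⁻¹ C`. -/
noncomputable def response (C : Matrix ι E F) (x : E → F) : Matrix E E F :=
  Cᵀ * (weighted C x)⁻¹ * C

/-- The matrix `H = X - X N X`. -/
noncomputable def reduced (C : Matrix ι E F) (x : E → F) : Matrix E E F :=
  diagonal x - diagonal x * response C x * diagonal x

/-- The matrix `1 - X N`. -/
noncomputable def coproj (C : Matrix ι E F) (x : E → F) : Matrix E E F :=
  1 - diagonal x * response C x

omit [Fintype E] in
theorem diagonal_add_piSingle (x : E → F) (f : E) (t : F) :
    diagonal (x + Pi.single f t) = diagonal x + Matrix.single f f t := by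
  rw [← diagonal_single]
  exact (diagonal_add x (Pi.single f t)).symm

variable (C : Matrix ι E F) (x : E → F)

omit [Fintype ι] [DecidableEq ι] in
theorem weighted_transpose : (weighted C x)ᵀ = weighted C x := by
  simp [weighted, transpose_mul, Matrix.mul_assoc]

theorem response_transpose : (response C x)ᵀ = response C x := by
  simp [response, transpose_mul, Matrix.mul_assoc, transpose_nonsing_inv, weighted_transpose]

theorem response_comm (e f : E) : response C x e f = response C x f e := by
  conv_lhs => rw [← response_transpose, transpose_apply]

variable {C x}

theorem response_mul_transpose (hA : IsUnit (weighted C x).det) :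
    response C x * diagonal x * Cᵀ = Cᵀ := by
  have : response C x * diagonal x * Cᵀ = Cᵀ * ((weighted C x)⁻¹ * weighted C x) := by
    simp only [response, weighted, Matrix.mul_assoc]
  rw [this, nonsing_inv_mul _ hA, Matrix.mul_one]

/-- `response C x * diagonal x` is a projector onto the row space of `C`, which contains the columns
of every `response C y`. -/
theorem response_mul_response {y : E → F} (hA : IsUnit (weighted C x).det) :
    response C x * diagonal x * response C y = response C y := by
  rw [show response C y = Cᵀ * ((weighted C y)⁻¹ * C) by simp [response, Matrix.mul_assoc],
    ← Matrix.mul_assoc, response_mul_transpose hA]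

theorem response_mul_response' {y : E → F} (hA : IsUnit (weighted C x).det) :
    response C y * diagonal x * response C x = response C y := by
  have := congrArg transpose (response_mul_response (y := y) hA)
  simpa [transpose_mul, response_transpose, Matrix.mul_assoc] using this

/-- A form of Sherman–Morrison without division: N(x) X' N(x') is evaluated once by absorbing X'
into N(x') and once by splitting X' = X + t·E_ff. -/
theorem response_update (hA : IsUnit (weighted C x).det) (f : E) (t : F)
    (hA' : IsUnit (weighted C (x + Pi.single f t)).det) (e g : E) :
    response C x e g = response C (x + Pi.single f t) e g +
      t * response C x e f * response C (x + Pi.single f t) f g := by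
  have h1 := response_mul_response' (y := x) hA'
  have hd : diagonal (x + Pi.single f t) = diagonal x + Matrix.single f f t :=
    diagonal_add_piSingle x f t
  have h2 : response C x * diagonal (x + Pi.single f t) * response C (x + Pi.single f t) =
      response C (x + Pi.single f t) +
        response C x * Matrix.single f f t * response C (x + Pi.single f t) := by
    conv_lhs => rw [hd]
    rw [Matrix.mul_add, Matrix.add_mul, response_mul_response hA]
  rw [h1] at h2
  have h3 := congrFun (congrFun h2 e) g
  rw [Matrix.add_apply] at h3
  rw [h3]
  congr 1
  rw [Matrix.mul_assoc, Matrix.mul_apply, Finset.sum_eq_single f]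
  · rw [Matrix.single_mul_apply_same]
    ring
  · intro b _ hb
    rw [Matrix.single_mul_apply_of_ne _ _ _ _ _ hb]
    ring
  · simp

/-- Matrix determinant lemma: an increment of one variable is a rank-one change of CXCᵀ. Thus N_ff
is the logarithmic derivative of the determinant in x_f. -/
theorem det_weighted_update (hA : IsUnit (weighted C x).det) (f : E) (t : F) :
    (weighted C (x + Pi.single f t)).det = (weighted C x).det * (1 + t * response C x f f) := by
  have hd : diagonal (x + Pi.single f t) = diagonal x + Matrix.single f f t :=
    diagonal_add_piSingle x f t
  have h1 : weighted C (x + Pi.single f t) = weighted C x +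
      replicateCol Unit (fun i => C i f) * replicateRow Unit (fun i => t * C i f) := by
    rw [weighted, hd, Matrix.mul_add, Matrix.add_mul, weighted]
    congr 1
    ext i j
    rw [Matrix.mul_assoc, Matrix.mul_apply, Finset.sum_eq_single f]
    · rw [Matrix.single_mul_apply_same]
      simp [Matrix.mul_apply]
    · intro b _ hb
      rw [Matrix.single_mul_apply_of_ne _ _ _ _ _ hb]
      ring
    · simp
  rw [h1, det_add_replicateCol_mul_replicateRow hA]
  congr 1
  have : replicateRow Unit (fun i => t * C i f) * (weighted C x)⁻¹ *
      replicateCol Unit (fun i => C i f) = of fun _ _ => t * response C x f f := by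
    ext a b
    simp only [response, Matrix.mul_apply, replicateRow_apply, replicateCol_apply,
      transpose_apply, Finset.mul_sum, Finset.sum_mul, mul_assoc, of_apply]
  rw [this]
  simp

theorem one_add_mul_response_ne_zero (hA : IsUnit (weighted C x).det) {f : E} {t : F}
    (hA' : IsUnit (weighted C (x + Pi.single f t)).det) : 1 + t * response C x f f ≠ 0 := by
  rw [det_weighted_update hA] at hA'
  exact (mul_ne_zero_iff.1 hA'.ne_zero).2

theorem response_update_apply (hA : IsUnit (weighted C x).det) (f : E) (t : F)
    (hA' : IsUnit (weighted C (x + Pi.single f t)).det) (e g : E) :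
    response C (x + Pi.single f t) e g = response C x e g -
      t / (1 + t * response C x f f) * response C x e f * response C x f g := by
  have h0 := one_add_mul_response_ne_zero hA hA'
  have h1 := response_update hA f t hA' e g
  have h2 := response_update hA f t hA' f g
  field_simp
  linear_combination (-(1 + t * response C x f f)) * h1 + t * response C x e f * h2

theorem coproj_apply (e g : E) :
    coproj C x e g = (if e = g then 1 else 0) - x e * response C x e g := by
  simp [coproj, Matrix.one_apply, Matrix.diagonal_mul]

theorem reduced_apply (e g : E) :
    reduced C x e g = (if e = g then x e else 0) - x e * response C x e g * x g := by
  simp [reduced, Matrix.diagonal_apply, Matrix.diagonal_mul, Matrix.mul_diagonal]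

theorem coproj_update (hA : IsUnit (weighted C x).det) (f : E) (t : F)
    (hA' : IsUnit (weighted C (x + Pi.single f t)).det) (e g : E) :
    coproj C (x + Pi.single f t) e g = coproj C x e g -
      t / (1 + t * response C x f f) * response C x f g * coproj C x e f := by
  have h0 := one_add_mul_response_ne_zero hA hA'
  simp only [coproj_apply, response_update_apply hA f t hA', Pi.add_apply, Pi.single_apply]
  by_cases hef : e = f
  · subst hef
    simp only [if_true]
    field_simp
    ring
  · simp only [hef, if_false]
    field_simp
    ring

/-- An increment of x_f changes H by a rank-one matrix built from column f of 1 − XN. All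
information extracted from ℱ comes from this formula. -/
theorem reduced_update (hA : IsUnit (weighted C x).det) (f : E) (t : F)
    (hA' : IsUnit (weighted C (x + Pi.single f t)).det) (e g : E) :
    reduced C (x + Pi.single f t) e g = reduced C x e g +
      t / (1 + t * response C x f f) * (coproj C x e f * coproj C x g f) := by
  have h0 := one_add_mul_response_ne_zero hA hA'
  simp only [coproj_apply, reduced_apply, response_update_apply hA f t hA', Pi.add_apply,
    Pi.single_apply]
  by_cases hef : e = f
  · subst hef
    by_cases hge : g = e
    · subst hge
      simp only [if_true]
      field_simp
      ring
    · simp only [hge, Ne.symm hge, if_false, if_true]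
      rw [response_comm C x g e]
      field_simp
      ring
  · by_cases hgf : g = f
    · subst hgf
      simp only [hef, if_true, if_false]
      field_simp
      ring
    · simp only [hef, hgf, if_false]
      rw [response_comm C x g f]
      rcases eq_or_ne e g with rfl | heg
      · simp only [if_true]
        field_simp
        ring
      · simp only [heg, if_false]
        field_simp
        ring

omit [Fintype ι] [DecidableEq ι] in
theorem weighted_smul (t : F) : weighted C (t • x) = t • weighted C x := by
  rw [weighted, diagonal_smul, Matrix.mul_smul, Matrix.smul_mul, weighted]

theorem response_smul (hA : IsUnit (weighted C x).det) {t : F} (ht : t ≠ 0) :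
    response C (t • x) = t⁻¹ • response C x := by
  have : (weighted C (t • x))⁻¹ = t⁻¹ • (weighted C x)⁻¹ := by
    apply inv_eq_left_inv
    rw [weighted_smul, Matrix.smul_mul, Matrix.mul_smul, smul_smul, inv_mul_cancel₀ ht,
      nonsing_inv_mul _ hA, one_smul]
  rw [response, this, Matrix.mul_smul, Matrix.smul_mul, response]

theorem reduced_smul (hA : IsUnit (weighted C x).det) {t : F} (ht : t ≠ 0) :
    reduced C (t • x) = t • reduced C x := by
  ext e g
  simp only [reduced_apply, response_smul hA ht, Matrix.smul_apply, smul_eq_mul, Pi.smul_apply]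
  split_ifs
  · field_simp
  · field_simp
    ring

omit [Fintype ι] [DecidableEq ι] in
theorem weighted_map {F' : Type*} [Field F'] (φ : F →+* F') :
    weighted (C.map φ) (φ ∘ x) = (weighted C x).map φ := by
  simp only [weighted, Matrix.map_mul, transpose_map, diagonal_map (map_zero φ)]
  rfl

theorem response_map {F' : Type*} [Field F'] (φ : F →+* F') (hA : IsUnit (weighted C x).det) :
    response (C.map φ) (φ ∘ x) = (response C x).map φ := by
  have : (weighted (C.map φ) (φ ∘ x))⁻¹ = ((weighted C x)⁻¹).map φ := by
    apply inv_eq_left_inv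
    rw [weighted_map, ← Matrix.map_mul, nonsing_inv_mul _ hA]
    simp
  rw [response, this, response, Matrix.map_mul, Matrix.map_mul, transpose_map]

/-- The quadratic form of CXCᵀ is the sum of x_e (Cᵀv)_e², which is definite for positive rational
x. -/
theorem isUnit_det_weighted_of_pos {C : Matrix ι E ℚ} (hC : ∀ v, Cᵀ *ᵥ v = 0 → v = 0)
    {x : E → ℚ} (hx : ∀ e, 0 < x e) : IsUnit (weighted C x).det := by
  rw [← Matrix.isUnit_iff_isUnit_det, ← Matrix.mulVec_injective_iff_isUnit]
  refine (injective_iff_map_eq_zero (Matrix.mulVecLin (weighted C x))).2 ?_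
  intro v hv
  apply hC
  have h1 : v ⬝ᵥ (weighted C x *ᵥ v) = ∑ e, x e * (Cᵀ *ᵥ v) e ^ 2 := by
    rw [weighted, ← Matrix.mulVec_mulVec, ← Matrix.mulVec_mulVec, Matrix.dotProduct_mulVec,
      ← Matrix.mulVec_transpose]
    simp only [dotProduct, Matrix.mulVec_diagonal]
    exact Finset.sum_congr rfl fun e _ => by ring
  rw [Matrix.mulVecLin_apply] at hv
  rw [hv, dotProduct_zero, eq_comm,
    Finset.sum_eq_zero_iff_of_nonneg fun e _ => mul_nonneg (hx e).le (sq_nonneg _)] at h1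
  ext e
  have := h1 e (Finset.mem_univ e)
  simpa [(hx e).ne'] using this

/-- N_ee is the sum of x_g N_eg², so its vanishing kills row e of N, hence row e of NXCᵀ = Cᵀ. -/
theorem response_self_ne_zero {C : Matrix ι E ℚ} {x : E → ℚ} (hA : IsUnit (weighted C x).det)
    (hx : ∀ e, 0 < x e) {e : E} (he : ∃ i, C i e ≠ 0) : response C x e e ≠ 0 := by
  intro h0
  have h1 : ∑ g, x g * response C x e g ^ 2 = 0 := by
    rw [← h0]
    conv_rhs => rw [← response_mul_response (y := x) hA]
    rw [Matrix.mul_apply]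
    refine Finset.sum_congr rfl fun g _ => ?_
    rw [Matrix.mul_diagonal, response_comm C x g e]
    ring
  rw [Finset.sum_eq_zero_iff_of_nonneg fun e _ => mul_nonneg (hx e).le (sq_nonneg _)] at h1
  obtain ⟨i, hi⟩ := he
  apply hi
  have h2 := congrFun (congrFun (response_mul_transpose hA) e) i
  rw [Matrix.mul_apply, transpose_apply] at h2
  rw [← h2]
  refine Finset.sum_eq_zero fun g _ => ?_
  have h3 := h1 g (Finset.mem_univ g)
  have h4 : response C x e g = 0 := by simpa [(hx g).ne'] using h3
  rw [Matrix.mul_diagonal, h4]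
  ring

end Matrix

/-! ### Cycle bases of connected graphs -/

/-- The rows of `C` form a basis of the integral cycle space of a connected graph. -/
structure IsCycleBasis {V E : Type*} [Fintype E] {L : ℕ} (src tgt : E → V)
    (C : Matrix (Fin L) E ℤ) : Prop where
  connected : ∀ v w, EdgeFlow.joined src tgt Set.univ v w
  injective : ∀ v, Cᵀ *ᵥ v = 0 → v = 0
  bdry_eq_zero_iff : ∀ h : E → ℤ, EdgeFlow.bdry src tgt h = 0 ↔ ∃ v, Cᵀ *ᵥ v = h

namespace IsCycleBasis

open EdgeFlow

variable {V E : Type*} [Fintype E] {L : ℕ} {src tgt : E → V} {C : Matrix (Fin L) E ℤ}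

omit [Fintype E] in
theorem map_transpose_mulVec {m R S : Type*} [Fintype m] [CommRing R] [CommRing S] (φ : R →+* S)
    (C : Matrix m E R) (v : m → R) (e : E) :
    ((C.map φ)ᵀ *ᵥ (φ ∘ v)) e = φ ((Cᵀ *ᵥ v) e) := by
  simp [Matrix.mulVec, dotProduct]

theorem rat_injective (hC : IsCycleBasis src tgt C) (v : Fin L → ℚ)
    (hv : (C.map (Int.cast : ℤ → ℚ))ᵀ *ᵥ v = 0) : v = 0 := by
  obtain ⟨d, g, hd, hg⟩ := exists_integer_multiple v
  have hg' : (Int.castRingHom ℚ) ∘ g = (d : ℚ) • v := funext hg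
  have h0 : Cᵀ *ᵥ g = 0 := by
    ext e
    have := map_transpose_mulVec (Int.castRingHom ℚ) C g e
    rw [hg', Matrix.mulVec_smul] at this
    have h1 : ((C.map (Int.castRingHom ℚ))ᵀ *ᵥ v) = 0 := hv
    rw [h1, smul_zero, Pi.zero_apply] at this
    simpa using this.symm
  have h1 := hC.injective g h0
  ext i
  have h2 := hg i
  rw [h1] at h2
  simpa [hd] using h2

theorem rat_bdry_eq_zero_iff (hC : IsCycleBasis src tgt C) (h : E → ℚ) :
    bdry src tgt h = 0 ↔ ∃ v, (C.map (Int.cast : ℤ → ℚ))ᵀ *ᵥ v = h := by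
  constructor
  · intro hh
    obtain ⟨d, g, hd, hg⟩ := exists_integer_multiple h
    have hg' : (fun e => (Int.castRingHom ℚ) (g e)) = (d : ℚ) • h := funext hg
    have h0 : bdry src tgt g = 0 := by
      ext v
      have := bdry_map src tgt (Int.castRingHom ℚ) g v
      rw [hg', map_smul, hh, smul_zero, Pi.zero_apply] at this
      simpa using this.symm
    obtain ⟨v, hv⟩ := (hC.bdry_eq_zero_iff g).1 h0
    refine ⟨(d : ℚ)⁻¹ • (Int.castRingHom ℚ) ∘ v, ?_⟩
    have hd' : (d : ℚ) ≠ 0 := by exact_mod_cast hd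
    rw [Matrix.mulVec_smul]
    ext e
    have := map_transpose_mulVec (Int.castRingHom ℚ) C v e
    rw [hv] at this
    rw [Pi.smul_apply, smul_eq_mul]
    refine (congrArg _ this).trans ?_
    rw [eq_intCast, hg, inv_mul_cancel_left₀ hd']
  · rintro ⟨v, rfl⟩
    have hi : ∀ i, bdry src tgt ((C.map (Int.cast : ℤ → ℚ)) i) = 0 := by
      intro i
      have h1 : bdry src tgt (C i) = 0 :=
        (hC.bdry_eq_zero_iff _).2 ⟨Pi.single i 1, by
          ext e; simp⟩
      ext w
      have := bdry_map src tgt (Int.castRingHom ℚ) (C i) w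
      rw [h1] at this
      exact this.trans (by simp)
    have : (C.map (Int.cast : ℤ → ℚ))ᵀ *ᵥ v = ∑ i, v i • (C.map (Int.cast : ℤ → ℚ)) i := by
      ext e
      simp [Matrix.mulVec, dotProduct, Finset.sum_apply, mul_comm]
    rw [this, map_sum]
    simp [hi]

theorem loops_add_card [Fintype V] [Nonempty V] (hC : IsCycleBasis src tgt C) :
    L + Fintype.card V = Fintype.card E + 1 := by
  have h1 := finrank_ker_bdry_add_card src tgt
  have h2 : Nat.card (Quotient (joined src tgt Set.univ)) = 1 := by
    rw [Nat.card_eq_one_iff_unique]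
    refine ⟨⟨fun a b => ?_⟩, ⟨Quotient.mk _ (Classical.arbitrary V)⟩⟩
    induction a using Quotient.ind
    induction b using Quotient.ind
    exact Quotient.sound (hC.connected _ _)
  have h3 : LinearMap.ker (bdry (R := ℚ) src tgt) =
      LinearMap.range (C.map (Int.cast : ℤ → ℚ))ᵀ.mulVecLin := by
    ext h
    rw [LinearMap.mem_ker, hC.rat_bdry_eq_zero_iff]
    rfl
  have h4 := LinearMap.finrank_range_of_inj (f := (C.map (Int.cast : ℤ → ℚ))ᵀ.mulVecLin)
    ((injective_iff_map_eq_zero _).2 hC.rat_injective)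
  rw [h3, h4, Module.finrank_fintype_fun_eq_card, Fintype.card_fin] at h1
  omega

/-- The integral form of acyclicity. -/
def Acyclic (src tgt : E → V) (F : Finset E) : Prop :=
  ∀ h : E → ℤ, bdry src tgt h = 0 → (∀ e ∉ F, h e = 0) → h = 0

theorem card_of_acyclic [Fintype V] {F : Finset E} (hF : Acyclic src tgt F) :
    F.card + Nat.card (Quotient (joined src tgt (F : Set E))) = Fintype.card V := by
  refine card_quotient_joined_of_forest src tgt F fun h hh hsupp => ?_
  obtain ⟨d, g, hd, hg⟩ := exists_integer_multiple h
  have hg' : (fun e => (Int.castRingHom ℚ) (g e)) = (d : ℚ) • h := funext hg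
  have h0 : g = 0 := by
    apply hF
    · ext v
      have := bdry_map src tgt (Int.castRingHom ℚ) g v
      rw [hg', map_smul, hh, smul_zero, Pi.zero_apply] at this
      simpa using this.symm
    · intro e he
      have := hg e
      rw [hsupp e he, mul_zero] at this
      exact_mod_cast this
  ext e
  have := hg e
  rw [h0] at this
  simpa [hd] using this

variable [DecidableEq E]

theorem card_quotient_eq_iff [Fintype V] [Nonempty V] (hC : IsCycleBasis src tgt C) {F : Finset E}
    (hF : Acyclic src tgt F) (p : ℕ) :
    Nat.card (Quotient (joined src tgt (F : Set E))) = p ↔ Fᶜ.card + 1 = L + p := by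
  have h1 := card_of_acyclic hF
  have h2 := hC.loops_add_card
  have h3 := F.card_compl
  have h4 := F.card_le_univ
  omega

/-- Fundamental cycles: each edge is closed up by a path inside the connected spanning set `F`,
which does not disturb the values off `F`. -/
theorem exists_cycle_extending (hC : IsCycleBasis src tgt C) {F : Finset E}
    (hF : Nat.card (Quotient (joined src tgt (F : Set E))) = 1) (y : E → ℤ) :
    ∃ v, ∀ e ∉ F, (Cᵀ *ᵥ v) e = y e := by
  classical
  rw [Nat.card_eq_one_iff_unique] at hF
  have hj : ∀ u v, joined src tgt (F : Set E) u v := fun u v =>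
    Quotient.exact (hF.1.elim (Quotient.mk _ u) (Quotient.mk _ v))
  choose f hf hb using fun e => exists_flow_of_joined (R := ℤ) (hj (tgt e) (src e))
  obtain ⟨v, hv⟩ := (hC.bdry_eq_zero_iff (∑ e, y e • (f e + Pi.single e 1))).1 (by
    rw [map_sum]
    refine Finset.sum_eq_zero fun e _ => ?_
    rw [map_smul, map_add, hb, bdry_single, sub_add_sub_cancel', sub_self, smul_zero])
  refine ⟨v, fun e he => ?_⟩
  rw [hv, Finset.sum_apply, Finset.sum_eq_single e]
  · simp [hf e e (by simpa using he)]
  · intro b _ hb'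
    simp [hf b e (by simpa using he), hb'.symm]
  · simp

/-- Fundamental cycles provide an integral inverse, so the determinant is ±1; being a Gram
determinant, it is nonnegative. -/
theorem det_eq_one (hC : IsCycleBasis src tgt C) {S : Finset E}
    (hF : Acyclic src tgt Sᶜ) (hcard : Nat.card (Quotient (joined src tgt ((Sᶜ : Finset E) : Set E))) = 1) :
    (C * Matrix.diagonal (fun e => if e ∈ S then (1 : ℤ) else 0) * Cᵀ).det = 1 := by
  set D : Matrix E E ℤ := Matrix.diagonal (fun e => if e ∈ S then (1 : ℤ) else 0) with hD
  have hDD : D * D = D := by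
    rw [hD, Matrix.diagonal_mul_diagonal]
    congr 1
    ext e
    simp
  choose v hv using fun e : E => hC.exists_cycle_extending hcard (Pi.single e 1)
  -- Column `e` holds the coordinates of the cycle that equals 1 at `e` and 0 at the other edges of
  -- `S` (for `e ∈ S`).
  let W : Matrix (Fin L) E ℤ := Matrix.of fun i e => v e i
  have h1 : D * Cᵀ * W = D := by
    ext e g
    have h2 : (Cᵀ * W) e g = (Cᵀ *ᵥ v g) e := by
      simp [Matrix.mul_apply, Matrix.mulVec, dotProduct, W]
    rw [Matrix.mul_assoc, hD, Matrix.diagonal_mul, h2, Matrix.diagonal_apply]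
    by_cases he : e ∈ S
    · rw [hv g e (by simpa using he)]
      by_cases heg : e = g
      · subst heg; simp [he]
      · simp [heg]
    · simp [he]
  have h3 : W * D * Cᵀ = 1 := by
    rw [← sub_eq_zero]
    -- The cycle with these coordinates vanishes on `S`, so it is supported on the tree and is zero.
    have key : ∀ u, (W * D * Cᵀ - 1) *ᵥ u = 0 := by
      intro u
      apply hC.injective
      apply hF
      · exact (hC.bdry_eq_zero_iff _).2 ⟨_, rfl⟩
      · intro e he
        have he' : e ∈ S := by simpa using he
        have h4 : D * Cᵀ * (W * D * Cᵀ - 1) = 0 := by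
          rw [Matrix.mul_sub, ← Matrix.mul_assoc, ← Matrix.mul_assoc, h1, hDD, Matrix.mul_one,
            sub_self]
        have h5 := congrFun (congrArg (fun M => M *ᵥ u) h4) e
        simp only [Matrix.zero_mulVec, Pi.zero_apply] at h5
        rw [← Matrix.mulVec_mulVec, ← Matrix.mulVec_mulVec, hD, Matrix.mulVec_diagonal] at h5
        simpa [he'] using h5
    ext i j
    have := congrFun (key (Pi.single j 1)) i
    simpa [Matrix.mulVec_single_one] using this
  have h4 : C * D * Wᵀ = 1 := by
    have := congrArg Matrix.transpose h3
    simpa [Matrix.transpose_mul, hD, Matrix.mul_assoc] using this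
  have h5 : (C * D * Cᵀ) * (W * Wᵀ) = 1 := by
    calc (C * D * Cᵀ) * (W * Wᵀ) = C * (D * Cᵀ * W) * Wᵀ := by simp only [Matrix.mul_assoc]
      _ = 1 := by rw [h1, h4]
  have h6 : IsUnit (C * D * Cᵀ).det := by
    exact (Matrix.isUnit_iff_isUnit_det _).1 (IsUnit.of_mul_eq_one _ h5)
  have h7 : 0 ≤ (C * D * Cᵀ).det := by
    let f := Int.castRingHom ℝ
    have hDT : Dᵀ = D := Matrix.diagonal_transpose _
    have h8 : (C * D * Cᵀ).map f = ((C * D).map f) * ((C * D).map f)ᴴ := by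
      rw [Matrix.conjTranspose_eq_transpose_of_trivial, ← Matrix.transpose_map,
        ← Matrix.map_mul, Matrix.transpose_mul, hDT, Matrix.mul_assoc C D (D * Cᵀ),
        ← Matrix.mul_assoc D, hDD, ← Matrix.mul_assoc]
    have h9 := (Matrix.posSemidef_self_mul_conjTranspose ((C * D).map f)).det_nonneg
    rw [← h8, ← RingHom.mapMatrix_apply, ← RingHom.map_det] at h9
    simpa [f] using h9
  rcases Int.isUnit_iff.1 h6 with h | h
  · exact h
  · omega

/-- A nonzero cycle that avoids `S` gives a kernel vector. -/
theorem det_eq_zero (hC : IsCycleBasis src tgt C) {S : Finset E}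
    (hF : ¬ Acyclic src tgt Sᶜ) :
    (C * Matrix.diagonal (fun e => if e ∈ S then (1 : ℤ) else 0) * Cᵀ).det = 0 := by
  simp only [Acyclic, not_forall] at hF
  obtain ⟨h, hh, hS, hne⟩ := hF
  obtain ⟨v, rfl⟩ := (hC.bdry_eq_zero_iff h).1 hh
  refine Matrix.exists_mulVec_eq_zero_iff.1 ⟨v, fun h0 => hne (by simp [h0]), ?_⟩
  rw [← Matrix.mulVec_mulVec, ← Matrix.mulVec_mulVec]
  have : Matrix.diagonal (fun e => if e ∈ S then (1 : ℤ) else 0) *ᵥ (Cᵀ *ᵥ v) = 0 := by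
    ext e
    rw [Matrix.mulVec_diagonal]
    by_cases he : e ∈ S
    · simp [hS e (by simpa using he)]
    · simp [he]
  rw [this, Matrix.mulVec_zero]

end IsCycleBasis

/-! ### Evaluation of the Symanzik polynomials -/

namespace Matrix

variable {L : ℕ} {E K : Type*} [Fintype E] [DecidableEq E] [Field K]

/-- The matrix `C` with the additional row `v`. -/
def bordered (C : Matrix (Fin L) E K) (v : E → K) : Matrix (Fin L ⊕ Unit) E K :=
  fromRows C (of fun _ => v)

omit [Fintype E] [DecidableEq E] [Field K] in
theorem bordered_transpose (C : Matrix (Fin L) E K) (v : E → K) :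
    (bordered C v)ᵀ = fromCols Cᵀ (of fun e _ => v e) := by
  ext e (i | i) <;> rfl

/-- Schur complement of the block CXCᵀ. -/
theorem det_bordered (C : Matrix (Fin L) E K) (v w x : E → K)
    (hA : IsUnit (weighted C x).det) :
    (bordered C v * diagonal x * (bordered C w)ᵀ).det =
      (weighted C x).det * (v ⬝ᵥ (reduced C x *ᵥ w)) := by
  have h1 : bordered C v * diagonal x * (bordered C w)ᵀ =
      fromBlocks (weighted C x) (C * diagonal x * of fun e (_ : Unit) => w e)
        ((of fun _ : Unit => v) * diagonal x * Cᵀ)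
        ((of fun _ : Unit => v) * diagonal x * of fun e (_ : Unit) => w e) := by
    rw [bordered_transpose, bordered, fromRows_mul, fromRows_mul_fromCols]
    rfl
  have := hA
  rw [← isUnit_iff_isUnit_det] at this
  have : Invertible (weighted C x) := this.invertible
  rw [h1, det_fromBlocks₁₁, invOf_eq_nonsing_inv]
  congr 1
  have h2 : (of fun _ : Unit => v) * diagonal x * (of fun e (_ : Unit) => w e) -
      (of fun _ : Unit => v) * diagonal x * Cᵀ * (weighted C x)⁻¹ *
        (C * diagonal x * of fun e (_ : Unit) => w e) =
      (of fun _ : Unit => v) * (reduced C x * of fun e (_ : Unit) => w e) := by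
    simp only [reduced, response, Matrix.sub_mul, Matrix.mul_sub, Matrix.mul_assoc]
  rw [h2, det_unique, Matrix.mul_apply]
  rfl

/-- Restricted to `S`, the added row is a combination of the rows of `C` plus a multiple of the unit
vector at `e₀`. Row operations leave these two multiples as factors, and the remaining determinant
is that of the tree obtained by adding `e₀` to the forest. -/
theorem det_bordered_indicator (C : Matrix (Fin L) E K) (S : Finset E) (e₀ : E) (he₀ : e₀ ∈ S)
    (hdet : (C * diagonal (fun e => if e ∈ S.erase e₀ then (1 : K) else 0) * Cᵀ).det = 1)
    (v w : E → K) (a b : Fin L → K) (β γ : K)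
    (hv : ∀ e ∈ S, v e = (Cᵀ *ᵥ a) e + if e = e₀ then β else 0)
    (hw : ∀ e ∈ S, w e = (Cᵀ *ᵥ b) e + if e = e₀ then γ else 0) :
    (bordered C v * diagonal (fun e => if e ∈ S then (1 : K) else 0) * (bordered C w)ᵀ).det =
      β * γ := by
  set D : Matrix E E K := diagonal (fun e => if e ∈ S then (1 : K) else 0) with hD
  have hDD : D * D = D := by
    rw [hD, diagonal_mul_diagonal]
    congr 1
    ext e
    simp
  let B₀ := bordered C (Pi.single e₀ 1)
  -- The row operation that turns the unit vector at `e₀` into the given row; its determinant is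
  -- `β`.
  let P : (Fin L → K) → K → Matrix (Fin L ⊕ Unit) (Fin L ⊕ Unit) K := fun a β =>
    fromBlocks 1 0 (of fun (_ : Unit) i => a i) (of fun _ _ => β)
  have key : ∀ (v : E → K) (a : Fin L → K) (β : K),
      (∀ e ∈ S, v e = (Cᵀ *ᵥ a) e + if e = e₀ then β else 0) →
      bordered C v * D = P a β * (B₀ * D) := by
    intro v a β hv
    ext (i | i) e
    · rw [hD, Matrix.mul_diagonal, Matrix.mul_apply, Fintype.sum_sum_type]
      simp [P, bordered, B₀, Matrix.one_apply, Matrix.mul_diagonal]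
    · rw [hD, Matrix.mul_diagonal, Matrix.mul_apply, Fintype.sum_sum_type]
      by_cases he : e ∈ S
      · simp [P, bordered, B₀, Matrix.mul_diagonal, he, hv e he, mulVec, dotProduct, Pi.single_apply,
          mul_comm]
      · simp [B₀, Matrix.mul_diagonal, he]
  have hdetP : ∀ (a : Fin L → K) (β : K), (P a β).det = β := by
    intro a β
    simp only [P]
    rw [det_fromBlocks_zero₁₂, det_one, one_mul, det_unique]
    rfl
  have h1 : bordered C v * D * (bordered C w)ᵀ = (bordered C v * D) * (bordered C w * D)ᵀ := by
    rw [transpose_mul, hD, diagonal_transpose, ← hD, ← Matrix.mul_assoc, Matrix.mul_assoc _ D D,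
      hDD]
  have h2 : (B₀ * D) * (B₀ * D)ᵀ = fromBlocks (C * D * Cᵀ) (of fun i (_ : Unit) => C i e₀)
      (of fun (_ : Unit) i => C i e₀) 1 := by
    rw [transpose_mul, hD, diagonal_transpose, ← hD, ← Matrix.mul_assoc, Matrix.mul_assoc _ D D,
      hDD, bordered_transpose]
    simp only [B₀, bordered]
    rw [fromRows_mul, fromRows_mul_fromCols]
    congr 1
    · ext i j
      simp [Matrix.mul_apply, hD, Matrix.diagonal_apply, Pi.single_apply, he₀]
    · ext i j
      simp [Matrix.mul_apply, hD, Matrix.diagonal_apply, Pi.single_apply, he₀]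
    · ext i j
      simp [Matrix.mul_apply, hD, Pi.single_apply, he₀]
  -- Eliminating the corner entry 1 removes `e₀` from the index set.
  have h3 : C * D * Cᵀ - (of fun i (_ : Unit) => C i e₀) * (of fun (_ : Unit) i => C i e₀) =
      C * diagonal (fun e => if e ∈ S.erase e₀ then (1 : K) else 0) * Cᵀ := by
    ext i j
    rw [Matrix.sub_apply, Matrix.mul_apply, Matrix.mul_apply, Matrix.mul_apply,
      ← Finset.add_sum_erase _ _ (Finset.mem_univ e₀),
      ← Finset.add_sum_erase (a := e₀) (s := Finset.univ) (f := fun j_1 =>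
        (C * diagonal (fun e => if e ∈ S.erase e₀ then (1 : K) else 0)) i j_1 * Cᵀ j_1 j)
        (Finset.mem_univ e₀)]
    simp only [hD, Matrix.mul_diagonal, Finset.univ_unique, Finset.sum_singleton, of_apply,
      transpose_apply, Finset.mem_erase, ne_eq, not_true_eq_false, false_and, if_false, he₀,
      if_true, mul_zero, zero_mul, zero_add, mul_one, add_sub_cancel_left]
    refine Finset.sum_congr rfl fun e he => ?_
    simp [(Finset.mem_erase.1 he).1]
  rw [h1, key v a β hv, key w b γ hw, transpose_mul, Matrix.mul_assoc,
    ← Matrix.mul_assoc (B₀ * D), h2, det_mul, det_mul, hdetP, det_transpose, hdetP,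
    det_fromBlocks_one₂₂, h3, hdet, one_mul]

end Matrix

namespace IsCycleBasis

open EdgeFlow

variable {V E : Type*} [Fintype E] [DecidableEq E] {L : ℕ} {src tgt : E → V}
  {C : Matrix (Fin L) E ℤ}

omit [DecidableEq E] in
theorem bdry_transpose_mulVec (hC : IsCycleBasis src tgt C) {K : Type*} [CommRing K]
    (v : Fin L → K) : bdry src tgt ((C.map (Int.cast : ℤ → K))ᵀ *ᵥ v) = 0 := by
  have hi : ∀ i, bdry src tgt ((C.map (Int.cast : ℤ → K)) i) = 0 := by
    intro i
    have h1 : bdry src tgt (C i) = 0 :=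
      (hC.bdry_eq_zero_iff _).2 ⟨Pi.single i 1, by ext e; simp⟩
    ext w
    have := bdry_map src tgt (Int.castRingHom K) (C i) w
    rw [h1] at this
    exact this.trans (by simp)
  have : (C.map (Int.cast : ℤ → K))ᵀ *ᵥ v = ∑ i, v i • (C.map (Int.cast : ℤ → K)) i := by
    ext e
    simp [Matrix.mulVec, dotProduct, Finset.sum_apply, mul_comm]
  rw [this, map_sum]
  simp [hi]

theorem exists_cycle_extending' (hC : IsCycleBasis src tgt C) {K : Type*} [CommRing K]
    {F : Finset E} (hF : Nat.card (Quotient (joined src tgt (F : Set E))) = 1) (y : E → K) :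
    ∃ v, ∀ e ∉ F, ((C.map (Int.cast : ℤ → K))ᵀ *ᵥ v) e = y e := by
  choose v hv using fun e : E => hC.exists_cycle_extending hF (Pi.single e 1)
  refine ⟨∑ g, y g • (Int.castRingHom K) ∘ v g, fun e he => ?_⟩
  have h1 : ∀ g, ((C.map (Int.cast : ℤ → K))ᵀ *ᵥ ((Int.castRingHom K) ∘ v g)) e =
      if e = g then 1 else 0 := by
    intro g
    refine (map_transpose_mulVec (Int.castRingHom K) C (v g) e).trans ?_
    rw [hv g e he, Pi.single_apply]
    split_ifs <;> simp
  simp only [Matrix.mulVec_sum, Matrix.mulVec_smul, Finset.sum_apply, Pi.smul_apply, h1]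
  simp

theorem det_map (C : Matrix (Fin L) E ℤ) (K : Type*) [CommRing K] (S : Finset E) :
    ((C.map (Int.cast : ℤ → K)) * Matrix.diagonal (fun e => if e ∈ S then (1 : K) else 0) *
      (C.map (Int.cast : ℤ → K))ᵀ).det =
    ((C * Matrix.diagonal (fun e => if e ∈ S then (1 : ℤ) else 0) * Cᵀ).det : K) := by
  have h1 : (C.map (Int.cast : ℤ → K)) *
      Matrix.diagonal (fun e => if e ∈ S then (1 : K) else 0) * (C.map (Int.cast : ℤ → K))ᵀ =
      (C * Matrix.diagonal (fun e => if e ∈ S then (1 : ℤ) else 0) * Cᵀ).map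
        (Int.castRingHom K) := by
    rw [Matrix.map_mul, Matrix.map_mul, Matrix.transpose_map, Matrix.diagonal_map (map_zero _)]
    congr 3
    ext e
    split_ifs <;> simp
  rw [h1, ← RingHom.mapMatrix_apply, ← RingHom.map_det, eq_intCast]

end IsCycleBasis

namespace FeynmanGraph

open EdgeFlow

variable {V Ed : Type*} {n : ℕ} (G : FeynmanGraph V Ed n) [Fintype Ed]

theorem mem_cycleSpace {h : Ed → ℤ} : h ∈ G.cycleSpace ↔ bdry G.src G.tgt h = 0 := by
  rw [cycleSpace, LinearMap.mem_ker, Matrix.mulVecLin_apply]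
  have : G.incidence = bdryMatrix G.src G.tgt ℤ := rfl
  rw [this, bdryMatrix_mulVec]

theorem isForest_iff {F : Finset Ed} : G.IsForest F ↔ IsCycleBasis.Acyclic G.src G.tgt F := by
  simp only [IsForest, IsCycleBasis.Acyclic, mem_cycleSpace]

variable [DecidableEq Ed] {L : ℕ} {C : Matrix (Fin L) Ed ℤ} {K : Type*} [Field K]

variable {G} in
theorem isSpanningForest_iff [Fintype V] (hC : IsCycleBasis G.src G.tgt C) (p : ℕ)
    {F : Finset Ed} : G.IsSpanningForest p F ↔ G.IsForest F ∧ Fᶜ.card + 1 = L + p := by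
  have : Nonempty V := ⟨G.leg 0⟩
  refine and_congr_right fun hF => ?_
  exact hC.card_quotient_eq_iff (G.isForest_iff.1 hF) p

-- Forests are indexed by their complements, matching the sets `S` of the determinant expansion. By
-- Euler's formula the size of `S` fixes the number of trees, so only acyclicity remains to be
-- tested.
open Classical in
variable {G} in
theorem sum_spanningForest [Fintype V] (hC : IsCycleBasis G.src G.tgt C) (p m : ℕ)
    (hm : m + 1 = L + p) (c d : Finset Ed → K) (x : Ed → K)
    (h1 : ∀ S, S.card = m → G.IsSpanningForest p Sᶜ → d S = c Sᶜ)
    (h2 : ∀ S, S.card = m → ¬ G.IsForest Sᶜ → d S = 0) :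
    ∑ F : Finset Ed with G.IsSpanningForest p F, c F * ∏ e ∈ Fᶜ, x e =
      ∑ S ∈ Finset.powersetCard m Finset.univ, (∏ e ∈ S, x e) * d S := by
  have hp : Finset.powersetCard m (Finset.univ : Finset Ed) =
      Finset.univ.filter fun S => S.card = m := by
    ext S
    simp [Finset.mem_powersetCard]
  rw [hp, Finset.sum_filter, Finset.sum_filter]
  refine Fintype.sum_equiv (Function.Involutive.toPerm _ (compl_involutive (α := Finset Ed)))
    _ _ fun F => ?_
  rw [Function.Involutive.coe_toPerm]
  by_cases hF : G.IsSpanningForest p F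
  · have h3 := (isSpanningForest_iff hC p).1 hF
    have h4 : Fᶜ.card = m := by omega
    rw [if_pos hF, if_pos h4, h1 _ h4 (by rwa [compl_compl]), compl_compl, mul_comm]
  · rw [if_neg hF]
    split_ifs with h4
    · rw [h2 _ h4, mul_zero]
      rw [compl_compl]
      intro h5
      exact hF ((isSpanningForest_iff hC p).2 ⟨h5, by omega⟩)
    · rfl

-- The matrix-tree theorem in terms of cycles: a set `S` of size L contributes 1 if its complement
-- is a spanning tree and 0 otherwise.
variable {G} in
theorem eval_firstSymanzik [Fintype V] (hC : IsCycleBasis G.src G.tgt C) (x : Ed → K) :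
    MvPolynomial.eval x (G.firstSymanzik K) =
      (Matrix.weighted (C.map (Int.cast : ℤ → K)) x).det := by
  classical
  rw [firstSymanzik, map_sum, Matrix.weighted, Matrix.det_mul_diagonal_mul_transpose_eq_sum,
    Fintype.card_fin, ← sum_spanningForest hC 1 L rfl (fun _ => 1)]
  · refine Finset.sum_congr rfl fun F _ => ?_
    rw [map_prod, one_mul]
    simp
  · intro S hS hF
    rw [IsCycleBasis.det_map, hC.det_eq_one (G.isForest_iff.1 hF.1) hF.2, Int.cast_one]
  · intro S hS hF
    rw [IsCycleBasis.det_map, hC.det_eq_zero (fun h => hF (G.isForest_iff.2 h)), Int.cast_zero]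

open Classical in
theorem sum_mul_inflow [Fintype V] {R : Type*} [CommRing R] (u : V → R) (l : Fin n) :
    ∑ v, u v * (G.inflow v l : R) = u (G.leg l.succ) - u (G.leg 0) := by
  simp only [inflow, Matrix.of_apply, Int.cast_sum, Finset.mul_sum]
  rw [Finset.sum_comm]
  have h1 : ∀ x, ∑ v, u v * (((if G.leg x = v then legCoeff n x l else 0 : ℤ)) : R) =
      u (G.leg x) * (legCoeff n x l : R) := by
    intro x
    simp
  simp only [h1]
  simp only [legCoeff, Matrix.of_apply]
  rw [Fin.sum_univ_succ, Finset.sum_eq_single l]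
  · simp
    rw [if_neg (Fin.succ_ne_zero l).symm]
    ring
  · intro b _ hb
    simp [hb, Fin.succ_ne_zero]
  · simp

-- Choose an edge `e₀` between the two trees. Modulo cycles, an external flow restricted to `S` is
-- concentrated on `e₀`, and its value there is, up to sign, the external momentum entering the tree
-- without leg 0. The sign occurs twice and drops out.
open Classical in
variable {G} in
theorem det_bordered_coeff [Fintype V] (hC : IsCycleBasis G.src G.tgt C) (S : Finset Ed)
    (hS : S.card = L + 1) (hF : G.IsSpanningForest 2 Sᶜ) (l m : Fin n) (v w : Ed → K)
    (hv : ∀ z, bdry G.src G.tgt v z = -(G.inflow z l : K))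
    (hw : ∀ z, bdry G.src G.tgt w z = -(G.inflow z m : K)) :
    (Matrix.bordered (C.map (Int.cast : ℤ → K)) v *
      Matrix.diagonal (fun e => if e ∈ S then (1 : K) else 0) *
      (Matrix.bordered (C.map (Int.cast : ℤ → K)) w)ᵀ).det =
    (if ¬ G.linked ((Sᶜ : Finset Ed) : Set Ed) (G.leg 0) (G.leg l.succ) ∧
      ¬ G.linked ((Sᶜ : Finset Ed) : Set Ed) (G.leg 0) (G.leg m.succ) then 1 else 0) := by
  have : Nonempty V := ⟨G.leg 0⟩
  set T : Set Ed := ((Sᶜ : Finset Ed) : Set Ed) with hT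
  -- The indicator of the tree that does not contain leg 0; pairing a boundary with `u` measures the
  -- flow across the cut.
  let u : V → ℤ := fun v => if G.linked T (G.leg 0) v then 0 else 1
  have hu : ∀ v, u v = 0 ∨ u v = 1 := fun v => by simp only [u]; split_ifs <;> simp
  have hu0 : u (G.leg 0) = 0 := if_pos ((G.linked T).refl _)
  have huT : ∀ e ∉ S, u (G.tgt e) = u (G.src e) := by
    intro e he
    have h1 : G.linked T (G.src e) (G.tgt e) :=
      joined_edge G.src G.tgt (T := T) (by simpa [hT] using he)
    have : G.linked T (G.leg 0) (G.tgt e) ↔ G.linked T (G.leg 0) (G.src e) :=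
      ⟨fun h => (G.linked T).trans h ((G.linked T).symm h1), fun h => (G.linked T).trans h h1⟩
    simp only [u, this]
  -- If no edge crossed the cut, `u` would be constant on the connected graph and the forest would
  -- have only one component.
  obtain ⟨e₀, he₀⟩ : ∃ e, u (G.tgt e) - u (G.src e) ≠ 0 := by
    by_contra! hall
    have h1 : ∀ v, u v = 0 := fun v => by
      rw [← hu0]
      exact (eq_of_joined (fun e _ => by linarith [hall e]) (hC.connected (G.leg 0) v)).symm
    have h2 : Nat.card (Quotient (G.linked T)) = 1 := by
      rw [Nat.card_eq_one_iff_unique]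
      refine ⟨⟨fun a b => ?_⟩, ⟨Quotient.mk _ (G.leg 0)⟩⟩
      have h3 : ∀ v, G.linked T (G.leg 0) v := fun v => by
        by_contra hv
        have := h1 v
        simp [u, hv] at this
      induction a using Quotient.ind
      induction b using Quotient.ind
      exact Quotient.sound ((G.linked T).trans ((G.linked T).symm (h3 _)) (h3 _))
    have h3 := hF.2
    rw [h2] at h3
    omega
  have he₀S : e₀ ∈ S := by
    by_contra h
    exact he₀ (by rw [huT e₀ h, sub_self])
  have hacyc : IsCycleBasis.Acyclic G.src G.tgt (S.erase e₀)ᶜ := by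
    intro h hh hsupp
    have h1 := sum_mul_bdry G.src G.tgt u h
    rw [hh] at h1
    simp only [Pi.zero_apply, mul_zero, Finset.sum_const_zero] at h1
    rw [Finset.sum_eq_single e₀] at h1
    · have h2 : h e₀ = 0 := by
        rcases mul_eq_zero.1 h1.symm with h2 | h2
        · exact h2
        · exact absurd h2 he₀
      refine G.isForest_iff.1 hF.1 h hh fun e he => ?_
      by_cases hee : e = e₀
      · rw [hee, h2]
      · exact hsupp e (by simpa [hee] using he)
    · intro e _ hne
      by_cases he : e ∈ S
      · rw [hsupp e (by simpa [hne] using he), zero_mul]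
      · rw [huT e he, sub_self, mul_zero]
    · simp
  have hone : Nat.card (Quotient (joined G.src G.tgt (((S.erase e₀)ᶜ : Finset Ed) : Set Ed))) =
      1 := by
    rw [hC.card_quotient_eq_iff hacyc, compl_compl, Finset.card_erase_of_mem he₀S, hS]
    rfl
  have hdet : ((C.map (Int.cast : ℤ → K)) *
      Matrix.diagonal (fun e => if e ∈ S.erase e₀ then (1 : K) else 0) *
      (C.map (Int.cast : ℤ → K))ᵀ).det = 1 := by
    rw [IsCycleBasis.det_map, hC.det_eq_one hacyc hone, Int.cast_one]
  have hcast : ∀ e, ((u (G.tgt e) - u (G.src e) : ℤ) : K) =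
      (u (G.tgt e) : K) - (u (G.src e) : K) := fun e => by push_cast; rfl
  have key : ∀ (l : Fin n) (v : Ed → K), (∀ z, bdry G.src G.tgt v z = -(G.inflow z l : K)) →
      ∃ (a : Fin L → K) (β : K),
        (∀ e ∈ S, v e = ((C.map (Int.cast : ℤ → K))ᵀ *ᵥ a) e + if e = e₀ then β else 0) ∧
        β * ((u (G.tgt e₀) - u (G.src e₀) : ℤ) : K) = -(u (G.leg l.succ) : K) := by
    intro l v hv
    obtain ⟨a, ha⟩ := hC.exists_cycle_extending' hone v
    refine ⟨a, v e₀ - ((C.map (Int.cast : ℤ → K))ᵀ *ᵥ a) e₀, fun e he => ?_, ?_⟩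
    · by_cases hee : e = e₀
      · subst hee; simp
      · rw [if_neg hee, add_zero, ha e (by simp [hee, he])]
    · have h1 := sum_mul_bdry G.src G.tgt (fun z => (u z : K))
        (v - (C.map (Int.cast : ℤ → K))ᵀ *ᵥ a)
      rw [map_sub, hC.bdry_transpose_mulVec, sub_zero] at h1
      simp only [hv, mul_neg, Finset.sum_neg_distrib] at h1
      rw [G.sum_mul_inflow, hu0, Int.cast_zero, sub_zero, Finset.sum_eq_single e₀] at h1
      · rw [h1, hcast]
        rfl
      · intro e _ hne
        by_cases he : e ∈ S
        · rw [Pi.sub_apply, ha e (by simp [hne, he]), sub_self, zero_mul]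
        · rw [huT e he, sub_self, mul_zero]
      · simp
  obtain ⟨a, β, ha, hβ⟩ := key l v hv
  obtain ⟨b, γ, hb, hγ⟩ := key m w hw
  rw [Matrix.det_bordered_indicator _ S e₀ he₀S hdet v w a b β γ ha hb]
  have hsq : ((u (G.tgt e₀) - u (G.src e₀) : ℤ) : K) * ((u (G.tgt e₀) - u (G.src e₀) : ℤ) : K)
      = 1 := by
    have : (u (G.tgt e₀) - u (G.src e₀)) * (u (G.tgt e₀) - u (G.src e₀)) = 1 := by
      rcases hu (G.tgt e₀) with h1 | h1 <;> rcases hu (G.src e₀) with h2 | h2 <;>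
        simp [h1, h2] at he₀ ⊢
    rw [← Int.cast_mul, this, Int.cast_one]
  have h1 : β * γ = (u (G.leg l.succ) : K) * (u (G.leg m.succ) : K) := by
    linear_combination (-β * γ) * hsq + (γ * ((u (G.tgt e₀) - u (G.src e₀) : ℤ) : K)) * hβ -
      (u (G.leg l.succ) : K) * hγ
  rw [h1]
  simp only [u]
  split_ifs <;> simp_all

-- Each entry pairing of H with two external flows is a bordered determinant divided by 𝒰. Its
-- monomials have degree L + 1, and their coefficients are those of the spanning 2-forests.
open Classical in
variable {G} in
theorem eval_secondSymanzik [CharZero K] [Fintype V] (hC : IsCycleBasis G.src G.tgt C) (massSq : Ed → K)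
    (Gm : Matrix (Fin n) (Fin n) K) (E : Matrix (Fin n) Ed K)
    (hE : ∀ l z, bdry G.src G.tgt (E l) z = -(G.inflow z l : K)) (x : Ed → K)
    (hA : IsUnit (Matrix.weighted (C.map (Int.cast : ℤ → K)) x).det) :
    MvPolynomial.eval x (G.secondSymanzik massSq Gm) =
      (Matrix.weighted (C.map (Int.cast : ℤ → K)) x).det * (∑ e, massSq e * x e -
        ∑ l, ∑ m, Gm l m * (E l ⬝ᵥ (Matrix.reduced (C.map (Int.cast : ℤ → K)) x *ᵥ E m))) := by
  have h1 : ∑ F : Finset Ed with G.IsSpanningForest 2 F, G.flowSq Gm F * ∏ e ∈ Fᶜ, x e =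
      ∑ l, ∑ m, Gm l m * (Matrix.bordered (C.map (Int.cast : ℤ → K)) (E l) * Matrix.diagonal x *
        (Matrix.bordered (C.map (Int.cast : ℤ → K)) (E m))ᵀ).det := by
    have h0 := fun l m => Matrix.det_mul_diagonal_mul_transpose_eq_sum
      (Matrix.bordered (C.map (Int.cast : ℤ → K)) (E l))
      (Matrix.bordered (C.map (Int.cast : ℤ → K)) (E m)) x
    simp only [h0, Finset.mul_sum]
    simp only [Finset.sum_comm (s := Finset.univ) (t := Finset.powersetCard _ _)]
    simp only [Fintype.card_sum, Fintype.card_fin, Fintype.card_unit]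
    rw [sum_spanningForest hC 2 (L + 1) rfl (G.flowSq Gm) (fun S => ∑ l, ∑ m, Gm l m *
      (Matrix.bordered (C.map (Int.cast : ℤ → K)) (E l) *
        Matrix.diagonal (fun e => if e ∈ S then (1 : K) else 0) *
        (Matrix.bordered (C.map (Int.cast : ℤ → K)) (E m))ᵀ).det)]
    · refine Finset.sum_congr rfl fun S _ => ?_
      simp only [Finset.mul_sum]
      refine Finset.sum_congr rfl fun l _ => Finset.sum_congr rfl fun m _ => ?_
      ring
    · intro S hS hF
      rw [flowSq]
      refine Finset.sum_congr rfl fun l _ => Finset.sum_congr rfl fun m _ => ?_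
      rw [det_bordered_coeff hC S hS hF l m _ _ (hE l) (hE m)]
      simp
    · intro S hS hF
      refine Finset.sum_eq_zero fun l _ => Finset.sum_eq_zero fun m _ => ?_
      -- If the complement of `S` contains a cycle, the coordinates of this cycle, extended by 0,
      -- form a left null vector of the bordered matrix.
      have hF' : ¬ IsCycleBasis.Acyclic G.src G.tgt Sᶜ := fun h => hF (G.isForest_iff.2 h)
      simp only [IsCycleBasis.Acyclic, not_forall] at hF'
      obtain ⟨h, hh, hsupp, hne⟩ := hF'
      obtain ⟨a, rfl⟩ := (hC.bdry_eq_zero_iff h).1 hh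
      have ha : a ≠ 0 := fun h0 => hne (by simp [h0])
      refine mul_eq_zero_of_right _ (Matrix.exists_vecMul_eq_zero_iff.1
        ⟨Sum.elim (fun i => (a i : K)) 0, fun h0 => ha ?_, ?_⟩)
      · ext i
        simpa using congrFun h0 (Sum.inl i)
      · rw [← Matrix.vecMul_vecMul, ← Matrix.vecMul_vecMul]
        have h2 : Matrix.vecMul (Matrix.vecMul (Sum.elim (fun i => (a i : K)) 0)
            (Matrix.bordered (C.map (Int.cast : ℤ → K)) (E l)))
            (Matrix.diagonal (fun e => if e ∈ S then (1 : K) else 0)) = 0 := by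
          ext e
          rw [Matrix.vecMul_diagonal]
          by_cases he : e ∈ S
          · have h3 : ((Cᵀ *ᵥ a) e : K) = 0 := by
              rw [hsupp e (by simpa using he), Int.cast_zero]
            simp only [Matrix.mulVec, dotProduct, Matrix.transpose_apply, Int.cast_sum,
              Int.cast_mul] at h3
            simp only [he, if_true, mul_one, Pi.zero_apply, ← h3]
            simp [Matrix.vecMul, dotProduct, Matrix.bordered, mul_comm]
          · simp [he]
        rw [h2, Matrix.zero_vecMul]
  rw [secondSymanzik, map_add, map_mul, map_sum, map_sum, eval_firstSymanzik hC]
  simp only [map_mul, MvPolynomial.eval_C, MvPolynomial.eval_X, map_prod, neg_mul, map_neg,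
    Finset.sum_neg_distrib]
  rw [h1]
  simp only [Matrix.det_bordered _ _ _ _ hA]
  rw [mul_sub, Finset.mul_sum, Finset.mul_sum, mul_comm, Finset.mul_sum, sub_eq_add_neg]
  congr 2
  refine Finset.sum_congr rfl fun l _ => ?_
  rw [Finset.mul_sum]
  refine Finset.sum_congr rfl fun m _ => ?_
  ring

end FeynmanGraph

/-! ### Generic points; recovering the cycle space from the first Symanzik polynomial -/

namespace Matrix

variable {ι E : Type*} [Fintype ι] [DecidableEq ι] [Fintype E] [DecidableEq E]

omit [DecidableEq E] in
theorem exists_pos_eval_ne_zero {p : MvPolynomial E ℚ} (hp : p ≠ 0) :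
    ∃ x : E → ℚ, (∀ e, 0 < x e) ∧ MvPolynomial.eval x p ≠ 0 := by
  by_contra! h
  refine hp (MvPolynomial.funext_set (fun _ => Set.Ioi (0 : ℚ)) (fun _ => Set.Ioi_infinite 0) ?_)
  intro x hx
  rw [map_zero]
  exact h x fun e => hx e (Set.mem_univ e)

/-- At a generic positive point all entries of the response matrix vanish that vanish at some
positive point only if they vanish identically. -/
theorem exists_generic (C : Matrix ι E ℚ) (hC : ∀ v, Cᵀ *ᵥ v = 0 → v = 0) :
    ∃ x₀ : E → ℚ, (∀ e, 0 < x₀ e) ∧ ∀ e f, response C x₀ e f = 0 →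
      ∀ x : E → ℚ, (∀ e, 0 < x e) → response C x e f = 0 := by
  classical
  let Cp : Matrix ι E (MvPolynomial E ℚ) := C.map MvPolynomial.C
  let X : Matrix E E (MvPolynomial E ℚ) := diagonal MvPolynomial.X
  -- The adjugate clears the denominator: `p e f` is a polynomial with value det(CXCᵀ)·N_ef at
  -- positive points.
  let p : E → E → MvPolynomial E ℚ := fun e f =>
    (Cpᵀ * (Cp * X * Cpᵀ).adjugate * Cp) e f
  have hp : ∀ (x : E → ℚ), (∀ e, 0 < x e) → ∀ e f,
      MvPolynomial.eval x (p e f) = (weighted C x).det * response C x e f := by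
    intro x hx e f
    have hA := isUnit_det_weighted_of_pos hC hx
    have h1 : (Cpᵀ * (Cp * X * Cpᵀ).adjugate * Cp).map
        (MvPolynomial.eval x) = Cᵀ * (weighted C x).adjugate * C := by
      have hCp : Cp.map (MvPolynomial.eval x) = C := by
        ext i e
        simp [Cp]
      have hCpT : Cpᵀ.map (MvPolynomial.eval x) = Cᵀ := by
        ext e i
        simp [Cp]
      have hX : X.map (MvPolynomial.eval x) = diagonal x := by
        rw [diagonal_map (map_zero _)]
        simp
      rw [Matrix.map_mul, Matrix.map_mul, ← RingHom.mapMatrix_apply, RingHom.map_adjugate,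
        RingHom.mapMatrix_apply, Matrix.map_mul, Matrix.map_mul, hCp, hCpT, hX, weighted]
    have h2 := congrFun (congrFun h1 e) f
    rw [map_apply] at h2
    rw [h2, response, Matrix.inv_def, Ring.inverse_eq_inv', Matrix.mul_smul, Matrix.smul_mul,
      Matrix.smul_apply, smul_eq_mul, mul_inv_cancel_left₀ hA.ne_zero]
  -- Identically vanishing entries are replaced by 1, so the product is a nonzero polynomial and one
  -- point serves all entries at once.
  have hq : ∏ ef : E × E, (if p ef.1 ef.2 = 0 then 1 else p ef.1 ef.2) ≠ 0 := by
    refine Finset.prod_ne_zero_iff.2 fun ef _ => ?_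
    split_ifs with h
    · exact one_ne_zero
    · exact h
  obtain ⟨x₀, hx₀, hne⟩ := exists_pos_eval_ne_zero hq
  refine ⟨x₀, hx₀, fun e f hef x hx => ?_⟩
  have hpz : p e f = 0 := by
    by_contra hpe
    rw [map_prod, Finset.prod_ne_zero_iff] at hne
    have h1 := hne (e, f) (Finset.mem_univ _)
    rw [if_neg hpe, hp x₀ hx₀, hef, mul_zero] at h1
    exact h1 rfl
  have h1 := hp x hx e f
  rw [hpz, map_zero, eq_comm, mul_eq_zero] at h1
  exact h1.resolve_left (isUnit_det_weighted_of_pos hC hx).ne_zero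

omit [Fintype E] in
theorem pos_add_single {x : E → ℚ} (hx : ∀ e, 0 < x e) (f : E) {t : ℚ} (ht : 0 < t) (e : E) :
    0 < (x + Pi.single f t : E → ℚ) e := by
  rw [Pi.add_apply, Pi.single_apply]
  have := hx e
  split_ifs <;> linarith

/-- A point where nonvanishing of the entries of the response matrix is an equivalence relation. -/
structure IsGeneric (C : Matrix ι E ℚ) (x : E → ℚ) : Prop where
  pos : ∀ e, 0 < x e
  trans : ∀ e f g, response C x e f ≠ 0 → response C x f g ≠ 0 → response C x e g ≠ 0

/-- If N_eg vanishes generically, it still vanishes after an increment of x_f. The change is a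
nonzero multiple of N_ef N_fg, so one of these factors is zero: nonvanishing is transitive. -/
theorem exists_isGeneric (C : Matrix ι E ℚ) (hC : ∀ v, Cᵀ *ᵥ v = 0 → v = 0) :
    ∃ x, IsGeneric C x := by
  obtain ⟨x₀, hx₀, h⟩ := exists_generic C hC
  refine ⟨x₀, hx₀, fun e f g hef hfg heg => ?_⟩
  have hx' := pos_add_single hx₀ f one_pos
  have hA := isUnit_det_weighted_of_pos hC hx₀
  have hA' := isUnit_det_weighted_of_pos hC hx'
  have h1 := response_update_apply hA f 1 hA' e g
  have h0 := one_add_mul_response_ne_zero hA hA'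
  rw [heg, h e g heg _ hx', zero_sub, eq_comm, neg_eq_zero] at h1
  exact mul_ne_zero (mul_ne_zero (div_ne_zero one_ne_zero h0) hef) hfg h1

section signs

variable {C₁ C₂ : Matrix ι E ℚ} (h₁ : ∀ v, C₁ᵀ *ᵥ v = 0 → v = 0) (h₂ : ∀ v, C₂ᵀ *ᵥ v = 0 → v = 0)
  (hU : ∀ x : E → ℚ, (∀ e, 0 < x e) → (weighted C₁ x).det = (weighted C₂ x).det)

include h₁ h₂ hU

/-- First order: N_ee is read off from the ratio of determinants after an increment of x_e. -/
theorem response_self_eq {x : E → ℚ} (hx : ∀ e, 0 < x e) (e : E) :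
    response C₁ x e e = response C₂ x e e := by
  have hA₁ := isUnit_det_weighted_of_pos h₁ hx
  have hA₂ := isUnit_det_weighted_of_pos h₂ hx
  have h := hU _ (pos_add_single hx e one_pos)
  rw [det_weighted_update hA₁, det_weighted_update hA₂, hU x hx] at h
  have := mul_left_cancel₀ hA₂.ne_zero h
  linarith

/-- Second order: an increment of x_f lowers N_ee by a multiple of N_ef². -/
theorem response_sq_eq {x : E → ℚ} (hx : ∀ e, 0 < x e) (e f : E) :
    response C₁ x e f ^ 2 = response C₂ x e f ^ 2 := by
  have hx' := pos_add_single hx f one_pos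
  have hA₁ := isUnit_det_weighted_of_pos h₁ hx
  have hA₂ := isUnit_det_weighted_of_pos h₂ hx
  have hA₁' := isUnit_det_weighted_of_pos h₁ hx'
  have hA₂' := isUnit_det_weighted_of_pos h₂ hx'
  have h := response_self_eq h₁ h₂ hU hx' e
  have h0 := one_add_mul_response_ne_zero hA₂ hA₂'
  rw [response_update_apply hA₁ f 1 hA₁', response_update_apply hA₂ f 1 hA₂',
    response_self_eq h₁ h₂ hU hx e, response_self_eq h₁ h₂ hU hx f, response_comm C₁ x f e,
    response_comm C₂ x f e] at h
  have hc0 := div_ne_zero one_ne_zero h0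
  exact mul_left_cancel₀ hc0 (by linear_combination -h)

/-- Third order: the squares also agree after an increment of x_g, and the cross term in the square
of the changed entry is the triple product. -/
theorem response_triple_eq {x : E → ℚ} (hx : ∀ e, 0 < x e) (e f g : E) :
    response C₁ x e f * response C₁ x f g * response C₁ x g e =
      response C₂ x e f * response C₂ x f g * response C₂ x g e := by
  have hx' := pos_add_single hx g one_pos
  have hA₁ := isUnit_det_weighted_of_pos h₁ hx
  have hA₂ := isUnit_det_weighted_of_pos h₂ hx
  have hA₁' := isUnit_det_weighted_of_pos h₁ hx'
  have hA₂' := isUnit_det_weighted_of_pos h₂ hx'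
  have h := response_sq_eq h₁ h₂ hU hx' e f
  have hef := response_sq_eq h₁ h₂ hU hx e f
  have heg := response_sq_eq h₁ h₂ hU hx e g
  have hgf := response_sq_eq h₁ h₂ hU hx g f
  have h0 := one_add_mul_response_ne_zero hA₂ hA₂'
  rw [response_update_apply hA₁ g 1 hA₁', response_update_apply hA₂ g 1 hA₂',
    response_self_eq h₁ h₂ hU hx g] at h
  set c := 1 / (1 + 1 * response C₂ x g g) with hc
  have hc0 : c ≠ 0 := div_ne_zero one_ne_zero h0
  rw [response_comm C₁ x g e, response_comm C₂ x g e, response_comm C₁ x f g,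
    response_comm C₂ x f g]
  have : c * (response C₁ x e f * response C₁ x g f * response C₁ x e g) =
      c * (response C₂ x e f * response C₂ x g f * response C₂ x e g) := by
    have h3 : (c * response C₁ x e g * response C₁ x g f) ^ 2 =
        (c * response C₂ x e g * response C₂ x g f) ^ 2 := by
      rw [mul_pow, mul_pow, mul_pow, mul_pow, heg, hgf]
    linear_combination (-1 / 2) * h + (1 / 2) * hef + (1 / 2) * h3
  exact mul_left_cancel₀ hc0 this

/-- Two matrices with the same `det (C X Cᵀ)` have, up to signs, the same row space. -/
theorem exists_signs (hnz : ∀ e, ∃ i, C₂ i e ≠ 0) :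
    ∃ (κ : E → ℤˣ) (T : Matrix ι ι ℚ),
      ∀ e i, (C₁ᵀ * T) e i = ((κ e : ℤ) : ℚ) * C₂ i e := by
  classical
  obtain ⟨x, hx⟩ := exists_isGeneric C₂ h₂
  have hA₁ := isUnit_det_weighted_of_pos h₁ hx.pos
  have hA₂ := isUnit_det_weighted_of_pos h₂ hx.pos
  -- Signs are normalized against one representative edge in each class of this relation.
  let s : Setoid E :=
    { r := fun e f => response C₂ x e f ≠ 0
      iseqv := ⟨fun e => response_self_ne_zero hA₂ hx.pos (hnz e),
        fun h => by rwa [response_comm], fun h h' => hx.trans _ _ _ h h'⟩ }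
  let rep : E → E := fun e => (Quotient.mk s e).out
  have hrep : ∀ e, response C₂ x (rep e) e ≠ 0 := fun e => Quotient.mk_out (s := s) e
  have hrepeq : ∀ e f, response C₂ x e f ≠ 0 → rep e = rep f := fun e f h => by
    have : Quotient.mk s e = Quotient.mk s f := Quotient.sound h
    simp only [rep, this]
  let κ : E → ℤˣ := fun e => if response C₁ x (rep e) e = response C₂ x (rep e) e then 1 else -1
  have hκ2 : ∀ e, ((κ e : ℤ) : ℚ) * ((κ e : ℤ) : ℚ) = 1 := fun e => by
    simp only [κ]; split_ifs <;> simp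
  have hκ : ∀ e, response C₁ x (rep e) e = ((κ e : ℤ) : ℚ) * response C₂ x (rep e) e := by
    intro e
    simp only [κ]
    split_ifs with h
    · simp [h]
    · have h1 := response_sq_eq h₁ h₂ hU hx.pos (rep e) e
      rcases sq_eq_sq_iff_eq_or_eq_neg.1 h1 with h2 | h2
      · exact absurd h2 h
      · simp [h2]
  have hN : ∀ e f, response C₁ x e f =
      ((κ e : ℤ) : ℚ) * ((κ f : ℤ) : ℚ) * response C₂ x e f := by
    intro e f
    by_cases hef : response C₂ x e f = 0
    · have h1 := response_sq_eq h₁ h₂ hU hx.pos e f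
      rw [hef] at h1 ⊢
      simpa using h1
    -- In the triple product through the common representative, the two entries involving it are
    -- nonzero and already compared, which determines the third.
    · have h1 := response_triple_eq h₁ h₂ hU hx.pos e f (rep e)
      have h2 := hκ f
      rw [← hrepeq e f hef] at h2
      have h3 := hrep f
      rw [← hrepeq e f hef] at h3
      rw [response_comm C₁ x f, h2, hκ e, response_comm C₂ x f] at h1
      have h4 : response C₂ x (rep e) f * response C₂ x (rep e) e ≠ 0 := mul_ne_zero h3 (hrep e)
      apply mul_right_cancel₀ h4
      have h5 := hκ2 e
      have h6 := hκ2 f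
      linear_combination (((κ e : ℤ) : ℚ) * ((κ f : ℤ) : ℚ)) * h1 -
        (response C₁ x e f * response C₂ x (rep e) f * response C₂ x (rep e) e) *
          (((κ f : ℤ) : ℚ) * ((κ f : ℤ) : ℚ) * h5 + h6)
  -- With the sign matrix D one has N₁D = DN₂, so C₁ᵀ times this witness is N₁DXC₂ᵀ = DN₂XC₂ᵀ =
  -- DC₂ᵀ.
  refine ⟨κ, (weighted C₁ x)⁻¹ * C₁ * diagonal (fun e => ((κ e : ℤ) : ℚ)) * diagonal x * C₂ᵀ,
    fun e i => ?_⟩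
  have h1 : C₁ᵀ * ((weighted C₁ x)⁻¹ * C₁ * diagonal (fun e => ((κ e : ℤ) : ℚ)) * diagonal x *
      C₂ᵀ) = response C₁ x * diagonal (fun e => ((κ e : ℤ) : ℚ)) * diagonal x * C₂ᵀ := by
    simp only [response, Matrix.mul_assoc]
  have h2 : response C₁ x * diagonal (fun e => ((κ e : ℤ) : ℚ)) =
      diagonal (fun e => ((κ e : ℤ) : ℚ)) * response C₂ x := by
    ext e f
    rw [mul_diagonal, diagonal_mul, hN, mul_right_comm, mul_assoc _ (((κ f : ℤ) : ℚ)), mul_right_comm]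
    linear_combination (((κ e : ℤ) : ℚ) * response C₂ x e f) * hκ2 f
  rw [h1, h2, Matrix.mul_assoc, Matrix.mul_assoc, diagonal_mul, ← Matrix.mul_assoc,
    response_mul_transpose hA₂, transpose_apply]

end signs

end Matrix

/-! ### Recovering masses and external forms from the second Symanzik polynomial -/

namespace Matrix

variable {ι E K : Type*} [Fintype ι] [DecidableEq ι] [Fintype E] [DecidableEq E] [Field K]
  [CharZero K]

/-- The pairing of two matrices. -/
def entrySum (D R : Matrix E E K) : K := ∑ e, ∑ f, D e f * R e f

section form

variable {C : Matrix ι E ℚ} (hC : ∀ v, Cᵀ *ᵥ v = 0 → v = 0)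

/-- A rational point viewed over `K`. -/
def castPt (K : Type*) [Field K] (x : E → ℚ) : E → K := fun e => (x e : K)

omit [Fintype E] in
theorem castPt_add_single (x : E → ℚ) (f : E) (t : ℚ) :
    castPt K (x + Pi.single f t) = castPt K x + Pi.single f (t : K) := by
  ext e
  simp only [castPt, Pi.add_apply, Pi.single_apply]
  split_ifs <;> simp

omit [DecidableEq ι] [Fintype ι] in
theorem weighted_castPt (x : E → ℚ) : weighted (C.map (Rat.cast : ℚ → K)) (castPt K x) =
    (weighted C x).map (Rat.cast : ℚ → K) :=
  weighted_map (C := C) (x := x) (Rat.castHom K)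

theorem det_weighted_castPt (x : E → ℚ) :
    (weighted (C.map (Rat.cast : ℚ → K)) (castPt K x)).det = ((weighted C x).det : K) := by
  rw [weighted_castPt]
  exact ((Rat.castHom K).map_det (weighted C x)).symm

theorem response_castPt {x : E → ℚ} (hA : IsUnit (weighted C x).det) (e f : E) :
    response (C.map (Rat.cast : ℚ → K)) (castPt K x) e f = ((response C x e f : ℚ) : K) :=
  congrFun (congrFun (response_map (Rat.castHom K) hA) e) f

theorem coproj_castPt {x : E → ℚ} (hA : IsUnit (weighted C x).det) :
    coproj (C.map (Rat.cast : ℚ → K)) (castPt K x) = (coproj C x).map (Rat.cast : ℚ → K) := by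
  ext e f
  rw [map_apply, coproj_apply, coproj_apply, response_castPt hA]
  simp [castPt, apply_ite (Rat.cast : ℚ → K)]

include hC in
theorem isUnit_det_weighted_castPt {x : E → ℚ} (hx : ∀ e, 0 < x e) :
    IsUnit (weighted (C.map (Rat.cast : ℚ → K)) (castPt K x)).det := by
  rw [det_weighted_castPt, isUnit_iff_ne_zero]
  exact_mod_cast (isUnit_det_weighted_of_pos hC hx).ne_zero

-- An increment t at f changes the expression by δ_f t + t(WᵀDW)_ff/(1 + tN_ff), where W = 1 − XN.
-- Different values of t separate the two terms, so δ and the diagonal of WᵀDW vanish at every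
-- positive point. A further increment at f adds to column e of W a multiple of column f,
-- proportional to N_fe; polarization then gives the off-diagonal entry, but only where N_ef ≠ 0.
include hC in
theorem form_vanishing (hnz : ∀ e, ∃ i, C i e ≠ 0) (δ : E → K) (D : Matrix E E K)
    (hD : D.IsSymm)
    (hF : ∀ x : E → ℚ, (∀ e, 0 < x e) → ∑ e, δ e * castPt K x e +
      entrySum D (reduced (C.map (Rat.cast : ℚ → K)) (castPt K x)) = 0) :
    δ = 0 ∧ ∀ x : E → ℚ, (∀ e, 0 < x e) → ∀ e f, response C x e f ≠ 0 →
      (((coproj C x).map (Rat.cast : ℚ → K))ᵀ * D * (coproj C x).map (Rat.cast : ℚ → K)) e f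
        = 0 := by
  let W : (E → ℚ) → Matrix E E K := fun x => coproj (C.map (Rat.cast : ℚ → K)) (castPt K x)
  have hent : ∀ x e f, ((W x)ᵀ * D * W x) e f = ∑ b, ∑ a, W x a e * D a b * W x b f := by
    intro x e f
    simp only [Matrix.mul_apply, Finset.sum_mul, transpose_apply]
  have hdiff : ∀ x : E → ℚ, (∀ e, 0 < x e) → ∀ (f : E) (t : ℚ), 0 < t →
      δ f * t + t / (1 + t * response C x f f) * ((W x)ᵀ * D * W x) f f = 0 := by
    intro x hx f t ht
    have hx' := pos_add_single hx f ht
    have h1 := hF _ hx'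
    have h2 := hF _ hx
    have hA := isUnit_det_weighted_castPt (K := K) hC hx
    have hA' := isUnit_det_weighted_castPt (K := K) hC hx'
    rw [castPt_add_single] at h1 hA'
    have h3 : entrySum D (reduced (C.map (Rat.cast : ℚ → K)) (castPt K x + Pi.single f (t : K))) =
        entrySum D (reduced (C.map (Rat.cast : ℚ → K)) (castPt K x)) +
          t / (1 + t * response C x f f) * ((W x)ᵀ * D * W x) f f := by
      rw [hent, Finset.sum_comm, entrySum, entrySum, Finset.mul_sum, ← Finset.sum_add_distrib]
      refine Finset.sum_congr rfl fun a _ => ?_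
      rw [Finset.mul_sum, ← Finset.sum_add_distrib]
      refine Finset.sum_congr rfl fun b _ => ?_
      rw [reduced_update hA f t hA', response_castPt (isUnit_det_weighted_of_pos hC hx)]
      simp only [W]
      ring
    have h4 : ∑ e, δ e * (castPt K x + Pi.single f (t : K) : E → K) e =
        ∑ e, δ e * castPt K x e + δ f * t := by
      simp [mul_add, Finset.sum_add_distrib, Pi.single_apply]
    rw [h3, h4] at h1
    linear_combination h1 - h2
  have aux : ∀ a d n s : K, 1 + a * n ≠ 0 → a ≠ 0 → d * a + a / (1 + a * n) * s = 0 →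
      d * (1 + a * n) + s = 0 := by
    intro a d n s h0 ha h
    have h1 : a / (1 + a * n) * (1 + a * n) = a := div_mul_cancel₀ a h0
    have h2 : a * (d * (1 + a * n) + s) = 0 := by linear_combination (1 + a * n) * h - s * h1
    exact (mul_eq_zero.1 h2).resolve_left ha
  have hdiag : ∀ x : E → ℚ, (∀ e, 0 < x e) → ∀ f, δ f = 0 ∧ ((W x)ᵀ * D * W x) f f = 0 := by
    intro x hx f
    have hn := response_self_ne_zero (isUnit_det_weighted_of_pos hC hx) hx (hnz f)
    have h0 : ∀ t : ℚ, 0 < t → (1 + t * response C x f f : K) ≠ 0 := by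
      intro t ht
      have := one_add_mul_response_ne_zero (isUnit_det_weighted_of_pos hC hx)
        (isUnit_det_weighted_of_pos hC (pos_add_single hx f ht))
      exact_mod_cast this
    -- After multiplication by 1 + tN_ff the relation is affine in t, so two values of t suffice.
    have h1 := hdiff x hx f 1 one_pos
    have h2 := hdiff x hx f 2 two_pos
    have h01 := h0 1 one_pos
    have h02 := h0 2 two_pos
    set s := ((W x)ᵀ * D * W x) f f
    push_cast at h1 h2 h01 h02
    have h1' : δ f * (1 + 1 * response C x f f) + s = 0 := by
      exact aux _ _ _ _ h01 one_ne_zero h1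
    have h2' : δ f * (1 + 2 * response C x f f) + s = 0 := by
      exact aux _ _ _ _ h02 two_ne_zero h2
    have h3 : δ f * ((response C x f f : ℚ) : K) = 0 := by linear_combination h2' - h1'
    have h4 : δ f = 0 := by
      rcases mul_eq_zero.1 h3 with h | h
      · exact h
      · exact absurd (by exact_mod_cast h) hn
    refine ⟨h4, ?_⟩
    rw [h4] at h1'
    linear_combination h1'
  constructor
  · ext f
    exact (hdiag (fun _ => 1) (fun _ => one_pos) f).1
  · intro x hx e f hef
    have hA₀ := isUnit_det_weighted_of_pos hC hx
    rw [← coproj_castPt hA₀]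
    change ((W x)ᵀ * D * W x) e f = 0
    have hx' := pos_add_single hx f one_pos
    have hA := isUnit_det_weighted_castPt (K := K) hC hx
    have hA' := isUnit_det_weighted_castPt (K := K) hC hx'
    have h1 := (hdiag _ hx' e).2
    have hW' : ∀ a, W (x + Pi.single f 1) a e = W x a e -
        1 / (1 + 1 * response C x f f) * response C x f e * W x a f := by
      intro a
      simp only [W]
      rw [castPt_add_single, Rat.cast_one] at hA' ⊢
      rw [coproj_update hA f 1 hA' a e, response_castPt hA₀, response_castPt hA₀]
    set c : K := 1 / (1 + 1 * response C x f f) * response C x f e with hc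
    have hc0 : c ≠ 0 := by
      have h5 := one_add_mul_response_ne_zero hA₀ (isUnit_det_weighted_of_pos hC hx')
      refine mul_ne_zero (div_ne_zero one_ne_zero ?_) ?_
      · exact_mod_cast h5
      · rw [response_comm]
        exact_mod_cast hef
    have hsymm : ((W x)ᵀ * D * W x) f e = ((W x)ᵀ * D * W x) e f := by
      have : ((W x)ᵀ * D * W x)ᵀ = (W x)ᵀ * D * W x := by
        rw [transpose_mul, transpose_mul, transpose_transpose, hD.eq, Matrix.mul_assoc]
      rw [← transpose_apply ((W x)ᵀ * D * W x) e f, this]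
    have h2 : ((W (x + Pi.single f 1))ᵀ * D * W (x + Pi.single f 1)) e e =
        ((W x)ᵀ * D * W x) e e - c * ((W x)ᵀ * D * W x) f e - c * ((W x)ᵀ * D * W x) e f +
          c ^ 2 * ((W x)ᵀ * D * W x) f f := by
      simp only [hent, hW', Finset.mul_sum, ← Finset.sum_add_distrib, ← Finset.sum_sub_distrib]
      refine Finset.sum_congr rfl fun b _ => Finset.sum_congr rfl fun a _ => ?_
      ring
    rw [h2, (hdiag x hx e).2, (hdiag x hx f).2, hsymm] at h1
    have h3 : c * ((W x)ᵀ * D * W x) e f = 0 := by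
      linear_combination (-1 / 2) * h1
    exact (mul_eq_zero.1 h3).resolve_left hc0

end form

/-- Over ℚ an injective A has an invertible Gram matrix AᵀA. -/
theorem exists_left_inverse {m n : Type*} [Fintype m] [DecidableEq m] [Fintype n] [DecidableEq n]
    {A : Matrix m n ℚ} (hA : ∀ v, A *ᵥ v = 0 → v = 0) : ∃ B : Matrix n m ℚ, B * A = 1 := by
  have h := isUnit_det_weighted_of_pos (C := Aᵀ) (by simpa using hA) (x := fun _ => 1)
    fun _ => one_pos
  refine ⟨(weighted Aᵀ fun _ => 1)⁻¹ * Aᵀ, ?_⟩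
  have : weighted Aᵀ (fun _ => 1) = Aᵀ * A := by
    rw [weighted, diagonal_one, Matrix.mul_one, transpose_transpose]
  rw [Matrix.mul_assoc, ← this, nonsing_inv_mul _ h]

/-- Two rational frames with the same Gram-type form differ by an orthogonal matrix. -/
theorem exists_orthogonal {m n : Type*} [Fintype m] [DecidableEq m] [Fintype n] [DecidableEq n]
    {A₁ A₂ : Matrix m n ℚ} (h₁ : ∀ v, A₁ *ᵥ v = 0 → v = 0) (h₂ : ∀ v, A₂ *ᵥ v = 0 → v = 0)
    {G : Matrix n n K} (hG : G.det ≠ 0)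
    (h : A₂.map (Rat.cast : ℚ → K) * G * (A₂.map (Rat.cast : ℚ → K))ᵀ =
      A₁.map (Rat.cast : ℚ → K) * G * (A₁.map (Rat.cast : ℚ → K))ᵀ) :
    ∃ N : Matrix n n ℚ, A₂ = A₁ * N ∧
      N.map (Rat.cast : ℚ → K) * G * (N.map (Rat.cast : ℚ → K))ᵀ = G := by
  obtain ⟨B₁, hB₁⟩ := exists_left_inverse h₁
  obtain ⟨B₂, hB₂⟩ := exists_left_inverse h₂
  let φ := Rat.castHom K
  have hmap : ∀ {a b c : Type _} [Fintype b] (M : Matrix a b ℚ) (N : Matrix b c ℚ),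
      (M * N).map (Rat.cast : ℚ → K) = M.map (Rat.cast : ℚ → K) * N.map (Rat.cast : ℚ → K) :=
    fun M N => Matrix.map_mul (f := φ)
  have hone : (1 : Matrix n n ℚ).map (Rat.cast : ℚ → K) = 1 := by simp
  set a₁ := A₁.map (Rat.cast : ℚ → K) with ha₁
  set a₂ := A₂.map (Rat.cast : ℚ → K) with ha₂
  set b₁ := B₁.map (Rat.cast : ℚ → K) with hb₁
  set b₂ := B₂.map (Rat.cast : ℚ → K) with hb₂
  have e₁ : b₁ * a₁ = 1 := by rw [hb₁, ha₁, ← hmap, hB₁, hone]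
  have e₂ : b₂ * a₂ = 1 := by rw [hb₂, ha₂, ← hmap, hB₂, hone]
  have e₁' : a₁ᵀ * b₁ᵀ = 1 := by rw [← transpose_mul, e₁, transpose_one]
  have e₂' : a₂ᵀ * b₂ᵀ = 1 := by rw [← transpose_mul, e₂, transpose_one]
  have hGu : IsUnit G.det := isUnit_iff_ne_zero.2 hG
  have h3 : a₂ = a₁ * (G * a₁ᵀ * b₂ᵀ * G⁻¹) := by
    calc a₂ = a₂ * (G * (a₂ᵀ * b₂ᵀ) * G⁻¹) := by
          rw [e₂', Matrix.mul_one, mul_nonsing_inv _ hGu, Matrix.mul_one]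
      _ = (a₂ * G * a₂ᵀ) * (b₂ᵀ * G⁻¹) := by simp only [Matrix.mul_assoc]
      _ = a₁ * (G * a₁ᵀ * b₂ᵀ * G⁻¹) := by rw [h]; simp only [Matrix.mul_assoc]
  have hN : (B₁ * A₂).map (Rat.cast : ℚ → K) = G * a₁ᵀ * b₂ᵀ * G⁻¹ := by
    rw [hmap, ← hb₁, ← ha₂, h3, ← Matrix.mul_assoc, e₁, Matrix.one_mul]
  -- The comparison matrix found over K is the image of the rational matrix `B₁ * A₂`, so the
  -- orthogonal matrix can be taken rational although G lives over K.
  have h4 : a₂ = a₁ * (B₁ * A₂).map (Rat.cast : ℚ → K) := by rw [hN]; exact h3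
  refine ⟨B₁ * A₂, ?_, ?_⟩
  · have h5 : A₂.map φ = (A₁ * (B₁ * A₂)).map φ := by
      rw [show (A₁ * (B₁ * A₂)).map φ = a₁ * (B₁ * A₂).map (Rat.cast : ℚ → K) from Matrix.map_mul (f := φ), ← h4]
      rfl
    exact Matrix.map_injective φ.injective h5
  · set N := (B₁ * A₂).map (Rat.cast : ℚ → K)
    calc N * G * Nᵀ = (b₁ * a₁) * N * G * Nᵀ * (a₁ᵀ * b₁ᵀ) := by
          rw [e₁, e₁', Matrix.one_mul, Matrix.mul_one]
      _ = b₁ * ((a₁ * N) * G * (a₁ * N)ᵀ) * b₁ᵀ := by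
          rw [transpose_mul]; simp only [Matrix.mul_assoc]
      _ = b₁ * (a₁ * G * a₁ᵀ) * b₁ᵀ := by rw [← h4, h]
      _ = (b₁ * a₁) * G * (a₁ᵀ * b₁ᵀ) := by simp only [Matrix.mul_assoc]
      _ = G := by rw [e₁, e₁', Matrix.one_mul, Matrix.mul_one]

end Matrix

/-! ### Blocks -/

namespace FeynmanGraph

open EdgeFlow

variable {V Ed : Type*} {n : ℕ} (G : FeynmanGraph V Ed n) [Fintype Ed]

/-- A rational cycle. -/
def IsCycle (h : Ed → ℚ) : Prop := bdry G.src G.tgt h = 0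

variable {G}

theorem IsCycle.sub {h h' : Ed → ℚ} (hh : G.IsCycle h) (hh' : G.IsCycle h') :
    G.IsCycle (h - h') := by
  rw [IsCycle, map_sub, hh, hh', sub_zero]

theorem IsCycle.add {h h' : Ed → ℚ} (hh : G.IsCycle h) (hh' : G.IsCycle h') :
    G.IsCycle (h + h') := by
  rw [IsCycle, map_add, hh, hh', add_zero]

theorem IsCycle.smul {h : Ed → ℚ} (hh : G.IsCycle h) (c : ℚ) : G.IsCycle (c • h) := by
  rw [IsCycle, map_smul, hh, smul_zero]

theorem isCycle_intCast {h : Ed → ℤ} (hh : h ∈ G.cycleSpace) :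
    G.IsCycle fun e => (h e : ℚ) := by
  rw [mem_cycleSpace] at hh
  ext v
  have := bdry_map G.src G.tgt (Int.castRingHom ℚ) h v
  rw [hh] at this
  simpa using this

theorem IsCycle.exists_int {h : Ed → ℚ} (hh : G.IsCycle h) :
    ∃ g ∈ G.cycleSpace, ∀ e, g e = 0 ↔ h e = 0 := by
  obtain ⟨d, g, hd, hg⟩ := exists_integer_multiple h
  have hg' : (fun e => (Int.castRingHom ℚ) (g e)) = (d : ℚ) • h := funext hg
  refine ⟨g, ?_, fun e => ?_⟩
  · rw [mem_cycleSpace]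
    ext v
    have := bdry_map G.src G.tgt (Int.castRingHom ℚ) g v
    rw [hg', map_smul, hh, smul_zero, Pi.zero_apply] at this
    simpa using this.symm
  · rw [← Int.cast_inj (α := ℚ), hg]
    simp [hd]

theorem IsCircuit.exists_cycle {S : Set Ed} (hS : G.IsCircuit S) :
    ∃ h : Ed → ℚ, G.IsCycle h ∧ ∀ e, h e ≠ 0 ↔ e ∈ S := by
  obtain ⟨⟨h, hh, -, hsupp⟩, -⟩ := hS
  refine ⟨_, isCycle_intCast hh, fun e => ?_⟩
  rw [← hsupp, Function.mem_support]
  simp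

/-- Otherwise its support would be a strictly smaller support of a cycle, against minimality. -/
theorem IsCircuit.eq_zero {S : Set Ed} (hS : G.IsCircuit S) {h : Ed → ℚ} (hh : G.IsCycle h)
    (hsupp : ∀ e ∉ S, h e = 0) {e : Ed} (heS : e ∈ S) (he : h e = 0) : h = 0 := by
  by_contra hne
  obtain ⟨g, hg, hgh⟩ := hh.exists_int
  have h1 : S ⊆ Function.support g := by
    refine hS.2 ⟨g, hg, fun h0 => hne ?_, rfl⟩ fun f hf => ?_
    · ext e
      exact (hgh e).1 (by rw [h0]; rfl)
    · by_contra hfS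
      exact hf ((hgh f).2 (hsupp f hfS))
  exact h1 heS ((hgh e).2 he)

theorem IsCycle.exists_circuit {h : Ed → ℚ} (hh : G.IsCycle h) (hne : h ≠ 0) :
    ∃ S, G.IsCircuit S ∧ ∀ e ∈ S, h e ≠ 0 := by
  obtain ⟨g, hg, hgh⟩ := hh.exists_int
  have hfin : {S : Set Ed | ∃ h ∈ G.cycleSpace, h ≠ 0 ∧ Function.support h = S}.Finite :=
    Set.toFinite _
  obtain ⟨S, hS1, hS2⟩ := hfin.exists_le_minimal (a := Function.support g)
    ⟨g, hg, fun h0 => hne (by ext e; exact (hgh e).1 (by rw [h0]; rfl)), rfl⟩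
  exact ⟨S, hS2, fun e he h0 => hS1 he ((hgh e).2 h0)⟩

theorem block_eq_of_circuit {S : Set Ed} (hS : G.IsCircuit S) {e f : Ed} (he : e ∈ S)
    (hf : f ∈ S) : G.block e = G.block f :=
  Quotient.sound (Relation.EqvGen.rel _ _ ⟨S, hS, he, hf⟩)

theorem block_induction {r : Ed → Ed → Prop} (hr : Equivalence r)
    (h : ∀ S, G.IsCircuit S → ∀ e ∈ S, ∀ f ∈ S, r e f) {e f : Ed} (hef : G.block e = G.block f) :
    r e f := by
  have : Relation.EqvGen (fun e e' => ∃ S, G.IsCircuit S ∧ e ∈ S ∧ e' ∈ S) e f :=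
    Quotient.exact hef
  induction this with
  | rel x y hxy =>
    obtain ⟨S, hS, hx, hy⟩ := hxy
    exact h S hS x hx y hy
  | refl x => exact hr.refl x
  | symm x y hxy ih => exact hr.symm (ih (Quotient.sound hxy))
  | trans x y z h1 h2 ih1 ih2 => exact hr.trans (ih1 (Quotient.sound h1)) (ih2 (Quotient.sound h2))

/-- Rescaling a cycle by a function of the blocks gives a cycle. -/
theorem IsCycle.block_mul (z : G.Block → ℚ) : ∀ {h : Ed → ℚ}, G.IsCycle h →
    G.IsCycle fun e => z (G.block e) * h e := by
  classical
  suffices ∀ (k : ℕ) (h : Ed → ℚ), (Finset.univ.filter fun e => h e ≠ 0).card = k →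
      G.IsCycle h → G.IsCycle fun e => z (G.block e) * h e from fun {h} hh => this _ h rfl hh
  intro k
  induction k using Nat.strong_induction_on with
  | _ k ih =>
    intro h hk hh
    by_cases hne : h = 0
    · subst hne
      simp [IsCycle, ← Pi.zero_def]
    · obtain ⟨S, hS, hSh⟩ := hh.exists_circuit hne
      obtain ⟨g, hg, hgS⟩ := hS.exists_cycle
      have hSne : S.Nonempty := by
        rw [Set.nonempty_iff_ne_empty]
        rintro rfl
        obtain ⟨⟨h', -, hne', hs⟩, -⟩ := hS
        exact hne' (Function.support_eq_empty_iff.1 hs)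
      obtain ⟨e₀, he₀⟩ := hSne
      have hge₀ := (hgS e₀).2 he₀
      -- Subtracting a circuit contained in the support of `h` shrinks that support. The circuit
      -- itself lies in a single block and is merely rescaled.
      set h' := h - (h e₀ / g e₀) • g with hh'
      have h1 : G.IsCycle h' := hh.sub (hg.smul _)
      have h2 : G.IsCycle fun e => z (G.block e) * h' e := by
        refine ih _ ?_ h' rfl h1
        rw [← hk]
        apply Finset.card_lt_card
        refine ⟨fun e he => ?_, fun hsub => ?_⟩
        · simp only [Finset.mem_filter, Finset.mem_univ, true_and] at he ⊢
          intro h0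
          have : e ∉ S := fun heS => hSh e heS h0
          rw [← hgS, not_not] at this
          exact he (by simp [hh', h0, this])
        · have := hsub (show e₀ ∈ _ by simpa using hSh e₀ he₀)
          simp [hh', hge₀] at this
      have h3 : (fun e => z (G.block e) * h e) =
          (fun e => z (G.block e) * h' e) + (h e₀ / g e₀ * z (G.block e₀)) • g := by
        ext e
        simp only [hh', Pi.add_apply, Pi.smul_apply, Pi.sub_apply, smul_eq_mul]
        by_cases he : e ∈ S
        · rw [block_eq_of_circuit hS he he₀]
          ring
        · rw [← hgS, not_not] at he
          rw [he]
          ring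
      rw [h3]
      exact h2.add (hg.smul _)

/-- A function that multiplies cycles to cycles is constant on the blocks. -/
theorem eq_of_block_eq {z : Ed → ℚ} (hz : ∀ h, G.IsCycle h → G.IsCycle fun e => z e * h e)
    {e f : Ed} (hef : G.block e = G.block f) : z e = z f := by
  refine block_induction (r := fun e f => z e = z f)
    ⟨fun _ => rfl, fun h => h.symm, fun h1 h2 => h1.trans h2⟩ ?_ hef
  intro S hS e he f hf
  obtain ⟨g, hg, hgS⟩ := hS.exists_cycle
  -- The cycle z·g − z(e)g is supported on the circuit and vanishes at `e`, so it is zero.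
  have h1 := hS.eq_zero ((hz g hg).sub (hg.smul (z e))) (fun f hf => by
    rw [← hgS, not_not] at hf
    simp [hf]) he (by simp)
  have h2 := congrFun h1 f
  simp only [Pi.sub_apply, Pi.smul_apply, smul_eq_mul, Pi.zero_apply] at h2
  have := (hgS f).2 hf
  rw [← sub_mul] at h2
  have := (mul_eq_zero.1 h2).resolve_right this
  linarith

/-- The part of a cycle lying in one connected component of its support is again a cycle; by
minimality a circuit has only one component. -/
theorem joined_of_circuit {S : Set Ed} (hS : G.IsCircuit S) {e f : Ed} (he : e ∈ S) (hf : f ∈ S) :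
    joined G.src G.tgt S (G.src e) (G.src f) := by
  classical
  obtain ⟨g, hg, hgS⟩ := hS.exists_cycle
  let z : Ed → ℚ := fun e' => if joined G.src G.tgt S (G.src e) (G.src e') then 1 else 0
  have hz : G.IsCycle fun e' => z e' * g e' := by
    ext v
    have hv := congrFun hg v
    rw [bdry_apply] at hv ⊢
    have key : ∀ e', z e' * g e' * ((if G.tgt e' = v then 1 else 0) -
        (if G.src e' = v then 1 else 0)) = (if joined G.src G.tgt S (G.src e) v then 1 else 0) *
        (g e' * ((if G.tgt e' = v then 1 else 0) - (if G.src e' = v then 1 else 0))) := by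
      intro e'
      by_cases he' : e' ∈ S
      · have h1 : joined G.src G.tgt S (G.src e) (G.src e') ↔
            joined G.src G.tgt S (G.src e) (G.tgt e') :=
          ⟨fun h => (joined G.src G.tgt S).trans h (joined_edge _ _ he'),
            fun h => (joined G.src G.tgt S).trans h
              ((joined G.src G.tgt S).symm (joined_edge _ _ he'))⟩
        by_cases hsv : G.src e' = v
        · simp only [z, hsv]
          ring
        · by_cases htv : G.tgt e' = v
          · simp only [z, h1, htv]
            ring
          · simp [hsv, htv]
      · rw [← hgS, not_not] at he'
        simp [he']
    simp only [key, ← Finset.mul_sum]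
    rw [hv, Pi.zero_apply, mul_zero]
  by_contra h
  have h3 : z f = 0 := if_neg h
  have h1 := congrFun (hS.eq_zero hz (fun e' he' => by
    rw [← hgS, not_not] at he'
    simp [he']) hf (by simp [h3])) e
  have h2 : z e = 1 := if_pos ((joined G.src G.tgt S).refl _)
  simp only [h2, one_mul, Pi.zero_apply] at h1
  exact (hgS e).2 he h1

theorem joined_of_block_eq {e f : Ed} (hef : G.block e = G.block f) :
    joined G.src G.tgt {e' | G.block e' = G.block e} (G.src e) (G.src f) := by
  have key : G.block e = G.block f ∧
      joined G.src G.tgt {e' | G.block e' = G.block e} (G.src e) (G.src f) := by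
    refine block_induction (r := fun e f => G.block e = G.block f ∧
      joined G.src G.tgt {e' | G.block e' = G.block e} (G.src e) (G.src f)) ⟨?_, ?_, ?_⟩ ?_ hef
    · exact fun e => ⟨rfl, (joined _ _ _).refl _⟩
    · rintro e f ⟨h1, h2⟩
      exact ⟨h1.symm, h1 ▸ (joined _ _ _).symm h2⟩
    · rintro e f g ⟨h1, h2⟩ ⟨h3, h4⟩
      rw [← h1] at h4
      exact ⟨h1.trans h3, (joined _ _ _).trans h2 h4⟩
    · intro S hS e he f hf
      exact ⟨block_eq_of_circuit hS he hf, joined_mono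
        (fun e' he' => block_eq_of_circuit hS he' he) (joined_of_circuit hS he hf)⟩
  exact key.2

open Classical in
/-- If all external edges are attached to the block `b`, then the external momenta can be routed
through `b`. -/
theorem exists_flow_in_block {b : G.Block}
    (hb : ∀ x, ∃ e, G.block e = b ∧ (G.src e = G.leg x ∨ G.tgt e = G.leg x)) (l : Fin n) :
    ∃ φ : Ed → ℚ, (∀ e, G.block e ≠ b → φ e = 0) ∧
      ∀ v, bdry G.src G.tgt φ v = -(G.inflow v l : ℚ) := by
  have hleg : ∀ x, ∃ e, G.block e = b ∧
      joined G.src G.tgt {e' | G.block e' = b} (G.src e) (G.leg x) := by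
    intro x
    obtain ⟨e, he, h | h⟩ := hb x
    · exact ⟨e, he, h ▸ (joined _ _ _).refl _⟩
    · exact ⟨e, he, h ▸ joined_edge _ _ he⟩
  obtain ⟨e, he, h1⟩ := hleg 0
  obtain ⟨f, hf, h2⟩ := hleg l.succ
  have h3 := joined_of_block_eq (he.trans hf.symm)
  rw [he] at h3
  have h4 := (joined _ _ _).trans ((joined _ _ _).symm h2)
    ((joined _ _ _).trans ((joined _ _ _).symm h3) h1)
  obtain ⟨φ, hφ, hbφ⟩ := exists_flow_of_joined (R := ℚ) h4
  refine ⟨φ, fun e he => hφ e he, fun v => ?_⟩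
  rw [hbφ, inflow, Matrix.of_apply, Fin.sum_univ_succ, Finset.sum_eq_single l]
  · simp only [legCoeff, Matrix.of_apply, if_pos, Pi.sub_apply, Pi.single_apply,
      (Fin.succ_ne_zero l).symm, if_false]
    push_cast
    simp only [eq_comm (a := v)]
    split_ifs <;> simp
  · intro x _ hx
    simp [legCoeff, hx, Fin.succ_ne_zero]
  · simp

/-- At a generic point the response matrix has no zero entry between edges of the same block. -/
theorem response_ne_zero [DecidableEq Ed] {L : ℕ} {C : Matrix (Fin L) Ed ℤ}
    (hC : IsCycleBasis G.src G.tgt C) {x : Ed → ℚ}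
    (hx : Matrix.IsGeneric (C.map (Int.cast : ℤ → ℚ)) x) (hnz : ∀ e, ∃ i, C i e ≠ 0) {e f : Ed}
    (hef : G.block e = G.block f) :
    Matrix.response (C.map (Int.cast : ℤ → ℚ)) x e f ≠ 0 := by
  classical
  set N := Matrix.response (C.map (Int.cast : ℤ → ℚ)) x with hN
  have hA := Matrix.isUnit_det_weighted_of_pos hC.rat_injective hx.pos
  have hself : ∀ e, N e e ≠ 0 := fun e => by
    obtain ⟨i, hi⟩ := hnz e
    exact Matrix.response_self_ne_zero hA hx.pos ⟨i, by simpa using hi⟩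
  have hcomm : ∀ e f, N e f = N f e := Matrix.response_comm _ _
  -- The class of `e` under nonvanishing of N is a union of blocks: N·X projects onto the cycles and
  -- does not mix classes, so multiplication by the indicator of the class preserves cycles.
  have h1 := eq_of_block_eq (z := fun g => if N e g ≠ 0 then 1 else 0) (G := G) ?_ hef
  · by_contra h0
    simp [hself e, h0] at h1
  · intro h hh
    obtain ⟨v, rfl⟩ := (hC.rat_bdry_eq_zero_iff h).1 hh
    refine (hC.rat_bdry_eq_zero_iff _).2 ?_
    set h := (C.map (Int.cast : ℤ → ℚ))ᵀ *ᵥ v with hh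
    have h2 : h = (N * Matrix.diagonal x) *ᵥ h := by
      rw [hh, Matrix.mulVec_mulVec, hN, Matrix.response_mul_transpose hA]
    have h3 : (fun g => (if N e g ≠ 0 then (1 : ℚ) else 0) * h g) =
        (N * Matrix.diagonal x) *ᵥ (fun g => (if N e g ≠ 0 then (1 : ℚ) else 0) * h g) := by
      ext g
      conv_lhs => rw [h2]
      simp only [Matrix.mulVec, dotProduct, Finset.mul_sum, Matrix.mul_diagonal]
      refine Finset.sum_congr rfl fun k _ => ?_
      by_cases hgk : N g k = 0
      · simp [hgk]
      · have : N e g ≠ 0 ↔ N e k ≠ 0 :=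
          ⟨fun h => hx.trans _ _ _ h hgk, fun h => hx.trans _ _ _ h (by rwa [← hN, hcomm])⟩
        simp only [this]
        ring
    refine ⟨((Matrix.weighted (C.map (Int.cast : ℤ → ℚ)) x)⁻¹ * C.map (Int.cast : ℤ → ℚ) *
      Matrix.diagonal x) *ᵥ (fun g => (if N e g ≠ 0 then (1 : ℚ) else 0) * h g), ?_⟩
    rw [Matrix.mulVec_mulVec]
    conv_rhs => rw [h3]
    congr 1
    simp only [hN, Matrix.response, Matrix.mul_assoc]

end FeynmanGraph

/-! ### Sectors and lifts of signed bijections -/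

namespace Sector

open EdgeFlow

variable {K V Ed : Type*} [Fintype Ed] [DecidableEq Ed] {L n : ℕ}

section basic

variable (S : Sector K V Ed L n)

omit [DecidableEq Ed] in
theorem isCycleBasis (h : S.graph.Connected) : IsCycleBasis S.graph.src S.graph.tgt S.C where
  connected := h
  injective v hv := by
    have h1 := Fintype.linearIndependent_iff.1 S.C_indep v (by
      ext e
      have := congrFun hv e
      simpa [Matrix.mulVec, dotProduct, Finset.sum_apply, mul_comm] using this)
    exact funext h1
  bdry_eq_zero_iff h := by
    rw [← FeynmanGraph.mem_cycleSpace, ← S.C_span, Submodule.mem_span_range_iff_exists_fun]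
    refine exists_congr fun v => ?_
    have h1 : ∑ i, v i • S.C.row i = S.Cᵀ *ᵥ v := by
      ext e
      simp [Matrix.mulVec, dotProduct, Finset.sum_apply, mul_comm]
    rw [h1]

omit [DecidableEq Ed] in
theorem exists_C_ne_zero (hloop : ∀ e, ∃ h ∈ S.graph.cycleSpace, h e ≠ 0)
    (h : S.graph.Connected) (e : Ed) : ∃ i, S.C i e ≠ 0 := by
  obtain ⟨g, hg, hge⟩ := hloop e
  rw [FeynmanGraph.mem_cycleSpace, (S.isCycleBasis h).bdry_eq_zero_iff] at hg
  obtain ⟨v, rfl⟩ := hg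
  by_contra! h0
  exact hge (by simp [Matrix.mulVec, dotProduct, h0])

omit [DecidableEq Ed] in
theorem bdry_E (l : Fin n) (v : V) :
    bdry S.graph.src S.graph.tgt (S.E l) v = -(S.graph.inflow v l : ℚ) := by
  have h1 := congrFun (congrFun S.E_conserved v) l
  rw [← bdryMatrix_mulVec, eq_neg_iff_add_eq_zero]
  refine Eq.trans ?_ h1
  rw [Matrix.add_apply, Matrix.mul_apply, Matrix.map_apply]
  congr 1
  refine Finset.sum_congr rfl fun e _ => ?_
  rw [Matrix.transpose_apply, Matrix.map_apply]
  congr 1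
  simp [FeynmanGraph.incidence, bdryMatrix, apply_ite (Int.cast : ℤ → ℚ)]

omit [DecidableEq Ed] in
theorem bdry_EIn [Field K] [CharZero K] (l : Fin n) (v : V) :
    bdry S.graph.src S.graph.tgt (S.EIn K l) v = -(S.graph.inflow v l : K) := by
  have h1 := bdry_map S.graph.src S.graph.tgt (Rat.castHom K) (S.E l) v
  rw [S.bdry_E] at h1
  refine Eq.trans h1 ?_
  simp

-- As the legs sit at distinct vertices, the boundary at the vertex of leg l + 1 involves only `v
-- l`.
omit [DecidableEq Ed] in
theorem eq_zero_of_E_mulVec (hleg : Function.Injective S.graph.leg) {v : Fin n → ℚ}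
    (hv : bdry S.graph.src S.graph.tgt (S.Eᵀ *ᵥ v) = 0) : v = 0 := by
  classical
  have h1 : S.Eᵀ *ᵥ v = ∑ l, v l • S.E l := by
    ext e
    simp [Matrix.mulVec, dotProduct, Finset.sum_apply, mul_comm]
  ext l
  have h2 := congrFun hv (S.graph.leg l.succ)
  rw [h1, map_sum, Finset.sum_apply, Finset.sum_eq_single l] at h2
  · rw [map_smul, Pi.smul_apply, S.bdry_E, FeynmanGraph.inflow, Matrix.of_apply,
      Finset.sum_eq_single l.succ] at h2
    · simpa [FeynmanGraph.legCoeff] using h2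
    · intro x _ hx
      rw [if_neg fun h => hx (hleg h)]
    · simp
  · intro m _ hm
    rw [map_smul, Pi.smul_apply, S.bdry_E, FeynmanGraph.inflow, Matrix.of_apply,
      Finset.sum_eq_zero]
    · simp
    · intro x _
      split_ifs with h
      · rw [hleg h]
        simp [FeynmanGraph.legCoeff, Fin.succ_ne_zero, Ne.symm hm]
      · rfl
  · simp

theorem weighted_one : S.CIn ℚ * (S.CIn ℚ)ᵀ = Matrix.weighted (S.CIn ℚ) fun _ => 1 := by
  rw [Matrix.weighted, Matrix.diagonal_one, Matrix.mul_one]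

theorem isUnit_det_gram (h : S.graph.Connected) : IsUnit (S.CIn ℚ * (S.CIn ℚ)ᵀ).det := by
  rw [S.weighted_one]
  exact Matrix.isUnit_det_weighted_of_pos (S.isCycleBasis h).rat_injective fun _ => one_pos

theorem proj_eq : S.proj = Matrix.response (S.CIn ℚ) fun _ => 1 := by
  rw [proj, S.weighted_one, Matrix.response]

theorem proj_mul_C (h : S.graph.Connected) : S.proj * (S.CIn ℚ)ᵀ = (S.CIn ℚ)ᵀ := by
  have h1 := S.isUnit_det_gram h
  rw [proj, Matrix.mul_assoc, Matrix.mul_assoc, Matrix.nonsing_inv_mul _ h1, Matrix.mul_one]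

theorem projPerp_mul_C (h : S.graph.Connected) : S.projPerp * (S.CIn ℚ)ᵀ = 0 := by
  rw [projPerp, Matrix.sub_mul, Matrix.one_mul, S.proj_mul_C h, sub_self]

theorem projPerp_transpose : S.projPerpᵀ = S.projPerp := by
  rw [projPerp, Matrix.transpose_sub, Matrix.transpose_one, proj_eq, Matrix.response_transpose]

theorem projPerp_mul_self (h : S.graph.Connected) : S.projPerp * S.projPerp = S.projPerp := by
  conv_lhs => rw [projPerp, Matrix.mul_sub, Matrix.mul_one, ← projPerp]
  rw [proj, ← Matrix.mul_assoc, ← Matrix.mul_assoc, S.projPerp_mul_C h]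
  simp

/-- The matrix is the Gram matrix of EΠ⊥. A kernel vector v would make Eᵀv a cycle, that is, a flow
without external momenta. -/
theorem isUnit_det_gramPerp (h : S.graph.Connected) (hleg : Function.Injective S.graph.leg) :
    IsUnit (S.E * S.projPerp * S.Eᵀ).det := by
  have h1 : S.E * S.projPerp * S.Eᵀ = Matrix.weighted (S.E * S.projPerp) fun _ => 1 := by
    rw [Matrix.weighted, Matrix.diagonal_one, Matrix.mul_one, Matrix.transpose_mul,
      S.projPerp_transpose, ← Matrix.mul_assoc, Matrix.mul_assoc S.E S.projPerp S.projPerp,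
      S.projPerp_mul_self h]
  rw [h1]
  refine Matrix.isUnit_det_weighted_of_pos (fun v hv => ?_) fun _ => one_pos
  apply S.eq_zero_of_E_mulVec hleg
  rw [(S.isCycleBasis h).rat_bdry_eq_zero_iff]
  rw [Matrix.transpose_mul, S.projPerp_transpose, ← Matrix.mulVec_mulVec, projPerp,
    Matrix.sub_mulVec, Matrix.one_mulVec, sub_eq_zero] at hv
  refine ⟨((S.CIn ℚ * (S.CIn ℚ)ᵀ)⁻¹ * S.CIn ℚ) *ᵥ (S.Eᵀ *ᵥ v), ?_⟩
  conv_rhs => rw [hv, proj]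
  rw [Matrix.mulVec_mulVec]
  congr 1
  simp only [CIn, Matrix.mul_assoc]

end basic

section lift

variable {V₁ V₂ Ed₁ Ed₂ : Type*} [Fintype Ed₁] [DecidableEq Ed₁] [Fintype Ed₂] [DecidableEq Ed₂]

omit [Fintype Ed₁] [DecidableEq Ed₂] in
theorem signedPerm_mul_apply (κ : Ed₂ → ℤˣ) (σ : Ed₂ ≃ Ed₁) {m : Type*} (M : Matrix Ed₂ m ℚ)
    (j : Ed₂) (k : m) : (signedPerm κ σ * M) (σ j) k = ((κ j : ℤ) : ℚ) * M j k := by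
  rw [Matrix.mul_apply, Finset.sum_eq_single j]
  · simp [signedPerm]
  · intro b _ hb
    simp [signedPerm, hb.symm]
  · simp

/-- The momentum map `T` realises the signed bijection: `q₁ = P q₂`. -/
structure IsLift (S₁ : Sector K V₁ Ed₁ L n) (S₂ : Sector K V₂ Ed₂ L n) (κ : Ed₂ → ℤˣ)
    (σ : Ed₂ ≃ Ed₁) (T : MomentumMap ℚ L n) : Prop where
  loop : (S₁.CIn ℚ)ᵀ * T.L = signedPerm κ σ * (S₂.CIn ℚ)ᵀ
  ext : (S₁.CIn ℚ)ᵀ * T.M + S₁.Eᵀ * T.N = signedPerm κ σ * S₂.Eᵀ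

variable {S₁ : Sector K V₁ Ed₁ L n} {S₂ : Sector K V₂ Ed₂ L n} {κ : Ed₂ → ℤˣ}
  {σ : Ed₂ ≃ Ed₁} {T : MomentumMap ℚ L n}

/-- The equation q₁ = Pq₂ is solved by projecting. The cycle part gives the loop matrix, Π⊥ removes
all loop terms and isolates the external matrix, and the shift is what remains. In particular the
momentum map is determined by the signed bijection. -/
theorem IsLift.eq_lift (hT : IsLift S₁ S₂ κ σ T) (h₁ : S₁.graph.Connected)
    (hleg : Function.Injective S₁.graph.leg) :
    T = S₁.lift S₂ κ σ := by
  have hu := S₁.isUnit_det_gram h₁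
  have hv := S₁.isUnit_det_gramPerp h₁ hleg
  have hinv : (S₁.CIn ℚ * (S₁.CIn ℚ)ᵀ)⁻¹ * S₁.CIn ℚ * (S₁.CIn ℚ)ᵀ = 1 := by
    rw [Matrix.mul_assoc, Matrix.nonsing_inv_mul _ hu]
  have hL : T.L = (S₁.CIn ℚ * (S₁.CIn ℚ)ᵀ)⁻¹ * S₁.CIn ℚ * signedPerm κ σ * (S₂.CIn ℚ)ᵀ := by
    rw [Matrix.mul_assoc _ (signedPerm κ σ), ← hT.loop, ← Matrix.mul_assoc, hinv, Matrix.one_mul]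
  -- P maps cycles of the second graph to cycles of the first, which Π⊥ annihilates.
  have hPP : S₁.projPerp * signedPerm κ σ * S₂.projPerp = S₁.projPerp * signedPerm κ σ := by
    have h0 : S₂.projPerp = 1 - S₂.proj := rfl
    rw [h0, Matrix.mul_sub, Matrix.mul_one, proj, Matrix.mul_assoc (S₂.CIn ℚ)ᵀ,
      Matrix.mul_assoc S₁.projPerp, ← Matrix.mul_assoc (signedPerm κ σ), ← hT.loop,
      Matrix.mul_assoc, ← Matrix.mul_assoc S₁.projPerp, S₁.projPerp_mul_C h₁, Matrix.zero_mul,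
      sub_zero]
  have h2 : S₁.projPerp * signedPerm κ σ * S₂.projPerp * S₂.Eᵀ = S₁.projPerp * S₁.Eᵀ * T.N := by
    rw [hPP, Matrix.mul_assoc, ← hT.ext, Matrix.mul_add, ← Matrix.mul_assoc, S₁.projPerp_mul_C h₁,
      Matrix.zero_mul, zero_add, Matrix.mul_assoc]
  have hN : T.N = (S₁.E * S₁.projPerp * S₁.Eᵀ)⁻¹ * S₁.E * S₁.projPerp * signedPerm κ σ *
      S₂.projPerp * S₂.Eᵀ := by
    have : (S₁.E * S₁.projPerp * S₁.Eᵀ)⁻¹ * S₁.E * S₁.projPerp * signedPerm κ σ *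
        S₂.projPerp * S₂.Eᵀ = (S₁.E * S₁.projPerp * S₁.Eᵀ)⁻¹ * S₁.E *
          (S₁.projPerp * signedPerm κ σ * S₂.projPerp * S₂.Eᵀ) := by
      simp only [Matrix.mul_assoc]
    rw [this, h2]
    have : (S₁.E * S₁.projPerp * S₁.Eᵀ)⁻¹ * S₁.E * (S₁.projPerp * S₁.Eᵀ * T.N) =
        (S₁.E * S₁.projPerp * S₁.Eᵀ)⁻¹ * (S₁.E * S₁.projPerp * S₁.Eᵀ) * T.N := by
      simp only [Matrix.mul_assoc]
    rw [this, Matrix.nonsing_inv_mul _ hv, Matrix.one_mul]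
  have hM : T.M = (S₁.CIn ℚ * (S₁.CIn ℚ)ᵀ)⁻¹ * S₁.CIn ℚ * signedPerm κ σ * S₂.Eᵀ -
      (S₁.CIn ℚ * (S₁.CIn ℚ)ᵀ)⁻¹ * S₁.CIn ℚ * S₁.Eᵀ * T.N := by
    rw [Matrix.mul_assoc _ (signedPerm κ σ), ← hT.ext, Matrix.mul_add, ← Matrix.mul_assoc, hinv,
      Matrix.one_mul, ← Matrix.mul_assoc, add_sub_cancel_right]
  ext1
  · exact hL
  · rw [hM, hN]
    rfl
  · exact hN

end lift

end Sector

/-! ### Behaviour under change of cycle basis and signed permutations -/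

namespace Matrix

variable {ι E K : Type*} [Fintype ι] [DecidableEq ι] [Fintype E] [DecidableEq E] [Field K]
  [CharZero K]

theorem reduced_castPt {C : Matrix ι E ℚ} {x : E → ℚ} (hA : IsUnit (weighted C x).det) :
    reduced (C.map (Rat.cast : ℚ → K)) (castPt K x) = (reduced C x).map (Rat.cast : ℚ → K) := by
  ext e f
  rw [map_apply, reduced_apply, reduced_apply, response_castPt hA]
  simp [castPt, apply_ite (Rat.cast : ℚ → K)]

variable {F : Type*} [Field F]

theorem coproj_transpose_mul_transpose {C : Matrix ι E F} {x : E → F}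
    (hA : IsUnit (weighted C x).det) : (coproj C x)ᵀ * Cᵀ = 0 := by
  rw [coproj, transpose_sub, transpose_one, transpose_mul, diagonal_transpose,
    response_transpose, Matrix.sub_mul, Matrix.one_mul, response_mul_transpose hA, sub_self]

theorem exists_eq_of_coproj_mul_eq_zero {C : Matrix ι E F} {x : E → F} {m : Type*}
    {M : Matrix E m F} (h : (coproj C x)ᵀ * M = 0) : ∃ Z : Matrix ι m F, M = Cᵀ * Z := by
  rw [coproj, transpose_sub, transpose_one, transpose_mul, diagonal_transpose,
    response_transpose, Matrix.sub_mul, Matrix.one_mul, sub_eq_zero] at h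
  refine ⟨(weighted C x)⁻¹ * C * diagonal x * M, ?_⟩
  conv_lhs => rw [h, response]
  simp only [Matrix.mul_assoc]

theorem weighted_eq_of_mul_eq {C₁ C₂ : Matrix ι E F} {T : Matrix ι ι F}
    (h : C₁ᵀ * T = C₂ᵀ) (x : E → F) : weighted C₂ x = Tᵀ * weighted C₁ x * T := by
  have h' : C₂ = Tᵀ * C₁ := by
    rw [← transpose_transpose C₂, ← h, transpose_mul, transpose_transpose]
  rw [weighted, ← h, h', weighted]
  simp only [Matrix.mul_assoc]

theorem response_eq_of_mul_eq {C₁ C₂ : Matrix ι E F} {T : Matrix ι ι F} (hT : IsUnit T.det)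
    (h : C₁ᵀ * T = C₂ᵀ) {x : E → F} :
    response C₂ x = response C₁ x := by
  have h' : C₂ = Tᵀ * C₁ := by
    rw [← transpose_transpose C₂, ← h, transpose_mul, transpose_transpose]
  have hw := weighted_eq_of_mul_eq h x
  have hT' : IsUnit Tᵀ.det := by rwa [det_transpose]
  rw [response, hw, Matrix.mul_inv_rev, Matrix.mul_inv_rev, ← h, h', response]
  calc C₁ᵀ * T * (T⁻¹ * ((weighted C₁ x)⁻¹ * Tᵀ⁻¹)) * (Tᵀ * C₁)
      = C₁ᵀ * (T * T⁻¹) * (weighted C₁ x)⁻¹ * (Tᵀ⁻¹ * Tᵀ) * C₁ := by simp only [Matrix.mul_assoc]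
    _ = C₁ᵀ * (weighted C₁ x)⁻¹ * C₁ := by
      rw [mul_nonsing_inv _ hT, nonsing_inv_mul _ hT', Matrix.mul_one, Matrix.mul_one]

end Matrix

section signedPerm

open Matrix

variable {Ed₁ Ed₂ ι m : Type*} [Fintype Ed₁] [DecidableEq Ed₁] [Fintype Ed₂] [DecidableEq Ed₂]
  [Fintype ι] [DecidableEq ι] (κ : Ed₂ → ℤˣ) (σ : Ed₂ ≃ Ed₁)

theorem units_cast_mul_self (u : ℤˣ) : ((u : ℤ) : ℚ) * ((u : ℤ) : ℚ) = 1 := by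
  rcases Int.units_eq_one_or u with rfl | rfl <;> simp

omit [Fintype Ed₂] [DecidableEq Ed₂] in
theorem mul_signedPerm_apply (M : Matrix m Ed₁ ℚ) (k : m) (j : Ed₂) :
    (M * signedPerm κ σ) k j = ((κ j : ℤ) : ℚ) * M k (σ j) := by
  rw [Matrix.mul_apply, Finset.sum_eq_single (σ j)]
  · simp [signedPerm, mul_comm]
  · intro b _ hb
    simp [signedPerm, hb]
  · simp

omit [Fintype Ed₂] [DecidableEq Ed₂] in
theorem signedPerm_transpose_mul_apply (M : Matrix Ed₁ m ℚ) (k : m) (j : Ed₂) :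
    ((signedPerm κ σ)ᵀ * M) j k = ((κ j : ℤ) : ℚ) * M (σ j) k := by
  rw [← Matrix.transpose_apply ((signedPerm κ σ)ᵀ * M), Matrix.transpose_mul,
    Matrix.transpose_transpose, mul_signedPerm_apply]
  rfl

omit [Fintype Ed₂] in
theorem signedPerm_transpose_mul_self : (signedPerm κ σ)ᵀ * signedPerm κ σ = 1 := by
  ext i j
  rw [signedPerm_transpose_mul_apply, Matrix.one_apply]
  by_cases h : i = j
  · subst h
    simp [signedPerm, units_cast_mul_self]
  · simp [signedPerm, h]

omit [DecidableEq Ed₂] in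
theorem signedPerm_mul_transpose_self : signedPerm κ σ * (signedPerm κ σ)ᵀ = 1 := by
  classical
  ext i j
  obtain ⟨i, rfl⟩ := σ.surjective i
  obtain ⟨j, rfl⟩ := σ.surjective j
  rw [Sector.signedPerm_mul_apply, Matrix.one_apply, Matrix.transpose_apply]
  by_cases h : i = j
  · subst h
    simp [signedPerm, units_cast_mul_self]
  · simp [signedPerm, h, Ne.symm h]

theorem weighted_mul_signedPerm (C : Matrix ι Ed₁ ℚ) (x : Ed₂ → ℚ) :
    weighted (C * signedPerm κ σ) x = weighted C (x ∘ σ.symm) := by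
  have : signedPerm κ σ * diagonal x = diagonal (x ∘ σ.symm) * signedPerm κ σ := by
    ext i j
    rw [mul_diagonal, diagonal_mul]
    by_cases h : i = σ j
    · subst h
      simp [mul_comm]
    · simp [signedPerm, h]
  rw [weighted, weighted, transpose_mul]
  calc C * signedPerm κ σ * diagonal x * ((signedPerm κ σ)ᵀ * Cᵀ)
      = C * (signedPerm κ σ * diagonal x) * (signedPerm κ σ)ᵀ * Cᵀ := by
        simp only [Matrix.mul_assoc]
    _ = C * diagonal (x ∘ σ.symm) * (signedPerm κ σ * (signedPerm κ σ)ᵀ) * Cᵀ := by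
        rw [this]; simp only [Matrix.mul_assoc]
    _ = _ := by rw [signedPerm_mul_transpose_self, Matrix.mul_one]

theorem response_mul_signedPerm (C : Matrix ι Ed₁ ℚ) (x : Ed₂ → ℚ) (e f : Ed₂) :
    response (C * signedPerm κ σ) x e f =
      ((κ e : ℤ) : ℚ) * ((κ f : ℤ) : ℚ) * response C (x ∘ σ.symm) (σ e) (σ f) := by
  have : response (C * signedPerm κ σ) x =
      (signedPerm κ σ)ᵀ * (response C (x ∘ σ.symm) * signedPerm κ σ) := by
    rw [response, weighted_mul_signedPerm, transpose_mul, response]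
    simp only [Matrix.mul_assoc]
  rw [this, signedPerm_transpose_mul_apply, mul_signedPerm_apply, mul_assoc]

theorem coproj_mul_signedPerm (C : Matrix ι Ed₁ ℚ) (x : Ed₂ → ℚ) (e f : Ed₂) :
    coproj (C * signedPerm κ σ) x e f =
      ((κ e : ℤ) : ℚ) * ((κ f : ℤ) : ℚ) * coproj C (x ∘ σ.symm) (σ e) (σ f) := by
  rw [coproj_apply, coproj_apply, response_mul_signedPerm]
  by_cases h : e = f
  · subst h
    have := units_cast_mul_self (κ e)
    simp only [Function.comp_apply, Equiv.symm_apply_apply, if_true]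
    linear_combination -this
  · simp only [h, σ.injective.eq_iff, Function.comp_apply, Equiv.symm_apply_apply, if_false]
    ring

theorem reduced_mul_signedPerm (C : Matrix ι Ed₁ ℚ) (x : Ed₂ → ℚ) (e f : Ed₂) :
    reduced (C * signedPerm κ σ) x e f =
      ((κ e : ℤ) : ℚ) * ((κ f : ℤ) : ℚ) * reduced C (x ∘ σ.symm) (σ e) (σ f) := by
  rw [reduced_apply, reduced_apply, response_mul_signedPerm]
  by_cases h : e = f
  · subst h
    have := units_cast_mul_self (κ e)
    simp only [Function.comp_apply, Equiv.symm_apply_apply, if_true]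
    linear_combination -x e * this
  · simp only [h, σ.injective.eq_iff, Function.comp_apply, Equiv.symm_apply_apply, if_false]
    ring

end signedPerm

/-! ### The Lee–Pomeransky polynomial at rational points -/

namespace Sector

open EdgeFlow Matrix

variable {K V Ed : Type*} [Fintype Ed] [DecidableEq Ed] {L n : ℕ} [Field K] [CharZero K]

section potential

variable (Gm : Matrix (Fin n) (Fin n) K) (S : Sector K V Ed L n)

/-- The value of `ℱ / 𝒰` at a rational point. -/
noncomputable def potential (x : Ed → ℚ) : K :=
  ∑ e, S.massSq e * castPt K x e -
    entrySum ((S.EIn K)ᵀ * Gm * S.EIn K) ((reduced (S.CIn ℚ) x).map (Rat.cast : ℚ → K))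

omit [DecidableEq Ed] in
theorem CIn_eq_map : S.CIn K = (S.CIn ℚ).map (Rat.cast : ℚ → K) := by
  ext
  simp [CIn]

theorem eval_leePomeransky [Fintype V] (h : S.graph.Connected) {x : Ed → ℚ} (hx : ∀ e, 0 < x e) :
    MvPolynomial.eval (castPt K x) (S.leePomeransky Gm) =
      ((weighted (S.CIn ℚ) x).det : K) * (1 + S.potential Gm x) := by
  have hC := S.isCycleBasis h
  have hA : IsUnit (weighted (S.CIn ℚ) x).det :=
    isUnit_det_weighted_of_pos hC.rat_injective hx
  have hAK : IsUnit (weighted (S.CIn K) (castPt K x)).det := by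
    rw [CIn_eq_map]
    exact isUnit_det_weighted_castPt hC.rat_injective hx
  have hdet : (weighted (S.CIn K) (castPt K x)).det = ((weighted (S.CIn ℚ) x).det : K) := by
    rw [CIn_eq_map, det_weighted_castPt]
  have hred : reduced (S.CIn K) (castPt K x) =
      (reduced (S.CIn ℚ) x).map (Rat.cast : ℚ → K) := by
    rw [CIn_eq_map, reduced_castPt hA]
  rw [leePomeransky, FeynmanGraph.leePomeransky, map_add, FeynmanGraph.eval_firstSymanzik hC,
    FeynmanGraph.eval_secondSymanzik hC S.massSq Gm (S.EIn K) S.bdry_EIn _ hAK]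
  change (weighted (S.CIn K) (castPt K x)).det + (weighted (S.CIn K) (castPt K x)).det *
    (_ - ∑ l, ∑ m, Gm l m * (S.EIn K l ⬝ᵥ reduced (S.CIn K) (castPt K x) *ᵥ S.EIn K m)) = _
  have hsum : ∑ l, ∑ m, Gm l m * (S.EIn K l ⬝ᵥ reduced (S.CIn K) (castPt K x) *ᵥ S.EIn K m) =
      entrySum ((S.EIn K)ᵀ * Gm * S.EIn K) ((reduced (S.CIn ℚ) x).map (Rat.cast : ℚ → K)) := by
    rw [hred]
    set R := (reduced (S.CIn ℚ) x).map (Rat.cast : ℚ → K)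
    simp only [entrySum, Matrix.mul_apply, dotProduct, mulVec, Finset.mul_sum, Finset.sum_mul,
      transpose_apply]
    calc _ = ∑ l, ∑ e, ∑ m, ∑ f, Gm l m * (S.EIn K l e * (R e f * S.EIn K m f)) :=
          Finset.sum_congr rfl fun l _ => Finset.sum_comm
      _ = ∑ e, ∑ l, ∑ m, ∑ f, Gm l m * (S.EIn K l e * (R e f * S.EIn K m f)) := Finset.sum_comm
      _ = ∑ e, ∑ f, ∑ m, ∑ l, S.EIn K l e * Gm l m * S.EIn K m f * R e f := by
          refine Finset.sum_congr rfl fun e _ => ?_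
          rw [Finset.sum_comm]
          rw [Finset.sum_comm' (s := Finset.univ) (t := fun _ => Finset.univ)
            (t' := Finset.univ) (s' := fun _ => Finset.univ) (by simp)]
          rw [show (∑ l, ∑ m, ∑ f, Gm l m * (S.EIn K l e * (R e f * S.EIn K m f))) =
            ∑ l, ∑ f, ∑ m, Gm l m * (S.EIn K l e * (R e f * S.EIn K m f)) from
              Finset.sum_congr rfl fun l _ => Finset.sum_comm]
          rw [Finset.sum_comm]
          refine Finset.sum_congr rfl fun f _ => ?_
          rw [Finset.sum_comm]
          refine Finset.sum_congr rfl fun m _ => Finset.sum_congr rfl fun l _ => ?_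
          ring
  rw [hsum, hdet, potential]
  ring

/-- N has degree −1 in x, so H has degree 1. -/
theorem potential_smul (h : S.graph.Connected) {x : Ed → ℚ} (hx : ∀ e, 0 < x e) {t : ℚ}
    (ht : t ≠ 0) : S.potential Gm (t • x) = t * S.potential Gm x := by
  have hA := isUnit_det_weighted_of_pos (S.isCycleBasis h).rat_injective hx
  rw [potential, potential, show S.CIn ℚ = S.C.map Int.cast from rfl, reduced_smul hA ht, mul_sub,
    entrySum, entrySum, Finset.mul_sum, Finset.mul_sum]
  congr 1
  · refine Finset.sum_congr rfl fun e _ => ?_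
    simp [castPt]
    ring
  · refine Finset.sum_congr rfl fun e _ => ?_
    rw [Finset.mul_sum]
    refine Finset.sum_congr rfl fun f _ => ?_
    simp
    ring

end potential

variable {V₁ V₂ Ed₁ Ed₂ : Type*} [Fintype Ed₁] [DecidableEq Ed₁] [Fintype Ed₂] [DecidableEq Ed₂]
  {Gm : Matrix (Fin n) (Fin n) K} {S₁ : Sector K V₁ Ed₁ L n} {S₂ : Sector K V₂ Ed₂ L n}

omit [Fintype Ed₁] [Fintype Ed₂] [DecidableEq Ed₁] [DecidableEq Ed₂] [CharZero K] in
theorem eval_permSet {f₁ : MvPolynomial Ed₁ K} {f₂ : MvPolynomial Ed₂ K} {σ : Ed₂ ≃ Ed₁}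
    (hσ : σ ∈ permSet f₁ f₂) (x : Ed₂ → ℚ) :
    MvPolynomial.eval (castPt K (x ∘ σ.symm)) f₁ = MvPolynomial.eval (castPt K x) f₂ := by
  rw [← show MvPolynomial.rename σ.symm f₁ = f₂ from hσ, MvPolynomial.eval_rename]
  rfl

/-- 𝒰 has degree L and ℱ/𝒰 degree 1, so the values of 𝒰(1 + ℱ/𝒰) at x and 2x separate the two. -/
theorem det_eq_and_potential_eq [Fintype V₁] [Fintype V₂] (h₁ : S₁.graph.Connected)
    (h₂ : S₂.graph.Connected) {σ : Ed₂ ≃ Ed₁}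
    (hσ : σ ∈ permSet (S₁.leePomeransky Gm) (S₂.leePomeransky Gm)) {x : Ed₂ → ℚ}
    (hx : ∀ e, 0 < x e) :
    (weighted (S₁.CIn ℚ) (x ∘ σ.symm)).det = (weighted (S₂.CIn ℚ) x).det ∧
      S₁.potential Gm (x ∘ σ.symm) = S₂.potential Gm x := by
  have hy : ∀ e, 0 < (x ∘ σ.symm) e := fun e => hx _
  have hx2 : ∀ e, 0 < ((2 : ℚ) • x) e := fun e => by simpa using hx e
  have hy2 : ∀ e, 0 < ((2 : ℚ) • (x ∘ σ.symm)) e := fun e => by simpa using hx _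
  have e1 := eval_permSet hσ x
  have e2 := eval_permSet hσ ((2 : ℚ) • x)
  rw [show ((2 : ℚ) • x) ∘ σ.symm = (2 : ℚ) • (x ∘ σ.symm) from rfl] at e2
  rw [S₁.eval_leePomeransky Gm h₁ hy, S₂.eval_leePomeransky Gm h₂ hx] at e1
  rw [S₁.eval_leePomeransky Gm h₁ hy2, S₂.eval_leePomeransky Gm h₂ hx2,
    S₁.potential_smul Gm h₁ hy two_ne_zero, S₂.potential_smul Gm h₂ hx two_ne_zero,
    weighted_smul, weighted_smul, det_smul, det_smul] at e2
  set u₁ := (weighted (S₁.CIn ℚ) (x ∘ σ.symm)).det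
  set u₂ := (weighted (S₂.CIn ℚ) x).det with hu₂
  set p₁ := S₁.potential Gm (x ∘ σ.symm)
  set p₂ := S₂.potential Gm x
  push_cast at e2
  have h2 : ((2 : K) ^ Fintype.card (Fin L)) ≠ 0 := pow_ne_zero _ two_ne_zero
  have e3 : (u₁ : K) * (1 + 2 * p₁) = u₂ * (1 + 2 * p₂) := by
    apply mul_left_cancel₀ h2
    linear_combination e2
  have e4 : (u₁ : K) = u₂ := by linear_combination 2 * e1 - e3
  have e5 : u₁ = u₂ := by exact_mod_cast e4
  refine ⟨e5, ?_⟩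
  have hne : (u₂ : K) ≠ 0 := by
    exact_mod_cast (isUnit_det_weighted_of_pos (S₂.isCycleBasis h₂).rat_injective hx).ne_zero
  apply mul_left_cancel₀ hne
  rw [e4] at e1
  linear_combination e1

/-- At a generic point the reduced external flows are supported in one class. -/
theorem response_ne_zero_of_ext {S : Sector K V Ed L n} (h : S.MomentumGrouped Gm) {x : Ed → ℚ}
    (hx : IsGeneric (S.CIn ℚ) x) {e f : Ed} {l m : Fin n}
    (he : ((coproj (S.CIn ℚ) x)ᵀ * S.Eᵀ) e l ≠ 0) (hf : ((coproj (S.CIn ℚ) x)ᵀ * S.Eᵀ) f m ≠ 0) :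
    response (S.CIn ℚ) x e f ≠ 0 := by
  have hC := S.isCycleBasis h.connected
  have hA : IsUnit (weighted (S.CIn ℚ) x).det :=
    isUnit_det_weighted_of_pos hC.rat_injective hx.pos
  obtain ⟨b, hb⟩ := h.common_block (Fin.pos l)
  -- Up to a cycle, which the transpose of 1 − XN annihilates, the external flow can be routed
  -- through the common block `b`. Its reduced value at `e` is then nonzero only if `e` is related
  -- to an edge of `b`.
  have key : ∀ (l : Fin n) (e : Ed), ((coproj (S.CIn ℚ) x)ᵀ * S.Eᵀ) e l ≠ 0 →
      ∃ a, S.graph.block a = b ∧ response (S.CIn ℚ) x e a ≠ 0 := by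
    intro l e he
    obtain ⟨φ, hφb, hφ⟩ := FeynmanGraph.exists_flow_in_block hb l
    have hcyc : bdry S.graph.src S.graph.tgt (S.E l - φ) = 0 := by
      ext v
      rw [map_sub, Pi.sub_apply, S.bdry_E, hφ, sub_self, Pi.zero_apply]
    obtain ⟨u, hu⟩ := (hC.rat_bdry_eq_zero_iff _).1 hcyc
    have h1 : ((coproj (S.CIn ℚ) x)ᵀ * S.Eᵀ) e l = ((coproj (S.CIn ℚ) x)ᵀ *ᵥ φ) e := by
      have h2 : S.E l = φ + (S.CIn ℚ)ᵀ *ᵥ u := by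
        rw [show (S.CIn ℚ)ᵀ *ᵥ u = _ from hu, add_sub_cancel]
      have h3 : ((coproj (S.CIn ℚ) x)ᵀ * S.Eᵀ) e l = ((coproj (S.CIn ℚ) x)ᵀ *ᵥ S.E l) e := rfl
      rw [h3, h2, mulVec_add, mulVec_mulVec, coproj_transpose_mul_transpose hA, zero_mulVec,
        add_zero]
    rw [h1, mulVec, dotProduct] at he
    obtain ⟨a, -, ha⟩ := Finset.exists_ne_zero_of_sum_ne_zero he
    have hab : S.graph.block a = b := by
      by_contra hab
      rw [hφb a hab, mul_zero] at ha
      exact ha rfl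
    refine ⟨a, hab, ?_⟩
    have ha' := left_ne_zero_of_mul ha
    rw [transpose_apply, coproj_apply] at ha'
    by_cases hae : a = e
    · subst hae
      exact response_self_ne_zero hA hx.pos
        ((S.exists_C_ne_zero h.loop h.connected a).imp fun i hi => by simpa [CIn] using hi)
    · rw [if_neg hae, zero_sub, neg_ne_zero] at ha'
      rw [response_comm]
      exact right_ne_zero_of_mul ha'
  obtain ⟨a, ha, hea⟩ := key l e he
  obtain ⟨a', ha', hfa⟩ := key m f hf
  refine hx.trans _ a _ hea (hx.trans _ a' _ ?_ (by rwa [response_comm]))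
  exact FeynmanGraph.response_ne_zero hC hx (S.exists_C_ne_zero h.loop h.connected)
    (ha.trans ha'.symm)

end Sector

/-! ### Lifting a symmetry of the polynomials to the momenta -/

namespace Sector

open EdgeFlow Matrix

variable {K : Type*} [Field K] [CharZero K] {L n : ℕ}
  {V₁ V₂ Ed₁ Ed₂ : Type*} [Fintype Ed₁] [DecidableEq Ed₁] [Fintype Ed₂] [DecidableEq Ed₂]
  {Gm : Matrix (Fin n) (Fin n) K} {S₁ : Sector K V₁ Ed₁ L n} {S₂ : Sector K V₂ Ed₂ L n}

/-- The momentum map `T` realises the signed bijection `(κ, σ)` of the propagators, and it is a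
symmetry. -/
structure IsSymLift (Gm : Matrix (Fin n) (Fin n) K) (S₁ : Sector K V₁ Ed₁ L n)
    (S₂ : Sector K V₂ Ed₂ L n) (κ : Ed₂ → ℤˣ) (σ : Ed₂ ≃ Ed₁) (T : MomentumMap ℚ L n) : Prop
    extends IsLift S₁ S₂ κ σ T where
  det_loop : T.L.det = 1 ∨ T.L.det = -1
  orthogonal : (T.ofRat K).N * Gm * (T.ofRat K).Nᵀ = Gm
  massSq_eq : ∀ i, S₁.massSq (σ i) = S₂.massSq i

theorem coproj_mul_ext_injective {V Ed : Type*} [Fintype Ed] [DecidableEq Ed]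
    {S : Sector K V Ed L n} (h : S.MomentumGrouped Gm) {x : Ed → ℚ}
    {v : Fin n → ℚ} (hv : ((coproj (S.CIn ℚ) x)ᵀ * S.Eᵀ) *ᵥ v = 0) : v = 0 := by
  apply S.eq_zero_of_E_mulVec h.leg_injective
  rw [(S.isCycleBasis h.connected).rat_bdry_eq_zero_iff]
  have h1 : (coproj (S.CIn ℚ) x)ᵀ * replicateCol Unit (S.Eᵀ *ᵥ v) = 0 := by
    ext e j
    rw [← mulVec_mulVec] at hv
    exact congrFun hv e
  obtain ⟨Z, hZ⟩ := exists_eq_of_coproj_mul_eq_zero h1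
  refine ⟨fun i => Z i (), ?_⟩
  ext e
  exact (congrFun (congrFun hZ e) ()).symm

/-- Each edge sign enters the external form and H once each and cancels, so `κ` may be chosen
freely; it is later taken from the comparison of cycle spaces. -/
theorem potential_comp_symm (S₁ : Sector K V₁ Ed₁ L n) (κ : Ed₂ → ℤˣ) (σ : Ed₂ ≃ Ed₁)
    (x : Ed₂ → ℚ) : S₁.potential Gm (x ∘ σ.symm) = ∑ e, S₁.massSq (σ e) * castPt K x e -
      entrySum (((S₁.E * signedPerm κ σ).map (Rat.cast : ℚ → K))ᵀ * Gm *
        (S₁.E * signedPerm κ σ).map (Rat.cast : ℚ → K))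
        ((reduced (S₁.CIn ℚ * signedPerm κ σ) x).map (Rat.cast : ℚ → K)) := by
  have h8 : ∀ e, castPt K (x ∘ σ.symm) (σ e) = castPt K x e := fun e => by simp [castPt]
  rw [potential, ← σ.sum_comp]
  simp only [h8]
  congr 1
  rw [entrySum, entrySum, ← σ.sum_comp]
  refine Finset.sum_congr rfl fun e _ => ?_
  rw [← σ.sum_comp]
  refine Finset.sum_congr rfl fun f _ => ?_
  rw [map_apply, map_apply, reduced_mul_signedPerm]
  have hent : (((S₁.E * signedPerm κ σ).map (Rat.cast : ℚ → K))ᵀ * Gm *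
      (S₁.E * signedPerm κ σ).map (Rat.cast : ℚ → K)) e f =
      (((κ e : ℤ) : ℚ) : K) * (((κ f : ℤ) : ℚ) : K) *
        ((S₁.EIn K)ᵀ * Gm * S₁.EIn K) (σ e) (σ f) := by
    rw [Matrix.mul_apply, Matrix.mul_apply, Finset.mul_sum]
    refine Finset.sum_congr rfl fun l _ => ?_
    rw [Matrix.mul_apply, Matrix.mul_apply, Finset.sum_mul, Finset.sum_mul, Finset.mul_sum]
    refine Finset.sum_congr rfl fun m _ => ?_
    simp only [transpose_apply, map_apply, mul_signedPerm_apply, EIn]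
    push_cast
    ring
  rw [hent]
  have h5 : ((((κ e : ℤ) : ℚ)) : K) * (((κ e : ℤ) : ℚ) : K) = 1 := by
    exact_mod_cast congrArg (Rat.cast : ℚ → K) (units_cast_mul_self (κ e))
  have h6 : ((((κ f : ℤ) : ℚ)) : K) * (((κ f : ℤ) : ℚ) : K) = 1 := by
    exact_mod_cast congrArg (Rat.cast : ℚ → K) (units_cast_mul_self (κ f))
  push_cast at h5 h6 ⊢
  set a := ((S₁.EIn K)ᵀ * Gm * S₁.EIn K) (σ e) (σ f)
  set b : K := ((reduced (S₁.CIn ℚ) (x ∘ σ.symm) (σ e) (σ f) : ℚ) : K)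
  linear_combination (-a * b * ((κ f : ℤ) : K) * ((κ f : ℤ) : K)) * h5 - a * b * h6

/-- A symmetry of the Lee–Pomeransky polynomials lifts to a symmetry of the loop integrals. -/
theorem exists_isSymLift [Fintype V₁] [Fintype V₂] (hGm : Gm.IsSymm) (hdet : Gm.det ≠ 0)
    (h₁ : S₁.MomentumGrouped Gm) (h₂ : S₂.MomentumGrouped Gm) {σ : Ed₂ ≃ Ed₁}
    (hσ : σ ∈ permSet (S₁.leePomeransky Gm) (S₂.leePomeransky Gm)) :
    ∃ κ T, IsSymLift Gm S₁ S₂ κ σ T := by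
  have hC₁ := S₁.isCycleBasis h₁.connected
  have hC₂ := S₂.isCycleBasis h₂.connected
  have hi₁ : ∀ v, (S₁.CIn ℚ)ᵀ *ᵥ v = 0 → v = 0 := hC₁.rat_injective
  have hi₂ : ∀ v, (S₂.CIn ℚ)ᵀ *ᵥ v = 0 → v = 0 := hC₂.rat_injective
  have hi₁σ : ∀ (κ : Ed₂ → ℤˣ) (v : Fin L → ℚ), (S₁.CIn ℚ * signedPerm κ σ)ᵀ *ᵥ v = 0 → v = 0 := by
    intro κ v hv
    apply hi₁
    have h3 := congrArg (signedPerm κ σ *ᵥ ·) hv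
    simpa [mulVec_mulVec, transpose_mul, ← Matrix.mul_assoc, signedPerm_mul_transpose_self]
      using h3
  have hnz : ∀ e, ∃ i, S₂.CIn ℚ i e ≠ 0 := fun e =>
    (S₂.exists_C_ne_zero h₂.loop h₂.connected e).imp fun i hi => by simpa [CIn] using hi
  have heq := fun (x : Ed₂ → ℚ) hx =>
    det_eq_and_potential_eq (x := x) h₁.connected h₂.connected hσ hx
  obtain ⟨κ, T, hT⟩ := exists_signs (C₁ := S₁.CIn ℚ * signedPerm (fun _ => 1) σ) (hi₁σ _) hi₂
    (fun x hx => by rw [weighted_mul_signedPerm]; exact (heq x hx).1) hnz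
  set P := signedPerm κ σ with hP
  have hloop : (S₁.CIn ℚ)ᵀ * T = P * (S₂.CIn ℚ)ᵀ := by
    ext e i
    obtain ⟨e, rfl⟩ := σ.surjective e
    rw [hP, signedPerm_mul_apply, transpose_apply, ← hT, transpose_mul, Matrix.mul_assoc,
      signedPerm_transpose_mul_apply]
    simp
  set C₁' := S₁.CIn ℚ * P with hC₁'
  have hT' : C₁'ᵀ * T = (S₂.CIn ℚ)ᵀ := by
    rw [hC₁', transpose_mul, Matrix.mul_assoc, hloop, ← Matrix.mul_assoc,
      signedPerm_transpose_mul_self, Matrix.one_mul]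
  -- The two values of 𝒰 agree at x = 1 and differ by the factor (det T)².
  have hdetT : T.det = 1 ∨ T.det = -1 := by
    have h3 := weighted_eq_of_mul_eq hT' fun _ => 1
    have h4 := (heq (fun _ => 1) fun _ => one_pos).1
    rw [← weighted_mul_signedPerm κ] at h4
    have h5 := (isUnit_det_weighted_of_pos hi₂ (x := fun _ => 1) fun _ => one_pos).ne_zero
    have h6 := congrArg det h3
    rw [det_mul, det_mul, det_transpose, h4] at h6
    apply mul_self_eq_one_iff.1
    apply mul_right_cancel₀ h5
    linear_combination -h6
  have hTu : IsUnit T.det := by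
    rcases hdetT with h | h <;> rw [h] <;> simp
  have hresp : ∀ x, response (S₂.CIn ℚ) x = response C₁' x := fun x =>
    response_eq_of_mul_eq hTu hT'
  have hred : ∀ x, reduced (S₂.CIn ℚ) x = reduced C₁' x := fun x => by
    rw [reduced, reduced, hresp]
  have hcop : ∀ x, coproj (S₂.CIn ℚ) x = coproj C₁' x := fun x => by
    rw [coproj, coproj, hresp]
  let F₁ : Matrix (Fin n) Ed₂ ℚ := S₁.E * P
  let D : Matrix Ed₂ Ed₂ K := (F₁.map (Rat.cast : ℚ → K))ᵀ * Gm * F₁.map (Rat.cast : ℚ → K) -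
    (S₂.EIn K)ᵀ * Gm * S₂.EIn K
  have hsym : ∀ A : Matrix (Fin n) Ed₂ K, (Aᵀ * Gm * A).IsSymm := fun A => by
    rw [Matrix.IsSymm, transpose_mul, transpose_mul, transpose_transpose, hGm.eq, Matrix.mul_assoc]
  -- Both sectors now share the same H, so the difference of ℱ/𝒰 is, up to sign, a linear form in x
  -- plus the pairing of `D` with H.
  have hform := form_vanishing (K := K) hi₂ hnz (fun e => S₂.massSq e - S₁.massSq (σ e)) D
    ((hsym _).sub (hsym _)) (by
      intro x hx
      have hA := isUnit_det_weighted_of_pos hi₂ hx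
      have h3 := (heq x hx).2
      rw [reduced_castPt hA]
      have h4 := S₁.potential_comp_symm (Gm := Gm) κ σ x
      have h7 : ∀ A B R : Matrix Ed₂ Ed₂ K, entrySum (A - B) R = entrySum A R - entrySum B R := by
        intro A B R
        simp only [entrySum, Matrix.sub_apply, sub_mul, Finset.sum_sub_distrib]
      rw [h4, ← hP, ← hC₁', ← hred, potential] at h3
      rw [h7]
      simp only [sub_mul, Finset.sum_sub_distrib]
      linear_combination -h3)
  obtain ⟨hmass, hvan⟩ := hform
  obtain ⟨x, hx⟩ := exists_isGeneric (S₂.CIn ℚ) hi₂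
  let W := coproj (S₂.CIn ℚ) x
  let y : Ed₁ → ℚ := x ∘ σ.symm
  have hκ0 : ∀ e, ((κ e : ℤ) : ℚ) ≠ 0 := fun e => by
    simp
  have hy : IsGeneric (S₁.CIn ℚ) y := by
    have key : ∀ e f, response (S₁.CIn ℚ) y (σ e) (σ f) ≠ 0 ↔ response (S₂.CIn ℚ) x e f ≠ 0 := by
      intro e f
      rw [hresp, hC₁', response_mul_signedPerm]
      simp [y]
    refine ⟨fun e => hx.pos _, fun e f g => ?_⟩
    obtain ⟨e, rfl⟩ := σ.surjective e
    obtain ⟨f, rfl⟩ := σ.surjective f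
    obtain ⟨g, rfl⟩ := σ.surjective g
    rw [key, key, key]
    exact hx.trans e f g
  -- The external flows modulo cycles: the kernel of Wᵀ is the cycle space. Those of the first
  -- sector are transported by P.
  let A₂ : Matrix Ed₂ (Fin n) ℚ := Wᵀ * S₂.Eᵀ
  let A₁ : Matrix Ed₂ (Fin n) ℚ := Wᵀ * (Pᵀ * S₁.Eᵀ)
  have hA₁ : A₁ = Pᵀ * ((coproj (S₁.CIn ℚ) y)ᵀ * S₁.Eᵀ) := by
    have h3 : Wᵀ * Pᵀ = Pᵀ * (coproj (S₁.CIn ℚ) y)ᵀ := by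
      rw [← transpose_mul, ← transpose_mul]
      congr 1
      ext e f
      obtain ⟨e, rfl⟩ := σ.surjective e
      rw [hP, signedPerm_mul_apply, mul_signedPerm_apply]
      change _ * (coproj (S₂.CIn ℚ) x) e f = _
      rw [hcop, hC₁', coproj_mul_signedPerm]
      linear_combination (((κ f : ℤ) : ℚ) * coproj (S₁.CIn ℚ) y (σ e) (σ f)) *
        units_cast_mul_self (κ e)
    change Wᵀ * (Pᵀ * S₁.Eᵀ) = _
    rw [← Matrix.mul_assoc, h3, Matrix.mul_assoc]
  have hsupp₂ : ∀ e f l m, A₂ e l ≠ 0 → A₂ f m ≠ 0 → response (S₂.CIn ℚ) x e f ≠ 0 :=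
    fun e f l m he hf => response_ne_zero_of_ext h₂ hx he hf
  have hsupp₁ : ∀ e f l m, A₁ e l ≠ 0 → A₁ f m ≠ 0 → response (S₂.CIn ℚ) x e f ≠ 0 := by
    intro e f l m he hf
    rw [hA₁, signedPerm_transpose_mul_apply] at he hf
    have := response_ne_zero_of_ext h₁ hy (right_ne_zero_of_mul he) (right_ne_zero_of_mul hf)
    rw [hresp, hC₁', response_mul_signedPerm]
    exact mul_ne_zero (mul_ne_zero (hκ0 _) (hκ0 _)) this
  have hgram0 : ∀ (A : Matrix Ed₂ (Fin n) ℚ) (e f : Ed₂),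
      (∀ l m, A e l ≠ 0 → A f m ≠ 0 → False) →
      (A.map (Rat.cast : ℚ → K) * Gm * (A.map (Rat.cast : ℚ → K))ᵀ) e f = 0 := by
    intro A e f h
    simp only [Matrix.mul_apply, Finset.sum_mul]
    refine Finset.sum_eq_zero fun m _ => Finset.sum_eq_zero fun l _ => ?_
    by_contra h3
    refine h l m (fun h0 => h3 ?_) fun h0 => h3 ?_
    · simp [h0]
    · simp [h0]
  have hmap : ∀ {a b c : Type _} [Fintype b] (M : Matrix a b ℚ) (N : Matrix b c ℚ),
      (M * N).map (Rat.cast : ℚ → K) = M.map (Rat.cast : ℚ → K) * N.map (Rat.cast : ℚ → K) :=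
    fun M N => Matrix.map_mul (f := Rat.castHom K)
  -- Between different classes both sides vanish because all reduced flows live in one class; for
  -- related edges `hvan` applies.
  have hgram : A₂.map (Rat.cast : ℚ → K) * Gm * (A₂.map (Rat.cast : ℚ → K))ᵀ =
      A₁.map (Rat.cast : ℚ → K) * Gm * (A₁.map (Rat.cast : ℚ → K))ᵀ := by
    ext e f
    by_cases hef : response (S₂.CIn ℚ) x e f = 0
    · rw [hgram0 A₂ e f fun l m hl hm => hsupp₂ e f l m hl hm hef,
        hgram0 A₁ e f fun l m hl hm => hsupp₁ e f l m hl hm hef]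
    · have h3 := hvan x hx.pos e f hef
      have h4 : A₂.map (Rat.cast : ℚ → K) = (W.map (Rat.cast : ℚ → K))ᵀ * (S₂.EIn K)ᵀ := hmap _ _
      have h5 : A₁.map (Rat.cast : ℚ → K) = (W.map (Rat.cast : ℚ → K))ᵀ *
          (F₁.map (Rat.cast : ℚ → K))ᵀ := by
        have : A₁ = Wᵀ * F₁ᵀ := by simp only [A₁, F₁, transpose_mul]
        rw [this]
        exact hmap _ _
      rw [h4, h5]
      change ((W.map (Rat.cast : ℚ → K))ᵀ * D * W.map (Rat.cast : ℚ → K)) e f = 0 at h3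
      simp only [D, Matrix.mul_sub, Matrix.sub_mul, Matrix.sub_apply, sub_eq_zero] at h3
      simp only [transpose_mul, transpose_transpose, Matrix.mul_assoc] at h3 ⊢
      exact h3.symm
  obtain ⟨N, hN, hNG⟩ := exists_orthogonal
    (fun v hv => by
      rw [hA₁] at hv
      have h3 := congrArg (P *ᵥ ·) hv
      simp only [mulVec_mulVec, ← Matrix.mul_assoc, mulVec_zero] at h3
      rw [hP, signedPerm_mul_transpose_self, Matrix.one_mul] at h3
      exact coproj_mul_ext_injective h₁ h3)
    (fun v hv => coproj_mul_ext_injective h₂ hv) hdet hgram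
  -- The external flows now agree modulo cycles; the remaining cycle combination `Z` supplies the
  -- loop shift.
  obtain ⟨Z, hZ⟩ := exists_eq_of_coproj_mul_eq_zero (C := S₂.CIn ℚ) (x := x)
    (M := S₂.Eᵀ - Pᵀ * S₁.Eᵀ * N) (by
      rw [Matrix.mul_sub, sub_eq_zero, ← Matrix.mul_assoc]
      exact hN)
  refine ⟨κ, ⟨T, T * Z, N⟩, ⟨⟨hloop, ?_⟩, hdetT, hNG, fun i => ?_⟩⟩
  · change (S₁.CIn ℚ)ᵀ * (T * Z) + S₁.Eᵀ * N = P * S₂.Eᵀ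
    rw [← Matrix.mul_assoc, hloop, Matrix.mul_assoc, ← hZ, Matrix.mul_sub, ← Matrix.mul_assoc,
      ← Matrix.mul_assoc P, signedPerm_mul_transpose_self, Matrix.one_mul, sub_add_cancel]
  · exact (sub_eq_zero.1 (congrFun hmass i)).symm

end Sector

/-! ### Momenta are determined by their squares up to sign -/

open Matrix

section momentumSq

variable {K : Type*} [Field K] [CharZero K] {L n : ℕ} {Gm : Matrix (Fin n) (Fin n) K}

/-- The substitution k_i·k_j ↦ u_i u_j, k_i·p_l ↦ u_i w_l is allowed because these scalar products
are independent variables; the constants p_l·p_m are untouched. -/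
theorem eval_momentumSq (a : Fin L → K) (b : Fin n → K) (u : Fin L → K) (w : Fin n → K) :
    MvPolynomial.eval (Sum.elim (Sym2.lift ⟨fun i j => u i * u j, fun _ _ => mul_comm _ _⟩)
      fun il => u il.1 * w il.2) (momentumSq Gm a b) =
      (a ⬝ᵥ u) ^ 2 + 2 * ((a ⬝ᵥ u) * (b ⬝ᵥ w)) + ∑ l, ∑ m, b l * b m * Gm l m := by
  simp only [momentumSq, map_add, map_mul, map_sum, MvPolynomial.eval_C, MvPolynomial.eval_X,
    Sum.elim_inl, Sum.elim_inr, Sym2.lift_mk, map_ofNat, dotProduct, sq, Finset.sum_mul_sum]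
  congr 2
  · exact Finset.sum_congr rfl fun i _ => Finset.sum_congr rfl fun j _ => by ring
  · congr 1
    exact Finset.sum_congr rfl fun i _ => Finset.sum_congr rfl fun j _ => by ring

theorem momentumSq_smul_unit (ε : ℤˣ) (a : Fin L → K) (b : Fin n → K) :
    momentumSq Gm (fun i => ((ε : ℤ) : K) * a i) (fun l => ((ε : ℤ) : K) * b l) =
      momentumSq Gm a b := by
  rcases Int.units_eq_one_or ε with rfl | rfl <;> simp [momentumSq]

/-- The square of a momentum depending on the loop momenta determines it up to sign. -/
theorem exists_unit_of_momentumSq_eq {a a' : Fin L → K} {b b' : Fin n → K}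
    (h : momentumSq Gm a b = momentumSq Gm a' b') (ha' : a' ≠ 0) :
    ∃ ε : ℤˣ, (∀ i, a i = ((ε : ℤ) : K) * a' i) ∧ ∀ l, b l = ((ε : ℤ) : K) * b' l := by
  have key := fun u w => (eval_momentumSq (Gm := Gm) a b u w).symm.trans
    ((congrArg _ h).trans (eval_momentumSq a' b' u w))
  -- Setting u = 0 isolates the constant term; afterwards w = 0 gives the quadratic form and a
  -- general w the mixed term.
  have h0 := key 0 0
  simp only [dotProduct_zero, zero_pow two_ne_zero, mul_zero, zero_add] at h0
  have h1 : ∀ u, (a ⬝ᵥ u) ^ 2 = (a' ⬝ᵥ u) ^ 2 := fun u => by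
    have := key u 0
    rw [h0] at this
    simpa using this
  have h2 : ∀ u w, (a ⬝ᵥ u) * (b ⬝ᵥ w) = (a' ⬝ᵥ u) * (b' ⬝ᵥ w) := fun u w => by
    have := key u w
    rw [h0, h1] at this
    apply mul_left_cancel₀ (two_ne_zero (α := K))
    linear_combination this
  obtain ⟨i₀, hi₀⟩ := Function.ne_iff.1 ha'
  have h3 : ∀ i j, a i * a j = a' i * a' j := fun i j => by
    have e1 := h1 (Pi.single i 1 + Pi.single j 1)
    have e2 := h1 (Pi.single i 1)
    have e3 := h1 (Pi.single j 1)
    simp only [dotProduct_add, dotProduct_single, mul_one] at e1 e2 e3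
    apply mul_left_cancel₀ (two_ne_zero (α := K))
    linear_combination e1 - e2 - e3
  have h4 : ∀ i l, a i * b l = a' i * b' l := fun i l => by
    simpa using h2 (Pi.single i 1) (Pi.single l 1)
  -- One nonzero loop coefficient fixes the sign of all the others, including the external ones.
  have aux : ∀ ε : ℤˣ, a i₀ = ((ε : ℤ) : K) * a' i₀ →
      (∀ i, a i = ((ε : ℤ) : K) * a' i) ∧ ∀ l, b l = ((ε : ℤ) : K) * b' l := by
    intro ε hε
    have hε2 : ((ε : ℤ) : K) * ((ε : ℤ) : K) = 1 := by
      rcases Int.units_eq_one_or ε with rfl | rfl <;> simp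
    refine ⟨fun i => mul_left_cancel₀ hi₀ ?_, fun l => mul_left_cancel₀ hi₀ ?_⟩
    · linear_combination ((ε : ℤ) : K) * h3 i₀ i - ((ε : ℤ) : K) * a i * hε - a i * a' i₀ * hε2
    · linear_combination ((ε : ℤ) : K) * h4 i₀ l - ((ε : ℤ) : K) * b l * hε - b l * a' i₀ * hε2
  rcases mul_self_eq_mul_self_iff.1 (h3 i₀ i₀) with h | h
  · exact ⟨1, aux 1 (by simpa using h)⟩
  · exact ⟨-1, aux (-1) (by simpa using h)⟩

end momentumSq

/-! ### Symmetries as signed bijections of the propagators -/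

namespace Sector

open EdgeFlow

variable {K : Type*} [Field K] [CharZero K] {L n : ℕ}
  {V V₁ V₂ V₃ Ed Ed₁ Ed₂ Ed₃ : Type*} [Fintype Ed] [DecidableEq Ed] [Fintype Ed₁]
  [DecidableEq Ed₁] [Fintype Ed₂] [DecidableEq Ed₂] [Fintype Ed₃] [DecidableEq Ed₃]
  {Gm : Matrix (Fin n) (Fin n) K} {S : Sector K V Ed L n} {S₁ : Sector K V₁ Ed₁ L n}
  {S₂ : Sector K V₂ Ed₂ L n} {S₃ : Sector K V₃ Ed₃ L n}

/-- The matrix of the edge momentum parametrization. -/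
def flows (S : Sector K V Ed L n) : Matrix Ed (Fin L ⊕ Fin n) ℚ := fromCols (S.CIn ℚ)ᵀ S.Eᵀ

omit [DecidableEq Ed] [CharZero K] in
theorem flows_injective (hc : S.graph.Connected) (hleg : Function.Injective S.graph.leg)
    {v : Fin L ⊕ Fin n → ℚ} (hv : S.flows *ᵥ v = 0) : v = 0 := by
  rw [flows, fromCols_mulVec] at hv
  have hC := S.isCycleBasis hc
  have h1 : (v ∘ Sum.inr) = 0 := by
    apply S.eq_zero_of_E_mulVec hleg
    rw [hC.rat_bdry_eq_zero_iff]
    refine ⟨-(v ∘ Sum.inl), ?_⟩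
    rw [mulVec_neg]
    exact (eq_neg_of_add_eq_zero_right hv).symm
  rw [h1, mulVec_zero, add_zero] at hv
  have h2 := hC.rat_injective _ hv
  ext (i | l)
  · exact congrFun h2 i
  · exact congrFun h1 l

omit [DecidableEq Ed] in
theorem flows_map (S : Sector K V Ed L n) :
    S.flows.map (Rat.cast : ℚ → K) = fromCols (S.CIn K)ᵀ (S.EIn K)ᵀ := by
  ext e (i | l)
  · simp [flows, CIn]
  · rfl

theorem exists_flows_left_inverse (hc : S.graph.Connected)
    (hleg : Function.Injective S.graph.leg) :
    ∃ B : Matrix (Fin L ⊕ Fin n) Ed ℚ, B * S.flows = 1 :=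
  exists_left_inverse fun _ => S.flows_injective hc hleg

theorem isLift_iff {κ : Ed₂ → ℤˣ} {σ : Ed₂ ≃ Ed₁} {T : MomentumMap ℚ L n} :
    IsLift S₁ S₂ κ σ T ↔ S₁.flows * T.toMatrix = signedPerm κ σ * S₂.flows := by
  rw [flows, flows, MomentumMap.toMatrix, fromCols_mul_fromBlocks, mul_fromCols, fromCols_inj.eq_iff,
    Matrix.mul_zero, add_zero]
  exact ⟨fun h => ⟨h.loop, h.ext⟩, fun h => ⟨h.1, h.2⟩⟩

theorem units_cast_eq (u : ℤˣ) : (((u : ℤ) : ℚ) : K) = ((u : ℤ) : K) := by simp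

theorem ofRat_toMatrix (T : MomentumMap ℚ L n) :
    (T.ofRat K).toMatrix = T.toMatrix.map (Rat.cast : ℚ → K) := by
  rw [MomentumMap.toMatrix, MomentumMap.toMatrix, fromBlocks_map]
  simp [MomentumMap.ofRat]

theorem map_mul_ratCast {a b c : Type*} [Fintype b] (M : Matrix a b ℚ) (N : Matrix b c ℚ) :
    (M * N).map (Rat.cast : ℚ → K) = M.map (Rat.cast : ℚ → K) * N.map (Rat.cast : ℚ → K) :=
  Matrix.map_mul (f := Rat.castHom K)

theorem IsLift.map_loop {κ : Ed₂ → ℤˣ} {σ : Ed₂ ≃ Ed₁} {T : MomentumMap ℚ L n}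
    (h : IsLift S₁ S₂ κ σ T) (e : Ed₂) (i : Fin L) :
    ((S₁.CIn K)ᵀ * (T.ofRat K).L) (σ e) i = ((κ e : ℤ) : K) * (S₂.CIn K)ᵀ e i := by
  have h1 := congrArg (Rat.cast : ℚ → K) (congrFun (congrFun h.loop (σ e)) i)
  rw [signedPerm_mul_apply, Rat.cast_mul, units_cast_eq, ← map_apply (f := (Rat.cast : ℚ → K)),
    map_mul_ratCast] at h1
  rw [CIn_eq_map, CIn_eq_map]
  exact h1

theorem IsLift.map_ext {κ : Ed₂ → ℤˣ} {σ : Ed₂ ≃ Ed₁} {T : MomentumMap ℚ L n}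
    (h : IsLift S₁ S₂ κ σ T) (e : Ed₂) (l : Fin n) :
    ((S₁.CIn K)ᵀ * (T.ofRat K).M + (S₁.EIn K)ᵀ * (T.ofRat K).N) (σ e) l =
      ((κ e : ℤ) : K) * (S₂.EIn K)ᵀ e l := by
  have h1 := congrArg (Rat.cast : ℚ → K) (congrFun (congrFun h.ext (σ e)) l)
  rw [signedPerm_mul_apply, Rat.cast_mul, units_cast_eq, Matrix.add_apply, Rat.cast_add,
    ← map_apply (f := (Rat.cast : ℚ → K)), ← map_apply (f := (Rat.cast : ℚ → K)),
    map_mul_ratCast, map_mul_ratCast] at h1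
  rw [CIn_eq_map]
  exact h1

theorem IsSymLift.induces {κ : Ed₂ → ℤˣ} {σ : Ed₂ ≃ Ed₁} {T : MomentumMap ℚ L n}
    (h : IsSymLift Gm S₁ S₂ κ σ T) : Induces Gm S₁ S₂ (T.ofRat K) σ := by
  intro e
  refine ⟨?_, h.massSq_eq e⟩
  rw [edgeSqComp, edgeSq, ← momentumSq_smul_unit (κ e) ((S₂.CIn K)ᵀ e)]
  congr 1
  · exact funext fun i => h.map_loop e i
  · exact funext fun l => h.map_ext e l

theorem IsSymLift.mem_sym {κ : Ed₂ → ℤˣ} {σ : Ed₂ ≃ Ed₁} {T : MomentumMap ℚ L n}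
    (h : IsSymLift Gm S₁ S₂ κ σ T) : T.ofRat K ∈ Sym Gm S₁ S₂ := by
  refine ⟨?_, ⟨σ, h.induces⟩, h.orthogonal⟩
  have h1 : (T.ofRat K).L.det = ((T.L.det : ℚ) : K) := ((Rat.castHom K).map_det T.L).symm
  rw [h1]
  exact h.det_loop.imp (fun h => by simp [h]) fun h => by simp [h]

/-- Every symmetry realises a signed bijection of the propagators. -/
theorem exists_isSymLift_of_induces (h₁ : S₁.MomentumGrouped Gm) (h₂ : S₂.MomentumGrouped Gm)
    {T : MomentumMap K L n} (hT : T ∈ Sym Gm S₁ S₂) {α : Ed₂ ≃ Ed₁}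
    (hα : Induces Gm S₁ S₂ T α) :
    ∃ κ T', IsSymLift Gm S₁ S₂ κ α T' ∧ T = T'.ofRat K := by
  have hne : ∀ e, (S₂.CIn K)ᵀ e ≠ 0 := fun e h0 => by
    obtain ⟨i, hi⟩ := S₂.exists_C_ne_zero h₂.loop h₂.connected e
    exact hi (by simpa [CIn] using congrFun h0 i)
  choose κ hκL hκE using fun e => exists_unit_of_momentumSq_eq (hα e).1 (hne e)
  obtain ⟨B, hB⟩ := S₁.exists_flows_left_inverse h₁.connected h₁.leg_injective
  have hQ : S₁.flows.map (Rat.cast : ℚ → K) * T.toMatrix =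
      (signedPerm κ α * S₂.flows).map (Rat.cast : ℚ → K) := by
    ext e j
    obtain ⟨e, rfl⟩ := α.surjective e
    rw [map_apply, signedPerm_mul_apply, Rat.cast_mul, units_cast_eq,
      ← map_apply (M := S₂.flows) (f := (Rat.cast : ℚ → K)), flows_map, flows_map, MomentumMap.toMatrix,
      fromCols_mul_fromBlocks, Matrix.mul_zero, add_zero]
    rcases j with i | l
    · exact hκL e i
    · exact hκE e l
  -- A rational left inverse of the flow matrix shows that the symmetry, a priori over K, has
  -- rational entries.
  let R := B * (signedPerm κ α * S₂.flows)
  have hTR : T.toMatrix = R.map (Rat.cast : ℚ → K) := by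
    rw [map_mul_ratCast, ← hQ, ← Matrix.mul_assoc, ← map_mul_ratCast, hB]
    simp
  have hinj : Function.Injective (Rat.cast : ℚ → K) := Rat.cast_injective
  let T' : MomentumMap ℚ L n := ⟨R.toBlocks₁₁, R.toBlocks₁₂, R.toBlocks₂₂⟩
  have hTT' : T = T'.ofRat K := by
    ext i j
    · exact congrFun (congrFun hTR (Sum.inl i)) (Sum.inl j)
    · exact congrFun (congrFun hTR (Sum.inl i)) (Sum.inr j)
    · exact congrFun (congrFun hTR (Sum.inr i)) (Sum.inr j)
  refine ⟨κ, T', ⟨?_, ?_, ?_, fun i => (hα i).2⟩, hTT'⟩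
  · rw [isLift_iff]
    apply Matrix.map_injective hinj
    refine Eq.trans ?_ hQ
    rw [hTT', ofRat_toMatrix]
    exact map_mul_ratCast _ _
  · have h1 : T.L.det = ((T'.L.det : ℚ) : K) := by
      rw [hTT']
      exact ((Rat.castHom K).map_det T'.L).symm
    have h2 := hT.1
    rw [h1] at h2
    exact h2.imp (fun h => hinj (by simpa using h)) fun h => hinj (by simpa using h)
  · rw [← hTT']
    exact hT.2.2

/-- Both bijections assign to an edge the same propagator after the change of variables, and the
propagators of the second sector are pairwise distinct. -/
theorem Induces.unique (h₂ : S₂.MomentumGrouped Gm) {T : MomentumMap K L n} {α β : Ed₂ ≃ Ed₁}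
    (hα : Induces Gm S₁ S₂ T α) (hβ : Induces Gm S₁ S₂ T β) : α = β := by
  ext e
  have h1 : β (β.symm (α e)) = α e := β.apply_symm_apply _
  have h2 := hα e
  have h3 := hβ (β.symm (α e))
  rw [h1] at h3
  have h4 : β.symm (α e) = e := h₂.propagator_injective (by
    rw [propagator, propagator, ← h3.1, ← h3.2, ← h2.1, ← h2.2])
  rw [← h4, h1, h4]

end Sector

/-! ### Composition, block flips and invariance of the polynomials -/

open Matrix

/-- The composition of linear changes of the momenta. -/
def MomentumMap.comp {K : Type*} [Semiring K] {L n : ℕ} (T T' : MomentumMap K L n) :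
    MomentumMap K L n where
  L := T.L * T'.L
  M := T.L * T'.M + T.M * T'.N
  N := T.N * T'.N

theorem MomentumMap.toMatrix_comp {K : Type*} [Semiring K] {L n : ℕ} (T T' : MomentumMap K L n) :
    (T.comp T').toMatrix = T.toMatrix * T'.toMatrix := by
  simp [MomentumMap.toMatrix, MomentumMap.comp, fromBlocks_multiply]

namespace Sector

open EdgeFlow

variable {K : Type*} [Field K] [CharZero K] {L n : ℕ}
  {V V₁ V₂ V₃ Ed Ed₁ Ed₂ Ed₃ : Type*} [Fintype Ed] [DecidableEq Ed] [Fintype Ed₁]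
  [DecidableEq Ed₁] [Fintype Ed₂] [DecidableEq Ed₂] [Fintype Ed₃] [DecidableEq Ed₃]
  {Gm : Matrix (Fin n) (Fin n) K} {S : Sector K V Ed L n} {S₁ : Sector K V₁ Ed₁ L n}
  {S₂ : Sector K V₂ Ed₂ L n} {S₃ : Sector K V₃ Ed₃ L n}

theorem signedPerm_mul_signedPerm (κ : Ed₂ → ℤˣ) (σ : Ed₂ ≃ Ed₁) (κ' : Ed₃ → ℤˣ)
    (σ' : Ed₃ ≃ Ed₂) : signedPerm κ σ * signedPerm κ' σ' =
      signedPerm (fun e => κ (σ' e) * κ' e) (σ'.trans σ) := by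
  ext i e
  obtain ⟨i, rfl⟩ := σ.surjective i
  rw [signedPerm_mul_apply]
  by_cases h : i = σ' e
  · subst h
    simp [signedPerm]
  · simp [signedPerm, h]

theorem IsSymLift.comp {κ : Ed₂ → ℤˣ} {σ : Ed₂ ≃ Ed₁} {κ' : Ed₃ → ℤˣ} {σ' : Ed₃ ≃ Ed₂}
    {T T' : MomentumMap ℚ L n} (h : IsSymLift Gm S₁ S₂ κ σ T) (h' : IsSymLift Gm S₂ S₃ κ' σ' T') :
    IsSymLift Gm S₁ S₃ (fun e => κ (σ' e) * κ' e) (σ'.trans σ) (T.comp T') where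
  toIsLift := by
    rw [isLift_iff, MomentumMap.toMatrix_comp, ← Matrix.mul_assoc, isLift_iff.1 h.toIsLift,
      Matrix.mul_assoc, isLift_iff.1 h'.toIsLift, ← Matrix.mul_assoc, signedPerm_mul_signedPerm]
  det_loop := by
    have : (T.comp T').L.det = T.L.det * T'.L.det := det_mul _ _
    rw [this]
    rcases h.det_loop with h | h <;> rcases h'.det_loop with h' | h' <;> simp [h, h']
  orthogonal := by
    have h1 : ((T.comp T').ofRat K).N = (T.ofRat K).N * (T'.ofRat K).N := map_mul_ratCast _ _
    rw [h1, transpose_mul]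
    calc _ = (T.ofRat K).N * ((T'.ofRat K).N * Gm * (T'.ofRat K).Nᵀ) * (T.ofRat K).Nᵀ := by
          simp only [Matrix.mul_assoc]
      _ = Gm := by rw [h'.orthogonal, h.orthogonal]
  massSq_eq i := by
    rw [Equiv.trans_apply, h.massSq_eq, h'.massSq_eq]

theorem exists_cycle_matrix (hc : S.graph.Connected) {m : Type*} {A : Matrix Ed m ℚ}
    (hA : ∀ j, S.graph.IsCycle fun e => A e j) : ∃ Z : Matrix (Fin L) m ℚ, A = (S.CIn ℚ)ᵀ * Z := by
  choose z hz using fun j => ((S.isCycleBasis hc).rat_bdry_eq_zero_iff _).1 (hA j)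
  refine ⟨of fun i j => z j i, ?_⟩
  ext e j
  exact (congrFun (hz j) e).symm

theorem isCycle_CIn_mul (hc : S.graph.Connected) {m : Type*} (Z : Matrix (Fin L) m ℚ) (j : m) :
    S.graph.IsCycle fun e => ((S.CIn ℚ)ᵀ * Z) e j :=
  ((S.isCycleBasis hc).rat_bdry_eq_zero_iff _).2 ⟨fun i => Z i j, rfl⟩

/-- Flipping the sign of all momenta in some blocks is a symmetry. -/
theorem exists_isSymLift_block (h : S.MomentumGrouped Gm) (z : S.graph.Block → ℤˣ) :
    ∃ T, IsSymLift Gm S S (fun e => z (S.graph.block e)) (Equiv.refl Ed) T := by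
  have hC := S.isCycleBasis h.connected
  set κ : Ed → ℤˣ := fun e => z (S.graph.block e) with hκ
  set D := signedPerm κ (Equiv.refl Ed) with hD
  have hDapp : ∀ {m : Type} (A : Matrix Ed m ℚ) (e : Ed) (j : m),
      (D * A) e j = ((κ e : ℤ) : ℚ) * A e j := fun A e j => signedPerm_mul_apply κ _ A e j
  have hDD : D * D = 1 := by
    ext e j
    rw [hD, signedPerm_mul_signedPerm]
    by_cases hej : e = j
    · subst hej
      simp [signedPerm]
    · simp [signedPerm, hej]
  obtain ⟨Z, hZ⟩ := S.exists_cycle_matrix h.connected (A := D * (S.CIn ℚ)ᵀ) (by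
    intro i
    have h1 := S.isCycle_CIn_mul h.connected 1 i
    rw [Matrix.mul_one] at h1
    have h2 := h1.block_mul fun b => ((z b : ℤ) : ℚ)
    have h3 : (fun e => (D * (S.CIn ℚ)ᵀ) e i) = fun e =>
      ((z (S.graph.block e) : ℤ) : ℚ) * (S.CIn ℚ)ᵀ e i := funext fun e => hDapp _ e i
    rw [h3]
    exact h2)
  have hZZ : Z * Z = 1 := by
    have h1 : (S.CIn ℚ)ᵀ * (Z * Z - 1) = 0 := by
      rw [Matrix.mul_sub, ← Matrix.mul_assoc, ← hZ, Matrix.mul_assoc, ← hZ, ← Matrix.mul_assoc,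
        hDD, Matrix.one_mul, Matrix.mul_one, sub_self]
    have h2 : Z * Z - 1 = 0 := by
      ext i j
      have h3 := hC.rat_injective (fun i => (Z * Z - 1) i j) (by
        ext e
        exact congrFun (congrFun h1 e) j)
      exact congrFun h3 i
    exact sub_eq_zero.1 h2
  -- The external flows can be moved into the common block `b` by cycles, so a block flip multiplies
  -- them by `z b` modulo cycles. For n = 0 there may be no such block and any sign serves.
  obtain ⟨s, Y, hY⟩ : ∃ (s : ℤˣ) (Y : Matrix (Fin L) (Fin n) ℚ),
      D * S.Eᵀ = (S.CIn ℚ)ᵀ * Y + ((s : ℤ) : ℚ) • S.Eᵀ := by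
    rcases Nat.eq_zero_or_pos n with hn | hn
    · refine ⟨1, 0, ?_⟩
      ext e l
      exact absurd l.2 (by omega)
    · obtain ⟨b, hb⟩ := h.common_block hn
      obtain ⟨Y, hY⟩ := S.exists_cycle_matrix h.connected
        (A := D * S.Eᵀ - ((z b : ℤ) : ℚ) • S.Eᵀ) (by
        intro l
        obtain ⟨φ, hφb, hφ⟩ := FeynmanGraph.exists_flow_in_block hb l
        have hcyc : S.graph.IsCycle (S.E l - φ) := by
          ext v
          rw [map_sub, Pi.sub_apply, S.bdry_E, hφ, sub_self, Pi.zero_apply]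
        have h2 := hcyc.block_mul fun b => ((z b : ℤ) : ℚ)
        have h3 := h2.sub (hcyc.smul ((z b : ℤ) : ℚ))
        convert h3 using 1
        ext e
        rw [Matrix.sub_apply, hDapp]
        simp only [Matrix.smul_apply, transpose_apply, Pi.sub_apply, Pi.smul_apply, smul_eq_mul]
        by_cases he : S.graph.block e = b
        · rw [hκ]
          simp only [he]
          ring
        · rw [hφb e he]
          ring)
      exact ⟨z b, Y, by rw [← hY, sub_add_cancel]⟩
  refine ⟨⟨Z, Y, ((s : ℤ) : ℚ) • 1⟩, ⟨⟨hZ.symm, ?_⟩, ?_, ?_, fun i => rfl⟩⟩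
  · rw [Matrix.mul_smul, Matrix.mul_one]
    exact hY.symm
  · apply mul_self_eq_one_iff.1
    rw [← det_mul, hZZ, det_one]
  · have h1 : ((⟨Z, Y, ((s : ℤ) : ℚ) • 1⟩ : MomentumMap ℚ L n).ofRat K).N =
        ((s : ℤ) : K) • (1 : Matrix (Fin n) (Fin n) K) := by
      ext i j
      simp [MomentumMap.ofRat, Matrix.one_apply, apply_ite (Rat.cast : ℚ → K)]
    rw [h1]
    rcases Int.units_eq_one_or s with rfl | rfl <;> simp

/-- The matrix C₁P is a basis of the second cycle space up to determinant ±1, so 𝒰 is preserved.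
Modulo rows of C₁P, which H annihilates, the second external flow is NᵀE₁P; the orthogonality of N
and cyclicity of the trace then give equality of ℱ/𝒰. -/
theorem IsSymLift.mem_permSet [Fintype V₁] [Fintype V₂] (hGm : Gm.IsSymm)
    (h₁ : S₁.graph.Connected) (h₂ : S₂.graph.Connected) {κ : Ed₂ → ℤˣ} {σ : Ed₂ ≃ Ed₁}
    {T : MomentumMap ℚ L n} (h : IsSymLift Gm S₁ S₂ κ σ T) :
    σ ∈ permSet (S₁.leePomeransky Gm) (S₂.leePomeransky Gm) := by
  have hC₁ := S₁.isCycleBasis h₁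
  have hC₂ := S₂.isCycleBasis h₂
  have hPP := signedPerm_transpose_mul_self κ σ
  set P := signedPerm κ σ with hP
  set C₁' := S₁.CIn ℚ * P with hC₁'
  have hT' : C₁'ᵀ * T.L = (S₂.CIn ℚ)ᵀ := by
    rw [hC₁', transpose_mul, Matrix.mul_assoc, h.loop, ← Matrix.mul_assoc, hPP, Matrix.one_mul]
  have hE : S₂.E = T.Mᵀ * C₁' + T.Nᵀ * (S₁.E * P) := by
    have h1 : S₂.Eᵀ = Pᵀ * ((S₁.CIn ℚ)ᵀ * T.M + S₁.Eᵀ * T.N) := by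
      rw [h.ext, ← Matrix.mul_assoc, hPP, Matrix.one_mul]
    rw [← transpose_transpose S₂.E, h1]
    simp only [hC₁', transpose_mul, transpose_add, transpose_transpose, Matrix.add_mul,
      Matrix.mul_assoc]
  have hTu : IsUnit T.L.det := by
    rcases h.det_loop with h | h <;> rw [h] <;> simp
  have hresp : ∀ x, response (S₂.CIn ℚ) x = response C₁' x := fun x =>
    response_eq_of_mul_eq hTu hT'
  have hdet : ∀ x, (weighted C₁' x).det = (weighted (S₂.CIn ℚ) x).det := fun x => by
    rw [weighted_eq_of_mul_eq hT', det_mul, det_mul, det_transpose]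
    rcases h.det_loop with h | h <;> rw [h] <;> ring
  have htrace : ∀ A R : Matrix Ed₂ Ed₂ K, entrySum A R = (Aᵀ * R).trace := by
    intro A R
    simp only [entrySum, trace, diag_apply, Matrix.mul_apply, transpose_apply]
    exact Finset.sum_comm
  have hpot : ∀ x, (∀ e, 0 < x e) → S₁.potential Gm (x ∘ σ.symm) = S₂.potential Gm x := by
    intro x hx
    have hA : IsUnit (weighted C₁' x).det := by
      rw [hdet]
      exact isUnit_det_weighted_of_pos hC₂.rat_injective hx
    rw [S₁.potential_comp_symm (Gm := Gm) κ σ x, potential, ← hP, ← hC₁']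
    have hH : reduced (S₂.CIn ℚ) x = reduced C₁' x := by rw [reduced, reduced, hresp]
    rw [hH]
    congr 1
    · simp only [h.massSq_eq]
    set R := (reduced C₁' x).map (Rat.cast : ℚ → K) with hR
    set F := (S₁.E * P).map (Rat.cast : ℚ → K) with hF
    set C := C₁'.map (Rat.cast : ℚ → K) with hC
    have hCR : C * R = 0 := by
      rw [hC, hR, ← map_mul_ratCast]
      have : C₁' * reduced C₁' x = 0 := by
        have h3 : C₁' * diagonal x * response C₁' x = C₁' := by
          have := congrArg transpose (response_mul_transpose hA)
          simpa [transpose_mul, response_transpose, Matrix.mul_assoc] using this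
        rw [reduced, Matrix.mul_sub, ← Matrix.mul_assoc, ← Matrix.mul_assoc, h3, sub_self]
      rw [this]
      simp
    have hRt : Rᵀ = R := by
      ext e f
      rw [transpose_apply, hR, map_apply, map_apply, reduced_apply, reduced_apply,
        response_comm]
      by_cases hef : e = f
      · rw [hef]
      · rw [if_neg hef, if_neg (Ne.symm hef)]
        congr 1
        ring
    have hRC : R * Cᵀ = 0 := by
      rw [← hRt, ← transpose_mul, hCR, transpose_zero]
    set N := (T.ofRat K).N with hN
    have hEK : S₂.EIn K = (T.ofRat K).Mᵀ * C + Nᵀ * F := by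
      rw [EIn, hE, hF, hC, Matrix.map_add _ (fun a b => Rat.cast_add a b),
        map_mul_ratCast T.Mᵀ, map_mul_ratCast T.Nᵀ]
      rfl
    rw [htrace, htrace]
    have hs : ∀ A : Matrix (Fin n) Ed₂ K, (Aᵀ * Gm * A)ᵀ = Aᵀ * Gm * A := fun A => by
      rw [transpose_mul, transpose_mul, transpose_transpose, hGm.eq, Matrix.mul_assoc]
    rw [hs, hs]
    have h4 : S₂.EIn K * R = Nᵀ * (F * R) := by
      rw [hEK, Matrix.add_mul, Matrix.mul_assoc, hCR, Matrix.mul_zero, zero_add, Matrix.mul_assoc]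
    have h5 : F * R * (S₂.EIn K)ᵀ = F * R * Fᵀ * N := by
      rw [hEK, transpose_add, Matrix.mul_add, transpose_mul, transpose_mul, Matrix.mul_assoc F R,
        ← Matrix.mul_assoc R, hRC, Matrix.zero_mul, Matrix.mul_zero, zero_add,
        transpose_transpose, ← Matrix.mul_assoc]
    calc (Fᵀ * Gm * F * R).trace = (Fᵀ * (Gm * (F * R))).trace := by simp only [Matrix.mul_assoc]
      _ = (Gm * (F * R) * Fᵀ).trace := trace_mul_comm _ _
      _ = (N * Gm * Nᵀ * (F * R * Fᵀ)).trace := by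
        rw [hN, h.orthogonal]; simp only [Matrix.mul_assoc]
      _ = (N * (Gm * Nᵀ * (F * R * Fᵀ))).trace := by simp only [Matrix.mul_assoc]
      _ = (Gm * Nᵀ * (F * R * Fᵀ) * N).trace := trace_mul_comm _ _
      _ = (Gm * Nᵀ * (F * R * (S₂.EIn K)ᵀ)).trace := by rw [h5]; simp only [Matrix.mul_assoc]
      _ = (Gm * (S₂.EIn K * R) * (S₂.EIn K)ᵀ).trace := by rw [h4]; simp only [Matrix.mul_assoc]
      _ = ((S₂.EIn K)ᵀ * (Gm * (S₂.EIn K * R))).trace := (trace_mul_comm _ _).symm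
      _ = ((S₂.EIn K)ᵀ * Gm * S₂.EIn K * R).trace := by simp only [Matrix.mul_assoc]
  change MvPolynomial.rename σ.symm (S₁.leePomeransky Gm) = S₂.leePomeransky Gm
  -- In characteristic 0 the positive rationals are infinitely many points of K, which suffices to
  -- compare polynomials.
  refine MvPolynomial.funext_set (fun _ => (Rat.cast : ℚ → K) '' Set.Ioi 0)
    (fun _ => (Set.Ioi_infinite 0).image Rat.cast_injective.injOn) fun x hx => ?_
  choose q hq hqx using fun e => hx e (Set.mem_univ e)
  have hx' : x = castPt K q := funext fun e => (hqx e).symm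
  rw [MvPolynomial.eval_rename, hx', show castPt K q ∘ σ.symm = castPt K (q ∘ σ.symm) from rfl,
    S₁.eval_leePomeransky Gm h₁ (x := q ∘ σ.symm) fun e => hq _, S₂.eval_leePomeransky Gm h₂ hq, hpot q hq,
    ← hdet, hC₁', weighted_mul_signedPerm]

end Sector

/-! ### Parametrization of the symmetries -/

open Matrix

namespace Sector

open EdgeFlow

variable {K : Type*} [Field K] [CharZero K] {L n : ℕ}
  {V₁ V₂ Ed₁ Ed₂ : Type*} [Fintype Ed₁] [DecidableEq Ed₁] [Fintype Ed₂] [DecidableEq Ed₂]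
  {Gm : Matrix (Fin n) (Fin n) K} {S₁ : Sector K V₁ Ed₁ L n} {S₂ : Sector K V₂ Ed₂ L n}

theorem IsSymLift.twist (h₁ : S₁.MomentumGrouped Gm) {κ : Ed₂ → ℤˣ} {σ : Ed₂ ≃ Ed₁}
    {T : MomentumMap ℚ L n} (h : IsSymLift Gm S₁ S₂ κ σ T) (z : S₁.graph.Block → ℤˣ) :
    ∃ T', IsSymLift Gm S₁ S₂ (fun e => z (S₁.graph.block (σ e)) * κ e) σ T' := by
  obtain ⟨T', hT'⟩ := exists_isSymLift_block h₁ z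
  exact ⟨_, hT'.comp h⟩

theorem IsSymLift.eq_lift (h₁ : S₁.MomentumGrouped Gm) {κ : Ed₂ → ℤˣ} {σ : Ed₂ ≃ Ed₁}
    {T : MomentumMap ℚ L n} (h : IsSymLift Gm S₁ S₂ κ σ T) : T = S₁.lift S₂ κ σ :=
  h.toIsLift.eq_lift h₁.connected h₁.leg_injective

/-- Two sign choices for the same bijection differ by signs of the blocks. -/
theorem IsSymLift.exists_block (h₁ : S₁.MomentumGrouped Gm) {κ κ' : Ed₂ → ℤˣ} {σ : Ed₂ ≃ Ed₁}
    {T T' : MomentumMap ℚ L n} (h : IsSymLift Gm S₁ S₂ κ σ T) (h' : IsSymLift Gm S₁ S₂ κ' σ T') :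
    ∃ z : S₁.graph.Block → ℤˣ, ∀ e, κ' e = z (S₁.graph.block (σ e)) * κ e := by
  -- Multiplication by this quotient of the two sign choices maps cycles to cycles, so `d` is
  -- constant on blocks.
  let d : Ed₁ → ℤˣ := fun e => κ' (σ.symm e) * κ (σ.symm e)
  have hd : ∀ e, κ' e = d (σ e) * κ e := fun e => by
    simp only [d, Equiv.symm_apply_apply, mul_assoc, Int.units_mul_self, mul_one]
  have hTu : IsUnit T.L.det := by
    rcases h.det_loop with h | h <;> rw [h] <;> simp
  have hmat : ∀ Z : Matrix (Fin L) (Fin 1) ℚ, ∃ Z' : Matrix (Fin L) (Fin 1) ℚ,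
      ∀ e, ((S₁.CIn ℚ)ᵀ * Z') e 0 = ((d e : ℤ) : ℚ) * ((S₁.CIn ℚ)ᵀ * Z) e 0 := by
    intro Z
    refine ⟨T'.L * (T.L⁻¹ * Z), fun e => ?_⟩
    obtain ⟨e, rfl⟩ := σ.surjective e
    have h2 : (S₁.CIn ℚ)ᵀ * Z = signedPerm κ σ * ((S₂.CIn ℚ)ᵀ * (T.L⁻¹ * Z)) := by
      rw [← Matrix.mul_assoc, ← h.loop, Matrix.mul_assoc, ← Matrix.mul_assoc T.L,
        mul_nonsing_inv _ hTu, Matrix.one_mul]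
    rw [h2, signedPerm_mul_apply, ← Matrix.mul_assoc, h'.loop, Matrix.mul_assoc,
      signedPerm_mul_apply, hd]
    push_cast
    have := units_cast_mul_self (κ e)
    ring
  have hblock : ∀ e f, S₁.graph.block e = S₁.graph.block f → d e = d f := by
    intro e f hef
    have h2 := FeynmanGraph.eq_of_block_eq (G := S₁.graph) (z := fun e => ((d e : ℤ) : ℚ)) (by
      intro g hg
      obtain ⟨u, hu⟩ := ((S₁.isCycleBasis h₁.connected).rat_bdry_eq_zero_iff g).1 hg
      obtain ⟨Z', hZ'⟩ := hmat (of fun i _ => u i)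
      have h3 := S₁.isCycle_CIn_mul h₁.connected Z' 0
      convert h3 using 1
      ext e
      rw [hZ', ← hu]
      rfl) hef
    exact Units.ext (by exact_mod_cast h2)
  refine ⟨fun b => d (Quotient.out b), fun e => ?_⟩
  rw [hd]
  congr 1
  exact hblock _ _ (Quotient.out_eq (S₁.graph.block (σ e))).symm

/-- Every edge of the second graph carries a loop momentum, from whose coefficient the sign is read
off. -/
theorem IsSymLift.sign_unique (h₂ : S₂.MomentumGrouped Gm) {κ κ' : Ed₂ → ℤˣ} {σ : Ed₂ ≃ Ed₁}
    {T : MomentumMap ℚ L n} (h : IsSymLift Gm S₁ S₂ κ σ T) (h' : IsSymLift Gm S₁ S₂ κ' σ T) :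
    κ = κ' := by
  ext e
  obtain ⟨i, hi⟩ := S₂.exists_C_ne_zero h₂.loop h₂.connected e
  have h1 := congrFun (congrFun (h.loop.symm.trans h'.loop) (σ e)) i
  rw [signedPerm_mul_apply, signedPerm_mul_apply] at h1
  have h2 : (S₂.CIn ℚ)ᵀ e i ≠ 0 := by simpa [CIn] using hi
  exact_mod_cast mul_right_cancel₀ h2 h1

theorem ofRat_injective : Function.Injective (MomentumMap.ofRat K (L := L) (n := n)) := by
  intro T T' h
  have hinj : Function.Injective (Rat.cast : ℚ → K) := Rat.cast_injective
  ext1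
  · exact Matrix.map_injective hinj (congrArg MomentumMap.L h)
  · exact Matrix.map_injective hinj (congrArg MomentumMap.M h)
  · exact Matrix.map_injective hinj (congrArg MomentumMap.N h)

/-- The symmetries are parametrized by signs of the blocks and symmetries of the Lee–Pomeransky
polynomials. -/
theorem exists_symEquiv [Fintype V₁] [Fintype V₂] (hGm : Gm.IsSymm)
    (h₁ : S₁.MomentumGrouped Gm) (h₂ : S₂.MomentumGrouped Gm)
    (κ : permSet (S₁.leePomeransky Gm) (S₂.leePomeransky Gm) → Ed₂ → ℤˣ)
    (hκ : ∀ σ, ∃ T, IsSymLift Gm S₁ S₂ (κ σ) σ.1 T) :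
    ∃ Φ : (S₁.graph.Block → ℤˣ) × permSet (S₁.leePomeransky Gm) (S₂.leePomeransky Gm) ≃
        Sector.Sym Gm S₁ S₂, ∀ z σ,
      (Φ (z, σ)).1 =
        (S₁.lift S₂ (fun e => z (S₁.graph.block (σ.1 e)) * κ σ e) σ.1).ofRat K ∧
      IsSymLift Gm S₁ S₂ (fun e => z (S₁.graph.block (σ.1 e)) * κ σ e) σ.1
        (S₁.lift S₂ (fun e => z (S₁.graph.block (σ.1 e)) * κ σ e) σ.1) := by
  have hlift : ∀ (z : S₁.graph.Block → ℤˣ) σ,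
      IsSymLift Gm S₁ S₂ (fun e => z (S₁.graph.block (σ.1 e)) * κ σ e) σ.1
        (S₁.lift S₂ (fun e => z (S₁.graph.block (σ.1 e)) * κ σ e) σ.1) := by
    intro z σ
    obtain ⟨T, hT⟩ := hκ σ
    obtain ⟨T', hT'⟩ := hT.twist h₁ z
    rw [← hT'.eq_lift h₁]
    exact hT'
  let f : (S₁.graph.Block → ℤˣ) × permSet (S₁.leePomeransky Gm) (S₂.leePomeransky Gm) →
      Sector.Sym Gm S₁ S₂ := fun zσ => ⟨_, (hlift zσ.1 zσ.2).mem_sym⟩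
  have hf : Function.Bijective f := by
    constructor
    -- The bijection σ is recovered as the one induced on propagators, then the signs from the
    -- momenta, and z because every block contains an edge.
    · rintro ⟨z, σ⟩ ⟨z', σ'⟩ hzz
      have h3 := ofRat_injective (congrArg Subtype.val hzz)
      have hA := hlift z σ
      have hB := hlift z' σ'
      have h4 : σ = σ' := Subtype.ext (hA.induces.unique h₂ (by
        have := hB.induces
        rwa [← h3] at this))
      subst h4
      have h5 := hA.sign_unique h₂ (by rwa [← h3] at hB)
      refine Prod.ext (funext fun b => ?_) rfl
      obtain ⟨e, rfl⟩ : ∃ e, S₁.graph.block e = b := Quotient.exists_rep b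
      obtain ⟨e, rfl⟩ := σ.1.surjective e
      exact mul_right_cancel (congrFun h5 e)
    · rintro ⟨T, hT⟩
      obtain ⟨α, hα⟩ := hT.2.1
      obtain ⟨κ', T', hT', rfl⟩ := exists_isSymLift_of_induces h₁ h₂ hT hα
      let σ : permSet (S₁.leePomeransky Gm) (S₂.leePomeransky Gm) :=
        ⟨α, hT'.mem_permSet hGm h₁.connected h₂.connected⟩
      obtain ⟨T₀, hT₀⟩ := hκ σ
      obtain ⟨z, hz⟩ := hT₀.exists_block h₁ hT'
      refine ⟨(z, σ), Subtype.ext ?_⟩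
      change _ = T'.ofRat K
      rw [hT'.eq_lift h₁, funext hz]
  exact ⟨Equiv.ofBijective f hf, fun z σ => ⟨rfl, hlift z σ⟩⟩

end Sector

/-! ### Monomial actions -/

/-- A monomial representation of `Γ` on functions on `E`. -/
structure MonomialAction (Γ E : Type*) [Group Γ] where
  perm : Γ →* Equiv.Perm E
  coef : Γ → E → ℚ
  coef_one : ∀ e, coef 1 e = 1
  coef_mul : ∀ g h e, coef (g * h) e = coef g (perm h e) * coef h e

namespace MonomialAction

variable {Γ E : Type*} [Group Γ] (M : MonomialAction Γ E)

theorem coef_inv_mul (g : Γ) (e : E) : M.coef g⁻¹ (M.perm g e) * M.coef g e = 1 := by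
  rw [← M.coef_mul, inv_mul_cancel, M.coef_one]

theorem coef_ne_zero (g : Γ) (e : E) : M.coef g e ≠ 0 := right_ne_zero_of_mul_eq_one (M.coef_inv_mul g e)

/-- The action on functions. -/
def act (g : Γ) : (E → ℚ) →ₗ[ℚ] (E → ℚ) where
  toFun h e := M.coef g ((M.perm g).symm e) * h ((M.perm g).symm e)
  map_add' h h' := by ext e; simp [mul_add]
  map_smul' c h := by ext e; simp [mul_left_comm]

@[simp]
theorem act_apply (g : Γ) (h : E → ℚ) (e : E) : M.act g h (M.perm g e) = M.coef g e * h e := by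
  simp [act]

theorem act_eq_iff {g : Γ} {h h' : E → ℚ} :
    M.act g h = h' ↔ ∀ e, h' (M.perm g e) = M.coef g e * h e := by
  refine ⟨fun hh e => by rw [← hh, act_apply], fun hh => ?_⟩
  ext e
  obtain ⟨e, rfl⟩ := (M.perm g).surjective e
  rw [act_apply, hh]

theorem act_one (h : E → ℚ) : M.act 1 h = h := by
  rw [act_eq_iff]
  simp [M.coef_one]

theorem act_mul (g g' : Γ) (h : E → ℚ) : M.act (g * g') h = M.act g (M.act g' h) := by
  rw [act_eq_iff]
  intro e
  rw [map_mul, Equiv.Perm.mul_apply, act_apply, act_apply, M.coef_mul, mul_assoc]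

theorem act_inv_act (g : Γ) (h : E → ℚ) : M.act g⁻¹ (M.act g h) = h := by
  rw [← act_mul, inv_mul_cancel, act_one]

theorem act_act_inv (g : Γ) (h : E → ℚ) : M.act g (M.act g⁻¹ h) = h := by
  rw [← act_mul, mul_inv_cancel, act_one]

theorem act_indicator (g : Γ) (X : Set E) (h : E → ℚ) :
    M.act g (X.indicator h) = (M.perm g '' X).indicator (M.act g h) := by
  classical
  rw [act_eq_iff]
  intro e
  simp only [Set.indicator_apply, (M.perm g).injective.mem_set_image, act_apply]
  split_ifs <;> simp

/-- The contragredient action. -/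
def dual : MonomialAction Γ E where
  perm := M.perm
  coef g e := (M.coef g e)⁻¹
  coef_one e := by rw [M.coef_one, inv_one]
  coef_mul g h e := by rw [M.coef_mul, mul_inv]

theorem sum_act_mul_dual_act [Fintype E] (g : Γ) (h t : E → ℚ) :
    ∑ e, M.act g h e * M.dual.act g t e = ∑ e, h e * t e := by
  rw [← Equiv.sum_comp (M.perm g)]
  refine Finset.sum_congr rfl fun e _ => ?_
  have h1 : M.dual.act g t (M.perm g e) = (M.coef g e)⁻¹ * t e := M.dual.act_apply g t e
  rw [h1, act_apply]
  have := mul_inv_cancel₀ (M.coef_ne_zero g e)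
  linear_combination h e * t e * this

/-- `g` acts as multiplication by `-1`. -/
def IsNeg (g : Γ) : Prop := ∀ h, M.act g h = -h

end MonomialAction

section char

variable {Γ : Type*} [Group Γ]

/-- The sign of a nonzero rational number. -/
def signUnit (r : ℚ) : ℤˣ := if 0 < r then 1 else -1

theorem signUnit_mul {r s : ℚ} (hr : r ≠ 0) (hs : s ≠ 0) :
    signUnit (r * s) = signUnit r * signUnit s := by
  rcases hr.lt_or_gt with hr | hr <;> rcases hs.lt_or_gt with hs | hs
  · simp [signUnit, mul_pos_of_neg_of_neg hr hs, hr.not_gt, hs.not_gt]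
  · simp [signUnit, (mul_neg_of_neg_of_pos hr hs).not_gt, hr.not_gt, hs]
  · simp [signUnit, (mul_neg_of_pos_of_neg hr hs).not_gt, hs.not_gt, hr]
  · simp [signUnit, mul_pos hr hs, hr, hs]

/-- A rational number attached uniquely and multiplicatively to each group element is a homomorphism
into the nonzero rationals; its sign is the character. -/
theorem exists_sign_char (P : Γ → ℚ → Prop) (hex : ∀ g, ∃ s, P g s)
    (huniq : ∀ g s s', P g s → P g s' → s = s')
    (hmul : ∀ g g' s s', P g s → P g' s' → P (g * g') (s * s')) (hone : P 1 1) :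
    ∃ χ : Γ →* ℤˣ, ∀ g, P g (-1) → χ g = -1 := by
  choose r hr using hex
  have h1 : r 1 = 1 := huniq _ _ _ (hr 1) hone
  have hm : ∀ g g', r (g * g') = r g * r g' := fun g g' =>
    huniq _ _ _ (hr _) (hmul _ _ _ _ (hr g) (hr g'))
  have h0 : ∀ g, r g ≠ 0 := fun g h0 => by
    have := hm g g⁻¹
    rw [mul_inv_cancel, h1, h0, zero_mul] at this
    exact one_ne_zero this
  refine ⟨⟨⟨fun g => signUnit (r g), by simp [h1, signUnit]⟩, fun g g' => ?_⟩, fun g hg => ?_⟩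
  · change signUnit (r (g * g')) = _
    rw [hm, signUnit_mul (h0 g) (h0 g')]
  · change signUnit (r g) = -1
    rw [huniq _ _ _ (hr g) hg]
    norm_num [signUnit]

variable {E : Type*} (M : MonomialAction Γ E)

/-- The scalar by which the group acts on the line spanned by `u` modulo `W`. -/
theorem exists_char_of_line (W : Submodule ℚ (E → ℚ)) (hW : ∀ g, ∀ h ∈ W, M.act g h ∈ W)
    {u : E → ℚ} (hu : u ∉ W) (h : ∀ g, ∃ r : ℚ, M.act g u - r • u ∈ W) :
    ∃ χ : Γ →* ℤˣ, ∀ g, M.IsNeg g → χ g = -1 := by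
  obtain ⟨χ, hχ⟩ := exists_sign_char (fun g r => M.act g u - r • u ∈ W) h
    (fun g s s' hs hs' => by
      by_contra hne
      refine hu ((W.smul_mem_iff (sub_ne_zero.2 hne)).1 ?_)
      have := W.sub_mem hs' hs
      rwa [sub_sub_sub_cancel_left, ← sub_smul] at this)
    (fun g g' s s' hs hs' => by
      have h1 := W.add_mem (hW g _ hs') (W.smul_mem s' hs)
      rw [M.act_mul]
      convert h1 using 1
      rw [map_sub, map_smul, smul_sub, smul_smul, mul_comm s s']
      abel)
    (by simp [M.act_one])
  refine ⟨χ, fun g hg => hχ g ?_⟩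
  rw [hg u]
  simp

/-- The product of the coefficients is the determinant without the sign of the permutation, and is
still multiplicative. On −1 it equals (−1)^|E| = −1. -/
theorem exists_char_of_odd [Fintype E] (hE : Odd (Fintype.card E)) :
    ∃ χ : Γ →* ℤˣ, ∀ g, M.IsNeg g → χ g = -1 := by
  classical
  obtain ⟨χ, hχ⟩ := exists_sign_char (fun g r => r = ∏ e, M.coef g e) (fun g => ⟨_, rfl⟩)
    (fun g s s' hs hs' => hs.trans hs'.symm)
    (fun g g' s s' hs hs' => by
      rw [hs, hs', ← Equiv.prod_comp (M.perm g'), ← Finset.prod_mul_distrib]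
      exact Finset.prod_congr rfl fun e _ => (M.coef_mul g g' e).symm)
    (by simp [M.coef_one])
  refine ⟨χ, fun g hg => hχ g ?_⟩
  have h1 : ∀ e, M.coef g e = -1 := fun e => by
    have h2 := M.act_apply g (fun _ => 1) e
    rw [hg] at h2
    simpa using h2.symm
  simp [h1, hE.neg_one_pow]

end char

/-! ### Connected subspaces and tight sets -/

section connectivity

variable {E : Type*} {Λ : Submodule ℚ (E → ℚ)}

/-- A subspace is connected if it does not decompose along a partition of the coordinates. -/
def IsConn (Λ : Submodule ℚ (E → ℚ)) : Prop :=
  ∀ X : Set E, (∀ h ∈ Λ, X.indicator h ∈ Λ) → X = ∅ ∨ X = Set.univ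

/-- `X` is glued to its complement along a one-dimensional space spanned by `a`. -/
def IsOneDim (Λ : Submodule ℚ (E → ℚ)) (X : Set E) (a : E → ℚ) : Prop :=
  X.indicator a = a ∧ ∀ h ∈ Λ, ∃ t : ℚ, X.indicator h - t • a ∈ Λ

theorem IsOneDim.notMem (hconn : IsConn Λ) {X : Set E} {a : E → ℚ} (h : IsOneDim Λ X a)
    (h0 : X.Nonempty) (h1 : X ≠ Set.univ) : a ∉ Λ := by
  intro ha
  rcases hconn X (fun f hf => by
    obtain ⟨t, ht⟩ := h.2 f hf
    have := Λ.add_mem ht (Λ.smul_mem t ha)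
    rwa [sub_add_cancel] at this) with h | h
  · exact h0.ne_empty h
  · exact h1 h

theorem exists_apply_ne_zero (hconn : IsConn Λ) [Nontrivial E] (e : E) : ∃ h ∈ Λ, h e ≠ 0 := by
  by_contra! h0
  rcases hconn {e} (fun h hh => by
    have : Set.indicator {e} h = 0 := by
      ext f
      by_cases hf : f = e
      · simp [hf, h0 h hh]
      · simp [hf]
    rw [this]
    exact Λ.zero_mem) with h | h
  · exact Set.singleton_ne_empty e h
  · obtain ⟨f, hf⟩ := exists_ne e
    exact hf (Set.eq_univ_iff_forall.1 h f)

theorem single_notMem [DecidableEq E] (hconn : IsConn Λ) [Nontrivial E] (e : E) :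
    Pi.single e (1 : ℚ) ∉ Λ := by
  intro he
  rcases hconn {e} (fun h hh => by
    have : Set.indicator {e} h = h e • Pi.single e (1 : ℚ) := by
      ext f
      by_cases hf : f = e
      · subst hf; simp
      · simp [hf]
    rw [this]
    exact Λ.smul_mem _ he) with h | h
  · exact Set.singleton_ne_empty e h
  · obtain ⟨f, hf⟩ := exists_ne e
    exact hf (Set.eq_univ_iff_forall.1 h f)

theorem indicator_smul_rat (X : Set E) (c : ℚ) (h : E → ℚ) :
    X.indicator (c • h) = c • X.indicator h :=
  Set.indicator_const_smul X c h

/-- The vectors of `Λ` supported on `X`. -/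
def supportedIn (Λ : Submodule ℚ (E → ℚ)) (X : Set E) : Submodule ℚ (E → ℚ) where
  carrier := {h | h ∈ Λ ∧ X.indicator h = h}
  add_mem' := by
    rintro h h' ⟨h1, h2⟩ ⟨h3, h4⟩
    exact ⟨Λ.add_mem h1 h3, by rw [Set.indicator_add', h2, h4]⟩
  zero_mem' := ⟨Λ.zero_mem, Set.indicator_zero' _⟩
  smul_mem' c h := by
    rintro ⟨h1, h2⟩
    refine ⟨Λ.smul_mem c h1, ?_⟩
    conv_rhs => rw [← h2]
    exact indicator_smul_rat X c h

theorem indicator_eq_self_iff {X : Set E} {h : E → ℚ} :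
    X.indicator h = h ↔ ∀ e ∉ X, h e = 0 := by
  rw [Set.indicator_eq_self]
  exact ⟨fun hh e he => by_contra fun h0 => he (hh h0), fun hh e he => by_contra fun h0 => he (hh e h0)⟩

theorem mem_supportedIn {X : Set E} {h : E → ℚ} :
    h ∈ supportedIn Λ X ↔ h ∈ Λ ∧ ∀ e ∉ X, h e = 0 := by
  rw [← indicator_eq_self_iff]
  rfl

variable [Finite E]

open Module

/-- The connectivity function is at most one. -/
def IsTight (Λ : Submodule ℚ (E → ℚ)) (X : Set E) : Prop :=
  finrank ℚ Λ ≤ finrank ℚ (supportedIn Λ X) + finrank ℚ (supportedIn Λ Xᶜ) + 1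

theorem IsTight.compl {X : Set E} (h : IsTight Λ X) : IsTight Λ Xᶜ := by
  rw [IsTight, compl_compl]
  rw [IsTight] at h
  omega

theorem finrank_supportedIn_sup (X : Set E) :
    finrank ℚ (supportedIn Λ X ⊔ supportedIn Λ Xᶜ : Submodule ℚ (E → ℚ)) =
      finrank ℚ (supportedIn Λ X) + finrank ℚ (supportedIn Λ Xᶜ) := by
  rw [← Submodule.finrank_sup_add_finrank_inf_eq]
  have : supportedIn Λ X ⊓ supportedIn Λ Xᶜ = ⊥ := by
    rw [eq_bot_iff]
    intro h hh
    rw [Submodule.mem_inf, mem_supportedIn, mem_supportedIn] at hh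
    rw [Submodule.mem_bot]
    ext e
    by_cases he : e ∈ X
    · exact hh.2.2 e fun h => h he
    · exact hh.1.2 e he
  rw [this, finrank_bot, add_zero]

theorem supportedIn_sup_le (X : Set E) : supportedIn Λ X ⊔ supportedIn Λ Xᶜ ≤ Λ :=
  sup_le (fun _ h => h.1) fun _ h => h.1

theorem mem_sup_of_indicator {X : Set E} {h : E → ℚ} (hh : h ∈ Λ) (hX : X.indicator h ∈ Λ) :
    h ∈ supportedIn Λ X ⊔ supportedIn Λ Xᶜ := by
  rw [← Set.indicator_self_add_compl X h]
  refine Submodule.add_mem_sup ⟨hX, by rw [Set.indicator_indicator, Set.inter_self]⟩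
    ⟨?_, by rw [Set.indicator_indicator, Set.inter_self]⟩
  have := Set.indicator_self_add_compl X h
  rw [← eq_sub_iff_add_eq'] at this
  rw [this]
  exact Λ.sub_mem hh hX

theorem indicator_mem_of_mem_sup {X : Set E} {h : E → ℚ}
    (hh : h ∈ supportedIn Λ X ⊔ supportedIn Λ Xᶜ) : X.indicator h ∈ Λ := by
  obtain ⟨k, hk, l, hl, rfl⟩ := Submodule.mem_sup.1 hh
  have : X.indicator l = 0 := by
    rw [← hl.2, Set.indicator_indicator, Set.inter_compl_self, Set.indicator_empty']
  rw [Set.indicator_add', hk.2, this, add_zero]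
  exact hk.1

/-- Modulo the vectors that split along `X`, the space `Λ` is spanned by one vector whose
restriction is not in `Λ`, if there is any. -/
theorem IsOneDim.isTight {X : Set E} {a : E → ℚ} (h : IsOneDim Λ X a) : IsTight Λ X := by
  rw [IsTight, ← finrank_supportedIn_sup]
  by_cases hall : ∀ f ∈ Λ, X.indicator f ∈ Λ
  · have : Λ ≤ supportedIn Λ X ⊔ supportedIn Λ Xᶜ := fun f hf => mem_sup_of_indicator hf (hall f hf)
    exact (Submodule.finrank_mono this).trans (Nat.le_succ _)
  · push Not at hall
    obtain ⟨f₀, hf₀, hne⟩ := hall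
    obtain ⟨t₀, ht₀⟩ := h.2 f₀ hf₀
    have ht₀0 : t₀ ≠ 0 := by
      rintro rfl
      rw [zero_smul, sub_zero] at ht₀
      exact hne ht₀
    have : Λ ≤ (supportedIn Λ X ⊔ supportedIn Λ Xᶜ) ⊔ ℚ ∙ f₀ := by
      intro f hf
      obtain ⟨t, ht⟩ := h.2 f hf
      rw [← sub_add_cancel f ((t / t₀) • f₀)]
      refine Submodule.add_mem_sup (mem_sup_of_indicator (Λ.sub_mem hf (Λ.smul_mem _ hf₀)) ?_)
        (Submodule.smul_mem _ _ (Submodule.mem_span_singleton_self f₀))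
      have h2 := Λ.sub_mem ht (Λ.smul_mem (t / t₀) ht₀)
      have h3 : X.indicator (f - (t / t₀) • f₀) = X.indicator f - (t / t₀) • X.indicator f₀ := by
        rw [Set.indicator_sub', indicator_smul_rat]
      rw [h3]
      convert h2 using 1
      rw [smul_sub, smul_smul, div_mul_cancel₀ _ ht₀0]
      abel
    refine (Submodule.finrank_mono this).trans ((Submodule.finrank_add_le_finrank_add_finrank _ _).trans ?_)
    exact Nat.add_le_add_left ((finrank_span_le_card (R := ℚ) ({f₀} : Set (E → ℚ))).trans (by simp)) _

/-- Any vector that does not split generates `Λ` modulo the split ones by dimension; its restriction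
spans the gluing line. -/
theorem IsTight.exists_isOneDim {X : Set E} (h : IsTight Λ X) : ∃ a, IsOneDim Λ X a := by
  rw [IsTight, ← finrank_supportedIn_sup] at h
  by_cases hall : ∀ f ∈ Λ, X.indicator f ∈ Λ
  · exact ⟨0, Set.indicator_zero' _, fun f hf => ⟨0, by simpa using hall f hf⟩⟩
  · push Not at hall
    obtain ⟨f₀, hf₀, hne⟩ := hall
    refine ⟨X.indicator f₀, by rw [Set.indicator_indicator, Set.inter_self], fun f hf => ?_⟩
    have hlt : supportedIn Λ X ⊔ supportedIn Λ Xᶜ <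
        (supportedIn Λ X ⊔ supportedIn Λ Xᶜ) ⊔ ℚ ∙ f₀ := by
      rw [left_lt_sup, Submodule.span_singleton_le_iff_mem]
      exact fun h => hne (indicator_mem_of_mem_sup h)
    have hle : (supportedIn Λ X ⊔ supportedIn Λ Xᶜ) ⊔ ℚ ∙ f₀ ≤ Λ :=
      sup_le (supportedIn_sup_le X) ((Submodule.span_singleton_le_iff_mem _ _).2 hf₀)
    have heq := Submodule.eq_of_le_of_finrank_le hle
      (h.trans (Nat.succ_le_of_lt (Submodule.finrank_lt_finrank_of_lt hlt)))
    rw [← heq] at hf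
    obtain ⟨k, hk, l, hl, rfl⟩ := Submodule.mem_sup.1 hf
    obtain ⟨t, rfl⟩ := Submodule.mem_span_singleton.1 hl
    refine ⟨t, ?_⟩
    rw [Set.indicator_add', indicator_smul_rat, add_sub_cancel_right]
    exact indicator_mem_of_mem_sup hk

theorem finrank_supportedIn_add_le (X Y : Set E) :
    finrank ℚ (supportedIn Λ X) + finrank ℚ (supportedIn Λ Y) ≤
      finrank ℚ (supportedIn Λ (X ∪ Y)) + finrank ℚ (supportedIn Λ (X ∩ Y)) := by
  rw [← Submodule.finrank_sup_add_finrank_inf_eq]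
  refine Nat.add_le_add (Submodule.finrank_mono (sup_le ?_ ?_)) (Submodule.finrank_mono ?_)
  · intro h hh
    rw [mem_supportedIn] at hh ⊢
    exact ⟨hh.1, fun e he => hh.2 e fun h => he (Or.inl h)⟩
  · intro h hh
    rw [mem_supportedIn] at hh ⊢
    exact ⟨hh.1, fun e he => hh.2 e fun h => he (Or.inr h)⟩
  · rintro h ⟨h1, h2⟩
    rw [SetLike.mem_coe, mem_supportedIn] at h1 h2
    rw [mem_supportedIn]
    refine ⟨h1.1, fun e he => ?_⟩
    by_cases heX : e ∈ X
    · exact h2.2 e fun h => he ⟨heX, h⟩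
    · exact h1.2 e heX

theorem IsConn.finrank_lt (hconn : IsConn Λ) {X : Set E} (h0 : X ≠ ∅) (h1 : X ≠ Set.univ) :
    finrank ℚ (supportedIn Λ X) + finrank ℚ (supportedIn Λ Xᶜ) < finrank ℚ Λ := by
  rw [← finrank_supportedIn_sup]
  refine Submodule.finrank_lt_finrank_of_lt (lt_of_le_of_ne (supportedIn_sup_le X) fun heq => ?_)
  rcases hconn X (fun h hh => by
    rw [← heq] at hh
    exact indicator_mem_of_mem_sup hh) with h | h
  · exact h0 h
  · exact h1 h

/-- Uncrossing of tight sets. -/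
theorem IsTight.inter (hconn : IsConn Λ) {X Y : Set E} (hX : IsTight Λ X) (hY : IsTight Λ Y)
    (h0 : (X ∩ Y).Nonempty) (h1 : X ∪ Y ≠ Set.univ) : IsTight Λ (X ∩ Y) := by
  -- Supermodularity of the dimension is used for the two sets and for their complements.
  -- Connectedness bounds the contribution of the union strictly, leaving a defect of at most one
  -- for the intersection.
  have h2 := finrank_supportedIn_add_le (Λ := Λ) X Y
  have h3 := finrank_supportedIn_add_le (Λ := Λ) Xᶜ Yᶜ
  have h4 := hconn.finrank_lt (X := X ∪ Y) (fun h => by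
    obtain ⟨e, he⟩ := h0
    have : e ∈ X ∪ Y := Or.inl he.1
    rw [h] at this
    exact this) h1
  rw [Set.compl_union] at h4
  rw [← Set.compl_inter] at h3
  rw [IsTight] at hX hY ⊢
  omega

end connectivity

/-! ### Graphs without tight sets -/

theorem MonomialAction.IsNeg.perm_eq_and_coef_eq {Γ E : Type*} [Group Γ] {M : MonomialAction Γ E}
    {g : Γ} (hg : M.IsNeg g) (e : E) : M.perm g e = e ∧ M.coef g e = -1 := by
  classical
  have h1 := M.act_apply g (Pi.single e 1) e
  rw [hg, Pi.single_eq_same, mul_one] at h1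
  by_cases he : M.perm g e = e
  · rw [he] at h1
    exact ⟨he, by simpa using h1.symm⟩
  · exact absurd (by simpa [he] using h1.symm) (M.coef_ne_zero g e)

theorem MonomialAction.IsNeg.dual {Γ E : Type*} [Group Γ] {M : MonomialAction Γ E} {g : Γ}
    (hg : M.IsNeg g) : M.dual.IsNeg g := by
  have hperm := hg.perm_eq_and_coef_eq
  intro h
  rw [MonomialAction.act_eq_iff]
  intro e
  change (-h) (M.perm g e) = (M.coef g e)⁻¹ * h e
  rw [(hperm e).1, (hperm e).2]
  simp

theorem isOneDim_pair {E : Type*} [DecidableEq E] {Λ : Submodule ℚ (E → ℚ)} {e f : E}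
    (hef : e ≠ f) {s : ℚ} (hs : s ≠ 0) (h : Pi.single e (1 : ℚ) - s • Pi.single f (1 : ℚ) ∈ Λ) :
    IsOneDim Λ {e, f} (Pi.single e 1) := by
  refine ⟨indicator_eq_self_iff.2 fun x hx => ?_, fun k _ => ⟨k e + s⁻¹ * k f, ?_⟩⟩
  · rw [Pi.single_eq_of_ne]
    rintro rfl
    exact hx (Or.inl rfl)
  · convert Λ.smul_mem (-(s⁻¹ * k f)) h using 1
    ext x
    by_cases hxe : x = e
    · subst hxe
      simp [hef]
    · by_cases hxf : x = f
      · subst hxf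
        simp [hxe]
        field_simp
      · simp [hxe, hxf]

namespace EdgeFlow

variable {V E : Type*} (src tgt : E → V)

/-- The edges at a vertex. -/
def star (v : V) : Set E := {e | src e = v ∨ tgt e = v}

open Classical in
/-- The coboundary of a vertex. -/
noncomputable def starVec (v : V) : E → ℚ := fun e =>
  (if tgt e = v then 1 else 0) - (if src e = v then 1 else 0)

variable [Fintype E]

/-- The rational cycle space. -/
noncomputable def cycles : Submodule ℚ (E → ℚ) := LinearMap.ker (bdry src tgt)

variable {src tgt}

theorem mem_cycles {h : E → ℚ} : h ∈ cycles src tgt ↔ bdry src tgt h = 0 := LinearMap.mem_ker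

theorem bdry_eq_sum_starVec (h : E → ℚ) (v : V) :
    bdry src tgt h v = ∑ e, h e * starVec src tgt v e := by
  rw [bdry_apply]
  rfl

omit [Fintype E] in
theorem starVec_eq_zero {v : V} {e : E} (he : e ∉ star src tgt v) : starVec src tgt v e = 0 := by
  rw [star, Set.mem_ofPred_eq, not_or] at he
  simp [starVec, he.1, he.2]

theorem bdry_congr_star {h h' : E → ℚ} {v : V} (hh : ∀ e ∈ star src tgt v, h e = h' e) :
    bdry src tgt h v = bdry src tgt h' v := by
  rw [bdry_eq_sum_starVec, bdry_eq_sum_starVec]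
  refine Finset.sum_congr rfl fun e _ => ?_
  by_cases he : e ∈ star src tgt v
  · rw [hh e he]
  · rw [starVec_eq_zero he, mul_zero, mul_zero]

variable [Fintype V]

theorem sum_bdry (h : E → ℚ) : ∑ v, bdry src tgt h v = 0 := by
  have := sum_mul_bdry src tgt (fun _ => (1 : ℚ)) h
  simpa using this

omit [Fintype V] in
/-- Vectors orthogonal to all cycles are gradients. -/
theorem exists_potential {t : E → ℚ} (ht : ∀ h ∈ cycles src tgt, ∑ e, h e * t e = 0) :
    ∃ q : V → ℚ, ∀ e, t e = q (tgt e) - q (src e) := by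
  classical
  let s := joined src tgt Set.univ
  have hrep : ∀ v, s (Quotient.mk s v).out v := fun v => Quotient.mk_out v
  choose y _ hy using fun v => exists_flow_of_joined (R := ℚ) (hrep v)
  refine ⟨fun v => ∑ e, y v e * t e, fun e => ?_⟩
  have hs : Quotient.mk s (tgt e) = Quotient.mk s (src e) :=
    Quotient.sound (s.symm (joined_edge src tgt (Set.mem_univ e)))
  have h1 := ht (y (tgt e) - y (src e) - Pi.single e 1) (by
    rw [mem_cycles, map_sub, map_sub, hy, hy, bdry_single, hs]
    abel)
  simp only [Pi.sub_apply, sub_mul, Finset.sum_sub_distrib, Pi.single_apply, ite_mul, one_mul,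
    zero_mul, Finset.sum_ite_eq', Finset.mem_univ, if_true] at h1
  linarith

section component

variable (v w u : V)

/-- The edges meeting the component of `u` in the graph with `v` and `w` deleted. -/
def side (src tgt : E → V) (v w u : V) : Set E :=
  {e | joined src tgt (star src tgt v ∪ star src tgt w)ᶜ u (src e) ∨
    joined src tgt (star src tgt v ∪ star src tgt w)ᶜ u (tgt e)}

variable {v w u}

omit [Fintype V] [Fintype E] in
theorem joined_ne (hu : u ≠ v) {x : V}
    (hx : joined src tgt (star src tgt v ∪ star src tgt w)ᶜ u x) : x ≠ v := by
  intro hxv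
  have := eq_of_joined (f := fun x => x = v) (fun e he => by
    simp only [star, Set.mem_compl_iff, Set.mem_union, Set.mem_ofPred_eq, not_or] at he
    simp [he.1.1, he.1.2]) hx
  simp only [eq_iff_iff] at this
  exact hu (this.2 hxv)

omit [Fintype V] [Fintype E] in
theorem joined_ne' (hu : u ≠ w) {x : V}
    (hx : joined src tgt (star src tgt v ∪ star src tgt w)ᶜ u x) : x ≠ w := by
  rw [Set.union_comm] at hx
  exact joined_ne hu hx

omit [Fintype V] [Fintype E] in
theorem joined_or_of_mem_side (huv : u ≠ v) (huw : u ≠ w) {e : E} (he : e ∈ side src tgt v w u)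
    {x : V} (hx : e ∈ star src tgt x) :
    joined src tgt (star src tgt v ∪ star src tgt w)ᶜ u x ∨ x = v ∨ x = w := by
  by_cases hxv : x = v
  · exact Or.inr (Or.inl hxv)
  by_cases hxw : x = w
  · exact Or.inr (Or.inr hxw)
  left
  by_cases hev : e ∈ star src tgt v ∪ star src tgt w
  · have key : ∀ y, (src e = y ∧ tgt e = x ∨ src e = x ∧ tgt e = y) →
        joined src tgt (star src tgt v ∪ star src tgt w)ᶜ u y → False := by
      intro y hy hj
      have h1 := joined_ne huv hj
      have h2 := joined_ne' huw hj
      rcases hev with (h | h) | (h | h) <;> rcases hy with ⟨h3, h4⟩ | ⟨h3, h4⟩ <;>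
        simp_all
    rcases he with he | he <;> rcases hx with rfl | rfl
    · exact he
    · exact (key _ (Or.inl ⟨rfl, rfl⟩) he).elim
    · exact (key _ (Or.inr ⟨rfl, rfl⟩) he).elim
    · exact he
  · have h1 := joined_edge src tgt (T := (star src tgt v ∪ star src tgt w)ᶜ) hev
    have h2 : joined src tgt (star src tgt v ∪ star src tgt w)ᶜ u (src e) := by
      rcases he with he | he
      · exact he
      · exact (joined src tgt _).trans he ((joined src tgt _).symm h1)
    rcases hx with rfl | rfl
    · exact h2
    · exact (joined src tgt _).trans h2 h1

/-- Cutting a cycle down to one side of the vertices v and w can violate conservation only at v and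
w, and the total boundary is zero. -/
theorem bdry_indicator_side [DecidableEq V] (huv : u ≠ v) (huw : u ≠ w) {h : E → ℚ}
    (hh : h ∈ cycles src tgt) : ∃ t : ℚ, bdry src tgt ((side src tgt v w u).indicator h) =
      t • (Pi.single v 1 - Pi.single w 1) := by
  classical
  set k := (side src tgt v w u).indicator h with hk
  have h0 : ∀ x, x ≠ v → x ≠ w → bdry src tgt k x = 0 := by
    intro x hxv hxw
    by_cases hx : joined src tgt (star src tgt v ∪ star src tgt w)ᶜ u x
    · rw [bdry_congr_star (h' := h), mem_cycles.1 hh]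
      · rfl
      · intro e he
        rw [hk, Set.indicator_of_mem]
        rcases he with rfl | rfl
        · exact Or.inl hx
        · exact Or.inr hx
    · rw [bdry_congr_star (h' := 0), map_zero]
      · rfl
      · intro e he
        rw [hk, Set.indicator_of_notMem]
        · rfl
        · intro hes
          rcases joined_or_of_mem_side huv huw hes he with h | h | h
          · exact hx h
          · exact hxv h
          · exact hxw h
  have hsum := sum_bdry (src := src) (tgt := tgt) k
  by_cases hvw : v = w
  · subst hvw
    refine ⟨0, ?_⟩
    rw [Finset.sum_eq_single v (fun x _ hx => h0 x hx hx) (by simp)] at hsum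
    ext x
    by_cases hx : x = v
    · subst hx
      simp [hsum]
    · simp [h0 x hx hx]
  · refine ⟨bdry src tgt k v, ?_⟩
    rw [← Finset.add_sum_erase _ _ (Finset.mem_univ v),
      Finset.sum_eq_single w (fun x hx hxw => h0 x (Finset.ne_of_mem_erase hx) hxw)
        (fun h => absurd (Finset.mem_erase.2 ⟨Ne.symm hvw, Finset.mem_univ _⟩) h)] at hsum
    ext x
    by_cases hx : x = v
    · subst hx
      simp [hvw]
    · by_cases hxw : x = w
      · subst hxw
        simp [hx]
        linarith
      · simp [hx, hxw, h0 x hx hxw]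

theorem exists_isOneDim_side (huv : u ≠ v) (huw : u ≠ w) :
    ∃ a, IsOneDim (cycles src tgt) (side src tgt v w u) a := by
  classical
  by_cases hall : ∀ h ∈ cycles src tgt, (side src tgt v w u).indicator h ∈ cycles src tgt
  · exact ⟨0, Set.indicator_zero' _, fun h hh => ⟨0, by simpa using hall h hh⟩⟩
  · push Not at hall
    obtain ⟨h₀, hh₀, hne⟩ := hall
    obtain ⟨t₀, ht₀⟩ := bdry_indicator_side huv huw hh₀
    have h1 : t₀ ≠ 0 := by
      rintro rfl
      exact hne (mem_cycles.2 (by rw [ht₀, zero_smul]))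
    refine ⟨(side src tgt v w u).indicator h₀, by rw [Set.indicator_indicator, Set.inter_self],
      fun h hh => ?_⟩
    obtain ⟨t, ht⟩ := bdry_indicator_side huv huw hh
    refine ⟨t / t₀, mem_cycles.2 ?_⟩
    rw [map_sub, map_smul, ht, ht₀, smul_smul, div_mul_cancel₀ _ h1, sub_self]

end component

section threeConnected

variable (hconn : IsConn (cycles src tgt))
  (hrigid : ∀ X a, IsOneDim (cycles src tgt) X a → X.Subsingleton ∨ Xᶜ.Subsingleton)
  (hcard : 4 ≤ Fintype.card E)

include hconn in
omit [Fintype V] in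
theorem src_ne_tgt [Nontrivial E] (e : E) : src e ≠ tgt e := by
  classical
  intro h
  refine single_notMem hconn e (mem_cycles.2 ?_)
  rw [bdry_single, h, sub_self]

include hconn in
omit [Fintype V] in
theorem starVec_ne_zero [Nontrivial E] {v : V} {e : E} (he : e ∈ star src tgt v) :
    starVec src tgt v e ≠ 0 := by
  have h := src_ne_tgt hconn e
  rcases he with he | he
  · subst he
    simp [starVec, h.symm]
  · subst he
    simp [starVec, h]

include hconn in
omit [Fintype V] in
theorem exists_ne_mem_star [Nontrivial E] {v : V} {e : E} (he : e ∈ star src tgt v) :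
    ∃ f ∈ star src tgt v, f ≠ e := by
  classical
  obtain ⟨h, hh, hhe⟩ := exists_apply_ne_zero hconn e
  by_contra! hall
  have h1 := congrFun (mem_cycles.1 hh) v
  rw [bdry_eq_sum_starVec, Finset.sum_eq_single e] at h1
  · exact mul_ne_zero hhe (starVec_ne_zero hconn he) h1
  · intro f _ hf
    rw [starVec_eq_zero fun h => hf (hall f h), mul_zero]
  · simp

-- Removing two vertices does not disconnect the rest: otherwise one side would be glued along a
-- line with at least two edges on each side. The case `v = w` is included and uses connectedness
-- alone.
include hconn hrigid in
theorem joined_compl_star [Nontrivial E] {v w u u' : V} (huv : u ≠ v) (huw : u ≠ w) (hu'v : u' ≠ v)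
    (hu'w : u' ≠ w) {e e' : E} (he : e ∈ star src tgt u) (he' : e' ∈ star src tgt u') :
    joined src tgt (star src tgt v ∪ star src tgt w)ᶜ u u' := by
  classical
  by_contra hj
  have hin : ∀ f ∈ star src tgt u, f ∈ side src tgt v w u := by
    rintro f (rfl | rfl)
    · exact Or.inl ((joined src tgt _).refl _)
    · exact Or.inr ((joined src tgt _).refl _)
  have hout : ∀ f ∈ star src tgt u', f ∉ side src tgt v w u := by
    intro f hf hfs
    rcases joined_or_of_mem_side huv huw hfs hf with h | h | h
    · exact hj h
    · exact hu'v h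
    · exact hu'w h
  by_cases hvw : v = w
  · subst hvw
    rcases hconn (side src tgt v v u) (fun h hh => by
      obtain ⟨t, ht⟩ := bdry_indicator_side huv huv hh
      rw [mem_cycles, ht, sub_self, smul_zero]) with h | h
    · have := hin e he
      rw [h] at this
      exact this
    · exact hout e' he' (h ▸ Set.mem_univ _)
  · obtain ⟨a, ha⟩ := exists_isOneDim_side (src := src) (tgt := tgt) huv huw
    obtain ⟨f, hf, hfe⟩ := exists_ne_mem_star hconn he
    obtain ⟨f', hf', hfe'⟩ := exists_ne_mem_star hconn he'
    rcases hrigid _ a ha with h | h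
    · exact hfe (h (hin f hf) (hin e he))
    · exact hfe' (h (hout f' hf') (hout e' he'))

end threeConnected

end EdgeFlow

namespace EdgeFlow

variable {V E : Type*} {src tgt : E → V} [Fintype E] [Fintype V]

section threeConnected

variable (hconn : IsConn (cycles src tgt))
  (hrigid : ∀ X a, IsOneDim (cycles src tgt) X a → X.Subsingleton ∨ Xᶜ.Subsingleton)
  (hcard : 4 ≤ Fintype.card E)

omit [Fintype V] [Fintype E] in
theorem exists_other_end {v : V} {e : E} (he : e ∈ star src tgt v) (hne : src e ≠ tgt e) :
    ∃ u, u ≠ v ∧ e ∈ star src tgt u := by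
  rcases he with rfl | rfl
  · exact ⟨tgt e, hne.symm, Or.inr rfl⟩
  · exact ⟨src e, hne, Or.inl rfl⟩

-- Two parallel edges would form a glued pair whose complement has at least two edges.
include hrigid hcard in
omit [Fintype V] in
theorem eq_of_mem_star {v w : V} (hvw : v ≠ w) {e f : E} (hev : e ∈ star src tgt v)
    (hew : e ∈ star src tgt w) (hfv : f ∈ star src tgt v) (hfw : f ∈ star src tgt w) : e = f := by
  classical
  by_contra hef
  have key : ∃ s : ℚ, s ≠ 0 ∧ Pi.single e (1 : ℚ) - s • Pi.single f (1 : ℚ) ∈ cycles src tgt := by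
    have h0 : ∀ s : ℚ, Pi.single e (1 : ℚ) - s • Pi.single f (1 : ℚ) ∈ cycles src tgt ↔
        (Pi.single (tgt e) 1 - Pi.single (src e) 1 : V → ℚ) =
          s • (Pi.single (tgt f) 1 - Pi.single (src f) 1) := fun s => by
      rw [mem_cycles, map_sub, map_smul, bdry_single, bdry_single, sub_eq_zero]
    rcases hev with h1 | h1 <;> rcases hew with h2 | h2
    · exact absurd (h1.symm.trans h2) hvw
    · rcases hfv with h3 | h3 <;> rcases hfw with h4 | h4
      · exact absurd (h3.symm.trans h4) hvw
      · exact ⟨1, one_ne_zero, (h0 1).2 (by rw [h1, h2, h3, h4, one_smul])⟩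
      · exact ⟨-1, by norm_num, (h0 _).2 (by rw [h1, h2, h3, h4, neg_one_smul, neg_sub])⟩
      · exact absurd (h3.symm.trans h4) hvw
    · rcases hfv with h3 | h3 <;> rcases hfw with h4 | h4
      · exact absurd (h3.symm.trans h4) hvw
      · exact ⟨-1, by norm_num, (h0 _).2 (by rw [h1, h2, h3, h4, neg_one_smul, neg_sub])⟩
      · exact ⟨1, one_ne_zero, (h0 1).2 (by rw [h1, h2, h3, h4, one_smul])⟩
      · exact absurd (h3.symm.trans h4) hvw
    · exact absurd (h1.symm.trans h2) hvw
  obtain ⟨s, hs, hmem⟩ := key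
  rcases hrigid _ _ (isOneDim_pair hef hs hmem) with h | h
  · exact hef (h (Or.inl rfl) (Or.inr rfl))
  · have h1 : ({e, f}ᶜ : Finset E).card ≤ 1 := by
      rw [Finset.card_le_one]
      intro a ha b hb
      exact h (by simpa using ha) (by simpa using hb)
    rw [Finset.card_compl, Finset.card_pair hef] at h1
    omega

include hconn hrigid hcard

omit [Fintype V] in
theorem not_star_subset [Nontrivial E] {v w : V} (hvw : v ≠ w) {e : E} (he : e ∈ star src tgt w) :
    ¬ star src tgt w ⊆ star src tgt v := by
  intro hsub
  obtain ⟨f, hf, hfe⟩ := exists_ne_mem_star hconn he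
  exact hfe (eq_of_mem_star hrigid hcard hvw (hsub hf) hf (hsub he) he)

omit hcard in
/-- A gradient supported on the star of a vertex is a multiple of its coboundary. -/
theorem exists_eq_smul_starVec [Nontrivial E] {v : V} (q : V → ℚ)
    (hq : ∀ e ∉ star src tgt v, q (tgt e) = q (src e)) :
    ∃ s : ℚ, ∀ e, q (tgt e) - q (src e) = s * starVec src tgt v e := by
  obtain ⟨e₀⟩ := (inferInstance : Nonempty E)
  obtain ⟨u, huv, hu⟩ : ∃ u, u ≠ v ∧ e₀ ∈ star src tgt u := by
    by_cases h : src e₀ = v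
    · exact ⟨tgt e₀, fun h' => src_ne_tgt hconn e₀ (h.trans h'.symm), Or.inr rfl⟩
    · exact ⟨src e₀, h, Or.inl rfl⟩
  -- The graph stays connected when `v` is deleted, so `q` takes one value on all other vertices
  -- that carry edges.
  have hc : ∀ (x : V) (e : E), x ≠ v → e ∈ star src tgt x → q x = q u := by
    intro x e hx he
    have hj := joined_compl_star hconn hrigid hx hx huv huv he hu
    rw [Set.union_self] at hj
    exact eq_of_joined (fun e he => (hq e he).symm) hj
  refine ⟨q v - q u, fun e => ?_⟩
  have hne := src_ne_tgt hconn e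
  by_cases h1 : src e = v
  · have h2 : tgt e ≠ v := fun h => hne (h1.trans h.symm)
    rw [hc (tgt e) e h2 (Or.inr rfl), h1]
    simp [starVec, h1, h2]
  · by_cases h2 : tgt e = v
    · rw [hc (src e) e h1 (Or.inl rfl), h2]
      simp [starVec, h1, h2]
    · rw [hc _ e h1 (Or.inl rfl), hc _ e h2 (Or.inr rfl)]
      simp [starVec, h1, h2]

omit hcard in
/-- The complement of a star is connected. -/
theorem compl_star_conn [Nontrivial E] {v : V} {X : Set E} (hXv : X ⊆ (star src tgt v)ᶜ)
    (hX : ∀ h ∈ cycles src tgt, (∀ e ∈ star src tgt v, h e = 0) →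
      X.indicator h ∈ cycles src tgt) (hne : X.Nonempty) : X = (star src tgt v)ᶜ := by
  classical
  -- Two edges at `w` that avoid `v` lie on a cycle avoiding `v` that uses no other edge at `w`:
  -- join their other ends after deleting v and w. Hence `X` cannot separate them.
  have hadj : ∀ (w : V) (e f : E), w ≠ v → e ∉ star src tgt v → f ∉ star src tgt v →
      e ∈ star src tgt w → f ∈ star src tgt w → e ∈ X → f ∈ X := by
    intro w e f hwv he hf hew hfw heX
    by_contra hfX
    obtain ⟨u, huw, hu⟩ := exists_other_end hew (src_ne_tgt hconn e)
    obtain ⟨u', hu'w, hu'⟩ := exists_other_end hfw (src_ne_tgt hconn f)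
    have huv : u ≠ v := fun h => he (h ▸ hu)
    have hu'v : u' ≠ v := fun h => hf (h ▸ hu')
    have hj := joined_compl_star hconn hrigid huv huw hu'v hu'w hu hu'
    obtain ⟨y, hy, hby⟩ := exists_flow_of_joined (R := ℚ) hj
    have hs : ∀ (e : E) (u : V), e ∈ star src tgt u → e ∈ star src tgt w → u ≠ w →
        ∃ s : ℚ, s ≠ 0 ∧ bdry src tgt (Pi.single e s) = Pi.single u 1 - Pi.single w 1 := by
      intro e u hu hw huw
      rcases hu with h1 | h1 <;> rcases hw with h2 | h2
      · exact absurd (h1.symm.trans h2) huw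
      · refine ⟨-1, by norm_num, ?_⟩
        rw [bdry_single, h1, h2]
        rw [Pi.single_neg, Pi.single_neg]
        abel
      · exact ⟨1, one_ne_zero, by rw [bdry_single, h1, h2]⟩
      · exact absurd (h1.symm.trans h2) huw
    obtain ⟨s, hs0, hbs⟩ := hs e u hu hew huw
    obtain ⟨s', hs'0, hbs'⟩ := hs f u' hu' hfw hu'w
    have hef : e ≠ f := fun h => hfX (h ▸ heX)
    have hyv : ∀ g, g ∈ star src tgt v ∪ star src tgt w → y g = 0 := fun g hg =>
      hy g fun h => h hg
    set h : E → ℚ := y + Pi.single e s - Pi.single f s' with hh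
    have hcyc : h ∈ cycles src tgt := by
      rw [mem_cycles, hh, map_sub, map_add, hby, hbs, hbs']
      abel
    have h1 := hX h hcyc (fun g hg => by
      have hge : g ≠ e := fun h => he (h ▸ hg)
      have hgf : g ≠ f := fun h => hf (h ▸ hg)
      rw [hh]
      simp [hyv g (Or.inl hg), hge, hgf])
    have h2 := congrFun (mem_cycles.1 h1) w
    rw [bdry_eq_sum_starVec, Finset.sum_eq_single e] at h2
    · rw [Set.indicator_of_mem heX] at h2
      have h3 : h e = s := by
        rw [hh]
        simp [hyv e (Or.inr hew), hef]
      rw [h3] at h2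
      exact mul_ne_zero hs0 (starVec_ne_zero hconn hew) h2
    · intro g _ hge
      by_cases hgw : g ∈ star src tgt w
      · by_cases hgf : g = f
        · rw [hgf, Set.indicator_of_notMem hfX, zero_mul]
        · have h3 : h g = 0 := by
            rw [hh]
            simp [hyv g (Or.inr hgw), hge, hgf]
          rw [Set.indicator_apply, h3, ite_self, zero_mul]
      · rw [starVec_eq_zero hgw, mul_zero]
    · simp
  obtain ⟨e₀, he₀⟩ := hne
  refine Set.Subset.antisymm hXv fun f hf => ?_
  have hout : ∀ e, e ∉ star src tgt v → src e ≠ v ∧ tgt e ≠ v := fun e he =>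
    ⟨fun h => he (Or.inl h), fun h => he (Or.inr h)⟩
  have he₀v := hXv he₀
  have hj := joined_compl_star hconn hrigid (hout _ he₀v).1 (hout _ he₀v).1 (hout _ hf).1
    (hout _ hf).1 (e := e₀) (e' := f) (Or.inl rfl) (Or.inl rfl)
  rw [Set.union_self] at hj
  have h1 := eq_of_joined (f := fun w => ∃ g ∈ X, g ∈ star src tgt w) (fun e he => by
    rw [eq_iff_iff]
    constructor
    · rintro ⟨g, hgX, hg⟩
      exact ⟨e, hadj _ g e (hout e he).1 (hXv hgX) he hg (Or.inl rfl) hgX, Or.inr rfl⟩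
    · rintro ⟨g, hgX, hg⟩
      exact ⟨e, hadj _ g e (hout e he).2 (hXv hgX) he hg (Or.inr rfl) hgX, Or.inl rfl⟩) hj
  simp only [eq_iff_iff] at h1
  obtain ⟨g, hgX, hg⟩ := h1.1 ⟨e₀, he₀, Or.inl rfl⟩
  exact hadj _ g f (hout f hf).1 (hXv hgX) hf hg (Or.inl rfl) hgX

variable {Γ : Type*} [Group Γ] (M : MonomialAction Γ E)
  (hM : ∀ g, ∀ h ∈ cycles src tgt, M.act g h ∈ cycles src tgt)

omit hconn hrigid hcard [Fintype V] in
theorem sum_starVec {h : E → ℚ} (hh : h ∈ cycles src tgt) (v : V) :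
    ∑ e, h e * starVec src tgt v e = 0 := by
  rw [← bdry_eq_sum_starVec, mem_cycles.1 hh]
  rfl

include hM

-- The dual action preserves the orthogonal complement of the cycle space, which consists of
-- gradients.
omit hconn hrigid hcard [Fintype V] in
theorem exists_potential_dual_act (g : Γ) (v : V) :
    ∃ q : V → ℚ, ∀ e, M.dual.act g (starVec src tgt v) e = q (tgt e) - q (src e) := by
  refine exists_potential fun h hh => ?_
  have h1 := M.sum_act_mul_dual_act g (M.act g⁻¹ h) (starVec src tgt v)
  rw [M.act_act_inv] at h1
  rw [h1]
  exact sum_starVec (hM _ h hh) v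

/-- The group permutes the vertex stars, up to scalars. -/
theorem exists_dual_act_starVec [Nontrivial E] (g : Γ) {v : V} {e₀ : E}
    (he₀ : e₀ ∈ star src tgt v) :
    ∃ (w : V) (s : ℚ), M.perm g e₀ ∈ star src tgt w ∧
      M.dual.act g (starVec src tgt v) = s • starVec src tgt w := by
  obtain ⟨p, hp⟩ := exists_potential_dual_act M hM g v
  have hval : ∀ e, p (tgt (M.perm g e)) - p (src (M.perm g e)) =
      (M.coef g e)⁻¹ * starVec src tgt v e := fun e => by
    rw [← hp]
    exact M.dual.act_apply g _ e
  have hlev : ∀ e ∉ star src tgt v, p (tgt (M.perm g e)) = p (src (M.perm g e)) := fun e he => by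
    have := hval e
    rw [starVec_eq_zero he, mul_zero] at this
    linarith
  have hend : ∀ e ∉ star src tgt v, ∀ u, M.perm g e ∈ star src tgt u →
      p u = p (src (M.perm g e)) := by
    rintro e he u (rfl | rfl)
    · rfl
    · exact hlev e he
  obtain ⟨e₁, he₁⟩ : ∃ e, e ∉ star src tgt v := by
    obtain ⟨u, huv, hu⟩ := exists_other_end he₀ (src_ne_tgt hconn e₀)
    obtain ⟨e, -, he⟩ := Set.not_subset.1 (not_star_subset hconn hrigid hcard huv.symm hu)
    exact ⟨e, he⟩
  set a := p (src (M.perm g e₁)) with ha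
  -- The images of the edges off the star of v join vertices of equal potential, so cycles among
  -- them decompose by level. As the complement of a star is connected, only the level `a` occurs.
  have hX : {e | e ∉ star src tgt v ∧ p (src (M.perm g e)) = a} = (star src tgt v)ᶜ := by
    refine compl_star_conn hconn hrigid (fun e he => he.1) (fun h hh hv => ?_) ⟨e₁, he₁, rfl⟩
    set X : Set E := {e | e ∉ star src tgt v ∧ p (src (M.perm g e)) = a}
    have hk := hM g h hh
    rw [← M.act_inv_act g (X.indicator h)]
    refine hM _ _ (mem_cycles.2 ?_)
    rw [M.act_indicator]
    ext u
    by_cases hu : p u = a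
    · rw [bdry_congr_star (h' := M.act g h), mem_cycles.1 hk]
      intro f hf
      obtain ⟨e, rfl⟩ := (M.perm g).surjective f
      by_cases heX : e ∈ X
      · rw [Set.indicator_of_mem ((M.perm g).injective.mem_set_image.2 heX)]
      · rw [Set.indicator_of_notMem fun h => heX ((M.perm g).injective.mem_set_image.1 h),
          M.act_apply]
        by_cases hev : e ∈ star src tgt v
        · rw [hv e hev, mul_zero]
        · exact absurd ⟨hev, (hend e hev u hf).symm.trans hu⟩ heX
    · rw [bdry_congr_star (h' := 0), map_zero]
      intro f hf
      obtain ⟨e, rfl⟩ := (M.perm g).surjective f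
      rw [Set.indicator_of_notMem]
      · rfl
      · intro h
        have heX := (M.perm g).injective.mem_set_image.1 h
        exact hu ((hend e heX.1 u hf).trans heX.2)
  have hall : ∀ e ∉ star src tgt v, ∀ u, M.perm g e ∈ star src tgt u → p u = a := by
    intro e he u hu
    have h1 : e ∈ (star src tgt v)ᶜ := he
    rw [← hX] at h1
    exact (hend e he u hu).trans h1.2
  -- The image of `e₀` joins different levels, so it has an end `w` off the level `a`; then only
  -- images of edges of the star of v can meet `w`.
  obtain ⟨w, hw, hwa⟩ : ∃ w, M.perm g e₀ ∈ star src tgt w ∧ p w ≠ a := by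
    by_contra! h
    have h1 := hval e₀
    rw [h _ (Or.inl rfl), h _ (Or.inr rfl), sub_self] at h1
    exact mul_ne_zero (inv_ne_zero (M.coef_ne_zero g e₀)) (starVec_ne_zero hconn he₀) h1.symm
  obtain ⟨q, hq⟩ := exists_potential_dual_act M hM g⁻¹ w
  -- Pulled back by g, the star of `w` is a gradient supported on the star of v, hence a multiple of
  -- its coboundary.
  obtain ⟨s, hs⟩ := exists_eq_smul_starVec hconn hrigid (v := v) q (fun e he => by
    have h1 := M.dual.act_apply g⁻¹ (starVec src tgt w) (M.perm g e)
    have h2 : M.dual.perm g⁻¹ (M.perm g e) = e := by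
      change M.perm g⁻¹ (M.perm g e) = e
      rw [map_inv]
      exact (M.perm g).symm_apply_apply e
    rw [h2, hq, starVec_eq_zero fun h => hwa (hall e he w h), mul_zero] at h1
    linarith)
  have h3 : M.dual.act g⁻¹ (starVec src tgt w) = s • starVec src tgt v := by
    ext e
    rw [hq, hs]
    rfl
  have h4 : starVec src tgt w = s • M.dual.act g (starVec src tgt v) := by
    rw [← map_smul, ← h3, M.dual.act_act_inv]
  have hs0 : s ≠ 0 := by
    rintro rfl
    rw [zero_smul] at h4
    exact starVec_ne_zero hconn hw (congrFun h4 _)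
  refine ⟨w, s⁻¹, hw, ?_⟩
  rw [h4, smul_smul, inv_mul_cancel₀ hs0, one_smul]

/-- In the absence of tight sets, the signs of the action on the vertex stars give a character. -/
theorem exists_char_of_rigid :
    ∃ χ : Γ →* ℤˣ, ∀ g, M.IsNeg g → χ g = -1 := by
  have : Nontrivial E := Fintype.one_lt_card_iff_nontrivial.1 (by omega)
  obtain ⟨e₀⟩ := (inferInstance : Nonempty E)
  let touched : V → Prop := fun v => ∃ e, e ∈ star src tgt v
  have hprop : ∀ (v w : V) (r : ℚ), touched v → touched w →
      starVec src tgt v = r • starVec src tgt w → v = w := by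
    rintro v w r ⟨e, he⟩ - h
    by_contra hvw
    refine not_star_subset hconn hrigid hcard (Ne.symm hvw) he fun f hf => ?_
    by_contra hfw
    have := congrFun h f
    rw [Pi.smul_apply, starVec_eq_zero hfw, smul_zero] at this
    exact starVec_ne_zero hconn hf this
  have hne : ∀ (g : Γ) (v : V), touched v → M.dual.act g (starVec src tgt v) ≠ 0 := by
    rintro g v ⟨e, he⟩ h0
    have h1 := congrArg (M.dual.act g⁻¹) h0
    rw [M.dual.act_inv_act, map_zero] at h1
    exact starVec_ne_zero hconn he (congrFun h1 e)
  have hends : ∀ e, starVec src tgt (src e) e = -1 ∧ starVec src tgt (tgt e) e = 1 := fun e => by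
    have := src_ne_tgt hconn e
    simp [starVec, this, this.symm]
  -- One scalar for all vertices is required, so that it is canonical and multiplicative in g.
  -- Vertices without edges have zero coboundary and are excluded.
  let P : Γ → ℚ → Prop := fun g s => ∀ v, touched v → ∃ w, touched w ∧
    M.dual.act g (starVec src tgt v) = s • starVec src tgt w
  suffices h : ∃ χ : Γ →* ℤˣ, ∀ g, P g (-1) → χ g = -1 by
    obtain ⟨χ, hχ⟩ := h
    refine ⟨χ, fun g hg => hχ g fun v hv => ⟨v, hv, ?_⟩⟩
    rw [hg.dual, neg_one_smul]
  refine exists_sign_char P ?_ ?_ ?_ ?_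
  · intro g
    have hex : ∀ v, ∃ s : ℚ, touched v → ∃ w, touched w ∧
        M.dual.act g (starVec src tgt v) = s • starVec src tgt w := by
      intro v
      by_cases hv : touched v
      · obtain ⟨e, he⟩ := hv
        obtain ⟨w, s, hw, h⟩ := exists_dual_act_starVec hconn hrigid hcard M hM g he
        exact ⟨s, fun _ => ⟨w, ⟨_, hw⟩, h⟩⟩
      · exact ⟨0, fun h => absurd h hv⟩
    choose s hs using hex
    -- The coboundaries of the two ends take the opposite values −1 and 1 at an edge. The images of
    -- the ends are the two distinct ends of the image edge, where the values are again opposite, so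
    -- the scalars agree.
    have hedge : ∀ e, s (src e) = s (tgt e) := by
      intro e
      obtain ⟨w, s₁, hw, h1⟩ := exists_dual_act_starVec hconn hrigid hcard M hM g
        (v := src e) (e₀ := e) (Or.inl rfl)
      obtain ⟨w', s₂, hw', h2⟩ := exists_dual_act_starVec hconn hrigid hcard M hM g
        (v := tgt e) (e₀ := e) (Or.inr rfl)
      have huniq : ∀ (v w : V) (s₁ : ℚ), touched v → touched w →
          M.dual.act g (starVec src tgt v) = s₁ • starVec src tgt w → s v = s₁ := by
        intro v w s₁ hv hw h
        obtain ⟨w', hw', h'⟩ := hs v hv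
        have hs0 : s v ≠ 0 := fun h0 => hne g v hv (by rw [h', h0, zero_smul])
        have h3 := h'.symm.trans h
        have h4 : w' = w := hprop w' w ((s v)⁻¹ * s₁) hw' hw (by
          rw [mul_smul, ← h3, smul_smul, inv_mul_cancel₀ hs0, one_smul])
        subst h4
        obtain ⟨f, hf⟩ := hw
        exact mul_right_cancel₀ (starVec_ne_zero hconn hf) (congrFun h3 f)
      have hA := huniq _ w s₁ ⟨e, Or.inl rfl⟩ ⟨_, hw⟩ h1
      have hB := huniq _ w' s₂ ⟨e, Or.inr rfl⟩ ⟨_, hw'⟩ h2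
      have hww : w ≠ w' := by
        rintro rfl
        have hs2 : s₂ ≠ 0 := fun h0 => hne g (tgt e) ⟨e, Or.inr rfl⟩ (by rw [h2, h0, zero_smul])
        have h3 : M.dual.act g (starVec src tgt (src e) - (s₁ / s₂) • starVec src tgt (tgt e)) = 0 := by
          rw [map_sub, map_smul, h1, h2, smul_smul, div_mul_cancel₀ _ hs2, sub_self]
        have h4 := congrArg (M.dual.act g⁻¹) h3
        rw [M.dual.act_inv_act, map_zero, sub_eq_zero] at h4
        exact src_ne_tgt hconn e (hprop _ _ _ ⟨e, Or.inl rfl⟩ ⟨e, Or.inr rfl⟩ h4)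
      have h5 := M.dual.act_apply g (starVec src tgt (src e)) e
      have h6 := M.dual.act_apply g (starVec src tgt (tgt e)) e
      change M.dual.act g _ (M.perm g e) = _ at h5 h6
      rw [h1, (hends e).1] at h5
      rw [h2, (hends e).2] at h6
      have h7 : s₁ * (starVec src tgt w (M.perm g e)) + s₂ * starVec src tgt w' (M.perm g e) = 0 := by
        have h5' : s₁ * starVec src tgt w (M.perm g e) = M.dual.coef g e * -1 := h5
        have h6' : s₂ * starVec src tgt w' (M.perm g e) = M.dual.coef g e * 1 := h6
        rw [h5', h6']
        ring
      rw [hA, hB]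
      rcases hw with hw | hw <;> rcases hw' with hw' | hw'
      · exact absurd (hw.symm.trans hw') hww
      · rw [← hw, ← hw', (hends _).1, (hends _).2] at h7
        linarith
      · rw [← hw, ← hw', (hends _).1, (hends _).2] at h7
        linarith
      · exact absurd (hw.symm.trans hw') hww
    refine ⟨s (src e₀), fun v hv => ?_⟩
    have hsv : s (src e₀) = s v := by
      by_cases hvt : v = tgt e₀
      · rw [hvt, hedge]
      · obtain ⟨e, he⟩ := hv
        have hn := src_ne_tgt hconn e₀
        exact eq_of_joined (fun e _ => hedge e)
          (joined_compl_star hconn hrigid hn hn hvt hvt (e := e₀) (Or.inl rfl) he)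
    rw [hsv]
    exact hs v hv
  · intro g s s' h h'
    obtain ⟨w, hw, h1⟩ := h (src e₀) ⟨e₀, Or.inl rfl⟩
    obtain ⟨w', hw', h2⟩ := h' (src e₀) ⟨e₀, Or.inl rfl⟩
    have hs0 : s ≠ 0 := fun h0 => hne g (src e₀) ⟨e₀, Or.inl rfl⟩ (by rw [h1, h0, zero_smul])
    have h3 := h1.symm.trans h2
    have h4 : w = w' := hprop w w' (s⁻¹ * s') hw hw' (by
      rw [mul_smul, ← h3, smul_smul, inv_mul_cancel₀ hs0, one_smul])
    subst h4
    obtain ⟨f, hf⟩ := hw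
    exact mul_right_cancel₀ (starVec_ne_zero hconn hf) (congrFun h3 f)
  · intro g g' s s' h h' v hv
    obtain ⟨w, hw, h1⟩ := h' v hv
    obtain ⟨x, hx, h2⟩ := h w hw
    refine ⟨x, hx, ?_⟩
    rw [M.dual.act_mul, h1, map_smul, h2, smul_smul, mul_comm]
  · intro v hv
    exact ⟨v, hv, by rw [M.dual.act_one, one_smul]⟩

end threeConnected

end EdgeFlow

/-! ### Gluing lines and their contraction to single edges -/

section oneDim

variable {E : Type*} {Λ : Submodule ℚ (E → ℚ)}

theorem IsOneDim.of_sub_mem {X : Set E} {a b : E → ℚ} (h : IsOneDim Λ X a) (hb : X.indicator b = b)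
    {c : ℚ} (hab : a - c • b ∈ Λ) : IsOneDim Λ X b := by
  refine ⟨hb, fun k hk => ?_⟩
  obtain ⟨t, ht⟩ := h.2 k hk
  refine ⟨t * c, ?_⟩
  convert Λ.add_mem ht (Λ.smul_mem t hab) using 1
  rw [smul_sub, smul_smul]
  abel

/-- A spanning vector of the gluing line with minimal support. -/
theorem IsOneDim.exists_minimal [Finite E] {X : Set E} {a : E → ℚ} (h : IsOneDim Λ X a)
    (ha : a ∉ Λ) : ∃ (b : E → ℚ) (e : E), IsOneDim Λ X b ∧ b ∉ Λ ∧ b e = 1 ∧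
      ∀ k ∈ Λ, (∀ f, b f = 0 → k f = 0) → k = 0 := by
  let S : Set (E → ℚ) := {b | IsOneDim Λ X b ∧ b ∉ Λ}
  obtain ⟨b, ⟨hb, hbΛ⟩, hmin⟩ := exists_minimalFor_of_wellFoundedLT (fun b => b ∈ S)
    (fun b : E → ℚ => (Function.support b).ncard) ⟨a, h, ha⟩
  have hk : ∀ k ∈ Λ, (∀ f, b f = 0 → k f = 0) → k = 0 := by
    intro k hk hsupp
    by_contra hk0
    obtain ⟨f, hf⟩ := Function.ne_iff.1 hk0
    set b' := b - (b f / k f) • k with hb'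
    have hb'S : b' ∈ S := by
      refine ⟨hb.of_sub_mem (c := 1) ?_ (by
        rw [one_smul, hb', sub_sub_cancel]
        exact Λ.smul_mem _ hk), fun hmem => hbΛ ?_⟩
      · rw [indicator_eq_self_iff]
        intro e he
        have h0 := indicator_eq_self_iff.1 hb.1 e he
        simp [hb', h0, hsupp e h0]
      · have := Λ.add_mem hmem (Λ.smul_mem (b f / k f) hk)
        rwa [hb', sub_add_cancel] at this
    have hlt : (Function.support b').ncard < (Function.support b).ncard := by
      refine Set.ncard_lt_ncard (Set.ssubset_iff_subset_ne.2 ⟨fun e he hbe => he ?_, fun heq => ?_⟩)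
        (Set.toFinite _)
      · simp [hb', hbe, hsupp e hbe]
      · have h1 : f ∈ Function.support b := fun h0 => hf (hsupp f h0)
        rw [← heq] at h1
        exact h1 (by simp [hb', div_mul_cancel₀ _ hf])
    exact absurd (hmin hb'S hlt.le) (not_le.2 hlt)
  obtain ⟨e, he⟩ : ∃ e, b e ≠ 0 := by
    by_contra! h0
    exact hbΛ ((funext h0 : b = 0) ▸ Λ.zero_mem)
  refine ⟨(b e)⁻¹ • b, e, hb.of_sub_mem (c := b e) ?_ ?_, fun hmem => hbΛ ?_, ?_, fun k hkΛ hs => ?_⟩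
  · rw [indicator_smul_rat, hb.1]
  · rw [smul_smul, mul_inv_cancel₀ he, one_smul, sub_self]
    exact Λ.zero_mem
  · exact (Λ.smul_mem_iff (inv_ne_zero he)).1 hmem
  · simp [he]
  · exact hk k hkΛ fun f hf => hs f (by simp [hf])

/-- By connectedness some vector of `Λ` does not split along `X`; its restriction spans the gluing
line modulo `Λ`, so the line is unique. -/
theorem IsOneDim.exists_sub_smul_mem (hconn : IsConn Λ) {X : Set E} {a b : E → ℚ}
    (ha : IsOneDim Λ X a) (hb : IsOneDim Λ X b) (h0 : X.Nonempty) (h1 : X ≠ Set.univ) :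
    ∃ c : ℚ, a - c • b ∈ Λ := by
  obtain ⟨h, hh, hne⟩ : ∃ h ∈ Λ, X.indicator h ∉ Λ := by
    by_contra! hall
    rcases hconn X hall with h | h
    · exact h0.ne_empty h
    · exact h1 h
  obtain ⟨t, ht⟩ := ha.2 h hh
  obtain ⟨r, hr⟩ := hb.2 h hh
  have ht0 : t ≠ 0 := by
    rintro rfl
    rw [zero_smul, sub_zero] at ht
    exact hne ht
  refine ⟨t⁻¹ * r, ?_⟩
  convert Λ.smul_mem t⁻¹ (Λ.sub_mem hr ht) using 1
  rw [sub_sub_sub_cancel_left, smul_sub, smul_smul, smul_smul, inv_mul_cancel₀ ht0, one_smul]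

theorem IsOneDim.act {Γ : Type*} [Group Γ] (M : MonomialAction Γ E)
    (hM : ∀ g, ∀ h ∈ Λ, M.act g h ∈ Λ) {X : Set E} {a : E → ℚ} (h : IsOneDim Λ X a) (g : Γ) :
    IsOneDim Λ (M.perm g '' X) (M.act g a) := by
  refine ⟨by rw [← M.act_indicator, h.1], fun k hk => ?_⟩
  obtain ⟨t, ht⟩ := h.2 _ (hM g⁻¹ k hk)
  refine ⟨t, ?_⟩
  have h1 := hM g _ ht
  rwa [map_sub, map_smul, M.act_indicator, M.act_act_inv] at h1

end oneDim

namespace EdgeFlow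

universe u v

variable {V : Type v} {E : Type u} {src tgt : E → V} [Fintype E] [Fintype V] {Γ : Type*} [Group Γ]

/-- Replacing the classes of an invariant partition into one-dimensionally glued sets by single
edges. -/
theorem exists_quotient (hconn : IsConn (cycles src tgt)) (M : MonomialAction Γ E)
    (hM : ∀ g, ∀ h ∈ cycles src tgt, M.act g h ∈ cycles src tgt) (s : Setoid E)
    (hs : ∀ g e f, s e f → s (M.perm g e) (M.perm g f))
    (hdim : ∀ A : Quotient s, ∃ a, IsOneDim (cycles src tgt) {f | Quotient.mk s f = A} a)
    (hproper : ∀ A : Quotient s, {f | Quotient.mk s f = A} ≠ Set.univ) :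
    ∃ (V' : Type v) (_ : Fintype V') (src' tgt' : Quotient s → V')
      (_ : Fintype (Quotient s)) (M' : MonomialAction Γ (Quotient s)),
      IsConn (cycles src' tgt') ∧
      (∀ g, ∀ h ∈ cycles src' tgt', M'.act g h ∈ cycles src' tgt') ∧
      ∀ g, M.IsNeg g → M'.IsNeg g := by
  classical
  set Λ := cycles src tgt with hΛ
  let cls : Quotient s → Set E := fun A => {f | Quotient.mk s f = A}
  have hclsne : ∀ A, (cls A).Nonempty := fun A => Quotient.exists_rep A
  have hex : ∀ A : Quotient s, ∃ (b : E → ℚ) (e : E), IsOneDim Λ (cls A) b ∧ b ∉ Λ ∧ b e = 1 ∧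
      ∀ k ∈ Λ, (∀ f, b f = 0 → k f = 0) → k = 0 := fun A => by
    obtain ⟨a, ha⟩ := hdim A
    exact ha.exists_minimal (ha.notMem hconn (hclsne A) (hproper A))
  choose a e₀ ha haΛ hae hamin using hex
  have hasupp : ∀ A f, Quotient.mk s f ≠ A → a A f = 0 := fun A f hf =>
    indicator_eq_self_iff.1 (ha A).1 f hf
  have he₀ : ∀ A, Quotient.mk s (e₀ A) = A := fun A => by
    by_contra h
    have := hasupp A _ h
    rw [hae] at this
    exact one_ne_zero this
  -- A value on a class is spread over its edges along the chosen spanning vector of the gluing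
  -- line.
  let emb : (Quotient s → ℚ) →ₗ[ℚ] (E → ℚ) := ∑ A, (LinearMap.proj A).smulRight (a A)
  have hemb : ∀ t, emb t = ∑ A, t A • a A := fun t => by
    simp [emb]
  have hembf : ∀ t f, emb t f = t (Quotient.mk s f) * a (Quotient.mk s f) f := fun t f => by
    rw [hemb, Finset.sum_apply, Finset.sum_eq_single (Quotient.mk s f)]
    · simp
    · intro B _ hB
      simp [hasupp B f hB.symm]
    · simp
  have hsumcls : ∀ h : E → ℚ, h = ∑ A, (cls A).indicator h := fun h => by
    ext f
    rw [Finset.sum_apply, Finset.sum_eq_single (Quotient.mk s f)]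
    · rw [Set.indicator_of_mem]
      rfl
    · intro B _ hB
      rw [Set.indicator_of_notMem]
      exact fun h => hB h.symm
    · simp
  -- the contracted graph
  let T : Set E := {f | a (Quotient.mk s f) f ≠ 0 ∧ f ≠ e₀ (Quotient.mk s f)}
  let J := joined src tgt T
  let src' : Quotient s → Quotient J := fun A => Quotient.mk J (src (e₀ A))
  let tgt' : Quotient s → Quotient J := fun A => Quotient.mk J (tgt (e₀ A))
  let base : (Quotient s → ℚ) → (E → ℚ) := fun t => ∑ A, Pi.single (e₀ A) (t A)
  have hbase : ∀ t f, base t f = if f = e₀ (Quotient.mk s f) then t (Quotient.mk s f) else 0 := by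
    intro t f
    simp only [base, Finset.sum_apply]
    rw [Finset.sum_eq_single (Quotient.mk s f)]
    · simp [Pi.single_apply]
    · intro B _ hB
      rw [Pi.single_eq_of_ne]
      rintro rfl
      exact hB (he₀ B).symm
    · simp
  have hpush : ∀ t u, bdry src' tgt' t (Quotient.mk J u) =
      ∑ v, (if J u v then bdry src tgt (base t) v else 0) := by
    intro t u
    have h1 := sum_mul_bdry src tgt (fun v => if J u v then (1 : ℚ) else 0) (base t)
    simp only [ite_mul, one_mul, zero_mul] at h1
    rw [h1, bdry_apply]
    simp only [base, Finset.sum_apply, Finset.sum_mul]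
    rw [Finset.sum_comm]
    refine Finset.sum_congr rfl fun A _ => ?_
    rw [Finset.sum_eq_single (e₀ A)]
    · rw [Pi.single_eq_same]
      have hiff : ∀ x, (Quotient.mk J x = Quotient.mk J u) ↔ J u x := fun x =>
        ⟨fun h => J.symm (Quotient.exact h), fun h => Quotient.sound (J.symm h)⟩
      simp only [src', tgt', hiff]
    · intro f _ hf
      rw [Pi.single_eq_of_ne hf, zero_mul]
    · simp
  -- In each class the edge `e₀ A` is kept, the other edges in the support of `a A` are contracted,
  -- and those outside it are deleted. A cycle of the new graph lifts through the contracted edges.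
  have hcyc : ∀ t, t ∈ cycles src' tgt' ↔ emb t ∈ Λ := by
    intro t
    constructor
    · intro ht
      rw [mem_cycles] at ht
      obtain ⟨y, hyT, hy⟩ := exists_flow_of_sum_eq_zero (src := src) (tgt := tgt) T
        (-bdry src tgt (base t)) (fun u => by
          have h1 := hpush t u
          rw [ht, Pi.zero_apply] at h1
          rw [← neg_eq_zero, ← Finset.sum_neg_distrib]
          refine Eq.trans (Finset.sum_congr rfl fun v _ => ?_) h1.symm
          by_cases h : joined src tgt T u v
          · rw [if_pos h, if_pos h, Pi.neg_apply, neg_neg]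
          · rw [if_neg h, if_neg h, neg_zero])
      set k := base t + y with hk
      have hkΛ : k ∈ Λ := mem_cycles.2 (by rw [hk, map_add, hy, add_neg_cancel])
      have hke : ∀ A, k (e₀ A) = t A := fun A => by
        rw [hk, Pi.add_apply, hbase, hyT (e₀ A) (fun h => h.2 (by rw [he₀])), he₀, if_pos rfl,
          add_zero]
      have hk0 : ∀ f, a (Quotient.mk s f) f = 0 → k f = 0 := fun f hf => by
        rw [hk, Pi.add_apply, hbase, hyT f (fun h => h.1 hf), if_neg, add_zero]
        intro h
        rw [h, he₀, hae] at hf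
        exact one_ne_zero hf
      have hkeq : k = emb t := by
        rw [hsumcls k, hemb]
        refine Finset.sum_congr rfl fun A _ => ?_
        obtain ⟨r, hr⟩ := (ha A).2 k hkΛ
        -- Minimality of the support makes the lift a multiple of `a A` exactly, not only modulo
        -- `Λ`.
        have h2 := hamin A _ hr (fun f hf => by
          rw [Pi.sub_apply, Pi.smul_apply, hf, smul_zero, sub_zero]
          by_cases hfA : f ∈ cls A
          · rw [Set.indicator_of_mem hfA]
            apply hk0
            rw [show Quotient.mk s f = A from hfA, hf]
          · rw [Set.indicator_of_notMem hfA])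
        rw [sub_eq_zero] at h2
        have h3 := congrFun h2 (e₀ A)
        rw [Set.indicator_of_mem (show e₀ A ∈ cls A from he₀ A), hke, Pi.smul_apply, hae,
          smul_eq_mul, mul_one] at h3
        rw [h2, h3]
      rw [← hkeq]
      exact hkΛ
    · intro ht
      rw [mem_cycles] at ht ⊢
      ext u'
      obtain ⟨u, rfl⟩ := Quotient.exists_rep u'
      have h1 := sum_bdry_class_eq_zero (src := src) (tgt := tgt) T (emb t - base t) (fun f hf => by
        rw [Pi.sub_apply, hembf, hbase]
        by_cases h : f = e₀ (Quotient.mk s f)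
        · rw [if_pos h]
          have : a (Quotient.mk s f) f = 1 := by
            conv_lhs => rw [h, he₀]
            exact hae _
          rw [this, mul_one, sub_self]
        · rw [if_neg h]
          have : a (Quotient.mk s f) f = 0 := by
            by_contra h0
            exact hf ⟨h0, h⟩
          rw [this, mul_zero, sub_zero]) u
      rw [map_sub, ht] at h1
      rw [hpush, Pi.zero_apply, ← neg_eq_zero, ← Finset.sum_neg_distrib]
      refine Eq.trans (Finset.sum_congr rfl fun v _ => ?_) h1
      by_cases h : joined src tgt T u v
      · rw [if_pos h, if_pos h]
        simp
      · rw [if_neg h, if_neg h, neg_zero]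
  have hconn' : IsConn (cycles src' tgt') := by
    intro X' hX'
    have key : ∀ h ∈ Λ, {f | Quotient.mk s f ∈ X'}.indicator h ∈ Λ := by
      intro h hh
      choose t ht using fun A => (ha A).2 h hh
      have h1 : emb t ∈ Λ := by
        have h2 := Λ.sub_mem hh (Λ.sum_mem fun A (_ : A ∈ Finset.univ) => ht A)
        rwa [Finset.sum_sub_distrib, ← hsumcls, sub_sub_cancel, ← hemb] at h2
      have h3 := (hcyc _).1 (hX' t ((hcyc t).2 h1))
      have h4 := Λ.add_mem (Λ.sum_mem fun A (_ : A ∈ Finset.univ.filter (· ∈ X')) => ht A) h3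
      convert h4 using 1
      rw [Finset.sum_sub_distrib, hemb, Finset.sum_filter (p := (· ∈ X'))
        (f := fun A => t A • a A)]
      have h5 : ∑ A, X'.indicator t A • a A = ∑ A, if A ∈ X' then t A • a A else 0 :=
        Finset.sum_congr rfl fun A _ => by
          by_cases hA : A ∈ X'
          · rw [Set.indicator_of_mem hA, if_pos hA]
          · rw [Set.indicator_of_notMem hA, if_neg hA, zero_smul]
      rw [h5, sub_add_cancel]
      ext f
      rw [Finset.sum_apply, Finset.sum_filter]
      rw [Finset.sum_eq_single (Quotient.mk s f)]
      · by_cases hA : Quotient.mk s f ∈ X'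
        · rw [Set.indicator_of_mem (show f ∈ {f | Quotient.mk s f ∈ X'} from hA), if_pos hA,
            Set.indicator_of_mem (show f ∈ cls (Quotient.mk s f) from rfl)]
        · rw [Set.indicator_of_notMem (show f ∉ {f | Quotient.mk s f ∈ X'} from hA), if_neg hA]
      · intro B _ hB
        rw [Set.indicator_of_notMem (show f ∉ cls B from fun h => hB h.symm), ite_self]
      · simp
    rcases hconn _ key with h | h
    · left
      rw [Set.eq_empty_iff_forall_notMem] at h ⊢
      rintro ⟨f⟩ hf
      exact h f hf
    · right
      rw [Set.eq_univ_iff_forall] at h ⊢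
      rintro ⟨f⟩
      exact h f
  let q : Γ → Quotient s → Quotient s := fun g => Quotient.map (M.perm g) (hs g)
  have hqmul : ∀ g g' A, q (g * g') A = q g (q g' A) := by
    rintro g g' ⟨e⟩
    change Quotient.mk s (M.perm (g * g') e) = Quotient.mk s (M.perm g (M.perm g' e))
    rw [map_mul, Equiv.Perm.mul_apply]
  have hqone : ∀ A, q 1 A = A := by
    rintro ⟨e⟩
    change Quotient.mk s (M.perm 1 e) = Quotient.mk s e
    rw [map_one, Equiv.Perm.one_apply]
  let perm' : Γ →* Equiv.Perm (Quotient s) :=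
    { toFun := fun g => ⟨q g, q g⁻¹, fun A => by rw [← hqmul, inv_mul_cancel, hqone],
        fun A => by rw [← hqmul, mul_inv_cancel, hqone]⟩
      map_one' := Equiv.ext hqone
      map_mul' := fun g g' => Equiv.ext (hqmul g g') }
  have himage : ∀ g A, M.perm g '' cls A = cls (perm' g A) := by
    intro g A
    ext f
    constructor
    · rintro ⟨e, rfl, rfl⟩
      rfl
    · intro hf
      refine ⟨M.perm g⁻¹ f, ?_, ?_⟩
      · change q g⁻¹ (Quotient.mk s f) = A
        rw [show Quotient.mk s f = q g A from hf, ← hqmul, inv_mul_cancel, hqone]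
      · rw [map_inv]
        exact (M.perm g).apply_symm_apply f
  -- The group carries gluing lines to gluing lines; the scalars modulo `Λ` are the coefficients of
  -- the new monomial action.
  have hcoef : ∀ g A, ∃ c : ℚ, M.act g (a A) - c • a (perm' g A) ∈ Λ := by
    intro g A
    have h1 := (ha A).act M hM g
    rw [himage] at h1
    exact h1.exists_sub_smul_mem hconn (ha _) (hclsne _) (hproper _)
  choose coef hcoef using hcoef
  have huniq : ∀ A (c c' : ℚ), c • a A - c' • a A ∈ Λ → c = c' := by
    intro A c c' h
    rw [← sub_smul] at h
    by_contra hne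
    exact haΛ A ((Λ.smul_mem_iff (sub_ne_zero.2 hne)).1 h)
  let M' : MonomialAction Γ (Quotient s) :=
    { perm := perm'
      coef := coef
      coef_one := fun A => by
        refine huniq A _ _ ?_
        have h1 := hcoef 1 A
        rw [M.act_one, map_one, Equiv.Perm.one_apply] at h1
        rw [← neg_sub, one_smul]
        exact Λ.neg_mem h1
      coef_mul := fun g g' A => by
        refine huniq (perm' (g * g') A) _ _ ?_
        have h1 := hcoef (g * g') A
        have h2 := hM g _ (hcoef g' A)
        have h3 := Λ.smul_mem (coef g' A) (hcoef g (perm' g' A))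
        have h4 := Λ.sub_mem (Λ.add_mem h2 h3) h1
        convert h4 using 1
        rw [M.act_mul, map_sub, map_smul, map_mul, Equiv.Perm.mul_apply, mul_smul, smul_sub,
          smul_comm (coef g (perm' g' A))]
        abel }
  refine ⟨Quotient J, inferInstance, src', tgt', inferInstance, M', hconn', ?_, ?_⟩
  · intro g t ht
    rw [hcyc] at ht ⊢
    have h1 := Λ.sum_mem fun A (_ : A ∈ Finset.univ) => Λ.smul_mem (t A) (hcoef g A)
    have h2 := Λ.sub_mem (hM g _ ht) h1
    convert h2 using 1
    rw [hemb, hemb, map_sum, ← Finset.sum_sub_distrib, ← Equiv.sum_comp (M'.perm g)]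
    refine Finset.sum_congr rfl fun A _ => ?_
    rw [M'.act_apply, map_smul, smul_sub, sub_sub_cancel, smul_smul, mul_comm]
  · intro g hg
    have hfix : ∀ A, perm' g A = A := by
      rintro ⟨e⟩
      exact congrArg (Quotient.mk s) (hg.perm_eq_and_coef_eq e).1
    intro t
    rw [M'.act_eq_iff]
    intro A
    have h1 : coef g A = -1 := by
      refine huniq A _ _ ?_
      have h2 := hcoef g A
      rw [hg, hfix] at h2
      convert Λ.neg_mem h2 using 1
      simp
    change -t (perm' g A) = coef g A * t A
    rw [hfix, h1]
    ring

end EdgeFlow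

/-! ### Parallel and series classes -/

section parallelSeries

variable {E : Type*} {Λ : Submodule ℚ (E → ℚ)}

open Classical in
/-- The relation of being proportional modulo `Λ`. -/
noncomputable def parallelSetoid (Λ : Submodule ℚ (E → ℚ)) : Setoid E where
  r e f := ∃ s : ℚ, s ≠ 0 ∧ Pi.single e (1 : ℚ) - s • Pi.single f (1 : ℚ) ∈ Λ
  iseqv :=
    { refl := fun e => ⟨1, one_ne_zero, by simp⟩
      symm := by
        rintro e f ⟨s, hs, h⟩
        refine ⟨s⁻¹, inv_ne_zero hs, ?_⟩
        convert Λ.smul_mem (-s⁻¹) h using 1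
        rw [smul_sub, smul_smul, neg_mul, inv_mul_cancel₀ hs, neg_smul, neg_smul, one_smul]
        abel
      trans := by
        rintro e f g ⟨s, hs, h⟩ ⟨t, ht, h'⟩
        refine ⟨s * t, mul_ne_zero hs ht, ?_⟩
        convert Λ.add_mem h (Λ.smul_mem s h') using 1
        rw [smul_sub, smul_smul]
        abel }

/-- The relation of being proportional as functionals on `Λ`. -/
def seriesSetoid (Λ : Submodule ℚ (E → ℚ)) : Setoid E where
  r e f := ∃ s : ℚ, s ≠ 0 ∧ ∀ h ∈ Λ, h e = s * h f
  iseqv :=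
    { refl := fun e => ⟨1, one_ne_zero, by simp⟩
      symm := by
        rintro e f ⟨s, hs, h⟩
        refine ⟨s⁻¹, inv_ne_zero hs, fun k hk => ?_⟩
        rw [h k hk, inv_mul_cancel_left₀ hs]
      trans := by
        rintro e f g ⟨s, hs, h⟩ ⟨t, ht, h'⟩
        exact ⟨s * t, mul_ne_zero hs ht, fun k hk => by rw [h k hk, h' k hk, mul_assoc]⟩ }

/-- Modulo `Λ` every unit vector of the class is a multiple of one of them. -/
theorem isOneDim_parallel_class [Fintype E] (A : Quotient (parallelSetoid Λ)) :
    ∃ a, IsOneDim Λ {f | Quotient.mk (parallelSetoid Λ) f = A} a := by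
  classical
  obtain ⟨e₀, rfl⟩ := Quotient.exists_rep A
  have hex : ∀ f, ∃ s : ℚ, Quotient.mk (parallelSetoid Λ) f = Quotient.mk (parallelSetoid Λ) e₀ →
      Pi.single f (1 : ℚ) - s • Pi.single e₀ (1 : ℚ) ∈ Λ := by
    intro f
    by_cases h : Quotient.mk (parallelSetoid Λ) f = Quotient.mk (parallelSetoid Λ) e₀
    · obtain ⟨s, _, hs⟩ := Quotient.exact h
      refine ⟨s, fun _ => ?_⟩
      convert hs
    · exact ⟨0, fun h' => absurd h' h⟩
  choose s hs using hex
  refine ⟨Pi.single e₀ 1, indicator_eq_self_iff.2 fun x hx => ?_, fun h _ =>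
    ⟨∑ f with Quotient.mk (parallelSetoid Λ) f = Quotient.mk (parallelSetoid Λ) e₀, h f * s f, ?_⟩⟩
  · rw [Pi.single_eq_of_ne]
    rintro rfl
    exact hx rfl
  · have h1 := Λ.sum_mem (t := Finset.univ.filter fun f =>
      Quotient.mk (parallelSetoid Λ) f = Quotient.mk (parallelSetoid Λ) e₀) fun f hf =>
      Λ.smul_mem (h f) (hs f (Finset.mem_filter.1 hf).2)
    convert h1 using 1
    simp only [smul_sub, Finset.sum_sub_distrib, smul_smul, ← Finset.sum_smul]
    congr 1
    ext x
    rw [Finset.sum_apply, Finset.sum_filter, Finset.sum_eq_single x]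
    · simp [Set.indicator_apply]
    · intro f _ hf
      simp [hf.symm]
    · simp

/-- All vectors of `Λ` restrict to multiples of one vector of ratios on the class. -/
theorem isOneDim_series_class (A : Quotient (seriesSetoid Λ)) :
    ∃ a, IsOneDim Λ {f | Quotient.mk (seriesSetoid Λ) f = A} a := by
  classical
  obtain ⟨e₀, rfl⟩ := Quotient.exists_rep A
  have hex : ∀ f, ∃ s : ℚ, Quotient.mk (seriesSetoid Λ) f = Quotient.mk (seriesSetoid Λ) e₀ →
      ∀ h ∈ Λ, h f = s * h e₀ := by
    intro f
    by_cases h : Quotient.mk (seriesSetoid Λ) f = Quotient.mk (seriesSetoid Λ) e₀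
    · obtain ⟨s, _, hs⟩ := Quotient.exact h
      exact ⟨s, fun _ => hs⟩
    · exact ⟨0, fun h' => absurd h' h⟩
  choose s hs using hex
  refine ⟨Set.indicator _ s, by rw [Set.indicator_indicator, Set.inter_self], fun h hh =>
    ⟨h e₀, ?_⟩⟩
  convert Λ.zero_mem
  rw [← indicator_smul_rat, ← Set.indicator_sub']
  ext f
  by_cases hf : f ∈ {f | Quotient.mk (seriesSetoid Λ) f = Quotient.mk (seriesSetoid Λ) e₀}
  · rw [Set.indicator_of_mem hf]
    simp only [Pi.sub_apply, Pi.smul_apply, smul_eq_mul, Pi.zero_apply]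
    rw [hs f hf h hh]
    ring
  · rw [Set.indicator_of_notMem hf]
    rfl

theorem isOneDim_singleton (e : E) : ∃ a, IsOneDim Λ {e} a := by
  classical
  refine ⟨Pi.single e 1, indicator_eq_self_iff.2 fun x hx => ?_, fun h _ => ⟨h e, ?_⟩⟩
  · exact Pi.single_eq_of_ne (fun h => hx h) _
  · convert Λ.zero_mem
    ext f
    by_cases hf : f = e
    · subst hf
      simp
    · simp [hf]

/-- If `Λ` has a nonzero vector supported on the pair, the edges are parallel. If not, restrictions
to the pair lie exactly on the line of `a`, which gives a fixed ratio of the two coordinates. -/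
theorem IsOneDim.parallel_or_series (hconn : IsConn Λ) {e f : E} (hef : e ≠ f) {a : E → ℚ}
    (ha : IsOneDim Λ {e, f} a) : parallelSetoid Λ e f ∨ seriesSetoid Λ e f := by
  classical
  have : Nontrivial E := ⟨e, f, hef⟩
  by_cases h0 : ∃ k ∈ Λ, k ≠ 0 ∧ ∀ x ∉ ({e, f} : Set E), k x = 0
  · left
    obtain ⟨k, hk, hk0, hsupp⟩ := h0
    have h1 : k = k e • Pi.single e (1 : ℚ) + k f • Pi.single f (1 : ℚ) := by
      ext x
      by_cases hxe : x = e
      · subst hxe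
        simp [hef]
      · by_cases hxf : x = f
        · subst hxf
          simp [hxe]
        · rw [hsupp x (by simp [hxe, hxf])]
          simp [hxe, hxf]
    have he : k e ≠ 0 := by
      intro he
      rw [he, zero_smul, zero_add] at h1
      have hf : k f ≠ 0 := by
        intro hf
        rw [hf, zero_smul] at h1
        exact hk0 h1
      rw [h1, Λ.smul_mem_iff hf] at hk
      exact single_notMem hconn f hk
    have hf : k f ≠ 0 := by
      intro hf
      rw [hf, zero_smul, add_zero] at h1
      rw [h1, Λ.smul_mem_iff he] at hk
      exact single_notMem hconn e hk
    refine ⟨-((k e)⁻¹ * k f), neg_ne_zero.2 (mul_ne_zero (inv_ne_zero he) hf), ?_⟩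
    have h2 := Λ.smul_mem (k e)⁻¹ hk
    rw [h1, smul_add, smul_smul, smul_smul] at h2
    simp only [Pi.add_apply, Pi.smul_apply, Pi.single_eq_same, Pi.single_eq_of_ne hef,
      smul_eq_mul, mul_one, mul_zero, add_zero] at h2
    rw [inv_mul_cancel₀ he, one_smul] at h2
    convert h2 using 1
    rw [neg_smul, sub_neg_eq_add]
  · right
    push Not at h0
    have key : ∀ h ∈ Λ, ∃ t : ℚ, h e = t * a e ∧ h f = t * a f := by
      intro h hh
      obtain ⟨t, ht⟩ := ha.2 h hh
      have h1 : ({e, f} : Set E).indicator h - t • a = 0 := by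
        by_contra hne
        obtain ⟨x, hx, hx0⟩ := h0 _ ht hne
        rw [← ha.1, ← indicator_smul_rat, ← Set.indicator_sub', Set.indicator_of_notMem hx] at hx0
        exact hx0 rfl
      refine ⟨t, ?_, ?_⟩
      · have := congrFun h1 e
        simp at this
        linarith
      · have := congrFun h1 f
        simp at this
        linarith
    have hae : a e ≠ 0 := by
      intro h0
      obtain ⟨h, hh, hne⟩ := exists_apply_ne_zero hconn e
      obtain ⟨t, ht, _⟩ := key h hh
      rw [ht, h0, mul_zero] at hne
      exact hne rfl
    have haf : a f ≠ 0 := by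
      intro h0
      obtain ⟨h, hh, hne⟩ := exists_apply_ne_zero hconn f
      obtain ⟨t, _, ht⟩ := key h hh
      rw [ht, h0, mul_zero] at hne
      exact hne rfl
    refine ⟨a e / a f, div_ne_zero hae haf, fun h hh => ?_⟩
    obtain ⟨t, h1, h2⟩ := key h hh
    rw [h1, h2]
    field_simp

variable {Γ : Type*} [Group Γ] (M : MonomialAction Γ E) (hM : ∀ g, ∀ h ∈ Λ, M.act g h ∈ Λ)

theorem MonomialAction.act_single [DecidableEq E] (g : Γ) (e : E) :
    M.act g (Pi.single e 1) = M.coef g e • Pi.single (M.perm g e) 1 := by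
  rw [M.act_eq_iff]
  intro f
  by_cases h : f = e
  · subst h
    simp
  · simp [h]

include hM

theorem parallel_perm (g : Γ) (e f : E) (h : parallelSetoid Λ e f) :
    parallelSetoid Λ (M.perm g e) (M.perm g f) := by
  classical
  obtain ⟨s, hs, h⟩ := h
  have hc := M.coef_ne_zero g e
  refine ⟨(M.coef g e)⁻¹ * (s * M.coef g f), mul_ne_zero (inv_ne_zero hc)
    (mul_ne_zero hs (M.coef_ne_zero g f)), ?_⟩
  have h1 := Λ.smul_mem (M.coef g e)⁻¹ (hM g _ h)
  rw [map_sub, map_smul] at h1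
  convert h1 using 1
  have h2 := M.act_single g e
  have h3 := M.act_single g f
  rw [smul_sub, smul_smul]
  convert_to _ = (M.coef g e)⁻¹ • M.act g (Pi.single e 1) -
    ((M.coef g e)⁻¹ * s) • M.act g (Pi.single f 1) using 2
  rw [h2, h3, smul_smul, smul_smul, inv_mul_cancel₀ hc, one_smul, mul_assoc]

theorem series_perm (g : Γ) (e f : E) (h : seriesSetoid Λ e f) :
    seriesSetoid Λ (M.perm g e) (M.perm g f) := by
  obtain ⟨s, hs, h⟩ := h
  have hc := M.coef_ne_zero g f
  refine ⟨M.coef g e * s * (M.coef g f)⁻¹, mul_ne_zero (mul_ne_zero (M.coef_ne_zero g e) hs)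
    (inv_ne_zero hc), fun k hk => ?_⟩
  have h1 := h _ (hM g⁻¹ k hk)
  rw [← M.act_act_inv g k, M.act_apply, M.act_apply, h1]
  field_simp

/-- The unit vectors all span the same line modulo `Λ`. -/
theorem exists_char_of_parallel [Nontrivial E] (hconn : IsConn Λ)
    (htop : ∀ e f, parallelSetoid Λ e f) : ∃ χ : Γ →* ℤˣ, ∀ g, M.IsNeg g → χ g = -1 := by
  classical
  obtain ⟨e⟩ := (inferInstance : Nonempty E)
  refine exists_char_of_line M Λ hM (single_notMem hconn e) fun g => ?_
  obtain ⟨s, _, hs⟩ := htop (M.perm g e) e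
  refine ⟨M.coef g e * s, ?_⟩
  have := Λ.smul_mem (M.coef g e) hs
  rw [smul_sub, smul_smul] at this
  rw [M.act_single]
  convert this

/-- Here `Λ` itself is a line. -/
theorem exists_char_of_series [Nontrivial E] (hconn : IsConn Λ)
    (htop : ∀ e f, seriesSetoid Λ e f) : ∃ χ : Γ →* ℤˣ, ∀ g, M.IsNeg g → χ g = -1 := by
  obtain ⟨e⟩ := (inferInstance : Nonempty E)
  obtain ⟨h, hh, hne⟩ := exists_apply_ne_zero hconn e
  refine exists_char_of_line M ⊥ (fun g k hk => ?_) (u := h) (fun h0 => ?_) fun g => ?_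
  · rw [Submodule.mem_bot] at hk ⊢
    rw [hk, map_zero]
  · rw [Submodule.mem_bot] at h0
    rw [h0] at hne
    exact hne rfl
  · refine ⟨M.act g h e / h e, ?_⟩
    rw [Submodule.mem_bot, sub_eq_zero]
    ext f
    obtain ⟨s, _, hs⟩ := htop f e
    rw [Pi.smul_apply, hs _ (hM g h hh), hs h hh, smul_eq_mul]
    field_simp

end parallelSeries

/-! ### Translates of minimal 2-separations -/

section translates

variable {E : Type*} [Finite E] {Λ : Submodule ℚ (E → ℚ)} {Γ : Type*} [Group Γ]
  (M : MonomialAction Γ E) (hM : ∀ g, ∀ h ∈ Λ, M.act g h ∈ Λ)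

/-- A tight set with neither it nor its complement being a point. -/
def IsSplit (Λ : Submodule ℚ (E → ℚ)) (X : Set E) : Prop :=
  IsTight Λ X ∧ ¬ X.Subsingleton ∧ ¬ Xᶜ.Subsingleton

include hM in
theorem IsSplit.image {X : Set E} (hX : IsSplit Λ X) (g : Γ) : IsSplit Λ (M.perm g '' X) := by
  obtain ⟨a, ha⟩ := hX.1.exists_isOneDim
  refine ⟨(ha.act M hM g).isTight, fun h => hX.2.1 ?_, fun h => hX.2.2 ?_⟩
  · exact (Set.subsingleton_of_image (M.perm g).injective X h)
  · rw [← Set.image_compl_eq (M.perm g).bijective] at h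
    exact (Set.subsingleton_of_image (M.perm g).injective _ h)

/-- Minimal split sets of the same size are equal or disjoint. -/
theorem IsSplit.eq_of_inter_nonempty (hconn : IsConn Λ) {X Y : Set E} (hX : IsSplit Λ X)
    (hY : IsSplit Λ Y) (hmin : ∀ Z, IsSplit Λ Z → X.ncard ≤ Z.ncard) (hXY : Y.ncard = X.ncard)
    (hpair : X.ncard ≠ 2) (h : (X ∩ Y).Nonempty) : X = Y := by
  by_contra hne
  have h1 : (X ∩ Yᶜ).Nonempty := by
    rw [Set.nonempty_iff_ne_empty]
    intro h0
    exact hne (Set.eq_of_subset_of_ncard_le (by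
      rwa [← Set.sdiff_eq, Set.sdiff_eq_empty] at h0) hXY.le)
  have h2 : (Y ∩ Xᶜ).Nonempty := by
    rw [Set.nonempty_iff_ne_empty]
    intro h0
    exact hne (Set.eq_of_subset_of_ncard_le (by
      rwa [← Set.sdiff_eq, Set.sdiff_eq_empty] at h0) hXY.ge).symm
  have hsub : ∀ Z ⊆ X, Z ≠ X → IsTight Λ Z → Z.Subsingleton := by
    intro Z hZX hZ hZt
    by_contra hZs
    have h3 := hmin Z ⟨hZt, hZs, fun h => hX.2.2 (h.anti (Set.compl_subset_compl.2 hZX))⟩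
    exact hZ (Set.eq_of_subset_of_ncard_le hZX h3)
  -- If the two sets covered everything, minimality would force Y to be the complement of X,
  -- contrary to the common element.
  have h3 : X ∪ Y ≠ Set.univ := by
    intro hu
    have hsub : Xᶜ ⊆ Y := fun e he => (hu ▸ Set.mem_univ e : e ∈ X ∪ Y).resolve_left he
    have hle := hmin Xᶜ ⟨hX.1.compl, hX.2.2, by rw [compl_compl]; exact hX.2.1⟩
    have heq := Set.eq_of_subset_of_ncard_le hsub (hXY.le.trans hle)
    rw [← heq, Set.inter_compl_self] at h
    exact Set.not_nonempty_empty h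
  have h4 := hsub (X ∩ Y) Set.inter_subset_left (fun h0 => by
    obtain ⟨e, he, he'⟩ := h1
    rw [← h0] at he
    exact he' he.2) (hX.1.inter hconn hY.1 h h3)
  have h5 := hsub (X ∩ Yᶜ) Set.inter_subset_left (fun h0 => by
    obtain ⟨e, he, he'⟩ := h
    rw [← h0] at he
    exact he.2 he') (hX.1.inter hconn hY.1.compl h1 (fun h0 => by
    obtain ⟨e, he, he'⟩ := h2
    rcases (h0 ▸ Set.mem_univ e : e ∈ X ∪ Yᶜ) with h | h
    · exact he' h
    · exact h he))
  -- Uncrossing made X ∩ Y and X ∖ Y tight, so minimality leaves at most one edge in each; then |X|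
  -- = 2, which is excluded.
  have h6 := Set.ncard_inter_add_ncard_sdiff_eq_ncard X Y
  rw [Set.sdiff_eq] at h6
  have h7 := Set.ncard_le_one_iff_subsingleton.2 h4
  have h8 := Set.ncard_le_one_iff_subsingleton.2 h5
  have h9 : 1 < X.ncard := by
    by_contra h9
    exact hX.2.1 (Set.ncard_le_one_iff_subsingleton.1 (not_lt.1 h9))
  omega

end translates

/-! ### The character detecting −1 -/

namespace EdgeFlow

universe u v

variable {Γ : Type*} [Group Γ]

/-- If the cycle space of a graph is connected, a group of monomial automorphisms has a character
that detects multiplication by `-1`. -/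
theorem exists_char_of_isConn (k : ℕ) : ∀ {E : Type u} {V : Type v} [Fintype E] [Nonempty E]
    [Fintype V] {src tgt : E → V}, Fintype.card E = k → IsConn (cycles src tgt) →
    ∀ M : MonomialAction Γ E, (∀ g, ∀ h ∈ cycles src tgt, M.act g h ∈ cycles src tgt) →
    ∃ χ : Γ →* ℤˣ, ∀ g, M.IsNeg g → χ g = -1 := by
  classical
  induction k using Nat.strong_induction_on with
  | _ k ih =>
    intro E V _ _ _ src tgt hk hconn M hM
    -- The induction step: a nontrivial invariant partition into glued sets yields a smaller graph
    -- on which −1 still acts as −1.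
    have hquot : ∀ (s : Setoid E), (∀ g e f, s e f → s (M.perm g e) (M.perm g f)) →
        (∀ A : Quotient s, ∃ a, IsOneDim (cycles src tgt) {f | Quotient.mk s f = A} a) →
        (∀ A : Quotient s, {f | Quotient.mk s f = A} ≠ Set.univ) →
        (∃ e f, e ≠ f ∧ s e f) → ∃ χ : Γ →* ℤˣ, ∀ g, M.IsNeg g → χ g = -1 := by
      rintro s hs hdim hproper ⟨e, f, hef, hsef⟩
      obtain ⟨V', _, src', tgt', inst, M', hconn', hM', hneg⟩ :=
        exists_quotient hconn M hM s hs hdim hproper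
      have hlt : Fintype.card (Quotient s) < k := by
        rw [← hk, ← Nat.card_eq_fintype_card, ← Nat.card_eq_fintype_card]
        refine lt_of_le_of_ne (Nat.card_le_card_of_surjective _ Quotient.mk_surjective) fun h => ?_
        have := (Nat.bijective_iff_surjective_and_card (Quotient.mk s)).2
          ⟨Quotient.mk_surjective, h.symm⟩
        exact hef (this.1 (Quotient.sound hsef))
      have : Nonempty (Quotient s) := ⟨Quotient.mk s e⟩
      obtain ⟨χ, hχ⟩ := ih _ hlt rfl hconn' M' hM'
      exact ⟨χ, fun g hg => hχ g (hneg g hg)⟩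
    rcases Nat.even_or_odd (Fintype.card E) with heven | hodd
    swap
    · exact exists_char_of_odd M hodd
    have hpos : 0 < Fintype.card E := Fintype.card_pos
    have hE : Nontrivial E := by
      rw [← Fintype.one_lt_card_iff_nontrivial]
      obtain ⟨m, hm⟩ := heven
      omega
    have htotal : ∀ s : Setoid E, (∀ g e f, s e f → s (M.perm g e) (M.perm g f)) →
        (∀ A : Quotient s, ∃ a, IsOneDim (cycles src tgt) {f | Quotient.mk s f = A} a) →
        (∃ e f, e ≠ f ∧ s e f) →
        ((∀ e f, s e f) → ∃ χ : Γ →* ℤˣ, ∀ g, M.IsNeg g → χ g = -1) →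
        ∃ χ : Γ →* ℤˣ, ∀ g, M.IsNeg g → χ g = -1 := by
      intro s hs hdim hne htop
      by_cases hall : ∀ e f, s e f
      · exact htop hall
      refine hquot s hs hdim (fun A hA => hall fun e f => Quotient.exact ?_) hne
      rw [Set.eq_univ_iff_forall] at hA
      exact (hA e).trans (hA f).symm
    by_cases hpar : ∃ e f, e ≠ f ∧ parallelSetoid (cycles src tgt) e f
    · exact htotal _ (parallel_perm M hM) isOneDim_parallel_class hpar
        (exists_char_of_parallel M hM hconn)
    by_cases hser : ∃ e f, e ≠ f ∧ seriesSetoid (cycles src tgt) e f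
    · exact htotal _ (series_perm M hM) isOneDim_series_class hser
        (exists_char_of_series M hM hconn)
    have hpair : ∀ X a, IsOneDim (cycles src tgt) X a → X.ncard ≠ 2 := by
      intro X a hX h2
      obtain ⟨e, f, hef, rfl⟩ := Set.ncard_eq_two.1 h2
      rcases hX.parallel_or_series hconn hef with h | h
      · exact hpar ⟨e, f, hef, h⟩
      · exact hser ⟨e, f, hef, h⟩
    by_cases hrigid : ∀ X a, IsOneDim (cycles src tgt) X a → X.Subsingleton ∨ Xᶜ.Subsingleton
    · have h2 : Fintype.card E ≠ 2 := by
        have := hpair Set.univ 0 ⟨Set.indicator_zero' _, fun h hh => ⟨0, by simpa using hh⟩⟩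
        rwa [Set.ncard_univ, Nat.card_eq_fintype_card] at this
      refine exists_char_of_rigid hconn hrigid ?_ M hM
      obtain ⟨m, hm⟩ := heven
      omega
    push Not at hrigid
    obtain ⟨X₀, a₀, ha₀, hX₀, hX₀'⟩ := hrigid
    obtain ⟨X, hX, hmin⟩ := exists_minimalFor_of_wellFoundedLT
      (fun X : Set E => IsSplit (cycles src tgt) X) Set.ncard
      ⟨X₀, ha₀.isTight, Set.not_subsingleton_iff.2 hX₀, Set.not_subsingleton_iff.2 hX₀'⟩
    have hmin' : ∀ Z, IsSplit (cycles src tgt) Z → X.ncard ≤ Z.ncard := fun Z hZ => by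
      by_contra h
      exact h (hmin hZ (not_le.1 h).le)
    obtain ⟨a, ha⟩ := hX.1.exists_isOneDim
    have htrans : ∀ g g' e, e ∈ M.perm g '' X → e ∈ M.perm g' '' X →
        M.perm g '' X = M.perm g' '' X := by
      intro g g' e he he'
      have hcard : ∀ g, (M.perm g '' X).ncard = X.ncard := fun g =>
        Set.ncard_image_of_injective _ (M.perm g).injective
      refine (hX.image M hM g).eq_of_inter_nonempty hconn (hX.image M hM g') ?_ ?_ ?_ ⟨e, he, he'⟩
      · rw [hcard]
        exact hmin'
      · rw [hcard, hcard]
      · rw [hcard]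
        exact hpair X a ha
    -- The translates of the minimal split set are equal or disjoint; together with single edges
    -- they form an invariant partition.
    let s : Setoid E :=
      { r := fun e f => e = f ∨ ∃ g, e ∈ M.perm g '' X ∧ f ∈ M.perm g '' X
        iseqv :=
          { refl := fun e => Or.inl rfl
            symm := by
              rintro e f (h | ⟨g, h, h'⟩)
              · exact Or.inl h.symm
              · exact Or.inr ⟨g, h', h⟩
            trans := by
              rintro e f f' (rfl | ⟨g, h1, h2⟩) (rfl | ⟨g', h3, h4⟩)
              · exact Or.inl rfl
              · exact Or.inr ⟨g', h3, h4⟩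
              · exact Or.inr ⟨g, h1, h2⟩
              · exact Or.inr ⟨g, h1, (htrans g g' f h2 h3).symm ▸ h4⟩ } }
    have hclass : ∀ A : Quotient s, (∃ e, {f | Quotient.mk s f = A} = {e}) ∨
        ∃ g, {f | Quotient.mk s f = A} = M.perm g '' X := by
      intro A
      obtain ⟨e, rfl⟩ := Quotient.exists_rep A
      by_cases he : ∃ g, e ∈ M.perm g '' X
      · right
        obtain ⟨g, hg⟩ := he
        refine ⟨g, ?_⟩
        ext f
        constructor
        · intro hf
          rcases Quotient.exact hf with h | ⟨g', h, h'⟩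
          · rwa [h]
          · rw [htrans g g' e hg h']
            exact h
        · intro hf
          exact Quotient.sound (Or.inr ⟨g, hf, hg⟩)
      · left
        refine ⟨e, ?_⟩
        ext f
        constructor
        · intro hf
          rcases Quotient.exact hf with h | ⟨g', h, h'⟩
          · exact h
          · exact absurd ⟨g', h'⟩ he
        · rintro rfl
          rfl
    refine hquot s ?_ (fun A => ?_) (fun A => ?_) ?_
    · rintro g e f (rfl | ⟨g', ⟨x, hx, rfl⟩, ⟨y, hy, rfl⟩⟩)
      · exact Or.inl rfl
      · refine Or.inr ⟨g * g', ⟨x, hx, ?_⟩, ⟨y, hy, ?_⟩⟩ <;> rw [map_mul, Equiv.Perm.mul_apply]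
    · rcases hclass A with ⟨e, he⟩ | ⟨g, hg⟩
      · rw [he]
        exact isOneDim_singleton e
      · rw [hg]
        exact ⟨_, ha.act M hM g⟩
    · rcases hclass A with ⟨e, he⟩ | ⟨g, hg⟩
      · rw [he]
        exact Set.singleton_ne_univ e
      · rw [hg]
        intro h
        have := (hX.image M hM g).2.2
        rw [h, Set.compl_univ] at this
        exact this Set.subsingleton_empty
    · obtain ⟨x, hx, y, hy, hxy⟩ := Set.not_subsingleton_iff.1 hX.2.1
      exact ⟨x, y, hxy, Or.inr ⟨1, ⟨x, hx, by simp⟩, ⟨y, hy, by simp⟩⟩⟩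

end EdgeFlow

/-- Extending characters of stabilizers to a cocycle. -/
theorem exists_cocycle {Γ B : Type*} [Group Γ] (π : Γ →* Equiv.Perm B) (P : Γ → B → Prop)
    (hconj : ∀ g h b, P g (π h b) → P (h⁻¹ * g * h) b)
    (hchar : ∀ b, ∃ χ : Γ → ℤˣ, (∀ g h, π g b = b → π h b = b → χ (g * h) = χ g * χ h) ∧
      ∀ g, π g b = b → P g b → χ g = -1) :
    ∃ χ : Γ → B → ℤˣ, (∀ g h b, χ (g * h) b = χ g (π h b) * χ h b) ∧
      ∀ g b, π g b = b → P g b → χ g b = -1 := by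
  let s : Setoid B :=
    { r := fun b b' => ∃ g, π g b = b'
      iseqv :=
        { refl := fun b => ⟨1, by simp⟩
          symm := by
            rintro b _ ⟨g, rfl⟩
            exact ⟨g⁻¹, by rw [map_inv]; exact (π g).symm_apply_apply b⟩
          trans := by
            rintro b _ _ ⟨g, rfl⟩ ⟨h, rfl⟩
            exact ⟨h * g, by rw [map_mul, Equiv.Perm.mul_apply]⟩ } }
  let rep : B → B := fun b => (Quotient.mk s b).out
  have hrep : ∀ h b, rep (π h b) = rep b := fun h b =>
    congrArg Quotient.out (Quotient.sound (s := s) (s.symm ⟨h, rfl⟩))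
  have ht : ∀ b, ∃ g, π g (rep b) = b := fun b => Quotient.mk_out (s := s) b
  choose t ht using ht
  choose c hc hcP using hchar
  have hinv : ∀ b, π (t b)⁻¹ b = rep b := fun b => by
    rw [map_inv]
    exact (π (t b)).symm_apply_eq.2 (ht b).symm
  -- Conjugation with the chosen transporters moves every `g` into the stabilizer of the orbit
  -- representative, where its character is evaluated.
  have hfix : ∀ g b, π ((t (π g b))⁻¹ * g * t b) (rep b) = rep b := fun g b => by
    rw [map_mul, map_mul, Equiv.Perm.mul_apply, Equiv.Perm.mul_apply, ht, hinv, hrep]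
  refine ⟨fun g b => c (rep b) ((t (π g b))⁻¹ * g * t b), fun g h b => ?_, fun g b hg hP => ?_⟩
  · have h1 := hfix g (π h b)
    rw [hrep] at h1
    dsimp only
    rw [hrep, ← hc _ _ _ h1 (hfix h b), map_mul, Equiv.Perm.mul_apply]
    congr 1
    group
  · refine hcP _ _ (hfix g b) ?_
    rw [hg]
    apply hconj
    rwa [ht]

/-! ### A sign cocycle on the blocks -/

namespace MonomialAction

variable {Γ E : Type*} [Group Γ]

/-- The action of a subgroup on an invariant subset. -/
def restrict (M : MonomialAction Γ E) (H : Subgroup Γ) (p : E → Prop)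
    (hp : ∀ g ∈ H, ∀ e, p (M.perm g e) ↔ p e) : MonomialAction H {e // p e} where
  perm :=
    { toFun := fun g => (M.perm g).subtypePerm (hp g g.2)
      map_one' := by ext; simp
      map_mul' := fun g h => by
        ext e
        exact Equiv.congr_fun (M.perm.map_mul g h) (e : E) }
  coef g e := M.coef g e
  coef_one e := M.coef_one e
  coef_mul g h e := M.coef_mul g h e

theorem restrict_act (M : MonomialAction Γ E) (H : Subgroup Γ) (p : E → Prop)
    (hp : ∀ g ∈ H, ∀ e, p (M.perm g e) ↔ p e) (g : H) (h : E → ℚ) :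
    (M.restrict H p hp).act g (fun e => h e) = fun e : {e // p e} => M.act g h e := by
  rw [act_eq_iff]
  intro e
  exact M.act_apply g h e

end MonomialAction

namespace EdgeFlow

variable {V E : Type*} [Fintype E] {src tgt : E → V}

theorem mem_cycles_subtype (p : E → Prop) [Fintype {e // p e}] {h : E → ℚ}
    (hh : ∀ e, ¬ p e → h e = 0) :
    (fun e : {e // p e} => h e) ∈ cycles (fun e : {e // p e} => src e) (fun e => tgt e) ↔
      h ∈ cycles src tgt := by
  classical
  have key : bdry (fun e : {e // p e} => src e) (fun e => tgt e) (fun e : {e // p e} => h e) =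
      bdry src tgt h := by
    ext v
    rw [bdry_apply, bdry_apply, ← Finset.sum_filter_of_ne (p := p)]
    · rw [Finset.sum_subtype (p := p) _ (by simp)]
    · intro e _ hne
      by_contra hpe
      exact hne (by rw [hh e hpe, zero_mul])
  rw [mem_cycles, mem_cycles, key]

end EdgeFlow

namespace FeynmanGraph

open EdgeFlow

variable {V Ed : Type*} [Fintype Ed] {n : ℕ} (G : FeynmanGraph V Ed n)
  {Γ : Type*} [Group Γ] (M : MonomialAction Γ Ed)
  (hM : ∀ g, ∀ h ∈ cycles G.src G.tgt, M.act g h ∈ cycles G.src G.tgt)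

-- Conjugating the projection onto a block by g gives a multiplier of the cycle space, which is
-- constant on blocks.
include hM in
theorem block_perm (g : Γ) {e f : Ed} (hef : G.block e = G.block f) :
    G.block (M.perm g e) = G.block (M.perm g f) := by
  classical
  have h1 := eq_of_block_eq (G := G)
    (z := fun x => if G.block (M.perm g x) = G.block (M.perm g e) then 1 else 0) (by
      intro h hh
      have h2 : G.IsCycle _ := IsCycle.block_mul
        (fun b => if b = G.block (M.perm g e) then 1 else 0) (mem_cycles.1 (hM g h (mem_cycles.2 hh)))
      have h3 := mem_cycles.1 (hM g⁻¹ _ (mem_cycles.2 h2))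
      rw [IsCycle, ← h3, ← M.act_inv_act g (fun x =>
        (if G.block (M.perm g x) = G.block (M.perm g e) then 1 else 0) * h x)]
      congr 2
      rw [M.act_eq_iff]
      intro x
      rw [M.act_apply]
      ring) hef
  by_contra hne
  simp [Ne.symm hne] at h1

/-- The permutation of the blocks. -/
def blockPerm : Γ →* Equiv.Perm G.Block :=
  let q : Γ → G.Block → G.Block := fun g => Quotient.lift (fun e => G.block (M.perm g e))
    fun _ _ h => G.block_perm M hM g (Quotient.sound h)
  have hmul : ∀ g g' b, q (g * g') b = q g (q g' b) := by
    rintro g g' ⟨e⟩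
    change G.block (M.perm (g * g') e) = G.block (M.perm g (M.perm g' e))
    rw [map_mul, Equiv.Perm.mul_apply]
  have hone : ∀ b, q 1 b = b := by
    rintro ⟨e⟩
    change G.block (M.perm 1 e) = G.block e
    rw [map_one, Equiv.Perm.one_apply]
  { toFun := fun g => ⟨q g, q g⁻¹, fun b => by rw [← hmul, inv_mul_cancel, hone],
      fun b => by rw [← hmul, mul_inv_cancel, hone]⟩
    map_one' := Equiv.ext hone
    map_mul' := fun g g' => Equiv.ext (hmul g g') }

theorem blockPerm_block (g : Γ) (e : Ed) :
    G.blockPerm M hM g (G.block e) = G.block (M.perm g e) := rfl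

theorem exists_block_eq (b : G.Block) : ∃ e, G.block e = b := Quotient.exists_rep b

/-- A set that splits the cycles of the block has an indicator multiplying cycles to cycles; such a
function is constant on the block. -/
theorem isConn_block (b : G.Block) [Fintype {e // G.block e = b}] :
    IsConn (cycles (fun e : {e // G.block e = b} => G.src e) (fun e => G.tgt e)) := by
  classical
  intro X hX
  let z : Ed → ℚ := fun e => if ∃ h : G.block e = b, (⟨e, h⟩ : {e // G.block e = b}) ∈ X
    then 1 else 0
  have hz : ∀ h, G.IsCycle h → G.IsCycle fun e => z e * h e := by
    intro h hh
    have h1 : G.IsCycle _ := hh.block_mul fun c => if c = b then 1 else 0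
    have h2 := (mem_cycles_subtype (fun e => G.block e = b) (fun e he => by
      rw [if_neg he, zero_mul])).2 (mem_cycles.2 h1)
    have h3 := hX _ h2
    refine mem_cycles.1 ((mem_cycles_subtype (fun e => G.block e = b) (fun e he => ?_)).1 ?_)
    · have : z e = 0 := if_neg fun ⟨h, _⟩ => he h
      rw [this, zero_mul]
    · convert h3 using 1
      ext ⟨e, he⟩
      by_cases heX : (⟨e, he⟩ : {e // G.block e = b}) ∈ X
      · rw [Set.indicator_of_mem heX]
        have : z e = 1 := if_pos ⟨he, heX⟩
        simp [this, he]
      · rw [Set.indicator_of_notMem heX]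
        have : z e = 0 := if_neg fun ⟨_, h⟩ => heX h
        simp [this]
  by_cases h0 : X = ∅
  · exact Or.inl h0
  · right
    obtain ⟨⟨e, he⟩, heX⟩ := Set.nonempty_iff_ne_empty.2 h0
    rw [Set.eq_univ_iff_forall]
    rintro ⟨f, hf⟩
    have h1 := eq_of_block_eq hz (he.trans hf.symm)
    have h2 : z e = 1 := if_pos ⟨he, heX⟩
    rw [h2] at h1
    by_contra hfX
    have h3 : z f = 0 := if_neg fun ⟨_, h⟩ => hfX h
    rw [h3] at h1
    exact one_ne_zero h1

/-- A group of monomial automorphisms of the cycle space has a cocycle on the blocks that detects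
sign changes of single blocks. -/
theorem exists_block_cocycle [Fintype V] : ∃ χ : Γ → G.Block → ℤˣ,
    (∀ g h b, χ (g * h) b = χ g (G.blockPerm M hM h b) * χ h b) ∧
    ∀ g b, (∀ e, G.block e = b → M.perm g e = e ∧ M.coef g e = -1) → χ g b = -1 := by
  classical
  have hconj : ∀ (g h : Γ) (b : G.Block), (∀ e, G.block e = G.blockPerm M hM h b →
      M.perm g e = e ∧ M.coef g e = -1) → ∀ e, G.block e = b →
      M.perm (h⁻¹ * g * h) e = e ∧ M.coef (h⁻¹ * g * h) e = -1 := by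
    intro g h b hg e he
    have h3 := hg (M.perm h e) (by rw [← he, blockPerm_block])
    have h4 := M.coef_inv_mul h e
    refine ⟨?_, ?_⟩
    · rw [map_mul, map_mul, Equiv.Perm.mul_apply, Equiv.Perm.mul_apply, h3.1, map_inv]
      exact (M.perm h).symm_apply_apply e
    · rw [M.coef_mul, M.coef_mul, h3.1, h3.2]
      linear_combination -h4
  have hchar : ∀ b, ∃ χ : Γ → ℤˣ, (∀ g h, G.blockPerm M hM g b = b → G.blockPerm M hM h b = b →
      χ (g * h) = χ g * χ h) ∧ ∀ g, G.blockPerm M hM g b = b →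
      (∀ e, G.block e = b → M.perm g e = e ∧ M.coef g e = -1) → χ g = -1 := by
    intro b
    let H : Subgroup Γ :=
      { carrier := {g | G.blockPerm M hM g b = b}
        one_mem' := by simp
        mul_mem' := by
          intro g h hg hh
          change G.blockPerm M hM (g * h) b = b
          rw [map_mul, Equiv.Perm.mul_apply, hh, hg]
        inv_mem' := by
          intro g hg
          change G.blockPerm M hM g⁻¹ b = b
          rw [map_inv]
          exact (G.blockPerm M hM g).symm_apply_eq.2 hg.symm }
    have hp : ∀ g ∈ H, ∀ e, G.block (M.perm g e) = b ↔ G.block e = b := by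
      intro g hg e
      rw [← G.blockPerm_block M hM]
      constructor
      · intro h
        exact (G.blockPerm M hM g).injective (h.trans hg.symm)
      · intro h
        rw [h]
        exact hg
    have hne : Nonempty {e // G.block e = b} := by
      obtain ⟨e, he⟩ := G.exists_block_eq b
      exact ⟨⟨e, he⟩⟩
    -- The stabilizer of `b` acts monomially on the edges of `b` alone, whose cycle space is
    -- connected.
    obtain ⟨χ, hχ⟩ := exists_char_of_isConn _ rfl (G.isConn_block b)
      (M.restrict H (fun e => G.block e = b) hp) (by
        intro g t ht
        obtain ⟨h, hsupp, rfl⟩ : ∃ h : Ed → ℚ, (∀ e, ¬ G.block e = b → h e = 0) ∧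
            (fun e : {e // G.block e = b} => h e) = t :=
          ⟨fun e => if h : G.block e = b then t ⟨e, h⟩ else 0, fun e he => dif_neg he, by
            ext ⟨e, he⟩
            exact dif_pos he⟩
        rw [M.restrict_act, mem_cycles_subtype (fun e => G.block e = b)]
        · exact hM g h ((mem_cycles_subtype (fun e => G.block e = b) hsupp).1 ht)
        · intro e he
          obtain ⟨e, rfl⟩ := (M.perm g).surjective e
          rw [M.act_apply, hsupp e fun h => he ((hp g g.2 e).2 h), mul_zero])
    refine ⟨fun g => if hg : g ∈ H then χ ⟨g, hg⟩ else 1, fun g h hg hh => ?_, fun g hg hneg => ?_⟩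
    · have hgh : g * h ∈ H := H.mul_mem hg hh
      dsimp only
      rw [dif_pos hgh, dif_pos (show g ∈ H from hg), dif_pos (show h ∈ H from hh), ← map_mul]
      rfl
    · dsimp only
      rw [dif_pos (show g ∈ H from hg)]
      refine hχ _ fun t => ?_
      rw [MonomialAction.act_eq_iff]
      rintro ⟨e, he⟩
      have h3 := hneg e he
      have h4 : (M.restrict H (fun e => G.block e = b) hp).perm ⟨g, hg⟩ ⟨e, he⟩ = ⟨e, he⟩ :=
        Subtype.ext h3.1
      rw [h4]
      change -t ⟨e, he⟩ = M.coef g e * t ⟨e, he⟩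
      rw [h3.2]
      ring
  obtain ⟨χ, h1, h2⟩ := exists_cocycle (G.blockPerm M hM)
    (fun g b => ∀ e, G.block e = b → M.perm g e = e ∧ M.coef g e = -1) hconj hchar
  refine ⟨χ, h1, fun g b hg => h2 g b ?_ hg⟩
  obtain ⟨e, rfl⟩ := G.exists_block_eq b
  rw [blockPerm_block, (hg e rfl).1]

end FeynmanGraph

/-! ### The group of liftable signed permutations -/

open Matrix

/-- The group of signed permutations. -/
abbrev SignedPermGroup (E : Type*) : Type _ := (E → ℤˣ) ⋊[mulAutArrow] Equiv.Perm E

namespace SignedPermGroup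

variable {E : Type*}

/-- The signs of a signed permutation, indexed by the source. -/
def signs (g : SignedPermGroup E) (e : E) : ℤˣ := g.left (g.right e)

theorem signs_mul (g h : SignedPermGroup E) (e : E) :
    signs (g * h) e = signs g (h.right e) * signs h e := by
  change g.left (g.right (h.right e)) * h.left (g.right.symm (g.right (h.right e))) = _
  rw [Equiv.symm_apply_apply]
  rfl

theorem ext_signs {g h : SignedPermGroup E} (h1 : g.right = h.right)
    (h2 : ∀ e, signs g e = signs h e) : g = h := by
  refine SemidirectProduct.ext (funext fun e => ?_) h1
  obtain ⟨e, rfl⟩ := g.right.surjective e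
  have := h2 e
  rw [signs, signs, ← h1] at this
  exact this

end SignedPermGroup

namespace Sector

open EdgeFlow SignedPermGroup

variable {K : Type*} [Field K] [CharZero K] {L n : ℕ} {V Ed : Type*} [Fintype Ed]
  [DecidableEq Ed] (Gm : Matrix (Fin n) (Fin n) K) (S : Sector K V Ed L n)

theorem isSymLift_one : IsSymLift Gm S S (fun _ => 1) (Equiv.refl Ed) ⟨1, 0, 1⟩ := by
  have h1 : signedPerm (fun _ : Ed => 1) (Equiv.refl Ed) = 1 := by
    ext e f
    simp [signedPerm, Matrix.one_apply]
  refine ⟨⟨by rw [h1, Matrix.mul_one, Matrix.one_mul], by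
    rw [h1, Matrix.mul_zero, Matrix.mul_one, Matrix.one_mul, zero_add]⟩, Or.inl det_one, ?_,
    fun i => rfl⟩
  have h2 : ((⟨1, 0, 1⟩ : MomentumMap ℚ L n).ofRat K).N = 1 :=
    Matrix.map_one _ Rat.cast_zero Rat.cast_one
  rw [h2, Matrix.one_mul, transpose_one, Matrix.mul_one]

/-- The group of signed permutations of the propagators that lift to symmetries. -/
def symGroup : Subgroup (SignedPermGroup Ed) :=
  have hmul : ∀ g h : SignedPermGroup Ed, (∃ T, IsSymLift Gm S S (signs g) g.right T) →
      (∃ T, IsSymLift Gm S S (signs h) h.right T) →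
      ∃ T, IsSymLift Gm S S (signs (g * h)) (g * h).right T := by
    rintro g h ⟨T, hT⟩ ⟨T', hT'⟩
    rw [funext (signs_mul g h)]
    exact ⟨_, hT.comp hT'⟩
  have hone : ∃ T, IsSymLift Gm S S (signs (1 : SignedPermGroup Ed)) (1 : SignedPermGroup Ed).right
      T := ⟨_, S.isSymLift_one Gm⟩
  { carrier := {g | ∃ T, IsSymLift Gm S S (signs g) g.right T}
    mul_mem' := fun {g h} => hmul g h
    one_mem' := hone
    inv_mem' := by
      intro g hg
      -- The ambient group is finite, so inverses are powers and closure under products suffices.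
      have hpow : ∀ k : ℕ, ∃ T, IsSymLift Gm S S (signs (g ^ k)) (g ^ k).right T := by
        intro k
        induction k with
        | zero =>
          rw [pow_zero]
          exact hone
        | succ k ih =>
          rw [pow_succ]
          exact hmul _ _ ih hg
      have : Finite (SignedPermGroup Ed) :=
        Finite.of_equiv _ SemidirectProduct.equivProd.symm
      have h1 : g⁻¹ = g ^ (orderOf g - 1) := by
        rw [inv_eq_iff_mul_eq_one, ← pow_succ', Nat.sub_add_cancel (orderOf_pos g),
          pow_orderOf_eq_one]
      change ∃ T, IsSymLift Gm S S (signs g⁻¹) g⁻¹.right T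
      rw [h1]
      exact hpow _ }

/-- The action on the edge space. -/
def symAction : MonomialAction (S.symGroup Gm) Ed where
  perm := SemidirectProduct.rightHom.comp (S.symGroup Gm).subtype
  coef g e := ((signs g.1 e : ℤ) : ℚ)
  coef_one e := rfl
  coef_mul g h e := by
    change ((signs (g.1 * h.1) e : ℤ) : ℚ) = ((signs g.1 (h.1.right e) : ℤ) : ℚ) * _
    rw [signs_mul]
    push_cast
    rfl

theorem symAction_perm (g : S.symGroup Gm) : (S.symAction Gm).perm g = g.1.right := rfl

theorem symAction_act_mem {S : Sector K V Ed L n} (hc : S.graph.Connected) (g : S.symGroup Gm) :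
    ∀ h ∈ cycles S.graph.src S.graph.tgt,
      (S.symAction Gm).act g h ∈ cycles S.graph.src S.graph.tgt := by
  intro h hh
  obtain ⟨T, hT⟩ := g.2
  obtain ⟨u, rfl⟩ := ((S.isCycleBasis hc).rat_bdry_eq_zero_iff h).1 (mem_cycles.1 hh)
  refine mem_cycles.2 (((S.isCycleBasis hc).rat_bdry_eq_zero_iff _).2 ⟨T.L *ᵥ u, ?_⟩)
  symm
  rw [MonomialAction.act_eq_iff]
  intro e
  have h1 : (S.C.map (Int.cast : ℤ → ℚ))ᵀ *ᵥ T.L *ᵥ u =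
      (signedPerm (signs g.1) g.1.right * (S.CIn ℚ)ᵀ) *ᵥ u := by
    rw [mulVec_mulVec, ← hT.loop]
    rfl
  rw [h1, symAction_perm]
  simp only [mulVec, dotProduct, signedPerm_mul_apply, mul_assoc, ← Finset.mul_sum]
  rfl

section representation

variable {S} {Gm}

theorem isSymLift_lift (h : S.MomentumGrouped Gm) (g : S.symGroup Gm) :
    IsSymLift Gm S S (signs g.1) g.1.right (S.lift S (signs g.1) g.1.right) := by
  obtain ⟨T, hT⟩ := g.2
  rw [← hT.eq_lift h]
  exact hT

/-- The block matrices of the symmetries. -/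
noncomputable def symRep (h : S.MomentumGrouped Gm) :
    S.symGroup Gm →* GL (Fin L ⊕ Fin n) K :=
  MonoidHom.toHomUnits
    { toFun := fun g => ((S.lift S (signs g.1) g.1.right).ofRat K).toMatrix
      map_one' := by
        have h1 : S.lift S (signs (1 : S.symGroup Gm).1) (1 : S.symGroup Gm).1.right = ⟨1, 0, 1⟩ :=
          ((S.isSymLift_one Gm).eq_lift h).symm
        rw [h1, ofRat_toMatrix]
        have h2 : (⟨1, 0, 1⟩ : MomentumMap ℚ L n).toMatrix = 1 := fromBlocks_one
        rw [h2]
        exact Matrix.map_one _ Rat.cast_zero Rat.cast_one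
      map_mul' := fun g g' => by
        have h1 := (isSymLift_lift h g).comp (isSymLift_lift h g')
        have h2 : (fun e => signs g.1 (g'.1.right e) * signs g'.1 e) = signs (g * g').1 :=
          (funext (signs_mul g.1 g'.1)).symm
        rw [h2] at h1
        have h3 := h1.eq_lift h
        have h4 : S.lift S (signs (g * g').1) (g * g').1.right =
          (S.lift S (signs g.1) g.1.right).comp (S.lift S (signs g'.1) g'.1.right) := h3.symm
        rw [h4, ofRat_toMatrix, MomentumMap.toMatrix_comp, map_mul_ratCast, ← ofRat_toMatrix,
          ← ofRat_toMatrix] }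

theorem symRep_coe (h : S.MomentumGrouped Gm) (g : S.symGroup Gm) :
    (symRep h g : Matrix (Fin L ⊕ Fin n) (Fin L ⊕ Fin n) K) =
      ((S.lift S (signs g.1) g.1.right).ofRat K).toMatrix := rfl

/-- The symmetries flipping the signs of blocks. -/
def blockSigns (h : S.MomentumGrouped Gm) : (S.graph.Block → ℤˣ) →* S.symGroup Gm :=
  ((SemidirectProduct.inl (φ := mulAutArrow)).comp
    { toFun := fun z e => z (S.graph.block e)
      map_one' := rfl
      map_mul' := fun _ _ => rfl }).codRestrict _ fun z => exists_isSymLift_block h z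

theorem blockSigns_right (h : S.MomentumGrouped Gm) (z : S.graph.Block → ℤˣ) :
    (blockSigns h z).1.right = 1 := rfl

theorem signs_blockSigns (h : S.MomentumGrouped Gm) (z : S.graph.Block → ℤˣ) (e : Ed) :
    signs (blockSigns h z).1 e = z (S.graph.block e) := rfl

end representation

end Sector

/-! ### Splitting the extension -/

open Matrix

namespace Sector

open EdgeFlow SignedPermGroup

variable {K : Type*} [Field K] [CharZero K] {L n : ℕ} {V Ed : Type*} [Fintype V] [Fintype Ed]
  [DecidableEq Ed] {Gm : Matrix (Fin n) (Fin n) K} {S : Sector K V Ed L n}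

/-- The permutation of the blocks by a symmetry. -/
def symBlockPerm (h : S.MomentumGrouped Gm) : S.symGroup Gm →* Equiv.Perm S.graph.Block :=
  S.graph.blockPerm (S.symAction Gm) (symAction_act_mem Gm h.connected)

omit [Fintype V] in
theorem symBlockPerm_block (h : S.MomentumGrouped Gm) (g : S.symGroup Gm) (e : Ed) :
    symBlockPerm h g (S.graph.block e) = S.graph.block (g.1.right e) := rfl

/-- The cocycle restricts to the identity on block flips, which is what allows any lift to be
normalized. -/
theorem exists_symCocycle (h : S.MomentumGrouped Gm) :
    ∃ χ : S.symGroup Gm → S.graph.Block → ℤˣ,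
      (∀ g g' b, χ (g * g') b = χ g (symBlockPerm h g' b) * χ g' b) ∧
      ∀ z b, χ (blockSigns h z) b = z b := by
  obtain ⟨χ, h1, h2⟩ := S.graph.exists_block_cocycle (S.symAction Gm)
    (symAction_act_mem Gm h.connected)
  have h3 : ∀ z b, z b = -1 → χ (blockSigns h z) b = -1 := by
    intro z b hz
    refine h2 _ b fun e he => ⟨rfl, ?_⟩
    change ((signs (blockSigns h z).1 e : ℤ) : ℚ) = -1
    rw [signs_blockSigns, he, hz]
    simp
  refine ⟨χ, h1, fun z b => ?_⟩
  rcases Int.units_eq_one_or (z b) with hz | hz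
  -- The defining property of χ only speaks of the sign −1; for `z b = 1` it is applied after
  -- multiplying with the global flip.
  · have h4 := h1 (blockSigns h z) (blockSigns h fun _ => -1) b
    have h5 : symBlockPerm h (blockSigns h fun _ => -1) b = b := by
      obtain ⟨e, rfl⟩ := S.graph.exists_block_eq b
      rfl
    have h5' : S.graph.blockPerm (S.symAction Gm) (symAction_act_mem Gm h.connected)
      (blockSigns h fun _ => -1) b = b := h5
    rw [← map_mul, h5', h3 (fun _ => -1) b rfl, h3 _ b (by simp [hz])] at h4
    rw [hz]
    simpa using h4.symm
  · rw [h3 z b hz, hz]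

/-- The symmetries of the Lee–Pomeransky polynomial lift multiplicatively. -/
theorem exists_section (hGm : Gm.IsSymm) (hdet : Gm.det ≠ 0) (h : S.MomentumGrouped Gm) :
    ∃ s : permGroup (S.leePomeransky Gm) →* S.symGroup Gm, ∀ σ, (s σ).1.right = σ.1 := by
  obtain ⟨χ, hχ, hχz⟩ := exists_symCocycle h
  have hex : ∀ σ : permGroup (S.leePomeransky Gm), ∃ g : S.symGroup Gm,
      g.1.right = σ.1 ∧ ∀ b, χ g b = 1 := by
    intro σ
    obtain ⟨κ, T, hT⟩ := exists_isSymLift hGm hdet h h (σ := σ.1) σ.2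
    let g₀ : SignedPermGroup Ed := ⟨fun e => κ (σ.1.symm e), σ.1⟩
    have hsigns : signs g₀ = κ := funext fun e => congrArg κ (σ.1.symm_apply_apply e)
    let g : S.symGroup Gm := ⟨g₀, T, by rw [hsigns]; exact hT⟩
    -- The flip by χ, indexed by target blocks, cancels the cocycle of the arbitrary lift.
    refine ⟨blockSigns h (fun b => χ g ((symBlockPerm h g).symm b)) * g, ?_, fun b => ?_⟩
    · change (1 : Equiv.Perm Ed) * σ.1 = σ.1
      rw [one_mul]
    · rw [hχ, hχz, Equiv.symm_apply_apply, Int.units_mul_self]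
  choose s hs hsχ using hex
  -- Two lifts of the same permutation differ by a block flip z, and χ recovers z. So the normalized
  -- lift is unique, and products of normalized lifts are normalized.
  have huniq : ∀ g g' : S.symGroup Gm, g.1.right = g'.1.right → (∀ b, χ g b = 1) →
      (∀ b, χ g' b = 1) → g = g' := by
    intro g g' hr hg hg'
    obtain ⟨T, hT⟩ := g.2
    obtain ⟨T', hT'⟩ := g'.2
    rw [← hr] at hT'
    obtain ⟨z, hz⟩ := hT.exists_block h hT'
    have h1 : g' = blockSigns h z * g := by
      refine Subtype.ext (ext_signs ?_ fun e => ?_)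
      · change g'.1.right = (1 : Equiv.Perm Ed) * g.1.right
        rw [one_mul, hr]
      · rw [hz]
        exact (signs_mul (blockSigns h z).1 g.1 e).symm
    have h2 : z = 1 := by
      ext1 b
      obtain ⟨b, rfl⟩ := (symBlockPerm h g).surjective b
      have h3 := hχ (blockSigns h z) g b
      rw [← h1, hg', hg, hχz, mul_one] at h3
      exact h3.symm
    rw [h1, h2, map_one, one_mul]
  refine ⟨MonoidHom.mk' s fun σ τ => huniq _ _ ?_ (hsχ _) fun b => ?_, hs⟩
  · change _ = (s σ).1.right * (s τ).1.right
    rw [hs, hs, hs]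
    rfl
  · rw [hχ, hsχ, hsχ, one_mul]

theorem toMatrix_injective : Function.Injective
    (MomentumMap.toMatrix : MomentumMap K L n → Matrix (Fin L ⊕ Fin n) (Fin L ⊕ Fin n) K) := by
  intro T T' h
  obtain ⟨h1, h2, _, h3⟩ := fromBlocks_inj.1 h
  exact MomentumMap.ext h1 h2 h3

/-- The automorphisms of a sector form a semidirect product. -/
theorem exists_autEquiv (hGm : Gm.IsSymm) (hdet : Gm.det ≠ 0) (h : S.MomentumGrouped Gm) :
    ∃ (κ : permGroup (S.leePomeransky Gm) → Ed → ℤˣ)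
      (φ : permGroup (S.leePomeransky Gm) →* MulAut (S.graph.Block → ℤˣ))
      (A : Subgroup (GL (Fin L ⊕ Fin n) K))
      (Ψ : (S.graph.Block → ℤˣ) ⋊[φ] permGroup (S.leePomeransky Gm) ≃* A),
      (fun g : GL (Fin L ⊕ Fin n) K => (g : Matrix (Fin L ⊕ Fin n) (Fin L ⊕ Fin n) K)) '' A =
        MomentumMap.toMatrix '' Sector.Sym Gm S S ∧
      (∀ σ z e, φ σ z (S.graph.block (σ.1 e)) = z (S.graph.block e)) ∧
      ∀ g, ((Ψ g : GL (Fin L ⊕ Fin n) K) : Matrix (Fin L ⊕ Fin n) (Fin L ⊕ Fin n) K) =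
        ((S.lift S (fun e => g.left (S.graph.block (g.right.1 e)) * κ g.right e)
          g.right.1).ofRat K).toMatrix := by
  obtain ⟨s, hs⟩ := exists_section hGm hdet h
  let φ : permGroup (S.leePomeransky Gm) →* MulAut (S.graph.Block → ℤˣ) :=
    (mulAutArrow (G := Equiv.Perm S.graph.Block)).comp ((symBlockPerm h).comp s)
  have hφ : ∀ σ z e, φ σ z (S.graph.block (σ.1 e)) = z (S.graph.block e) := by
    intro σ z e
    have h1 : S.graph.block (σ.1 e) = symBlockPerm h (s σ) (S.graph.block e) := by
      rw [symBlockPerm_block, hs]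
    rw [h1]
    exact congrArg z ((symBlockPerm h (s σ)).symm_apply_apply _)
  let κ : permGroup (S.leePomeransky Gm) → Ed → ℤˣ := fun σ => signs (s σ).1
  -- Conjugating a block flip by a symmetry permutes its signs along the permutation of the blocks,
  -- which is the compatibility needed for the semidirect product.
  let Θ : (S.graph.Block → ℤˣ) ⋊[φ] permGroup (S.leePomeransky Gm) →* S.symGroup Gm :=
    SemidirectProduct.lift (blockSigns h) s fun σ => by
      ext1 z
      change blockSigns h (φ σ z) = s σ * blockSigns h z * (s σ)⁻¹
      rw [eq_mul_inv_iff_mul_eq]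
      refine Subtype.ext (ext_signs ?_ fun e => ?_)
      · change (1 : Equiv.Perm Ed) * _ = _ * (1 : Equiv.Perm Ed)
        rw [one_mul, mul_one]
      · change signs ((blockSigns h (φ σ z)).1 * (s σ).1) e =
          signs ((s σ).1 * (blockSigns h z).1) e
        rw [signs_mul, signs_mul, signs_blockSigns, signs_blockSigns, blockSigns_right, hs, hφ,
          mul_comm]
        rfl
  have hΘr : ∀ g, (Θ g).1.right = g.right.1 := fun g => by
    change (1 : Equiv.Perm Ed) * (s g.right).1.right = _
    rw [one_mul, hs]
  have hΘs : ∀ g, signs (Θ g).1 = fun e => g.left (S.graph.block (g.right.1 e)) * κ g.right e :=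
    fun g => funext fun e => by
      change signs ((blockSigns h g.left).1 * (s g.right).1) e = _
      rw [signs_mul, signs_blockSigns, hs]
  let Ω := (symRep h).comp Θ
  have hΩ : ∀ g, (Ω g : Matrix (Fin L ⊕ Fin n) (Fin L ⊕ Fin n) K) =
      ((S.lift S (fun e => g.left (S.graph.block (g.right.1 e)) * κ g.right e)
          g.right.1).ofRat K).toMatrix := fun g => by
    change (symRep h (Θ g) : Matrix (Fin L ⊕ Fin n) (Fin L ⊕ Fin n) K) = _
    rw [symRep_coe, hΘs, hΘr]
  obtain ⟨Φ, hΦ⟩ := exists_symEquiv hGm h h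
    (fun σ => κ ⟨σ.1, σ.2⟩) fun σ => by
      have h1 := isSymLift_lift h (s ⟨σ.1, σ.2⟩)
      rw [hs] at h1
      exact ⟨_, h1⟩
  have hΩΦ : ∀ g, (Ω g : Matrix (Fin L ⊕ Fin n) (Fin L ⊕ Fin n) K) =
      (Φ (g.left, ⟨g.right.1, g.right.2⟩)).1.toMatrix := fun g => by
    rw [hΩ, (hΦ _ _).1]
  have hinj : Function.Injective Ω := by
    intro g g' hg
    have h1 := congrArg (fun x : GL (Fin L ⊕ Fin n) K =>
      (x : Matrix (Fin L ⊕ Fin n) (Fin L ⊕ Fin n) K)) hg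
    simp only [hΩΦ] at h1
    have h2 := Φ.injective (Subtype.ext (toMatrix_injective h1))
    rw [Prod.mk.injEq] at h2
    exact SemidirectProduct.ext h2.1 (Subtype.ext (congrArg Subtype.val h2.2 :))
  refine ⟨κ, φ, Ω.range, MonoidHom.ofInjective hinj, ?_, hφ, hΩ⟩
  ext A
  constructor
  · rintro ⟨_, ⟨g, rfl⟩, rfl⟩
    exact ⟨_, (Φ (g.left, ⟨g.right.1, g.right.2⟩)).2, (hΩΦ g).symm⟩
  · rintro ⟨T, hT, rfl⟩
    obtain ⟨⟨z, σ⟩, hzσ⟩ := Φ.surjective ⟨T, hT⟩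
    refine ⟨_, ⟨⟨z, ⟨σ.1, σ.2⟩⟩, rfl⟩, ?_⟩
    change (Ω _ : Matrix (Fin L ⊕ Fin n) (Fin L ⊕ Fin n) K) = _
    rw [hΩΦ]
    change (Φ (z, σ)).1.toMatrix = _
    rw [hzσ]

end Sector

theorem mainTheorem4 {K : Type*} [Field K] [CharZero K] {V₁ V₂ Ed₁ Ed₂ : Type*}
    [Fintype V₁] [Fintype V₂] [Fintype Ed₁] [DecidableEq Ed₁] [Fintype Ed₂] [DecidableEq Ed₂]
    {L n : ℕ} (Gm : Matrix (Fin n) (Fin n) K) (hGm : Gm.IsSymm) (hdet : Gm.det ≠ 0)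
    (S₁ : Sector K V₁ Ed₁ L n) (S₂ : Sector K V₂ Ed₂ L n)
    (h₁ : S₁.MomentumGrouped Gm) (h₂ : S₂.MomentumGrouped Gm) :
    -- the inverse matrices in the projector formulas exist
    (IsUnit (S₁.CIn ℚ * (S₁.CIn ℚ)ᵀ).det ∧ IsUnit (S₂.CIn ℚ * (S₂.CIn ℚ)ᵀ).det ∧
      IsUnit (S₁.E * S₁.projPerp * S₁.Eᵀ).det ∧ IsUnit (S₂.E * S₂.projPerp * S₂.Eᵀ).det) ∧
    -- the bijection `Sym(Θ₁, Θ₂) ≃ ℤ₂^c × 𝕊(𝒢₁, 𝒢₂)`, given by the projector formulas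
    (∃ (κ : permSet (S₁.leePomeransky Gm) (S₂.leePomeransky Gm) → Ed₂ → ℤˣ)
      (Φ : (S₁.graph.Block → ℤˣ) × permSet (S₁.leePomeransky Gm) (S₂.leePomeransky Gm) ≃
        Sector.Sym Gm S₁ S₂),
      (∀ z σ,
        let ε : Ed₂ → ℤˣ := fun e => z (S₁.graph.block (σ.1 e)) * κ σ e
        let T : MomentumMap ℚ L n := S₁.lift S₂ ε σ.1
        (Φ (z, σ)).1 = T.ofRat K ∧
        (S₁.CIn ℚ)ᵀ * T.L = signedPerm ε σ.1 * (S₂.CIn ℚ)ᵀ ∧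
        (S₁.CIn ℚ)ᵀ * T.M + S₁.Eᵀ * T.N = signedPerm ε σ.1 * S₂.Eᵀ) ∧
      (∀ (T : Sector.Sym Gm S₁ S₂) (α : Ed₂ ≃ Ed₁),
        Sector.Induces Gm S₁ S₂ T.1 α ↔ α = (Φ.symm T).2.1)) ∧
    -- for a single sector, `Aut(Θ) = ℤ₂^c ⋊ 𝔾(𝒢)` as groups of block matrices
    (∃ (κ : permGroup (S₁.leePomeransky Gm) → Ed₁ → ℤˣ)
      (φ : permGroup (S₁.leePomeransky Gm) →* MulAut (S₁.graph.Block → ℤˣ))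
      (A : Subgroup (GL (Fin L ⊕ Fin n) K))
      (Ψ : (S₁.graph.Block → ℤˣ) ⋊[φ] permGroup (S₁.leePomeransky Gm) ≃* A),
      (fun g : GL (Fin L ⊕ Fin n) K => (g : Matrix (Fin L ⊕ Fin n) (Fin L ⊕ Fin n) K)) '' A =
        MomentumMap.toMatrix '' Sector.Sym Gm S₁ S₁ ∧
      (∀ σ z e, φ σ z (S₁.graph.block (σ.1 e)) = z (S₁.graph.block e)) ∧
      ∀ g, ((Ψ g : GL (Fin L ⊕ Fin n) K) : Matrix (Fin L ⊕ Fin n) (Fin L ⊕ Fin n) K) =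
        ((S₁.lift S₁ (fun e => g.left (S₁.graph.block (g.right.1 e)) * κ g.right e)
          g.right.1).ofRat K).toMatrix) := by
  refine ⟨⟨S₁.isUnit_det_gram h₁.connected, S₂.isUnit_det_gram h₂.connected,
    S₁.isUnit_det_gramPerp h₁.connected h₁.leg_injective,
    S₂.isUnit_det_gramPerp h₂.connected h₂.leg_injective⟩, ?_,
    Sector.exists_autEquiv hGm hdet h₁⟩
  -- For the bijection any choice of lifts serves; multiplicativity matters only for the group
  -- statement.
  choose κ hκ using fun σ : permSet (S₁.leePomeransky Gm) (S₂.leePomeransky Gm) =>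
    Sector.exists_isSymLift hGm hdet h₁ h₂ σ.2
  obtain ⟨Φ, hΦ⟩ := Sector.exists_symEquiv hGm h₁ h₂ κ hκ
  refine ⟨κ, Φ, fun z σ => ⟨(hΦ z σ).1, (hΦ z σ).2.loop, (hΦ z σ).2.ext⟩, fun T α => ?_⟩
  have hT : Sector.Induces Gm S₁ S₂ T.1 (Φ.symm T).2.1 := by
    have h1 := (hΦ (Φ.symm T).1 (Φ.symm T).2).2.induces
    rwa [← (hΦ _ _).1, Prod.mk.eta, Equiv.apply_symm_apply] at h1
  exact ⟨fun hα => hα.unique h₂ hT, fun hα => hα ▸ hT⟩
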